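/- Let $k$ be a commutative unital ring. **Templicial modules.** For a set $S$, a $k$-quiver on $S$ is a family $Q=(Q(a,b))_{a,b\in S}$ of $k$-modules; $k$-quivers on $S$ form a monoidal category with $(Q\otimes P)(a,b)=\bigoplus_{c\in S}Q(a,c)\otimes_k P(c,b)$ and unit $I(a,a)=k$, $I(a,b)=0$ for $a\neq b$. Let $\mathbf{fint}$ be the category of the posets $[n]=\{0<\dots<n\}$, $n\ge 0$, with the order morphisms preserving both endpoints, monoidal under $[m]+[n]=[m+n]$ (gluing the top of $[m]$ to the bottom of $[n]$). A templicial $k$-module is a pair $(X,S)$ of a set $S$ (the base) and a colax monoidal functor $X:\mathbf{fint}^{op}\to k\text{-quivers on }S$ whose counit $X_0\to I$ is an isomorphism; write $\mu_{m,n}:X_{m+n}\to X_m\otimes X_n$ for its comultiplication. A morphism $(X,S)\to(Y,T)$ is a map $f:S\to T$ with $k$-linear maps $X_n(a,b)\to Y_n(f(a),f(b))$ that commute with the operators of $\mathbf{fint}$, the comultiplications and the counits. **Free and underlying objects.** For a simplicial set $Y$, $\tilde F(Y)$ is the templicial module with base $Y_0$ for which $\tilde F(Y)_n(a,b)$ is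 the free $k$-module on the $n$-simplices with first vertex $a$ and last vertex $b$, and $\mu_{m,n}(y)=y|_{\{0,\dots,m\}}\otimes y|_{\{m,\dots,m+n\}}$. For a templicial module $X$, $\tilde U(X)$ is the simplicial set with $\tilde U(X)_n=\operatorname{Hom}(\tilde F(\Delta^n),X)$; evaluation at the nondegenerate $1$-simplex of $\Delta^1$ assigns to an edge of $\tilde U(X)$ from $a$ to $b$ an element of $X_1(a,b)$. A linear quasi-category is a templicial module $X$ such that for all $0<j<n$ every morphism $\tilde F(\Lambda^n_j)\to X$ extends along $\tilde F(\Lambda^n_j)\to\tilde F(\Delta^n)$. Let $\mathrm{QCat}$ and $\mathrm{QCat}(k)$ be the categories of quasi-categories and of linear quasi-categories (full subcategories of simplicial sets and of templicial modules), and let $\mathrm{Cat}$ and $\mathrm{Cat}(k)$ be the categories of small categories and of small $k$-linear categories. **Nerves and free linear categories.** $N:\mathrm{Cat}\to\mathrm{QCat}$ is the nerve, $\mathcal U:\mathrm{Cat}(k)\to\mathrm{Cat}$ the forgetful functor, and $\mathcal F:\mathrm{Cat}\to\mathrm{Cat}(k)$ the free $k$-linear category functor. For a small $k$-linear category $\mathcal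 C$, $N_k(\mathcal C)$ is the templicial module with base $\mathrm{Ob}(\mathcal C)$ and $$N_k(\mathcal C)_n(a,b)=\bigoplus_{a=A_0,A_1,\dots,A_n=b}\mathcal C(A_0,A_1)\otimes\dots\otimes\mathcal C(A_{n-1},A_n),$$ with operators given by composition and identities and with the canonical maps as comultiplication. **Homotopy categories.** $h:\mathrm{QCat}\to\mathrm{Cat}$ sends a quasi-category to its homotopy category, whose objects are the vertices and whose morphisms are the homotopy classes of edges. **Theorem.** 1. $\tilde F$ sends quasi-categories to linear quasi-categories, $\tilde U$ sends linear quasi-categories to quasi-categories, and $N_k(\mathcal C)$ is a linear quasi-category for every small $k$-linear category $\mathcal C$. 2. For every linear quasi-category $X$ the homotopy category $h\tilde U(X)$ carries the structure of a $k$-linear category, in such a way that assigning to an element of $X_1(a,b)$ the homotopy class of the corresponding edge is a $k$-linear map $X_1(a,b)\to h\tilde U(X)(a,b)$, and that for every morphism $\varphi$ of linear quasi-categories the functor $h\tilde U(\varphi)$ is $k$-linear. This defines the linear homotopy functor $h_k:\mathrm{QCat}(k)\to\mathrm{Cat}(k)$. 3. There are adjunctions $$\mathcal F\dashv\mathcal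 U\ (\mathrm{Cat}\leftrightarrow\mathrm{Cat}(k)),\quad h\dashv N\ (\mathrm{QCat}\leftrightarrow\mathrm{Cat}),\quad \tilde F\dashv\tilde U\ (\mathrm{QCat}\leftrightarrow\mathrm{QCat}(k)),\quad h_k\dashv N_k\ (\mathrm{QCat}(k)\leftrightarrow\mathrm{Cat}(k)).$$ 4. The square commutes up to natural isomorphism: $$N_k\circ\mathcal F\simeq\tilde F\circ N,\qquad \tilde U\circ N_k\simeq N\circ\mathcal U,\qquad \mathcal F\circ h\simeq h_k\circ\tilde F,\qquad h\circ\tilde U\simeq\mathcal U\circ h_k.$$ -/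

import Mathlib

open CategoryTheory Opposite Simplicial TensorProduct
open scoped DirectSum

universe u

namespace Templicial

/-! ### The category of finite intervals -/

/-- A morphism `[m] ⟶ [n]` of finite intervals: an order morphism preserving both endpoints. -/
@[ext]
structure IntervalMap (m n : ℕ) where
  toOrderHom : Fin (m + 1) →o Fin (n + 1)
  map_zero : toOrderHom 0 = 0
  map_last : toOrderHom (Fin.last m) = Fin.last n

namespace IntervalMap

def id (n : ℕ) : IntervalMap n n := ⟨OrderHom.id, rfl, rfl⟩

/-- Composition, in diagrammatic order. -/
def comp {l m n : ℕ} (f : IntervalMap l m) (g : IntervalMap m n) : IntervalMap l n :=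
  ⟨g.toOrderHom.comp f.toOrderHom, by simp [f.map_zero, g.map_zero],
    by simp [f.map_last, g.map_last]⟩

/-- The identity morphism `[m] ⟶ [n]` for `m = n`. For `(l + m) + n = l + (m + n)` and
`0 + n = n` these are the associator and the left unitor of the monoidal structure. -/
def cast {m n : ℕ} (h : m = n) : IntervalMap m n :=
  ⟨⟨Fin.cast (by rw [h]), fun _ _ hij => hij⟩, by subst h; rfl, by subst h; rfl⟩

/-- The function underlying `f + g`. -/
def addFun {m' m n' n : ℕ} (f : IntervalMap m' m) (g : IntervalMap n' n)
    (i : Fin (m' + n' + 1)) : Fin (m + n + 1) :=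
  if h : i.1 ≤ m' then ⟨(f.toOrderHom ⟨i.1, by omega⟩).1, by omega⟩
  else ⟨m + (g.toOrderHom ⟨i.1 - m', by omega⟩).1, by omega⟩

lemma addFun_of_le {m' m n' n : ℕ} (f : IntervalMap m' m) (g : IntervalMap n' n)
    (i : Fin (m' + n' + 1)) (j : Fin (m' + 1)) (h : i.1 = j.1) :
    (addFun f g i).1 = (f.toOrderHom j).1 := by
  obtain ⟨i, hi⟩ := i
  obtain rfl : i = j.1 := h
  have hj : j.1 ≤ m' := by omega
  simp [addFun, hj]

lemma addFun_of_ge {m' m n' n : ℕ} (f : IntervalMap m' m) (g : IntervalMap n' n)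
    (i : Fin (m' + n' + 1)) (j : Fin (n' + 1)) (h : i.1 = m' + j.1) :
    (addFun f g i).1 = m + (g.toOrderHom j).1 := by
  by_cases hj : j.1 = 0
  · obtain rfl : j = 0 := Fin.ext hj
    rw [g.map_zero, addFun_of_le f g i (Fin.last m') (by simpa using h), f.map_last]
    simp
  · obtain ⟨i, hi⟩ := i
    obtain rfl : i = m' + j.1 := h
    have hj : ¬ (m' + j.1 ≤ m') := by omega
    simp [addFun, hj]

/-- The monoidal product `f + g : [m' + n'] ⟶ [m + n]`, which glues the top endpoint of the
first interval to the bottom endpoint of the second. -/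
def add {m' m n' n : ℕ} (f : IntervalMap m' m) (g : IntervalMap n' n) :
    IntervalMap (m' + n') (m + n) where
  toOrderHom :=
    { toFun := addFun f g
      monotone' := by
        intro i j hij
        have hij' : i.1 ≤ j.1 := hij
        rw [Fin.le_def]
        by_cases h1 : j.1 ≤ m'
        · rw [addFun_of_le f g i ⟨i.1, by omega⟩ rfl, addFun_of_le f g j ⟨j.1, by omega⟩ rfl]
          exact f.toOrderHom.monotone (a := ⟨i.1, by omega⟩) (b := ⟨j.1, by omega⟩) hij'
        · rw [addFun_of_ge f g j ⟨j.1 - m', by omega⟩ (by simp; omega)]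
          by_cases h2 : i.1 ≤ m'
          · rw [addFun_of_le f g i ⟨i.1, by omega⟩ rfl]
            omega
          · rw [addFun_of_ge f g i ⟨i.1 - m', by omega⟩ (by simp; omega)]
            have h : (g.toOrderHom ⟨i.1 - m', by omega⟩) ≤ g.toOrderHom ⟨j.1 - m', by omega⟩ :=
              g.toOrderHom.monotone (by simp only [Fin.mk_le_mk]; omega)
            have h' := Fin.le_def.1 h
            omega }
  map_zero := by
    apply Fin.ext
    change (addFun f g 0).1 = _
    rw [addFun_of_le f g 0 0 rfl, f.map_zero]; rfl
  map_last := by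
    apply Fin.ext
    change (addFun f g (Fin.last _)).1 = _
    rw [addFun_of_ge f g _ (Fin.last n') rfl, g.map_last]; rfl

/-- The underlying morphism of the simplex category. -/
def toHom {m n : ℕ} (f : IntervalMap m n) : ⦋m⦌ ⟶ ⦋n⦌ := SimplexCategory.Hom.mk f.toOrderHom

end IntervalMap

/-! ### Templicial modules -/

open Classical in
/-- A templicial `k`-module with base `S`: a strongly unital colax monoidal functor from the
opposite of the category of finite intervals, with the monoidal product `+`, to the category of
`k`-quivers `(Q(a, b))_{a, b ∈ S}`, with the monoidal product
`(Q ⊗ P)(a, b) = ⨁_c Q(a, c) ⊗ P(c, b)` and unit `I(a, a) = k`, `I(a, b) = 0` for `a ≠ b`. -/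
structure TemplicialModule (k : Type u) [CommRing k] where
  /-- the base set `S` -/
  base : Type u
  /-- the quivers `X_n` -/
  obj : ℕ → base → base → ModuleCat.{u} k
  /-- contravariant functoriality in finite intervals: the inner faces and the degeneracies -/
  map {m n : ℕ} (f : IntervalMap m n) (a b : base) : obj n a b →ₗ[k] obj m a b
  map_id (n : ℕ) (a b : base) : map (IntervalMap.id n) a b = LinearMap.id
  map_comp {l m n : ℕ} (f : IntervalMap l m) (g : IntervalMap m n) (a b : base) :
    map (f.comp g) a b = map f a b ∘ₗ map g a b
  /-- the comultiplication `X_{m+n} ⟶ X_m ⊗ X_n` -/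
  comul (m n : ℕ) (a b : base) :
    obj (m + n) a b →ₗ[k] ⨁ c : base, (obj m a c ⊗[k] obj n c b)
  /-- naturality of the comultiplication, in each summand `c` -/
  comul_natural {m' m n' n : ℕ} (f : IntervalMap m' m) (g : IntervalMap n' n) (a b c : base)
    (x : obj (m + n) a b) :
    comul m' n' a b (map (f.add g) a b x) c =
      TensorProduct.map (map f a c) (map g c b) (comul m n a b x c)
  /-- coassociativity: the components of the two maps `X_{l+m+n} ⟶ X_l ⊗ X_m ⊗ X_n` in each
  summand `X_l(a, c) ⊗ (X_m(c, d) ⊗ X_n(d, b))` agree -/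
  coassoc (l m n : ℕ) (a b c d : base) (x : obj (l + (m + n)) a b) :
    TensorProduct.assoc k _ _ _
      (LinearMap.rTensor (obj n d b) (DirectSum.component k base _ c ∘ₗ comul l m a d)
        (comul (l + m) n a b (map (IntervalMap.cast (Nat.add_assoc l m n)) a b x) d)) =
    LinearMap.lTensor (obj l a c) (DirectSum.component k base _ d ∘ₗ comul m n c b)
      (comul l (m + n) a b x c)
  /-- the counit `X_0 ⟶ I` on the diagonal; off the diagonal the target is zero -/
  counit (a : base) : obj 0 a a →ₗ[k] k
  counit_comul (n : ℕ) (a b : base) (x : obj n a b) :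
    TensorProduct.lid k _ (LinearMap.rTensor (obj n a b) (counit a)
      (comul 0 n a b (map (IntervalMap.cast (Nat.zero_add n)) a b x) a)) = x
  comul_counit (n : ℕ) (a b : base) (x : obj n a b) :
    TensorProduct.rid k _ (LinearMap.lTensor (obj n a b) (counit b) (comul n 0 a b x b)) = x
  /-- strong unitality: the counit `X_0 ⟶ I` is an isomorphism of quivers -/
  counit_bijective (a : base) : Function.Bijective (counit a)
  obj_zero_subsingleton (a b : base) (h : a ≠ b) : Subsingleton (obj 0 a b)

namespace TemplicialModule

variable {k : Type u} [CommRing k]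

open Classical in
/-- A templicial morphism `(α, f) : (X, S) ⟶ (Y, T)`: a map `f : S → T` and a monoidal natural
transformation `α : f_! X ⟶ Y`. By the adjunction `f_! ⊣ f^*`, `α` amounts to maps
`X_n(a, b) ⟶ Y_n(f a, f b)`. -/
@[ext]
structure Hom (X Y : TemplicialModule k) where
  base : X.base → Y.base
  app (n : ℕ) (a b : X.base) : X.obj n a b →ₗ[k] Y.obj n (base a) (base b)
  naturality {m n : ℕ} (f : IntervalMap m n) (a b : X.base) (x : X.obj n a b) :
    app m a b (X.map f a b x) = Y.map f _ _ (app n a b x)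
  comul_app (m n : ℕ) (a b : X.base) (x : X.obj (m + n) a b) :
    Y.comul m n _ _ (app (m + n) a b x) =
      DirectSum.toModule k X.base (⨁ d : Y.base, (Y.obj m (base a) d ⊗[k] Y.obj n d (base b)))
        (fun c => DirectSum.lof k Y.base
            (fun d => Y.obj m (base a) d ⊗[k] Y.obj n d (base b)) (base c) ∘ₗ
          TensorProduct.map (app m a c) (app n c b))
        (X.comul m n a b x)
  counit_app (a : X.base) (x : X.obj 0 a a) : Y.counit (base a) (app 0 a a x) = X.counit a x

open Classical in
def Hom.id (X : TemplicialModule k) : Hom X X where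
  base a := a
  app _ _ _ := LinearMap.id
  naturality _ _ _ _ := rfl
  comul_app m n a b x := by
    generalize X.comul m n a b x = t
    induction t using DirectSum.induction_on with
    | zero => simp
    | of c t => 
      have : (DirectSum.of (fun c => X.obj m a c ⊗[k] X.obj n c b) c t) =
        DirectSum.lof k _ (fun c => X.obj m a c ⊗[k] X.obj n c b) c t := rfl
      rw [this, DirectSum.toModule_lof]; simp
    | add s t hs ht => rw [map_add, ← hs, ← ht]
  counit_app _ _ := rfl

open Classical in
def Hom.comp {X Y Z : TemplicialModule k} (f : Hom X Y) (g : Hom Y Z) : Hom X Z where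
  base a := g.base (f.base a)
  app n a b := g.app n _ _ ∘ₗ f.app n a b
  naturality h a b x := by simp [f.naturality, g.naturality]
  comul_app m n a b x := by
    simp only [LinearMap.comp_apply]
    rw [g.comul_app, f.comul_app]
    generalize X.comul m n a b x = t
    rw [← LinearMap.comp_apply]
    congr 1
    apply DirectSum.linearMap_ext
    intro c
    ext x y
    simp [DirectSum.toModule_lof]
  counit_app a x := by simp [f.counit_app, g.counit_app]

instance : Category (TemplicialModule.{u} k) where
  Hom := Hom
  id := Hom.id
  comp := Hom.comp

end TemplicialModule

/-! ### Simplices with given endpoints -/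

/-- The `i`-th vertex of a simplex. -/
def vtx {Y : SSet.{u}} {n : ℕ} (i : Fin (n + 1)) (y : Y _⦋n⦌) : Y _⦋0⦌ :=
  Y.map (SimplexCategory.const ⦋0⦌ ⦋n⦌ i).op y

/-- The inclusion `[m] ⟶ [m + n]` as the first `m + 1` elements. -/
def frontHom (m n : ℕ) : ⦋m⦌ ⟶ ⦋m + n⦌ :=
  SimplexCategory.Hom.mk ⟨fun i : Fin (m + 1) => (⟨i.1, by omega⟩ : Fin (m + n + 1)), fun _ _ h => h⟩

/-- The inclusion `[n] ⟶ [m + n]` as the last `n + 1` elements. -/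
def backHom (m n : ℕ) : ⦋n⦌ ⟶ ⦋m + n⦌ :=
  SimplexCategory.Hom.mk ⟨fun i : Fin (n + 1) => (⟨m + i.1, by omega⟩ : Fin (m + n + 1)),
    fun i j h => by
      have h' : i.1 ≤ j.1 := h
      simp only [Fin.mk_le_mk]; omega⟩

lemma map_map {Y : SSet.{u}} {l m n : ℕ} (f : ⦋l⦌ ⟶ ⦋m⦌) (g : ⦋m⦌ ⟶ ⦋n⦌) (y : Y _⦋n⦌) :
    Y.map f.op (Y.map g.op y) = Y.map (f ≫ g).op y := by
  simp [op_comp, Functor.map_comp]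

lemma map_map_eq (Y : SSet.{u}) {l m m' n : ℕ} {f : ⦋l⦌ ⟶ ⦋m⦌} {g : ⦋m⦌ ⟶ ⦋n⦌}
    {f' : ⦋l⦌ ⟶ ⦋m'⦌} {g' : ⦋m'⦌ ⟶ ⦋n⦌} (h : f ≫ g = f' ≫ g') (y : Y _⦋n⦌) :
    Y.map f.op (Y.map g.op y) = Y.map f'.op (Y.map g'.op y) := by
  rw [map_map, map_map, h]

lemma map_map_map_eq (Y : SSet.{u}) {l m n p : ℕ} {f : ⦋l⦌ ⟶ ⦋m⦌} {g : ⦋m⦌ ⟶ ⦋n⦌}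
    {h : ⦋n⦌ ⟶ ⦋p⦌} {f' : ⦋l⦌ ⟶ ⦋p⦌} (e : f ≫ g ≫ h = f') (y : Y _⦋p⦌) :
    Y.map f.op (Y.map g.op (Y.map h.op y)) = Y.map f'.op y := by
  rw [map_map, map_map, Category.assoc, e]

lemma map_map_map_eq' (Y : SSet.{u}) {l m n p q : ℕ} {f : ⦋l⦌ ⟶ ⦋m⦌} {g : ⦋m⦌ ⟶ ⦋n⦌}
    {h : ⦋n⦌ ⟶ ⦋p⦌} {f' : ⦋l⦌ ⟶ ⦋q⦌} {g' : ⦋q⦌ ⟶ ⦋p⦌} (e : f ≫ g ≫ h = f' ≫ g')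
    (y : Y _⦋p⦌) :
    Y.map f.op (Y.map g.op (Y.map h.op y)) = Y.map f'.op (Y.map g'.op y) := by
  rw [map_map, map_map, map_map, Category.assoc, e]

lemma frontHom_comp_add {m' m n' n : ℕ} (f : IntervalMap m' m) (g : IntervalMap n' n) :
    frontHom m' n' ≫ (f.add g).toHom = f.toHom ≫ frontHom m n := by
  ext i
  exact IntervalMap.addFun_of_le f g _ _ rfl

lemma backHom_comp_add {m' m n' n : ℕ} (f : IntervalMap m' m) (g : IntervalMap n' n) :
    backHom m' n' ≫ (f.add g).toHom = g.toHom ≫ backHom m n := by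
  ext i
  exact IntervalMap.addFun_of_ge f g _ _ rfl

lemma vtx_map {Y : SSet.{u}} {m n : ℕ} (f : ⦋m⦌ ⟶ ⦋n⦌) (i : Fin (m + 1)) (y : Y _⦋n⦌) :
    vtx i (Y.map f.op y) = vtx (f.toOrderHom i) y := by
  unfold vtx
  rw [map_map]
  congr 2

lemma vtx_zero_self {Y : SSet.{u}} (y : Y _⦋0⦌) (i : Fin (0 + 1)) : vtx i y = y := by
  unfold vtx
  have : SimplexCategory.const ⦋0⦌ ⦋0⦌ i = 𝟙 _ := by
    ext j; exact congrArg Fin.val (Subsingleton.elim (α := Fin 1) _ _)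
  rw [this]; simp

/-- The `n`-simplices of `Y` with first vertex `a` and last vertex `b`, where the vertices are
named by elements of `S`. -/
@[ext]
structure Simp (Y : SSet.{u}) {S : Type u} (vert : Y _⦋0⦌ → S) (n : ℕ) (a b : S) : Type u where
  val : Y _⦋n⦌
  first : vert (vtx 0 val) = a
  last : vert (vtx (Fin.last n) val) = b

namespace Simp

variable {Y : SSet.{u}} {S : Type u} {vert : Y _⦋0⦌ → S}

def map {m n : ℕ} (f : IntervalMap m n) {a b : S} (y : Simp Y vert n a b) :
    Simp Y vert m a b where
  val := Y.map f.toHom.op y.val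
  first := by rw [vtx_map]; exact (congrArg (fun i => vert (vtx i y.val)) f.map_zero).trans y.first
  last := by rw [vtx_map]; exact (congrArg (fun i => vert (vtx i y.val)) f.map_last).trans y.last

/-- The `m`-th vertex of an `(m + n)`-simplex. -/
def mid (m n : ℕ) {a b : S} (y : Simp Y vert (m + n) a b) : S :=
  vert (vtx (⟨m, by omega⟩ : Fin (m + n + 1)) y.val)

lemma mid_map_add {m' m n' n : ℕ} (f : IntervalMap m' m) (g : IntervalMap n' n) {a b : S}
    (y : Simp Y vert (m + n) a b) : (y.map (f.add g)).mid = y.mid := by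
  unfold mid map
  dsimp only
  rw [vtx_map]
  congr 2
  apply Fin.ext
  exact (IntervalMap.addFun_of_le f g _ (Fin.last m') rfl).trans (by rw [f.map_last]; rfl)

/-- The face on the first `m + 1` vertices. -/
def front (m n : ℕ) {a b c : S} (y : Simp Y vert (m + n) a b) (h : y.mid = c) :
    Simp Y vert m a c where
  val := Y.map (frontHom m n).op y.val
  first := by rw [vtx_map]; exact y.first
  last := by rw [vtx_map]; exact h

/-- The face on the last `n + 1` vertices. -/
def back (m n : ℕ) {a b c : S} (y : Simp Y vert (m + n) a b) (h : y.mid = c) :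
    Simp Y vert n c b where
  val := Y.map (backHom m n).op y.val
  first := by rw [vtx_map]; exact h
  last := by rw [vtx_map]; exact y.last

lemma mid_cast_front {l m n : ℕ} {a b d : S} (y : Simp Y vert (l + (m + n)) a b)
    (h : (y.map (IntervalMap.cast (Nat.add_assoc l m n))).mid = d) :
    (front (l + m) n _ h).mid = y.mid := by
  unfold mid front map
  dsimp only
  rw [vtx_map, vtx_map]
  rfl

lemma mid_back {l m n : ℕ} {a b c : S} (y : Simp Y vert (l + (m + n)) a b) (h : y.mid = c) :
    (back l (m + n) y h).mid = (y.map (IntervalMap.cast (Nat.add_assoc l m n))).mid := by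
  unfold mid back map
  dsimp only
  rw [vtx_map, vtx_map]
  rfl

end Simp

open Classical in
/-- The data of a templicial module together with elements indexed by the simplices of a
simplicial set which span the modules and on which the structure maps take the evident values.
The axioms of a templicial module then follow. -/
structure SpannedData (k : Type u) [CommRing k] (Y : SSet.{u}) (S : Type u) where
  vert : Y _⦋0⦌ → S
  obj : ℕ → S → S → ModuleCat.{u} k
  gen {n : ℕ} {a b : S} : Simp Y vert n a b → obj n a b
  span_gen (n : ℕ) (a b : S) : Submodule.span k (Set.range (gen (n := n) (a := a) (b := b))) = ⊤
  map {m n : ℕ} (f : IntervalMap m n) (a b : S) : obj n a b →ₗ[k] obj m a b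
  map_gen {m n : ℕ} (f : IntervalMap m n) (a b : S) (y : Simp Y vert n a b) :
    map f a b (gen y) = gen (y.map f)
  comul (m n : ℕ) (a b : S) : obj (m + n) a b →ₗ[k] ⨁ c : S, (obj m a c ⊗[k] obj n c b)
  comul_gen (m n : ℕ) (a b : S) (y : Simp Y vert (m + n) a b) :
    comul m n a b (gen y) = DirectSum.lof k S (fun c => obj m a c ⊗[k] obj n c b) y.mid
      (gen (y.front m n rfl) ⊗ₜ gen (y.back m n rfl))
  counit (a : S) : obj 0 a a →ₗ[k] k
  counit_gen (a : S) (y : Simp Y vert 0 a a) : counit a (gen y) = 1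
  counit_bijective (a : S) : Function.Bijective (counit a)

namespace SpannedData

variable {k : Type u} [CommRing k] {Y : SSet.{u}} {S : Type u} (D : SpannedData k Y S)

lemma hom_ext {n : ℕ} {a b : S} {M : Type*} [AddCommMonoid M] [Module k M]
    {f g : D.obj n a b →ₗ[k] M} (h : ∀ y, f (D.gen y) = g (D.gen y)) : f = g :=
  LinearMap.ext_on_range (D.span_gen n a b) h

lemma induct {n : ℕ} {a b : S} {p : D.obj n a b → Prop} (zero : p 0)
    (add : ∀ x y, p x → p y → p (x + y)) (smul : ∀ (r : k) x, p x → p (r • x))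
    (gen : ∀ y, p (D.gen y)) (x : D.obj n a b) : p x := by
  have hx : x ∈ Submodule.span k (Set.range (D.gen (n := n) (a := a) (b := b))) := by
    rw [D.span_gen]; trivial
  induction hx using Submodule.span_induction with
  | mem x h => obtain ⟨y, rfl⟩ := h; exact gen y
  | zero => exact zero
  | add x y _ _ hx hy => exact add x y hx hy
  | smul r x _ hx => exact smul r x hx

lemma comul_gen_eq {m n : ℕ} {a b c : S} (y : Simp Y D.vert (m + n) a b) (h : y.mid = c) :
    D.comul m n a b (D.gen y) c = D.gen (y.front m n h) ⊗ₜ D.gen (y.back m n h) := by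
  classical
  subst h
  rw [D.comul_gen]
  exact DirectSum.lof_apply k _ _

lemma comul_gen_ne {m n : ℕ} {a b c : S} (y : Simp Y D.vert (m + n) a b) (h : y.mid ≠ c) :
    D.comul m n a b (D.gen y) c = 0 := by
  classical
  rw [D.comul_gen]
  exact DirectSum.of_eq_of_ne _ _ _ h.symm

/-- The templicial module given by spanned data. -/
def toTemplicial : TemplicialModule k where
  base := S
  obj := D.obj
  map := D.map
  map_id n a b := D.hom_ext fun y => by
    rw [D.map_gen]
    congr 1
    ext
    change Y.map (𝟙 ⦋n⦌ : ⦋n⦌ ⟶ ⦋n⦌).op y.val = y.val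
    simp
  map_comp f g a b := D.hom_ext fun y => by
    simp only [LinearMap.comp_apply, D.map_gen]
    congr 1
    ext
    exact (map_map (Y := Y) f.toHom g.toHom y.val).symm
  comul := D.comul
  comul_natural {m' m n' n} f g a b c x := by
    induction x using D.induct with
    | zero => simp
    | add x y hx hy => simp only [map_add, DirectSum.add_apply, hx, hy]
    | smul r x hx => simp only [map_smul, DirectSum.smul_apply, hx]
    | gen y =>
      rw [D.map_gen]
      by_cases h : y.mid = c
      · rw [D.comul_gen_eq y h, D.comul_gen_eq _ ((Simp.mid_map_add f g y).trans h),
          TensorProduct.map_tmul, D.map_gen, D.map_gen]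
        congr 2
        · ext; exact map_map_eq _ (frontHom_comp_add f g) y.val
        · ext; exact map_map_eq _ (backHom_comp_add f g) y.val
      · rw [D.comul_gen_ne y h, D.comul_gen_ne _ (by rwa [Simp.mid_map_add f g y]), map_zero]
  coassoc l m n a b c d x := by
    induction x using D.induct with
    | zero => simp
    | add x y hx hy => simp only [map_add, DirectSum.add_apply, hx, hy]
    | smul r x hx => simp only [map_smul, DirectSum.smul_apply, hx]
    | gen y =>
      rw [D.map_gen]
      have e1 : ∀ (d : S) (h : (y.map (IntervalMap.cast (Nat.add_assoc l m n))).mid = d),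
          (Simp.front (l + m) n _ h).mid = y.mid := fun d h => Simp.mid_cast_front y h
      have e2 : ∀ (c : S) (h : y.mid = c), (Simp.back l (m + n) y h).mid =
          (y.map (IntervalMap.cast (Nat.add_assoc l m n))).mid := fun c h => Simp.mid_back y h
      by_cases hc : y.mid = c
      · rw [D.comul_gen_eq y hc, LinearMap.lTensor_tmul, LinearMap.comp_apply,
          ← DirectSum.apply_eq_component]
        by_cases hd : (y.map (IntervalMap.cast (Nat.add_assoc l m n))).mid = d
        · rw [D.comul_gen_eq _ hd, LinearMap.rTensor_tmul, LinearMap.comp_apply,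
            ← DirectSum.apply_eq_component, D.comul_gen_eq _ ((e1 d hd).trans hc),
            D.comul_gen_eq _ ((e2 c hc).trans hd), TensorProduct.assoc_tmul]
          congr 2
          · ext; exact map_map_map_eq Y (by ext; rfl) y.val
          · congr 1
            ext; exact map_map_map_eq' Y (by ext; rfl) y.val
          · congr 1
            ext
            refine map_map_eq Y ?_ y.val
            ext i
            exact Nat.add_assoc l m i.1
        · rw [D.comul_gen_ne _ hd, D.comul_gen_ne _ (by rwa [e2 c hc])]
          simp
      · rw [D.comul_gen_ne y hc]
        by_cases hd : (y.map (IntervalMap.cast (Nat.add_assoc l m n))).mid = d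
        · rw [D.comul_gen_eq _ hd, LinearMap.rTensor_tmul, LinearMap.comp_apply,
            ← DirectSum.apply_eq_component, D.comul_gen_ne _ (by rwa [e1 d hd])]
          simp
        · rw [D.comul_gen_ne _ hd]
          simp
  counit := D.counit
  counit_comul n a b x := by
    induction x using D.induct with
    | zero => simp
    | add x y hx hy => simp only [map_add, DirectSum.add_apply, hx, hy]
    | smul r x hx => simp only [map_smul, DirectSum.smul_apply, hx]
    | gen y =>
      have h : (y.map (IntervalMap.cast (Nat.zero_add n))).mid = a := by
        unfold Simp.mid Simp.map
        dsimp only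
        rw [vtx_map]
        refine Eq.trans ?_ y.first
        congr 2
      rw [D.map_gen, D.comul_gen_eq _ h, LinearMap.rTensor_tmul, D.counit_gen,
        TensorProduct.lid_tmul, one_smul]
      congr 1
      ext
      refine (map_map (Y := Y) _ _ y.val).trans ?_
      have : backHom 0 n ≫ (IntervalMap.cast (Nat.zero_add n)).toHom = 𝟙 ⦋n⦌ := by
        ext i; change 0 + i.1 = i.1; omega
      rw [this]; simp
  comul_counit n a b x := by
    induction x using D.induct with
    | zero => simp
    | add x y hx hy => simp only [map_add, DirectSum.add_apply, hx, hy]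
    | smul r x hx => simp only [map_smul, DirectSum.smul_apply, hx]
    | gen y =>
      have h : Simp.mid n 0 y = b := y.last
      rw [D.comul_gen_eq _ h, LinearMap.lTensor_tmul, D.counit_gen,
        TensorProduct.rid_tmul, one_smul]
      congr 1
      ext
      change Y.map (𝟙 ⦋n⦌ : ⦋n⦌ ⟶ ⦋n⦌).op y.val = y.val
      simp
  counit_bijective := D.counit_bijective
  obj_zero_subsingleton a b h := by
    have hs := D.span_gen 0 a b
    have : Set.range (D.gen (n := 0) (a := a) (b := b)) = ∅ := by
      rw [Set.range_eq_empty_iff]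
      refine ⟨fun y => h ?_⟩
      exact y.first.symm.trans y.last
    rw [this, Submodule.span_empty] at hs
    exact (Submodule.subsingleton_iff k).1 (subsingleton_of_bot_eq_top hs)

end SpannedData

/-- The image of a simplex under a morphism of simplicial sets. -/
def Simp.push {Y Y' : SSet.{u}} {S S' : Type u} {vert : Y _⦋0⦌ → S} {vert' : Y' _⦋0⦌ → S'}
    (φ : Y ⟶ Y') (base : S → S') (h : ∀ y, vert' (φ.app _ y) = base (vert y)) {n : ℕ} {a b : S}
    (y : Simp Y vert n a b) : Simp Y' vert' n (base a) (base b) where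
  val := φ.app _ y.val
  first := by
    unfold vtx
    rw [← NatTrans.naturality_apply, h]; exact congrArg base y.first
  last := by
    unfold vtx
    rw [← NatTrans.naturality_apply, h]; exact congrArg base y.last

namespace SpannedData

variable {k : Type u} [CommRing k] {Y Y' : SSet.{u}} {S S' : Type u}

open Classical in
lemma comul_gen' (D : SpannedData k Y S) {m n : ℕ} {a b c : S} (y : Simp Y D.vert (m + n) a b)
    (h : y.mid = c) :
    D.comul m n a b (D.gen y) = DirectSum.lof k S (fun c => D.obj m a c ⊗[k] D.obj n c b) c
      (D.gen (y.front m n h) ⊗ₜ D.gen (y.back m n h)) := by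
  subst h
  exact D.comul_gen m n a b y

section

variable (D : SpannedData k Y S) (D' : SpannedData k Y' S') (φ : Y ⟶ Y') (base : S → S')
  (h : ∀ y, D'.vert (φ.app _ y) = base (D.vert y))
  (app : ∀ (n : ℕ) (a b : S), D.obj n a b →ₗ[k] D'.obj n (base a) (base b))

lemma homMk_naturality
    (app_gen : ∀ (n : ℕ) (a b : S) (y : Simp Y D.vert n a b),
      app n a b (D.gen y) = D'.gen (y.push φ base h))
    {m n : ℕ} (f : IntervalMap m n) (a b : S) (x : D.obj n a b) :
    app m a b (D.map f a b x) = D'.map f _ _ (app n a b x) := by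
  induction x using D.induct with
  | zero => simp
  | add x y hx hy => simp only [map_add, hx, hy]
  | smul r x hx => simp only [map_smul, hx]
  | gen y =>
    rw [D.map_gen, app_gen, app_gen, D'.map_gen]
    congr 1
    ext
    exact NatTrans.naturality_apply φ _ _

open Classical in
lemma homMk_comul_app
    (app_gen : ∀ (n : ℕ) (a b : S) (y : Simp Y D.vert n a b),
      app n a b (D.gen y) = D'.gen (y.push φ base h))
    (m n : ℕ) (a b : S) (x : D.obj (m + n) a b) :
    D'.comul m n _ _ (app (m + n) a b x) =
      DirectSum.toModule k S (⨁ d : S', (D'.obj m (base a) d ⊗[k] D'.obj n d (base b)))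
        (fun c => DirectSum.lof k S'
            (fun d => D'.obj m (base a) d ⊗[k] D'.obj n d (base b)) (base c) ∘ₗ
          TensorProduct.map (app m a c) (app n c b))
        (D.comul m n a b x) := by
  induction x using D.induct with
  | zero => simp
  | add x y hx hy => simp only [map_add, hx, hy]
  | smul r x hx => simp only [map_smul, hx]
  | gen y =>
    have hm : Simp.mid m n (y.push φ base h) = base y.mid := by
      unfold Simp.mid Simp.push
      dsimp only
      rw [← h]
      unfold vtx
      rw [NatTrans.naturality_apply]
    rw [app_gen, D'.comul_gen' _ hm, D.comul_gen, DirectSum.toModule_lof, LinearMap.comp_apply,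
      TensorProduct.map_tmul, app_gen, app_gen]
    congr 3
    · ext; exact (NatTrans.naturality_apply φ _ _).symm
    · ext; exact (NatTrans.naturality_apply φ _ _).symm

lemma homMk_counit_app
    (app_gen : ∀ (n : ℕ) (a b : S) (y : Simp Y D.vert n a b),
      app n a b (D.gen y) = D'.gen (y.push φ base h))
    (a : S) (x : D.obj 0 a a) :
    D'.counit (base a) (app 0 a a x) = D.counit a x := by
  induction x using D.induct with
  | zero => simp
  | add x y hx hy => simp only [map_add, hx, hy]
  | smul r x hx => simp only [map_smul, hx]
  | gen y => rw [app_gen, D'.counit_gen, D.counit_gen]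

/-- A family of linear maps which sends generators to generators is a templicial morphism. -/
def homMk
    (app_gen : ∀ (n : ℕ) (a b : S) (y : Simp Y D.vert n a b),
      app n a b (D.gen y) = D'.gen (y.push φ base h))
    : D.toTemplicial ⟶ D'.toTemplicial where
  base := base
  app := app
  naturality := D.homMk_naturality D' φ base h app app_gen
  comul_app := D.homMk_comul_app D' φ base h app app_gen
  counit_app := D.homMk_counit_app D' φ base h app app_gen

end

end SpannedData

/-! ### The free templicial module and the underlying simplicial set -/

section Free

variable (k : Type u) [CommRing k]

instance (Y : SSet.{u}) (a : Y _⦋0⦌) : Unique (Simp Y (fun y => y) 0 a a) where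
  default := ⟨a, vtx_zero_self _ _, vtx_zero_self _ _⟩
  uniq y := by
    ext
    exact (vtx_zero_self _ _).symm.trans y.first

open Classical in
/-- The free templicial module on a simplicial set `Y`, with base `Y_0`: `F̃(Y)_n(a, b)` is the
free module on the set of `n`-simplices with first vertex `a` and last vertex `b`, with
comultiplication sending `y` to the tensor product of its front and back faces. -/
noncomputable def freeData (Y : SSet.{u}) : SpannedData k Y (Y _⦋0⦌) where
  vert y := y
  obj n a b := ModuleCat.of k (Simp Y (fun y => y) n a b →₀ k)
  gen y := Finsupp.single y 1
  span_gen n a b := by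
    rw [eq_top_iff]
    rintro x -
    induction x using Finsupp.induction_linear with
    | zero => exact zero_mem _
    | add x y hx hy => exact add_mem hx hy
    | single y r =>
      have : Finsupp.single y r = r • Finsupp.single y (1 : k) := by simp
      rw [this]
      exact Submodule.smul_mem _ _ (Submodule.subset_span ⟨y, rfl⟩)
  map f a b := Finsupp.lmapDomain k k (Simp.map f)
  map_gen f a b y := by
    exact Finsupp.mapDomain_single
  comul m n a b := Finsupp.linearCombination k fun y =>
    DirectSum.lof k (Y _⦋0⦌)
      (fun c => (Simp Y (fun y => y) m a c →₀ k) ⊗[k] (Simp Y (fun y => y) n c b →₀ k)) y.mid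
      (Finsupp.single (y.front m n rfl) 1 ⊗ₜ Finsupp.single (y.back m n rfl) 1)
  comul_gen m n a b y := by
    refine (Finsupp.linearCombination_single k (1 : k) y).trans (one_smul k _)
  counit a := Finsupp.linearCombination k fun _ => 1
  counit_gen a y := by
    refine (Finsupp.linearCombination_single k (1 : k) y).trans (one_smul k _)
  counit_bijective a := by
    constructor
    · intro x y hxy
      have key : ∀ x : Simp Y (fun y => y) 0 a a →₀ k,
          Finsupp.linearCombination k (fun _ => (1 : k)) x = x default := by
        intro x
        rw [Finsupp.linearCombination_unique]; simp
      have hxy' := ((key x).symm.trans hxy).trans (key y)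
      refine Finsupp.ext fun z => ?_
      rw [Unique.eq_default z]
      exact hxy'
    · intro r
      exact ⟨Finsupp.single default r,
        (Finsupp.linearCombination_single k r _).trans (by simp)⟩

/-- The free templicial module functor `F̃`. -/
noncomputable def freeTemplicial : SSet.{u} ⥤ TemplicialModule.{u} k where
  obj Y := (freeData k Y).toTemplicial
  map {Y Y'} φ := SpannedData.homMk (freeData k Y) (freeData k Y') φ (fun y => φ.app _ y)
    (fun _ => rfl)
    (fun n a b => Finsupp.lmapDomain k k (Simp.push φ (fun y => φ.app _ y) (fun _ => rfl)))
    (fun n a b y => Finsupp.mapDomain_single)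
  map_id Y := by
    refine TemplicialModule.Hom.ext rfl (heq_of_eq ?_)
    funext n a b
    refine (freeData k Y).hom_ext fun y => ?_
    exact Finsupp.mapDomain_single.trans rfl
  map_comp {Y Y' Y''} f g := by
    refine TemplicialModule.Hom.ext rfl (heq_of_eq ?_)
    funext n a b
    refine (freeData k Y).hom_ext fun y => ?_
    refine Finsupp.mapDomain_single.trans ?_
    symm
    change Finsupp.mapDomain (Simp.push g (fun y => g.app _ y) (fun _ => rfl))
      (Finsupp.mapDomain (Simp.push f (fun y => f.app _ y) (fun _ => rfl))
        (Finsupp.single y 1)) = Finsupp.single _ 1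
    rw [Finsupp.mapDomain_single, Finsupp.mapDomain_single]
    rfl

variable {k}

/-- The underlying simplicial set functor: `Ũ(X)_n` is the set of templicial morphisms
`F̃(Δ[n]) ⟶ X`. -/
noncomputable def underlying : TemplicialModule.{u} k ⥤ SSet.{u} :=
  yoneda ⋙ (Functor.whiskeringLeft _ _ _).obj (SSet.stdSimplex.{u} ⋙ freeTemplicial k).op

/-- A linear quasi-category: a templicial module in which all inner horns have fillers. -/
def IsLinearQuasicategory (k : Type u) [CommRing k] : ObjectProperty (TemplicialModule.{u} k) :=
  fun X => ∀ ⦃n : ℕ⦄ ⦃i : Fin (n + 1)⦄, 0 < i → i < Fin.last n →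
    ∀ f : (freeTemplicial k).obj (Λ[n, i] : SSet.{u}) ⟶ X,
      ∃ g : (freeTemplicial k).obj (Δ[n] : SSet.{u}) ⟶ X,
        (freeTemplicial k).map Λ[n, i].ι ≫ g = f

/-- The category of linear quasi-categories. -/
abbrev LinQCat (k : Type u) [CommRing k] := (IsLinearQuasicategory k).FullSubcategory

end Free

/-! ### Linear categories -/

/-- Small `k`-linear categories. -/
structure LinCat (k : Type u) [CommRing k] where
  carrier : Type u
  [cat : Category.{u} carrier]
  [preadditive : Preadditive carrier]
  [linear : Linear k carrier]

attribute [instance] LinCat.cat LinCat.preadditive LinCat.linear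

namespace LinCat

/-- `k`-linear functors. -/
@[ext]
structure Hom {k : Type u} [CommRing k] (C D : LinCat k) where
  functor : C.carrier ⥤ D.carrier
  additive : functor.Additive
  linear : functor.Linear k

attribute [instance] Hom.additive Hom.linear

instance (k : Type u) [CommRing k] : Category (LinCat.{u} k) where
  Hom := Hom
  id C := ⟨𝟭 _, inferInstance, inferInstance⟩
  comp F G := ⟨F.functor ⋙ G.functor, inferInstance, inferInstance⟩

/-- The underlying ordinary category. -/
def forget (k : Type u) [CommRing k] : LinCat.{u} k ⥤ Cat.{u, u} where
  obj C := Cat.of C.carrier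
  map F := F.functor.toCatHom

lemma smul_comp_comp {k : Type u} [CommRing k] {D : Type u} [Category.{u} D] [Preadditive D]
    [Linear k D] {A B B' A' : D} (r : k) (e : A ⟶ B) (f : B ⟶ B') (e' : B' ⟶ A') :
    r • (e ≫ f ≫ e') = e ≫ (r • f) ≫ e' := by
  rw [Linear.smul_comp, Linear.comp_smul]

lemma free_functor_ext {k : Type u} [CommRing k] {C : Type u} [Category.{u} C] {D : Type u}
    [Category.{u} D] [Preadditive D] [Linear k D] (F G : CategoryTheory.Free k C ⥤ D)
    [F.Additive] [F.Linear k] [G.Additive] [G.Linear k]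
    (h : Free.embedding k C ⋙ F = Free.embedding k C ⋙ G) : F = G := by
  refine CategoryTheory.Functor.ext (fun X => CategoryTheory.Functor.congr_obj h X) ?_
  intro X Y f
  induction f using Finsupp.induction_linear with
  | zero => exact (F.map_zero X Y).trans (by
      rw [show G.map (0 : (X ⟶ Y)) = 0 from G.map_zero X Y]; simp)
  | add f₁ f₂ w₁ w₂ =>
    refine (F.map_add (f := f₁) (g := f₂)).trans ?_
    rw [w₁, w₂, show G.map ((f₁ : X ⟶ Y) + f₂) = _ from G.map_add]
    simp
  | single f r =>
    have e : (Finsupp.single f r : (X : CategoryTheory.Free k C) ⟶ Y) =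
        r • (Free.embedding k C).map f := (Finsupp.smul_single_one f r).symm
    have h1 : F.map ((Free.embedding k C).map f) = _ := CategoryTheory.Functor.congr_hom h f
    change F.map (Finsupp.single f r : (X : CategoryTheory.Free k C) ⟶ Y) =
      _ ≫ G.map (Finsupp.single f r : (X : CategoryTheory.Free k C) ⟶ Y) ≫ _
    rw [e]
    refine (F.map_smul r _).trans ?_
    refine (congrArg (r • ·) h1).trans ?_
    refine Eq.trans ?_ (congrArg (fun z => _ ≫ z ≫ _)
      (G.map_smul r ((Free.embedding k C).map f)).symm)
    exact smul_comp_comp _ _ _ _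

lemma embedding_comp_lift {k : Type u} [CommRing k] {C : Type u} [Category.{u} C] {D : Type u}
    [Category.{u} D] [Preadditive D] [Linear k D] (F : C ⥤ D) :
    Free.embedding k C ⋙ Free.lift k F = F := by
  refine CategoryTheory.Functor.ext (fun X => rfl) ?_
  intro X Y f
  refine (Free.lift_map_single k F f (1 : k)).trans ?_
  refine (one_smul k _).trans ?_
  change _ = 𝟙 (F.obj X) ≫ F.map f ≫ 𝟙 (F.obj Y)
  simp

/-- The free `k`-linear category on a category. -/
noncomputable def free (k : Type u) [CommRing k] : Cat.{u, u} ⥤ LinCat.{u} k where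
  obj C := { carrier := CategoryTheory.Free k C }
  map {C D} F :=
    { functor := Free.lift (C := C) (D := CategoryTheory.Free k D) k
        (F.toFunctor ⋙ Free.embedding k D)
      additive := Free.lift_additive k _
      linear := Free.lift_linear k _ }
  map_id C := by
    apply Hom.ext
    exact free_functor_ext (C := C) (D := CategoryTheory.Free k C) _ (𝟭 _)
      ((embedding_comp_lift _).trans rfl)
  map_comp {C D E} F G := by
    apply Hom.ext
    refine free_functor_ext (C := C) (D := CategoryTheory.Free k E) _
      (Free.lift (C := C) (D := CategoryTheory.Free k D) k (F.toFunctor ⋙ Free.embedding k D) ⋙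
        Free.lift (C := D) (D := CategoryTheory.Free k E) k (G.toFunctor ⋙ Free.embedding k E)) ?_
    rw [embedding_comp_lift, ← CategoryTheory.Functor.assoc, embedding_comp_lift,
      CategoryTheory.Functor.assoc, embedding_comp_lift]
    rfl

end LinCat

/-! ### The linear nerve -/

section Nerve

variable {C : Type u} [Category.{u} C]

/-- The sequences of objects `A_0, …, A_n` with `A_0 = a` and `A_n = b`. -/
abbrev Path (C : Type u) (n : ℕ) (a b : C) : Type u :=
  {p : Fin (n + 1) → C // p 0 = a ∧ p (Fin.last n) = b}

/-- The composite `A_i ⟶ A_j` of a string of composable morphisms. -/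
noncomputable def composite {n : ℕ} (p : Fin (n + 1) → C)
    (c : ∀ i : Fin n, p i.castSucc ⟶ p i.succ) {i j : Fin (n + 1)} (h : i ≤ j) : p i ⟶ p j :=
  (ComposableArrows.mkOfObjOfMapSucc p c).map (homOfLE h)

section composite

variable {n : ℕ} (p : Fin (n + 1) → C) (c : ∀ i : Fin n, p i.castSucc ⟶ p i.succ)

@[simp]
lemma composite_self (i : Fin (n + 1)) : composite p c (le_refl i) = 𝟙 _ :=
  (ComposableArrows.mkOfObjOfMapSucc p c).map_id i

lemma composite_succ (i : Fin n) (h : i.castSucc ≤ i.succ) : composite p c h = c i :=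
  ComposableArrows.mkOfObjOfMapSucc_map_succ p c i.1 i.2

lemma composite_comp {i j l : Fin (n + 1)} (h : i ≤ j) (h' : j ≤ l) :
    composite p c h ≫ composite p c h' = composite p c (h.trans h') :=
  ((ComposableArrows.mkOfObjOfMapSucc p c).map_comp (homOfLE h) (homOfLE h')).symm

/-- The composite is the value of any functor with the given morphisms between neighbours. -/
lemma map_eq_composite (F : ComposableArrows C n) {i j : Fin (n + 1)} (h : i ≤ j) :
    F.map (homOfLE h) =
      composite F.obj (fun i => F.map (homOfLE (Fin.castSucc_lt_succ (i := i)).le)) h := by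
  induction j using Fin.induction with
  | zero =>
    obtain rfl : i = 0 := le_antisymm h (Fin.zero_le _)
    rw [composite_self]; exact F.map_id _
  | succ j ih =>
    by_cases hij : i = j.succ
    · subst hij; rw [composite_self]; exact F.map_id _
    · have h1 : i ≤ j.castSucc := by
        rw [Fin.le_def] at h ⊢
        have : i.1 ≠ j.1 + 1 := fun e => hij (Fin.ext e)
        simp at h ⊢; omega
      rw [← composite_comp _ _ h1 (Fin.castSucc_lt_succ (i := j)).le, ← ih h1, composite_succ,
        ← F.map_comp]
      rfl

lemma composite_congr (c' : ∀ i : Fin n, p i.castSucc ⟶ p i.succ) {i j : Fin (n + 1)} (h : i ≤ j)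
    (hc : ∀ r : Fin n, i ≤ r.castSucc → r.succ ≤ j → c r = c' r) :
    composite p c h = composite p c' h := by
  induction j using Fin.induction with
  | zero =>
    obtain rfl : i = 0 := le_antisymm h (Fin.zero_le _)
    simp
  | succ j ih =>
    by_cases hij : i = j.succ
    · subst hij; simp
    · have h1 : i ≤ j.castSucc := by
        rw [Fin.le_def] at h ⊢
        have : i.1 ≠ j.1 + 1 := fun e => hij (Fin.ext e)
        simp at h ⊢; omega
      rw [← composite_comp p c h1 (Fin.castSucc_lt_succ (i := j)).le,
        ← composite_comp p c' h1 (Fin.castSucc_lt_succ (i := j)).le, composite_succ,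
        composite_succ, hc j h1 le_rfl,
        ih h1 fun r hr hr' => hc r hr (hr'.trans (Fin.castSucc_lt_succ (i := j)).le)]

lemma composite_update_of_mem (r : Fin n) (x : p r.castSucc ⟶ p r.succ) {i j : Fin (n + 1)}
    (h : i ≤ j) (h1 : i ≤ r.castSucc) (h2 : r.succ ≤ j) :
    composite p (Function.update c r x) h = composite p c h1 ≫ x ≫ composite p c h2 := by
  have hr := (Fin.castSucc_lt_succ (i := r))
  rw [← composite_comp p _ (h1.trans hr.le) h2, ← composite_comp p _ h1 hr.le, composite_succ,
    Function.update_self, Category.assoc]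
  congr 1
  · refine composite_congr p _ _ _ fun s _ hs => Function.update_of_ne ?_ _ _
    rintro rfl
    exact absurd hs (not_le.2 hr)
  · congr 1
    refine composite_congr p _ _ _ fun s hs _ => Function.update_of_ne ?_ _ _
    rintro rfl
    exact absurd hs (not_le.2 hr)

lemma composite_update_of_notMem (r : Fin n) (x : p r.castSucc ⟶ p r.succ) {i j : Fin (n + 1)}
    (h : i ≤ j) (hr : r.succ ≤ i ∨ j ≤ r.castSucc) :
    composite p (Function.update c r x) h = composite p c h := by
  refine composite_congr p _ _ _ fun s h1 h2 => Function.update_of_ne ?_ _ _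
  rintro rfl
  have := (Fin.castSucc_lt_succ (i := s))
  rcases hr with hr | hr
  · exact absurd (hr.trans h1) (not_le.2 this)
  · exact absurd (h2.trans hr) (not_le.2 this)

end composite

lemma IntervalMap.exists_block {m n : ℕ} (f : IntervalMap m n) (r : Fin n) :
    ∃ j : Fin m, f.toOrderHom j.castSucc ≤ r.castSucc ∧ r.succ ≤ f.toOrderHom j.succ := by
  by_contra! hcon
  have key : ∀ j : Fin (m + 1), f.toOrderHom j ≤ r.castSucc := by
    intro j
    induction j using Fin.induction with
    | zero => rw [f.map_zero]; exact Fin.zero_le _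
    | succ j ih =>
      have := hcon j ih
      rw [Fin.lt_def] at this
      rw [Fin.le_def]
      simp only [Fin.val_succ, Fin.val_castSucc] at this ⊢
      omega
  have := key (Fin.last m)
  rw [f.map_last] at this
  exact absurd this (not_le.2 (Fin.castSucc_lt_last r))

lemma IntervalMap.not_block {m n : ℕ} (f : IntervalMap m n) (r : Fin n) {j j' : Fin m}
    (h1 : f.toOrderHom j.castSucc ≤ r.castSucc) (h2 : r.succ ≤ f.toOrderHom j.succ)
    (hne : j' ≠ j) :
    r.succ ≤ f.toOrderHom j'.castSucc ∨ f.toOrderHom j'.succ ≤ r.castSucc := by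
  rcases lt_or_gt_of_ne hne with h | h
  · right
    exact (f.toOrderHom.monotone (by rw [Fin.le_def]; simp; omega)).trans h1
  · left
    exact h2.trans (f.toOrderHom.monotone (by rw [Fin.le_def]; simp; omega))

lemma block_update {m n : ℕ} (f : IntervalMap m n) (p : Fin (n + 1) → C)
    (c : ∀ i : Fin n, p i.castSucc ⟶ p i.succ) (r : Fin n) {j : Fin m}
    (h1 : f.toOrderHom j.castSucc ≤ r.castSucc) (h2 : r.succ ≤ f.toOrderHom j.succ)
    (z : p r.castSucc ⟶ p r.succ) :
    (fun j => composite p (Function.update c r z)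
      (f.toOrderHom.monotone (Fin.castSucc_lt_succ (i := j)).le)) =
    Function.update (fun j => composite p c
      (f.toOrderHom.monotone (Fin.castSucc_lt_succ (i := j)).le)) j
      (composite p c h1 ≫ z ≫ composite p c h2) := by
  funext j'
  by_cases hj : j' = j
  · subst hj
    rw [Function.update_self]
    exact composite_update_of_mem p c r z _ h1 h2
  · rw [Function.update_of_ne hj]
    exact composite_update_of_notMem p c r z _ (f.not_block r h1 h2 hj)

/-- The simplicial operator on a string of morphisms: compose the blocks determined by `f`. -/
noncomputable def blockMultilinear (k : Type u) [CommRing k] [Preadditive C] [Linear k C] {m n : ℕ}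
    (f : IntervalMap m n) (p : Fin (n + 1) → C) :
    MultilinearMap k (fun i : Fin n => p i.castSucc ⟶ p i.succ)
      (⨂[k] j : Fin m, (p (f.toOrderHom j.castSucc) ⟶ p (f.toOrderHom j.succ))) :=
  MultilinearMap.mk'
    (fun c => PiTensorProduct.tprod k fun j =>
      composite p c (f.toOrderHom.monotone (Fin.castSucc_lt_succ (i := j)).le))
    (fun c r x y => by
      obtain ⟨j, h1, h2⟩ := f.exists_block r
      rw [block_update f p c r h1 h2, block_update f p c r h1 h2, block_update f p c r h1 h2,
        ← MultilinearMap.map_update_add]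
      simp)
    (fun c r s x => by
      obtain ⟨j, h1, h2⟩ := f.exists_block r
      rw [block_update f p c r h1 h2, block_update f p c r h1 h2,
        ← MultilinearMap.map_update_smul]
      simp)

/-- The first `m` morphisms of a string of `m + n` morphisms. -/
def frontString {m n : ℕ} (p : Fin (m + n + 1) → C)
    (c : ∀ i : Fin (m + n), p i.castSucc ⟶ p i.succ) (i : Fin m) :
    p ⟨i.castSucc.1, by simp only [Fin.val_castSucc]; omega⟩ ⟶ p ⟨i.succ.1, by simp only [Fin.val_succ]; omega⟩ :=
  c ⟨i.1, by omega⟩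

/-- The last `n` morphisms of a string of `m + n` morphisms. -/
def backString {m n : ℕ} (p : Fin (m + n + 1) → C)
    (c : ∀ i : Fin (m + n), p i.castSucc ⟶ p i.succ) (i : Fin n) :
    p ⟨m + i.castSucc.1, by simp only [Fin.val_castSucc]; omega⟩ ⟶ p ⟨m + i.succ.1, by simp only [Fin.val_succ]; omega⟩ :=
  c ⟨m + i.1, by omega⟩

section split

variable {m n : ℕ} (p : Fin (m + n + 1) → C) (c : ∀ i : Fin (m + n), p i.castSucc ⟶ p i.succ)

lemma frontString_update_lt (r : Fin m)
    (x : p (Fin.castSucc ⟨r.1, by omega⟩) ⟶ p (Fin.succ ⟨r.1, by omega⟩)) :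
    frontString p (Function.update c ⟨r.1, by omega⟩ x) =
      Function.update (frontString p c) r x := by
  funext i
  by_cases h : i = r
  · subst h
    rw [Function.update_self]
    exact Function.update_self _ _ _
  · rw [Function.update_of_ne h]
    exact Function.update_of_ne (show (⟨i.1, by omega⟩ : Fin (m + n)) ≠ ⟨r.1, by omega⟩ from
      fun e => h (Fin.ext (Fin.mk.inj e))) _ _

lemma frontString_update_ge (r : Fin (m + n)) (hr : m ≤ r.1) (x : p r.castSucc ⟶ p r.succ) :
    frontString p (Function.update c r x) = frontString p c := by
  funext i
  exact Function.update_of_ne (fun e => by have := congrArg Fin.val e; simp at this; omega) _ _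

lemma backString_update_ge (r : Fin n)
    (x : p (Fin.castSucc ⟨m + r.1, by omega⟩) ⟶ p (Fin.succ ⟨m + r.1, by omega⟩)) :
    backString p (Function.update c ⟨m + r.1, by omega⟩ x) =
      Function.update (backString p c) r x := by
  funext i
  by_cases h : i = r
  · subst h
    rw [Function.update_self]
    exact Function.update_self _ _ _
  · rw [Function.update_of_ne h]
    exact Function.update_of_ne
      (fun e => h (Fin.ext (by have := congrArg Fin.val e; simp at this; omega))) _ _

lemma backString_update_lt (r : Fin (m + n)) (hr : r.1 < m) (x : p r.castSucc ⟶ p r.succ) :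
    backString p (Function.update c r x) = backString p c := by
  funext i
  exact Function.update_of_ne (fun e => by have := congrArg Fin.val e; simp at this; omega) _ _

/-- Splitting a string of `m + n` morphisms after the first `m`. -/
noncomputable def splitMultilinear (k : Type u) [CommRing k] [Preadditive C] [Linear k C]
    {m n : ℕ} (p : Fin (m + n + 1) → C) :
    MultilinearMap k (fun i : Fin (m + n) => p i.castSucc ⟶ p i.succ)
      ((⨂[k] i : Fin m, (p ⟨i.castSucc.1, by simp only [Fin.val_castSucc]; omega⟩ ⟶ p ⟨i.succ.1, by simp only [Fin.val_succ]; omega⟩)) ⊗[k]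
        (⨂[k] i : Fin n,
          (p ⟨m + i.castSucc.1, by simp only [Fin.val_castSucc]; omega⟩ ⟶ p ⟨m + i.succ.1, by simp only [Fin.val_succ]; omega⟩))) :=
  MultilinearMap.mk'
    (fun c => PiTensorProduct.tprod k (frontString p c) ⊗ₜ PiTensorProduct.tprod k (backString p c))
    (fun c r x y => by
      rcases lt_or_ge r.1 m with hr | hr
      · rw [backString_update_lt p c r hr, backString_update_lt p c r hr,
          backString_update_lt p c r hr, ← TensorProduct.add_tmul]
        congr 1
        have key := frontString_update_lt p c ⟨r.1, hr⟩
        exact (congrArg _ (key (x + y))).trans ((MultilinearMap.map_update_add _ _ _ _ _).trans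
          (congrArg₂ _ (congrArg _ (key x).symm) (congrArg _ (key y).symm)))
      · obtain ⟨r, hr'⟩ := r
        obtain ⟨s, rfl⟩ := Nat.exists_eq_add_of_le hr
        rw [frontString_update_ge p c _ hr, frontString_update_ge p c _ hr,
          frontString_update_ge p c _ hr, ← TensorProduct.tmul_add]
        congr 1
        have key := backString_update_ge p c ⟨s, by omega⟩
        exact (congrArg _ (key (x + y))).trans ((MultilinearMap.map_update_add _ _ _ _ _).trans
          (congrArg₂ _ (congrArg _ (key x).symm) (congrArg _ (key y).symm))))
    (fun c r a x => by
      rcases lt_or_ge r.1 m with hr | hr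
      · rw [backString_update_lt p c r hr, backString_update_lt p c r hr,
          TensorProduct.smul_tmul']
        congr 1
        have key := frontString_update_lt p c ⟨r.1, hr⟩
        exact (congrArg _ (key (a • x))).trans ((MultilinearMap.map_update_smul _ _ _ _ _).trans
          (congrArg _ (congrArg _ (key x).symm)))
      · obtain ⟨r, hr'⟩ := r
        obtain ⟨s, rfl⟩ := Nat.exists_eq_add_of_le hr
        rw [frontString_update_ge p c _ hr, frontString_update_ge p c _ hr,
          ← TensorProduct.tmul_smul]
        congr 1
        have key := backString_update_ge p c ⟨s, by omega⟩
        exact (congrArg _ (key (a • x))).trans ((MultilinearMap.map_update_smul _ _ _ _ _).trans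
          (congrArg _ (congrArg _ (key x).symm))))

end split
section

variable {m n : ℕ} {a b : C}

def Path.map (f : IntervalMap m n) (p : Path C n a b) : Path C m a b :=
  ⟨fun i => p.1 (f.toOrderHom i), (congrArg p.1 f.map_zero).trans p.2.1,
    (congrArg p.1 f.map_last).trans p.2.2⟩

/-- The `m`-th object of a path of length `m + n`. -/
def Path.mid (m n : ℕ) (p : Path C (m + n) a b) : C := p.1 ⟨m, by omega⟩

def Path.front (p : Path C (m + n) a b) : Path C m a (Path.mid m n p) :=
  ⟨fun i => p.1 ⟨i.1, by omega⟩, p.2.1, rfl⟩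

def Path.back (p : Path C (m + n) a b) : Path C n (Path.mid m n p) b :=
  ⟨fun i => p.1 ⟨m + i.1, by omega⟩, rfl, p.2.2⟩

end

end Nerve

section NerveData

variable (k : Type u) [CommRing k] (C : Type u) [Category.{u} C] [Preadditive C] [Linear k C]

/-- `N_k(C)_n(a, b) = ⨁ C(A_0, A_1) ⊗ … ⊗ C(A_{n-1}, A_n)` over all `A_0, …, A_n` with `A_0 = a`
and `A_n = b`. -/
abbrev NerveObj (n : ℕ) (a b : C) : Type u :=
  ⨁ p : Path C n a b, ⨂[k] i : Fin n, (p.1 i.castSucc ⟶ p.1 i.succ)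

open Classical in
/-- The inclusion of the summand of a path. -/
noncomputable abbrev nerveIncl {n : ℕ} {a b : C} (p : Path C n a b) :
    (⨂[k] i : Fin n, (p.1 i.castSucc ⟶ p.1 i.succ)) →ₗ[k] NerveObj k C n a b :=
  DirectSum.lof k (Path C n a b) (fun p => ⨂[k] i : Fin n, (p.1 i.castSucc ⟶ p.1 i.succ)) p

open Classical in
/-- The simplicial operators of the nerve, given by composition and identities in `C`. -/
noncomputable def nerveOp {m n : ℕ} (f : IntervalMap m n) (a b : C) :
    NerveObj k C n a b →ₗ[k] NerveObj k C m a b :=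
  DirectSum.toModule k _ _ fun p =>
    nerveIncl k C (Path.map f p) ∘ₗ PiTensorProduct.lift (blockMultilinear k f p.1)

open Classical in
/-- The canonical map `C^{⊗ (m + n)} ⟶ C^{⊗ m} ⊗ C^{⊗ n}`. -/
noncomputable def nerveComul (m n : ℕ) (a b : C) :
    NerveObj k C (m + n) a b →ₗ[k] ⨁ c : C, (NerveObj k C m a c ⊗[k] NerveObj k C n c b) :=
  DirectSum.toModule k _ _ fun p =>
    DirectSum.lof k C (fun c => NerveObj k C m a c ⊗[k] NerveObj k C n c b) (Path.mid m n p) ∘ₗ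
      TensorProduct.map (nerveIncl k C (Path.front p)) (nerveIncl k C (Path.back p)) ∘ₗ
        PiTensorProduct.lift (splitMultilinear k p.1)

open Classical in
/-- The canonical isomorphism `C^{⊗ 0} ⟶ I`, on the diagonal. -/
noncomputable def nerveCounit (a : C) : NerveObj k C 0 a a →ₗ[k] k :=
  DirectSum.toModule k _ _ fun _ => (PiTensorProduct.isEmptyEquiv (Fin 0)).toLinearMap

variable {C}

/-- The element of `N_k(C)_n` given by a string of `n` composable morphisms. -/
noncomputable def nerveGen {n : ℕ} {a b : C}
    (y : Simp (nerve C) (fun F : ComposableArrows C 0 => F.obj 0) n a b) : NerveObj k C n a b :=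
  nerveIncl k C (⟨(y.val : ComposableArrows C n).obj, y.first, y.last⟩ : Path C n a b)
    (PiTensorProduct.tprod k fun i =>
      (y.val : ComposableArrows C n).map (homOfLE (Fin.castSucc_lt_succ (i := i)).le))

lemma nerveGen_eq {n : ℕ} {a b : C} (p : Path C n a b)
    (c : ∀ i : Fin n, p.1 i.castSucc ⟶ p.1 i.succ) :
    nerveGen k ⟨ComposableArrows.mkOfObjOfMapSucc p.1 c, p.2.1, p.2.2⟩ =
      nerveIncl k C p (PiTensorProduct.tprod k c) := by
  unfold nerveGen
  congr 2
  funext i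
  exact ComposableArrows.mkOfObjOfMapSucc_map_succ p.1 c i.1 i.2

lemma span_nerveGen (n : ℕ) (a b : C) :
    Submodule.span k (Set.range (nerveGen k (n := n) (a := a) (b := b))) = ⊤ := by
  classical
  rw [eq_top_iff]
  rintro x -
  induction x using DirectSum.induction_on with
  | zero => exact zero_mem _
  | add x y hx hy => exact add_mem hx hy
  | of p t =>
    have ht : t ∈ Submodule.span k (Set.range (PiTensorProduct.tprod k)) := by
      rw [PiTensorProduct.span_tprod_eq_top]; trivial
    change nerveIncl k C p t ∈ _
    induction ht using Submodule.span_induction with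
    | mem t h =>
      obtain ⟨c, rfl⟩ := h
      rw [← nerveGen_eq]
      exact Submodule.subset_span ⟨_, rfl⟩
    | zero => rw [map_zero]; exact zero_mem _
    | add s t _ _ hs ht => rw [map_add]; exact add_mem hs ht
    | smul r t _ ht => rw [map_smul]; exact Submodule.smul_mem _ _ ht

open Classical in
lemma nerveOp_tprod {m n : ℕ} (f : IntervalMap m n) (a b : C) (p : Path C n a b)
    (c : ∀ i : Fin n, p.1 i.castSucc ⟶ p.1 i.succ) :
    nerveOp k C f a b (nerveIncl k C p (PiTensorProduct.tprod k c)) =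
      nerveIncl k C (Path.map f p) (PiTensorProduct.tprod k fun j => composite p.1 c
        (f.toOrderHom.monotone (Fin.castSucc_lt_succ (i := j)).le)) := by
  refine (DirectSum.toModule_lof k p _).trans ?_
  exact congrArg (nerveIncl k C (Path.map f p)) (PiTensorProduct.lift.tprod c)

lemma nerveOp_gen {m n : ℕ} (f : IntervalMap m n) (a b : C)
    (y : Simp (nerve C) (fun F : ComposableArrows C 0 => F.obj 0) n a b) :
    nerveOp k C f a b (nerveGen k y) = nerveGen k (y.map f) := by
  refine (nerveOp_tprod k f a b ⟨(y.val : ComposableArrows C n).obj, y.first, y.last⟩ _).trans ?_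
  refine congrArg (fun z => nerveIncl k C (Path.map f
    ⟨(y.val : ComposableArrows C n).obj, y.first, y.last⟩) (PiTensorProduct.tprod k z)) ?_
  funext i
  exact (map_eq_composite (y.val : ComposableArrows C n) _).symm

open Classical in
lemma nerveComul_tprod (m n : ℕ) (a b : C) (p : Path C (m + n) a b)
    (c : ∀ i : Fin (m + n), p.1 i.castSucc ⟶ p.1 i.succ) :
    nerveComul k C m n a b (nerveIncl k C p (PiTensorProduct.tprod k c)) =
      DirectSum.lof k C (fun c => NerveObj k C m a c ⊗[k] NerveObj k C n c b) (Path.mid m n p)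
        (nerveIncl k C (Path.front p) (PiTensorProduct.tprod k (frontString p.1 c)) ⊗ₜ
          nerveIncl k C (Path.back p) (PiTensorProduct.tprod k (backString p.1 c))) := by
  refine (DirectSum.toModule_lof k p _).trans ?_
  refine congrArg (DirectSum.lof k C (fun c => NerveObj k C m a c ⊗[k] NerveObj k C n c b)
    (Path.mid m n p)) ?_
  let T : _ →ₗ[k] NerveObj k C m a (Path.mid m n p) ⊗[k] NerveObj k C n (Path.mid m n p) b :=
    TensorProduct.map (nerveIncl k C (Path.front p)) (nerveIncl k C (Path.back p))
  exact congrArg T (PiTensorProduct.lift.tprod (φ := splitMultilinear k p.1) c)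

open Classical in
lemma nerveComul_gen (m n : ℕ) (a b : C)
    (y : Simp (nerve C) (fun F : ComposableArrows C 0 => F.obj 0) (m + n) a b) :
    nerveComul k C m n a b (nerveGen k y) =
      DirectSum.lof k C (fun c => NerveObj k C m a c ⊗[k] NerveObj k C n c b) y.mid
        (nerveGen k (y.front m n rfl) ⊗ₜ nerveGen k (y.back m n rfl)) :=
  (nerveComul_tprod k m n a b ⟨(y.val : ComposableArrows C (m + n)).obj, y.first, y.last⟩ _).trans
    rfl

lemma nerveCounit_gen (a : C)
    (y : Simp (nerve C) (fun F : ComposableArrows C 0 => F.obj 0) 0 a a) :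
    nerveCounit k C a (nerveGen k y) = 1 := by
  classical
  unfold nerveCounit
  rw [nerveGen, DirectSum.toModule_lof]
  exact PiTensorProduct.isEmptyEquiv_apply_tprod _ _

lemma nerveCounit_bijective (a : C) : Function.Bijective (nerveCounit k C a) := by
  classical
  let p₀ : Path C 0 a a := ⟨fun _ => a, rfl, rfl⟩
  have hp : ∀ p : Path C 0 a a, p = p₀ := fun p => by
    apply Subtype.ext
    funext i
    obtain rfl : i = 0 := Subsingleton.elim (α := Fin 1) _ _
    exact p.2.1
  have h1 : ∀ t, nerveCounit k C a (nerveIncl k C p₀ t) =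
      PiTensorProduct.isEmptyEquiv (R := k) (Fin 0) t := fun t => by
    unfold nerveCounit
    rw [DirectSum.toModule_lof]
    rfl
  have h2 : Function.Surjective (nerveIncl k C p₀) := by
    intro x
    induction x using DirectSum.induction_on with
    | zero => exact ⟨0, map_zero _⟩
    | add x y hx hy =>
      obtain ⟨s, rfl⟩ := hx
      obtain ⟨t, rfl⟩ := hy
      exact ⟨s + t, map_add _ _ _⟩
    | of p t =>
      obtain rfl := hp p
      exact ⟨t, rfl⟩
  constructor
  · intro x y hxy
    obtain ⟨s, rfl⟩ := h2 x
    obtain ⟨t, rfl⟩ := h2 y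
    rw [h1, h1] at hxy
    rw [(PiTensorProduct.isEmptyEquiv (R := k) (Fin 0)).injective hxy]
  · intro r
    obtain ⟨t, rfl⟩ := (PiTensorProduct.isEmptyEquiv (R := k)
      (s := fun i : Fin 0 => (p₀.1 i.castSucc ⟶ p₀.1 i.succ)) (Fin 0)).surjective r
    exact ⟨_, h1 t⟩

open Classical in
/-- The nerve of `C`, as a templicial module. -/
noncomputable def nerveData (C : Type u) [Category.{u} C] [Preadditive C] [Linear k C] :
    SpannedData k (nerve C) C where
  vert := fun F : ComposableArrows C 0 => F.obj 0
  obj n a b := ModuleCat.of k (NerveObj k C n a b)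
  gen := nerveGen k
  span_gen := span_nerveGen k
  map f a b := nerveOp k C f a b
  map_gen := nerveOp_gen k
  comul := nerveComul k C
  comul_gen m n a b y := nerveComul_gen k m n a b y
  counit := nerveCounit k C
  counit_gen := nerveCounit_gen k
  counit_bijective := nerveCounit_bijective k

end NerveData

section NerveFunctor

variable {k : Type u} [CommRing k]

open Classical in
/-- The map induced on nerves by a linear functor. -/
noncomputable def nerveApp {C D : LinCat.{u} k} (H : LinCat.Hom C D) (n : ℕ) (a b : C.carrier) :
    NerveObj k C.carrier n a b →ₗ[k]
      NerveObj k D.carrier n (H.functor.obj a) (H.functor.obj b) :=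
  DirectSum.toModule k _ _ fun p =>
    nerveIncl k D.carrier (⟨fun i => H.functor.obj (p.1 i), congrArg H.functor.obj p.2.1,
      congrArg H.functor.obj p.2.2⟩ : Path D.carrier n (H.functor.obj a) (H.functor.obj b)) ∘ₗ
      PiTensorProduct.map fun _ => H.functor.mapLinearMap k

open Classical in
lemma nerveApp_gen {C D : LinCat.{u} k} (H : LinCat.Hom C D) (n : ℕ) (a b : C.carrier)
    (y : Simp (nerve C.carrier) (nerveData k C.carrier).vert n a b) :
    nerveApp H n a b (nerveGen k y) =
      nerveGen k (y.push (vert' := (nerveData k D.carrier).vert) (nerveMap H.functor)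
        H.functor.obj (fun _ => rfl)) := by
  refine (DirectSum.toModule_lof k _ _).trans ?_
  exact congrArg (nerveIncl k D.carrier _) (PiTensorProduct.map_tprod _ _)

/-- The linear nerve functor `N_k`. -/
noncomputable def linearNerve (k : Type u) [CommRing k] : LinCat.{u} k ⥤ TemplicialModule.{u} k where
  obj C := (nerveData k C.carrier).toTemplicial
  map {C D} H := SpannedData.homMk (nerveData k C.carrier) (nerveData k D.carrier)
    (nerveMap H.functor) H.functor.obj (fun _ => rfl) (nerveApp H) (nerveApp_gen H)
  map_id C := by
    refine TemplicialModule.Hom.ext rfl (heq_of_eq ?_)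
    funext n a b
    refine (nerveData k C.carrier).hom_ext fun y => ?_
    exact (nerveApp_gen _ n a b y).trans rfl
  map_comp {C D E} F G := by
    refine TemplicialModule.Hom.ext rfl (heq_of_eq ?_)
    funext n a b
    refine (nerveData k C.carrier).hom_ext fun y => ?_
    refine (nerveApp_gen _ n a b y).trans ?_
    symm
    refine (congrArg (nerveApp G n _ _) (nerveApp_gen F n a b y)).trans ?_
    exact (nerveApp_gen G n _ _ _).trans rfl

end NerveFunctor

/-! ### Nerve and homotopy category -/

/-- The nerve functor from categories to quasi-categories. -/
def nerveQCat : Cat.{u, u} ⥤ SSet.QCat.{u} :=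
  ObjectProperty.lift _ nerveFunctor fun C => inferInstanceAs (SSet.Quasicategory (nerve C))

section HomotopyCategory

variable (X : SSet.{u})

lemma δ_comp_symm {n : ℕ} (i : Fin (n + 2)) (x : X _⦋n + 1⦌) :
    SSet.stdSimplex.δ i ≫ SSet.yonedaEquiv.symm x = SSet.yonedaEquiv.symm (X.δ i x) := by
  apply SSet.yonedaEquiv.injective
  rw [Equiv.apply_symm_apply]
  rfl

/-- Inner horn filling in terms of simplices. -/
lemma exists_simplex [SSet.Quasicategory X] {n : ℕ} {i : Fin (n + 3)} (h0 : 0 < i)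
    (hn : i < Fin.last (n + 2)) (s : Fin (n + 3) → X _⦋n + 1⦌)
    (hs : ∀ (j k : Fin (n + 3)) (_ : j ≠ i) (_ : k ≠ i) (hjk : j < k),
      X.δ (k.pred (Fin.ne_zero_of_lt hjk)) (s j) =
        X.δ (j.castPred (Fin.ne_last_of_lt hjk)) (s k)) :
    ∃ σ : X _⦋n + 2⦌, ∀ j, j ≠ i → X.δ j σ = s j := by
  have hc : SSet.horn.IsCompatible (i := i) (fun j _ => SSet.yonedaEquiv.symm (s j)) := by
    rw [SSet.horn.isCompatible_iff]
    intro j k hj hk hjk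
    rw [δ_comp_symm, δ_comp_symm, hs j k hj hk hjk]
  obtain ⟨φ, hφ⟩ := hc.exists_desc
  obtain ⟨g, rfl⟩ := SSet.Quasicategory.hornFilling h0 hn φ
  refine ⟨SSet.yonedaEquiv g, fun j hj => ?_⟩
  apply SSet.yonedaEquiv.symm.injective
  rw [← δ_comp_symm, Equiv.symm_apply_apply, ← hφ j hj, SSet.horn.ι_ι_assoc]

/-- The `2`-truncation of a quasi-category has the horn fillers needed to compose and compare
edges. -/
instance [SSet.Quasicategory X] :
    SSet.Truncated.Quasicategory₂ ((SSet.truncation 2).obj X) where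
  fill21 {x₀ x₁ x₂} e₀₁ e₁₂ := by
    obtain ⟨σ, h⟩ := exists_simplex X (i := 1) (by decide) (by decide)
      ![e₁₂.edge, e₀₁.edge, e₀₁.edge] (by
        intro j k hj hk hjk
        fin_cases j <;> fin_cases k <;> first | (exfalso; revert hj hk hjk; decide) | skip
        exact e₁₂.src_eq.trans e₀₁.tgt_eq.symm)
    exact ⟨⟨⟨X.δ 1 σ, 
      (SSet.δ_comp_δ_apply (S := X) (i := 1) (j := 1) le_rfl σ).symm.trans
        ((congrArg (X.δ 1) (h 2 (by decide))).trans e₀₁.src_eq),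
      (SSet.δ_comp_δ_apply (S := X) (i := 0) (j := 0) le_rfl σ).trans
        ((congrArg (X.δ 0) (h 0 (by decide))).trans e₁₂.tgt_eq)⟩, ⟨σ, h 2 (by decide), h 0 (by decide), rfl⟩⟩⟩
  fill31 {x₀ x₁ x₂ x₃ e₀₁ e₁₂ e₂₃ e₀₂ e₁₃ e₀₃} f₃ f₀ f₂ := by
    obtain ⟨σ, h⟩ := exists_simplex X (i := 1) (by decide) (by decide)
      ![f₀.simplex, f₂.simplex, f₂.simplex, f₃.simplex] (by
        intro j k hj hk hjk
        fin_cases j <;> fin_cases k <;> first | (exfalso; revert hj hk hjk; decide) | skip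
        · exact f₀.d₁.trans f₂.d₀.symm
        · exact f₀.d₂.trans f₃.d₀.symm
        · exact f₂.d₂.trans f₃.d₂.symm)
    exact ⟨⟨X.δ 1 σ,
      (SSet.δ_comp_δ_apply (S := X) (i := 1) (j := 2) (by decide) σ).symm.trans
        ((congrArg (X.δ 1) (h 3 (by decide))).trans f₃.d₁),
      (SSet.δ_comp_δ_apply (S := X) (i := 0) (j := 0) le_rfl σ).trans
        ((congrArg (X.δ 0) (h 0 (by decide))).trans f₀.d₀),
      (SSet.δ_comp_δ_apply (S := X) (i := 1) (j := 1) le_rfl σ).symm.trans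
        ((congrArg (X.δ 1) (h 2 (by decide))).trans f₂.d₁)⟩⟩
  fill32 {x₀ x₁ x₂ x₃ e₀₁ e₁₂ e₂₃ e₀₂ e₁₃ e₀₃} f₃ f₀ f₁ := by
    obtain ⟨σ, h⟩ := exists_simplex X (i := 2) (by decide) (by decide)
      ![f₀.simplex, f₁.simplex, f₁.simplex, f₃.simplex] (by
        intro j k hj hk hjk
        fin_cases j <;> fin_cases k <;> first | (exfalso; revert hj hk hjk; decide) | skip
        · exact f₀.d₀.trans f₁.d₀.symm
        · exact f₀.d₂.trans f₃.d₀.symm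
        · exact f₁.d₂.trans f₃.d₁.symm)
    exact ⟨⟨X.δ 2 σ,
      (SSet.δ_comp_δ_apply (S := X) (i := 2) (j := 2) le_rfl σ).symm.trans
        ((congrArg (X.δ 2) (h 3 (by decide))).trans f₃.d₂),
      (SSet.δ_comp_δ_apply (S := X) (i := 0) (j := 1) (by decide) σ).trans
        ((congrArg (X.δ 1) (h 0 (by decide))).trans f₀.d₁),
      (SSet.δ_comp_δ_apply (S := X) (i := 1) (j := 1) le_rfl σ).trans
        ((congrArg (X.δ 1) (h 1 (by decide))).trans f₁.d₁)⟩⟩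

/-- The homotopy category of a quasi-category: its objects are the vertices and its morphisms are
the homotopy classes of edges. -/
abbrev HoCat [SSet.Quasicategory X] : Type u :=
  SSet.Truncated.HomotopyCategory₂ ((SSet.truncation 2).obj X)

variable {X}

/-- The homotopy class of an edge. -/
def edgeClass [SSet.Quasicategory X] {x y : X _⦋0⦌} (e : SSet.Edge x y) :
    (⟨x⟩ : HoCat X) ⟶ ⟨y⟩ :=
  SSet.Truncated.HomotopyCategory₂.homMk e.toTruncated

variable {Y Z : SSet.{u}}

/-- The functor induced on homotopy categories. -/
def hoMap [SSet.Quasicategory X] [SSet.Quasicategory Y] (φ : X ⟶ Y) : HoCat X ⥤ HoCat Y where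
  obj x := ⟨φ.app _ x.pt⟩
  map {x y} := Quotient.map (fun e => e.map ((SSet.truncation 2).map φ)) (by
    rintro e e' ⟨s⟩
    have s' := s.map ((SSet.truncation 2).map φ)
    rw [SSet.Truncated.Edge.map_id] at s'
    exact ⟨s'⟩)
  map_id x := congrArg (Quotient.mk _) (SSet.Truncated.Edge.map_id _ _)
  map_comp {x y z} f g := by
    obtain ⟨x⟩ := x
    obtain ⟨y⟩ := y
    obtain ⟨z⟩ := z
    obtain ⟨e, rfl⟩ := SSet.Truncated.HomotopyCategory₂.homMk_surjective f
    obtain ⟨e', rfl⟩ := SSet.Truncated.HomotopyCategory₂.homMk_surjective g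
    exact (((SSet.Truncated.Edge.compStruct e e').map
      ((SSet.truncation 2).map φ)).homotopyCategory₂_fac).symm

lemma hoMap_id [SSet.Quasicategory X] : hoMap (𝟙 X) = 𝟭 (HoCat X) := by
  refine CategoryTheory.Functor.hext (fun _ => rfl) ?_
  rintro x y ⟨e⟩
  rfl

lemma hoMap_comp [SSet.Quasicategory X] [SSet.Quasicategory Y] [SSet.Quasicategory Z]
    (φ : X ⟶ Y) (ψ : Y ⟶ Z) : hoMap (φ ≫ ψ) = hoMap φ ⋙ hoMap ψ := by
  refine CategoryTheory.Functor.hext (fun _ => rfl) ?_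
  rintro x y ⟨e⟩
  rfl

instance (X : SSet.QCat.{u}) : SSet.Quasicategory X.obj := X.property

/-- The homotopy category functor. -/
noncomputable def homotopyCategory : SSet.QCat.{u} ⥤ Cat.{u, u} where
  obj X := Cat.of (HoCat X.obj)
  map φ := (hoMap φ.hom).toCatHom
  map_id X := congrArg Functor.toCatHom (hoMap_id (X := X.obj))
  map_comp f g := congrArg Functor.toCatHom (hoMap_comp f.hom g.hom)

end HomotopyCategory

/-! ### The linear homotopy category -/

section LinearHomotopy

variable {k : Type u} [CommRing k]

/-- The vertex of `Δ[1]` given by `i`. -/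
def vertexOne (i : Fin 2) : (Δ[1] : SSet.{u}) _⦋0⦌ :=
  SSet.stdSimplex.objEquiv.symm (SimplexCategory.const ⦋0⦌ ⦋1⦌ i)

/-- The nondegenerate `1`-simplex of `Δ[1]`. -/
def edgeOne : Simp (Δ[1] : SSet.{u}) (fun y => y) 1 (vertexOne 0) (vertexOne 1) where
  val := SSet.stdSimplex.objEquiv.symm (𝟙 ⦋1⦌)
  first := rfl
  last := rfl

/-- The element of the base of `X` corresponding to a vertex of `Ũ(X)`. -/
noncomputable def vertexBase {X : TemplicialModule.{u} k} (x : (underlying.obj X) _⦋0⦌) : X.base :=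
  TemplicialModule.Hom.base (x : (freeTemplicial k).obj (Δ[0] : SSet.{u}) ⟶ X)
    (SSet.stdSimplex.objEquiv.symm (𝟙 ⦋0⦌) : (Δ[0] : SSet.{u}) _⦋0⦌)

/-- The two ends of a `1`-simplex of `Ũ(X)`, as elements of the base of `X`. -/
noncomputable def endBase {X : TemplicialModule.{u} k} (s : (underlying.obj X) _⦋1⦌) (i : Fin 2) :
    X.base :=
  TemplicialModule.Hom.base (s : (freeTemplicial k).obj (Δ[1] : SSet.{u}) ⟶ X) (vertexOne i)

/-- The element of `X_1` corresponding to a `1`-simplex of `Ũ(X)`, namely the image of the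
nondegenerate `1`-simplex of `Δ[1]`. -/
noncomputable def simplexValue {X : TemplicialModule.{u} k} (s : (underlying.obj X) _⦋1⦌) :
    X.obj 1 (endBase s 0) (endBase s 1) :=
  TemplicialModule.Hom.app (s : (freeTemplicial k).obj (Δ[1] : SSet.{u}) ⟶ X) 1
    (vertexOne 0) (vertexOne 1) (Finsupp.single edgeOne (1 : k))

lemma endBase_zero {X : TemplicialModule.{u} k} {x y : (underlying.obj X) _⦋0⦌}
    (e : SSet.Edge x y) : endBase e.edge 0 = vertexBase x := by
  refine Eq.trans ?_ (congrArg vertexBase e.src_eq)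
  have h : vertexOne 0 = (SSet.stdSimplex.δ (1 : Fin 2)).app _
      (SSet.stdSimplex.objEquiv.symm (𝟙 ⦋0⦌) : (Δ[0] : SSet.{u}) _⦋0⦌) := by
    apply SSet.stdSimplex.objEquiv.injective
    apply SimplexCategory.Hom.ext
    ext i
    obtain rfl : i = 0 := Subsingleton.elim (α := Fin 1) _ _
    rfl
  exact congrArg (TemplicialModule.Hom.base
    (e.edge : (freeTemplicial k).obj (Δ[1] : SSet.{u}) ⟶ X)) h

lemma endBase_one {X : TemplicialModule.{u} k} {x y : (underlying.obj X) _⦋0⦌}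
    (e : SSet.Edge x y) : endBase e.edge 1 = vertexBase y := by
  refine Eq.trans ?_ (congrArg vertexBase e.tgt_eq)
  have h : vertexOne 1 = (SSet.stdSimplex.δ (0 : Fin 2)).app _
      (SSet.stdSimplex.objEquiv.symm (𝟙 ⦋0⦌) : (Δ[0] : SSet.{u}) _⦋0⦌) := by
    apply SSet.stdSimplex.objEquiv.injective
    apply SimplexCategory.Hom.ext
    ext i
    obtain rfl : i = 0 := Subsingleton.elim (α := Fin 1) _ _
    rfl
  exact congrArg (TemplicialModule.Hom.base
    (e.edge : (freeTemplicial k).obj (Δ[1] : SSet.{u}) ⟶ X)) h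

/-- The element of `X_1(a, b)` corresponding to an edge of `Ũ(X)` from `a` to `b`. -/
noncomputable def edgeValue {X : TemplicialModule.{u} k} {x y : (underlying.obj X) _⦋0⦌}
    (e : SSet.Edge x y) : X.obj 1 (vertexBase x) (vertexBase y) :=
  cast (congrArg₂ (fun a b => (X.obj 1 a b : Type u)) (endBase_zero e) (endBase_one e))
    (simplexValue e.edge)

variable (k)

/-- The statement that `F̃` sends quasi-categories to linear quasi-categories. -/
def FreePreserves : Prop :=
  ∀ Y : SSet.{u}, SSet.Quasicategory Y → IsLinearQuasicategory k ((freeTemplicial k).obj Y)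

/-- The statement that `Ũ` sends linear quasi-categories to quasi-categories. -/
def UnderlyingPreserves : Prop :=
  ∀ X : TemplicialModule.{u} k, IsLinearQuasicategory k X → SSet.Quasicategory (underlying.obj X)

/-- The statement that nerves of linear categories are linear quasi-categories. -/
def NervePreserves : Prop :=
  ∀ C : LinCat.{u} k, IsLinearQuasicategory k ((linearNerve k).obj C)

variable {k}

/-- The functor `F̃` from quasi-categories to linear quasi-categories. -/
noncomputable def freeQCat (hF : FreePreserves.{u} k) : SSet.QCat.{u} ⥤ LinQCat.{u} k :=
  ObjectProperty.lift _ (ObjectProperty.ι _ ⋙ freeTemplicial k) fun Y => hF Y.obj Y.property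

/-- The functor `Ũ` from linear quasi-categories to quasi-categories. -/
noncomputable def underlyingQCat (hU : UnderlyingPreserves.{u} k) :
    LinQCat.{u} k ⥤ SSet.QCat.{u} :=
  ObjectProperty.lift _ (ObjectProperty.ι _ ⋙ underlying) fun X => hU X.obj X.property

/-- The linear nerve functor `N_k` from linear categories to linear quasi-categories. -/
noncomputable def linearNerveQCat (hN : NervePreserves.{u} k) : LinCat.{u} k ⥤ LinQCat.{u} k :=
  ObjectProperty.lift _ (linearNerve k) hN

/-- A `k`-linear structure on the homotopy categories of the quasi-categories `Ũ(X)`, for `X` a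
linear quasi-category, such that the maps `X_1(a, b) ⟶ h(Ũ(X))(a, b)` sending an element to the
homotopy class of the corresponding edge are `k`-linear, and such that the functors `h(Ũ(φ))` are
`k`-linear. As these maps are surjective, there is at most one such structure. -/
structure LinearHomotopyStructure (hU : UnderlyingPreserves.{u} k) where
  preadditive (X : LinQCat.{u} k) : Preadditive (HoCat ((underlyingQCat hU).obj X).obj)
  linear (X : LinQCat.{u} k) : Linear k (HoCat ((underlyingQCat hU).obj X).obj)
  class_add (X : LinQCat.{u} k) (x y : ((underlyingQCat hU).obj X).obj _⦋0⦌)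
    (e e₁ e₂ : SSet.Edge x y) (h : edgeValue (X := X.obj) e = edgeValue e₁ + edgeValue e₂) :
    edgeClass e = edgeClass e₁ + edgeClass e₂
  class_smul (X : LinQCat.{u} k) (x y : ((underlyingQCat hU).obj X).obj _⦋0⦌) (r : k)
    (e e₁ : SSet.Edge x y) (h : edgeValue (X := X.obj) e = r • edgeValue e₁) :
    edgeClass e = r • edgeClass e₁
  map_additive {X Y : LinQCat.{u} k} (φ : X ⟶ Y) :
    (hoMap ((underlyingQCat hU).map φ).hom).Additive
  map_linear {X Y : LinQCat.{u} k} (φ : X ⟶ Y) :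
    (hoMap ((underlyingQCat hU).map φ).hom).Linear k

/-- The linear homotopy category functor `h_k`. -/
noncomputable def LinearHomotopyStructure.functor {hU : UnderlyingPreserves.{u} k}
    (S : LinearHomotopyStructure hU) : LinQCat.{u} k ⥤ LinCat.{u} k where
  obj X :=
    letI := S.preadditive X
    letI := S.linear X
    { carrier := HoCat ((underlyingQCat hU).obj X).obj }
  map {X Y} φ :=
    letI := S.preadditive X
    letI := S.linear X
    letI := S.preadditive Y
    letI := S.linear Y
    { functor := hoMap ((underlyingQCat hU).map φ).hom
      additive := S.map_additive φ
      linear := S.map_linear φ }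
  map_id X := by
    apply LinCat.Hom.ext
    exact (congrArg (fun z => hoMap z.hom) ((underlyingQCat hU).map_id X)).trans hoMap_id
  map_comp f g := by
    apply LinCat.Hom.ext
    exact (congrArg (fun z => hoMap z.hom) ((underlyingQCat hU).map_comp f g)).trans
      (hoMap_comp _ _)

end LinearHomotopy

end Templicial

open Templicial

namespace Templicial

/-! ### Interval maps -/

namespace IntervalMap

/-! Morphisms out of `F̃(Y)`. Such a morphism to `X` is a map on vertices together with one element
of `X` for each simplex of `Y`. These elements must be compatible with interval maps, have counit
one in degree zero, and have as comultiplications the pure tensors of the front and back faces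
(`FreeHomData`). With the Yoneda lemma this gives `F̃ ⊣ Ũ` on all simplicial sets and templicial
modules, and horn filling in `Ũ(X)` transposes to horn filling in `X`. A simplex of `Δ[n]` outside
an inner horn runs from `0` to `n`. Hence a filler in `X` is a single element of `X_n` whose proper
comultiplications and whose inner faces other than the `j`-th are prescribed (`ExtensionData`).

Filling inner horns. The element is found in two stages. The comultiplications are made right one
after the other, from left to right, by adding a section of `μ_{p,q}` applied to the error.
Coassociativity shows that the error dies under the cuts further left, and the section has to
preserve this property (`HasSections`, `exists_wedge`). The faces are then corrected as in Moore's
proof that simplicial groups are Kan complexes: elements with vanishing proper comultiplications are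
stable under inner faces and under the interior degeneracies, so degenerate corrections do not
disturb the comultiplications (`exists_faces`). Suitable sections exist for `N_k(C)` because its
comultiplications are bijective (the Segal condition). They exist for `F̃(Y)`, with `Y` a
quasi-category, because two simplices sharing a vertex can be glued, and the choices can be made
compatible with dropping initial vertices (`seg_glue`).

The linear homotopy category. Vertices of `Ũ(X)` are base elements and edges are elements of `X_1`.
A triangle with outer edges `e`, `e'` and third edge `e''` exists if and only if some `w` in `X_2`
has comultiplication `e ⊗ e'` and inner face `e''` (`nonempty_compStruct_iff`). Two edges are
therefore homotopic if and only if their difference is the inner face of an element killed by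
`μ_{1,1}`. The morphisms of `h(Ũ(X))` thus form quotient modules of `X_1`, and composition is
bilinear because the witnesses `w` can be added and scaled.

Adjunctions. A morphism to a module satisfying the Segal condition is determined by its values on
`X_1`. When the base map is bijective, a map on `X_1` extends if it respects degenerate edges and
the compositions witnessed in degree two (`segalHom`). For `N_k(C)` this says that morphisms `X ⟶
N_k(C)` are linear functors `h(Ũ(X)) ⟶ C`. The adjunction `h ⊣ N` is the restriction of the nerve
adjunction on simplicial sets, once the two models of the homotopy category are identified.

The squares. A morphism `F̃(Δ[n]) ⟶ N_k(C)` is determined by its values on edges, which form a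
functor from `[n]`; this compares `Ũ N_k` with `N U`. Both `F̃(N C)` and the linear nerve of the
free linear category satisfy the Segal condition and agree in degree one. The isomorphism of `F h`
with `h_k F̃` follows from uniqueness of left adjoints, and `h Ũ = U h_k` holds by construction. -/

lemma ext_val {m n : ℕ} {f g : IntervalMap m n}
    (h : ∀ i, (f.toOrderHom i).1 = (g.toOrderHom i).1) : f = g := by
  ext i
  exact h i

@[simp]
lemma cast_val {m n : ℕ} (h : m = n) (i : Fin (m + 1)) : ((cast h).toOrderHom i).1 = i.1 := rfl

lemma comp_val {l m n : ℕ} (f : IntervalMap l m) (g : IntervalMap m n) (i : Fin (l + 1)) :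
    (f.comp g).toOrderHom i = g.toOrderHom (f.toOrderHom i) := rfl

lemma add_val_of_le {m' m n' n : ℕ} (f : IntervalMap m' m) (g : IntervalMap n' n)
    {i : Fin (m' + n' + 1)} (h : i.1 ≤ m') :
    ((f.add g).toOrderHom i).1 = (f.toOrderHom ⟨i.1, by omega⟩).1 :=
  addFun_of_le f g i ⟨i.1, by omega⟩ rfl

lemma add_val_of_ge {m' m n' n : ℕ} (f : IntervalMap m' m) (g : IntervalMap n' n)
    {i : Fin (m' + n' + 1)} (h : m' ≤ i.1) :
    ((f.add g).toOrderHom i).1 = m + (g.toOrderHom ⟨i.1 - m', by omega⟩).1 :=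
  addFun_of_ge f g i ⟨i.1 - m', by omega⟩ (by simp; omega)

instance (m : ℕ) : Subsingleton (IntervalMap m 0) :=
  ⟨fun f g => ext_val fun i => by
    have h1 := (f.toOrderHom i).2
    have h2 := (g.toOrderHom i).2
    omega⟩

instance (n : ℕ) : Subsingleton (IntervalMap 1 n) :=
  ⟨fun f g => ext_val fun i => by
    rcases Fin.exists_fin_two.1 ⟨i, rfl⟩ with h | h
    · subst h; exact congrArg Fin.val (f.map_zero.trans g.map_zero.symm)
    · subst h; exact congrArg Fin.val (f.map_last.trans g.map_last.symm)⟩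

lemma eq_zero_of_zero {n : ℕ} (f : IntervalMap 0 n) : n = 0 :=
  (congrArg Fin.val (f.map_last.symm.trans f.map_zero))

/-- The collapse `[m] ⟶ [0]`. -/
def toZero (m : ℕ) : IntervalMap m 0 := ⟨⟨fun _ => 0, fun _ _ _ => le_rfl⟩, rfl, rfl⟩

/-- The inclusion `[1] ⟶ [n]` of the endpoints. -/
def ofOne (n : ℕ) : IntervalMap 1 n where
  toOrderHom := ⟨fun i => ⟨i.1 * n, by
      have := Nat.mul_le_mul_right n (show i.1 ≤ 1 by omega); omega⟩,
    fun i j h => by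
      have h' : i.1 ≤ j.1 := h
      exact Nat.mul_le_mul_right n h'⟩
  map_zero := Fin.ext (Nat.zero_mul n)
  map_last := Fin.ext (Nat.one_mul n)

/-- An interval map defined on a sum is a sum. -/
lemma exists_split {p q n : ℕ} (f : IntervalMap (p + q) n) :
    ∃ (i j : ℕ) (h : i + j = n) (f₁ : IntervalMap p i) (f₂ : IntervalMap q j),
      f = (f₁.add f₂).comp (cast h) ∧ i = (f.toOrderHom ⟨p, by omega⟩).1 := by
  have hle : ∀ j : Fin (p + q + 1), j.1 ≤ p →
      (f.toOrderHom j).1 ≤ (f.toOrderHom ⟨p, by omega⟩).1 := fun j hj => f.toOrderHom.monotone hj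
  have hge : ∀ j : Fin (p + q + 1), p ≤ j.1 →
      (f.toOrderHom ⟨p, by omega⟩).1 ≤ (f.toOrderHom j).1 := fun j hj => f.toOrderHom.monotone hj
  have hlast := f.map_last
  have hzero := f.map_zero
  -- The target is cut at the image of `p`. The summands are the restriction of `f` to the first `p
  -- + 1` points and its restriction to the last `q + 1` points, shifted down by `f p`.
  refine ⟨(f.toOrderHom ⟨p, by omega⟩).1, n - (f.toOrderHom ⟨p, by omega⟩).1, by omega,
    ⟨⟨fun j => ⟨(f.toOrderHom ⟨j.1, by omega⟩).1,
      Nat.lt_succ_of_le (hle ⟨j.1, by omega⟩ (by simp; omega))⟩, fun j l h => ?_⟩, ?_, ?_⟩,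
    ⟨⟨fun j => ⟨(f.toOrderHom ⟨p + j.1, by omega⟩).1 - (f.toOrderHom ⟨p, by omega⟩).1,
      by have := (f.toOrderHom ⟨p + j.1, by omega⟩).2; omega⟩, fun j l h => ?_⟩, ?_, ?_⟩, ?_, rfl⟩
  · exact f.toOrderHom.monotone (a := ⟨j.1, by omega⟩) (b := ⟨l.1, by omega⟩) h
  · exact Fin.ext (congrArg Fin.val hzero :)
  · ext; rfl
  · have h' : j.1 ≤ l.1 := h
    have : (f.toOrderHom ⟨p + j.1, by omega⟩).1 ≤ (f.toOrderHom ⟨p + l.1, by omega⟩).1 :=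
      f.toOrderHom.monotone (by simp only [Fin.mk_le_mk]; omega)
    change (_ : ℕ) ≤ _
    simp only
    omega
  · exact Fin.ext (Nat.sub_self _)
  · ext
    change (f.toOrderHom (Fin.last _)).1 - _ = _
    rw [hlast]; rfl
  · refine ext_val fun j => ?_
    rw [comp_val, cast_val]
    rcases le_total j.1 p with h | h
    · rw [add_val_of_le _ _ h]; rfl
    · rw [add_val_of_ge _ _ h]
      have := hge j h
      have e : (⟨p + (j.1 - p), by omega⟩ : Fin (p + q + 1)) = j := Fin.ext (by simp; omega)
      change _ = _ + ((f.toOrderHom ⟨p + (j.1 - p), by omega⟩).1 - _)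
      rw [e]
      omega

end IntervalMap

namespace TemplicialModule

variable {k : Type u} [CommRing k] (X : TemplicialModule.{u} k)

/-! ### Transport along equalities of base elements -/

/-- Transport along equalities of base elements. -/
def tr {n : ℕ} {a b a' b' : X.base} (ha : a = a') (hb : b = b') :
    X.obj n a b →ₗ[k] X.obj n a' b' := by
  subst ha hb; exact LinearMap.id

@[simp]
lemma tr_rfl {n : ℕ} {a b : X.base} (ha : a = a) (hb : b = b) (x : X.obj n a b) :
    X.tr ha hb x = x := rfl

@[simp]
lemma tr_tr {n : ℕ} {a b a' b' a'' b'' : X.base} (ha : a = a') (hb : b = b') (ha' : a' = a'')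
    (hb' : b' = b'') (x : X.obj n a b) :
    X.tr ha' hb' (X.tr ha hb x) = X.tr (ha.trans ha') (hb.trans hb') x := by
  subst ha hb ha' hb'; rfl

lemma map_tr {m n : ℕ} (f : IntervalMap m n) {a b a' b' : X.base} (ha : a = a') (hb : b = b')
    (x : X.obj n a b) : X.map f a' b' (X.tr ha hb x) = X.tr ha hb (X.map f a b x) := by
  subst ha hb; rfl

lemma tr_injective {n : ℕ} {a b a' b' : X.base} (ha : a = a') (hb : b = b') :
    Function.Injective (X.tr (n := n) ha hb) := by
  subst ha hb; exact fun _ _ h => h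

variable {X} {Y : TemplicialModule.{u} k}

/-- The targets of the components depend on the base map, so components of two morphisms are
compared after transport. -/
lemma Hom.ext_tr {φ ψ : Hom X Y} (hb : ∀ a, φ.base a = ψ.base a)
    (h : ∀ n a b (x : X.obj n a b), Y.tr (hb a) (hb b) (φ.app n a b x) = ψ.app n a b x) :
    φ = ψ := by
  obtain ⟨base, app, h1, h2, h3⟩ := φ
  obtain ⟨base', app', h1', h2', h3'⟩ := ψ
  obtain rfl : base = base' := funext hb
  obtain rfl : app = app' := by
    funext n a b
    ext x
    exact h n a b x
  rfl

variable (X)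

/-! ### The unit and degenerate elements -/

/-- The element of `X_0(a, a)` of counit one. -/
noncomputable def unit (a : X.base) : X.obj 0 a a := (X.counit_bijective a).2 1 |>.choose

@[simp]
lemma counit_unit (a : X.base) : X.counit a (X.unit a) = 1 :=
  ((X.counit_bijective a).2 1).choose_spec

lemma eq_unit {a : X.base} {x : X.obj 0 a a} (h : X.counit a x = 1) : x = X.unit a :=
  (X.counit_bijective a).1 (h.trans (X.counit_unit a).symm)

lemma eq_smul_unit {a : X.base} (x : X.obj 0 a a) : x = X.counit a x • X.unit a :=
  (X.counit_bijective a).1 (by simp)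

/-- The totally degenerate element of `X_m(a, a)`. -/
noncomputable def deg (m : ℕ) (a : X.base) : X.obj m a a :=
  X.map (IntervalMap.toZero m) a a (X.unit a)

lemma map_comp_apply {l m n : ℕ} (f : IntervalMap l m) (g : IntervalMap m n) {a b : X.base}
    (x : X.obj n a b) : X.map f a b (X.map g a b x) = X.map (f.comp g) a b x := by
  rw [X.map_comp]; rfl

@[simp]
lemma map_id_apply {n : ℕ} {a b : X.base} (x : X.obj n a b) :
    X.map (IntervalMap.id n) a b x = x := by
  rw [X.map_id]; rfl

@[simp]
lemma map_cast_rfl {n : ℕ} {a b : X.base} (h : n = n) (x : X.obj n a b) :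
    X.map (IntervalMap.cast h) a b x = x := X.map_id_apply x

@[simp]
lemma map_deg {l m : ℕ} (f : IntervalMap l m) (a : X.base) :
    X.map f a a (X.deg m a) = X.deg l a := by
  unfold deg
  rw [map_comp_apply, Subsingleton.elim (f.comp (IntervalMap.toZero m))]

lemma deg_zero (a : X.base) : X.deg 0 a = X.unit a := by
  unfold deg
  rw [Subsingleton.elim (IntervalMap.toZero 0) (IntervalMap.id 0), map_id_apply]

lemma tr_deg {m : ℕ} {a a' : X.base} (h h' : a = a') : X.tr h h' (X.deg m a) = X.deg m a' := by
  subst h; rfl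

open Classical in
/-- The inclusion of the summand `X_m(a, c) ⊗ X_n(c, b)`. -/
noncomputable abbrev incl (m n : ℕ) (a b c : X.base) :
    X.obj m a c ⊗[k] X.obj n c b →ₗ[k] ⨁ c : X.base, (X.obj m a c ⊗[k] X.obj n c b) :=
  DirectSum.lof k X.base (fun c => X.obj m a c ⊗[k] X.obj n c b) c

lemma incl_same {m n : ℕ} {a b c : X.base} (t : X.obj m a c ⊗[k] X.obj n c b) :
    X.incl m n a b c t c = t := by
  classical exact DirectSum.lof_apply (M := fun c => X.obj m a c ⊗[k] X.obj n c b) k c t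

lemma incl_ne {m n : ℕ} {a b c d : X.base} (t : X.obj m a c ⊗[k] X.obj n c b) (h : c ≠ d) :
    X.incl m n a b c t d = 0 := by
  classical exact DirectSum.of_eq_of_ne (β := fun c => X.obj m a c ⊗[k] X.obj n c b) _ _ _ h.symm

lemma eq_incl {m n : ℕ} {a b c : X.base} {s : ⨁ c : X.base, (X.obj m a c ⊗[k] X.obj n c b)}
    {t : X.obj m a c ⊗[k] X.obj n c b} (h : s c = t) (h' : ∀ d, c ≠ d → s d = 0) :
    s = X.incl m n a b c t := by
  refine DFinsupp.ext fun d => ?_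
  by_cases hd : c = d
  · subst hd; exact h.trans (X.incl_same t).symm
  · exact (h' d hd).trans (X.incl_ne t hd).symm

/-- Naturality of the comultiplication holds in each summand separately, so being concentrated in
one summand `c` is preserved by operators of the form `f + g`. -/
lemma comul_map_of_incl {m' m n' n : ℕ} (f : IntervalMap m' m) (g : IntervalMap n' n)
    {a b c : X.base} {x : X.obj (m + n) a b} {t : X.obj m a c ⊗[k] X.obj n c b}
    (h : X.comul m n a b x = X.incl m n a b c t) :
    X.comul m' n' a b (X.map (f.add g) a b x) =
      X.incl m' n' a b c
        (TensorProduct.map (X.map f a c) (X.map g c b) t) := by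
  refine X.eq_incl ?_ fun d hd => ?_
  · rw [X.comul_natural, h, incl_same]
  · rw [X.comul_natural, h, incl_ne _ _ hd, map_zero]

/-- `X_0(b, b)` is free of rank one on its unit, so a tensor with it is recovered by applying the
counit. -/
lemma tensor_unit_right {M : Type*} [AddCommGroup M] [Module k M] (b : X.base)
    (t : M ⊗[k] X.obj 0 b b) :
    t = TensorProduct.rid k M (LinearMap.lTensor M (X.counit b) t) ⊗ₜ X.unit b := by
  induction t with
  | zero => simp
  | add s t hs ht =>
    rw [map_add, map_add, TensorProduct.add_tmul, ← hs, ← ht]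
  | tmul x y =>
    rw [LinearMap.lTensor_tmul, TensorProduct.rid_tmul, TensorProduct.smul_tmul,
      ← X.eq_smul_unit y]

lemma tensor_unit_left {M : Type*} [AddCommGroup M] [Module k M] (b : X.base)
    (t : X.obj 0 b b ⊗[k] M) :
    t = X.unit b ⊗ₜ TensorProduct.lid k M (LinearMap.rTensor M (X.counit b) t) := by
  induction t with
  | zero => simp
  | add s t hs ht =>
    rw [map_add, map_add, TensorProduct.tmul_add, ← hs, ← ht]
  | tmul x y =>
    rw [LinearMap.rTensor_tmul, TensorProduct.lid_tmul, ← TensorProduct.smul_tmul,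
      ← X.eq_smul_unit x]

/-- The counit axiom gives the summand at `b`. All other summands vanish because `X_0` is zero off
the diagonal. -/
lemma comul_right_zero {n : ℕ} {a b : X.base} (x : X.obj n a b) :
    X.comul n 0 a b x =
      X.incl n 0 a b b (x ⊗ₜ X.unit b) := by
  refine X.eq_incl ?_ fun c h => ?_
  · refine (X.tensor_unit_right b _).trans ?_
    rw [X.comul_counit]
  · have := X.obj_zero_subsingleton c b (Ne.symm h)
    exact Subsingleton.elim _ _

lemma comul_left_zero {n : ℕ} {a b : X.base} (x : X.obj n a b) :
    X.comul 0 n a b (X.map (IntervalMap.cast (Nat.zero_add n)) a b x) =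
      X.incl 0 n a b a (X.unit a ⊗ₜ x) := by
  refine X.eq_incl ?_ fun c h => ?_
  · refine (X.tensor_unit_left a _).trans ?_
    rw [X.counit_comul]
  · have := X.obj_zero_subsingleton a c h
    exact Subsingleton.elim _ _

/-- In degree `0 + 0` this is the counit axiom for the unit. Naturality along the sum of the two
collapses gives the general case. -/
lemma comul_deg (p q : ℕ) (a : X.base) :
    X.comul p q a a (X.deg (p + q) a) =
      X.incl p q a a a
        (X.deg p a ⊗ₜ X.deg q a) := by
  have h := X.comul_map_of_incl (IntervalMap.toZero p) (IntervalMap.toZero q)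
    (X.comul_right_zero (X.unit a))
  have e : (IntervalMap.toZero p).add (IntervalMap.toZero q) = IntervalMap.toZero (p + q) :=
    Subsingleton.elim (α := IntervalMap (p + q) 0) _ _
  rw [e] at h
  exact h

variable {X}

lemma Hom.app_unit (φ : Hom X Y) (a : X.base) : φ.app 0 a a (X.unit a) = Y.unit (φ.base a) :=
  Y.eq_unit (by rw [φ.counit_app, counit_unit])

lemma Hom.app_deg (φ : Hom X Y) (m : ℕ) (a : X.base) :
    φ.app m a a (X.deg m a) = Y.deg m (φ.base a) := by
  unfold deg
  rw [φ.naturality, φ.app_unit]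

lemma Hom.comul_app_of_incl (φ : Hom X Y) {m n : ℕ} {a b c : X.base} {x : X.obj (m + n) a b}
    {t : X.obj m a c ⊗[k] X.obj n c b}
    (h : X.comul m n a b x = X.incl m n a b c t) :
    Y.comul m n _ _ (φ.app (m + n) a b x) =
      Y.incl m n (φ.base a) (φ.base b) (φ.base c)
        (TensorProduct.map (φ.app m a c) (φ.app n c b) t) := by
  rw [φ.comul_app, h, DirectSum.toModule_lof]
  rfl

lemma comul_tr_of_incl {m n : ℕ} {a b a' b' c c' : X.base} (ha : a = a') (hb : b = b')
    (hc : c = c') {x : X.obj (m + n) a b} {y : X.obj m a c} {z : X.obj n c b}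
    (h : X.comul m n a b x =
      X.incl m n a b c (y ⊗ₜ z)) :
    X.comul m n a' b' (X.tr ha hb x) =
      X.incl m n a' b' c'
        (X.tr ha hc y ⊗ₜ X.tr hc hb z) := by
  subst ha hb hc; exact h

end TemplicialModule

end Templicial

namespace Templicial

open TemplicialModule

/-! ### Morphisms out of free templicial modules -/

section FreeHom

variable {k : Type u} [CommRing k]

/-- The generator of `F̃(Y)` given by a simplex. -/
noncomputable def freeGen (k : Type u) [CommRing k] {Y : SSet.{u}} {n : ℕ} {a b : Y _⦋0⦌}
    (y : Simp Y (fun y => y) n a b) : ((freeTemplicial k).obj Y).obj n a b :=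
  (freeData k Y).gen y

/-- The data of a morphism `F̃(Y) ⟶ X`. -/
structure FreeHomData (Y : SSet.{u}) (X : TemplicialModule.{u} k) where
  base : Y _⦋0⦌ → X.base
  val {n : ℕ} {a b : Y _⦋0⦌} (y : Simp Y (fun y => y) n a b) : X.obj n (base a) (base b)
  map_val {m n : ℕ} (f : IntervalMap m n) {a b : Y _⦋0⦌} (y : Simp Y (fun y => y) n a b) :
    X.map f _ _ (val y) = val (y.map f)
  comul_val {m n : ℕ} {a b : Y _⦋0⦌} (y : Simp Y (fun y => y) (m + n) a b) :
    X.comul m n _ _ (val y) =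
      X.incl m n _ _ (base y.mid) (val (y.front m n rfl) ⊗ₜ val (y.back m n rfl))
  counit_val {a : Y _⦋0⦌} (y : Simp Y (fun y => y) 0 a a) : X.counit _ (val y) = 1

namespace FreeHomData

variable {Y : SSet.{u}} {X : TemplicialModule.{u} k} (d : FreeHomData Y X)

/-- The linear maps underlying the morphism given by `FreeHomData`. -/
noncomputable def app (n : ℕ) (a b : Y _⦋0⦌) :
    (freeData k Y).obj n a b →ₗ[k] X.obj n (d.base a) (d.base b) :=
  Finsupp.linearCombination k (d.val (n := n) (a := a) (b := b))

lemma app_gen {n : ℕ} {a b : Y _⦋0⦌} (y : Simp Y (freeData k Y).vert n a b) :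
    d.app n a b ((freeData k Y).gen y) = d.val y :=
  (Finsupp.linearCombination_single k (1 : k) y).trans (one_smul k _)

lemma app_naturality {m n : ℕ} (f : IntervalMap m n) (a b : Y _⦋0⦌) :
    d.app m a b ∘ₗ (freeData k Y).map f a b = X.map f _ _ ∘ₗ d.app n a b :=
  (freeData k Y).hom_ext fun y => by
    rw [LinearMap.comp_apply, LinearMap.comp_apply, (freeData k Y).map_gen, app_gen, app_gen]
    exact (d.map_val f y).symm

open Classical in
lemma app_comul (m n : ℕ) (a b : Y _⦋0⦌) :
    X.comul m n _ _ ∘ₗ d.app (m + n) a b =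
      DirectSum.toModule k (Y _⦋0⦌)
        (⨁ c : X.base, (X.obj m (d.base a) c ⊗[k] X.obj n c (d.base b)))
        (fun c => X.incl m n (d.base a) (d.base b) (d.base c) ∘ₗ
          TensorProduct.map (d.app m a c) (d.app n c b)) ∘ₗ (freeData k Y).comul m n a b :=
  (freeData k Y).hom_ext fun y => by
    rw [LinearMap.comp_apply, LinearMap.comp_apply, (freeData k Y).comul_gen, app_gen,
      DirectSum.toModule_lof, LinearMap.comp_apply, TensorProduct.map_tmul, app_gen, app_gen]
    exact d.comul_val y

lemma app_counit (a : Y _⦋0⦌) : X.counit (d.base a) ∘ₗ d.app 0 a a = (freeData k Y).counit a :=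
  (freeData k Y).hom_ext fun y => by
    rw [LinearMap.comp_apply, (freeData k Y).counit_gen, app_gen]
    exact d.counit_val y

/-- The morphism given by `FreeHomData`. -/
noncomputable def toHom : (freeTemplicial k).obj Y ⟶ X :=
  show Hom (freeData k Y).toTemplicial X from
  { base := d.base
    app := d.app
    naturality := fun f a b x => LinearMap.congr_fun (d.app_naturality f a b) x
    comul_app := fun m n a b x => LinearMap.congr_fun (d.app_comul m n a b) x
    counit_app := fun a x => LinearMap.congr_fun (d.app_counit a) x }

lemma toHom_app (n : ℕ) (a b : Y _⦋0⦌) (y : Simp Y (fun y => y) n a b) :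
    Hom.app d.toHom n a b (freeGen k y) = d.val y := d.app_gen y

end FreeHomData

variable {Y Z : SSet.{u}} {X : TemplicialModule.{u} k}

lemma map_freeGen {m n : ℕ} (f : IntervalMap m n) {a b : Y _⦋0⦌}
    (y : Simp Y (fun y => y) n a b) :
    ((freeTemplicial k).obj Y).map f a b (freeGen k y) = freeGen k (y.map f) :=
  (freeData k Y).map_gen f a b y

lemma comul_freeGen {m n : ℕ} {a b : Y _⦋0⦌} (y : Simp Y (fun y => y) (m + n) a b) :
    ((freeTemplicial k).obj Y).comul m n a b (freeGen k y) =
      ((freeTemplicial k).obj Y).incl m n a b y.mid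
        (freeGen k (y.front m n rfl) ⊗ₜ freeGen k (y.back m n rfl)) :=
  (freeData k Y).comul_gen m n a b y

lemma counit_freeGen {a : Y _⦋0⦌} (y : Simp Y (fun y => y) 0 a a) :
    ((freeTemplicial k).obj Y).counit a (freeGen k y) = 1 :=
  (freeData k Y).counit_gen a y

lemma freeTemplicial_map_freeGen (φ : Y ⟶ Z) {n : ℕ} {a b : Y _⦋0⦌}
    (y : Simp Y (fun y => y) n a b) :
    Hom.app ((freeTemplicial k).map φ) n a b (freeGen k y) =
      freeGen k (y.push φ (vert' := fun y => y) (fun y => φ.app _ y) (fun _ => rfl)) :=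
  Finsupp.mapDomain_single

lemma freeHom_ext {φ ψ : (freeTemplicial k).obj Y ⟶ X}
    (hb : ∀ a, Hom.base φ a = Hom.base ψ a)
    (h : ∀ n a b (y : Simp Y (fun y => y) n a b),
      X.tr (hb a) (hb b) (Hom.app φ n a b (freeGen k y)) = Hom.app ψ n a b (freeGen k y)) :
    φ = ψ := by
  refine Hom.ext_tr hb fun n a b x => ?_
  have : X.tr (hb a) (hb b) ∘ₗ Hom.app φ n a b = Hom.app ψ n a b :=
    (freeData k Y).hom_ext fun y => h n a b y
  exact LinearMap.congr_fun this x

lemma comul_app_freeGen (φ : (freeTemplicial k).obj Y ⟶ X) {m n : ℕ} {a b c : Y _⦋0⦌}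
    (y : Simp Y (fun y => y) (m + n) a b) (h : y.mid = c) :
    X.comul m n _ _ (Hom.app φ (m + n) a b (freeGen k y)) =
      X.incl m n _ _ (Hom.base φ c)
        (Hom.app φ m a c (freeGen k (y.front m n h)) ⊗ₜ
          Hom.app φ n c b (freeGen k (y.back m n h))) := by
  subst h
  exact Hom.comul_app_of_incl φ (comul_freeGen y)

end FreeHom

/-! ### The value of a simplex of `Ũ(X)` -/

section Underlying

variable {k : Type u} [CommRing k] {X X' : TemplicialModule.{u} k}

/-- The `i`-th vertex of `Δ[n]`. -/
def stdVertex {n : ℕ} (i : Fin (n + 1)) : (Δ[n] : SSet.{u}) _⦋0⦌ :=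
  SSet.stdSimplex.objEquiv.symm (SimplexCategory.const ⦋0⦌ ⦋n⦌ i)

/-- A simplex of `Δ[n]`, with its end points. -/
def stdSimp {m n : ℕ} (α : ⦋m⦌ ⟶ ⦋n⦌) :
    Simp (Δ[n] : SSet.{u}) (fun y => y) m (stdVertex (α.toOrderHom 0))
      (stdVertex (α.toOrderHom (Fin.last m))) where
  val := SSet.stdSimplex.objEquiv.symm α
  first := by
    apply SSet.stdSimplex.objEquiv.injective
    ext; rfl
  last := by
    apply SSet.stdSimplex.objEquiv.injective
    ext; rfl

/-- A simplex of `Ũ(X)`, seen as a morphism. -/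
def toHom {n : ℕ} (s : (underlying.obj X) _⦋n⦌) :
    (freeTemplicial k).obj (Δ[n] : SSet.{u}) ⟶ X := s

lemma vertexBase_vtx {n : ℕ} (s : (underlying.obj X) _⦋n⦌) (i : Fin (n + 1)) :
    vertexBase (vtx i s) = Hom.base (toHom s) (stdVertex i) := rfl

lemma base_vertexBase {n : ℕ} (s : (underlying.obj X) _⦋n⦌) (v : (Δ[n] : SSet.{u}) _⦋0⦌) :
    Hom.base (toHom s) v = vertexBase (vtx (v 0) s) := by
  rw [vertexBase_vtx]
  congr 1
  apply SSet.stdSimplex.objEquiv.injective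
  ext i
  obtain rfl : i = 0 := Subsingleton.elim (α := Fin 1) _ _
  rfl

/-- The value of a simplex of `Ũ(X)` on the nondegenerate simplex of `Δ[n]`. -/
noncomputable def simpValue {n : ℕ} {a b : X.base}
    (s : Simp (underlying.obj X) vertexBase n a b) : X.obj n a b :=
  X.tr s.first s.last (Hom.app (toHom s.val) n (stdVertex 0) (stdVertex (Fin.last n))
    (freeGen k (stdSimp (𝟙 ⦋n⦌))))

lemma app_freeGen_congr {Y : SSet.{u}} (φ : (freeTemplicial k).obj Y ⟶ X) {n : ℕ}
    {a b a' b' : Y _⦋0⦌} (y : Simp Y (fun y => y) n a b) (y' : Simp Y (fun y => y) n a' b')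
    (h : y.val = y'.val) (ha : Hom.base φ a = Hom.base φ a') (hb : Hom.base φ b = Hom.base φ b') :
    X.tr ha hb (Hom.app φ n a b (freeGen k y)) = Hom.app φ n a' b' (freeGen k y') := by
  obtain ⟨y, rfl, rfl⟩ := y
  obtain ⟨y', rfl, rfl⟩ := y'
  obtain rfl : y = y' := h
  rfl

/-- The value of a face of `s` is the value of `s` on the corresponding simplex of `Δ[n]`. -/
lemma simpValue_map {m n : ℕ} (α : ⦋m⦌ ⟶ ⦋n⦌) (s : (underlying.obj X) _⦋n⦌) {a b : X.base}
    (h1 h2) {v w : (Δ[n] : SSet.{u}) _⦋0⦌} (y : Simp (Δ[n] : SSet.{u}) (fun y => y) m v w)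
    (hy : y.val = (stdSimp α).val) (hv : Hom.base (toHom s) v = a)
    (hw : Hom.base (toHom s) w = b) :
    simpValue (⟨(underlying.obj X).map α.op s, h1, h2⟩ :
        Simp (underlying.obj X) vertexBase m a b) =
      X.tr hv hw (Hom.app (toHom s) m v w (freeGen k y)) := by
  unfold simpValue
  have e : Hom.app (toHom ((underlying.obj X).map α.op s)) m (stdVertex 0)
      (stdVertex (Fin.last m)) (freeGen k (stdSimp (𝟙 ⦋m⦌))) =
      Hom.app (toHom s) m _ _ (freeGen k ((stdSimp (𝟙 ⦋m⦌)).push (vert' := fun y => y)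
        (SSet.stdSimplex.map α) (fun y => (SSet.stdSimplex.map α).app _ y) (fun _ => rfl))) :=
    congrArg (Hom.app (toHom s) m _ _) (freeTemplicial_map_freeGen (SSet.stdSimplex.map α) _)
  refine (congrArg _ e).trans ?_
  refine (X.tr_injective hv.symm hw.symm) ?_
  refine (X.tr_tr _ _ _ _ _).trans (Eq.trans ?_ (X.tr_tr _ _ _ _ _).symm)
  refine app_freeGen_congr (toHom s) _ y (Eq.trans ?_ hy.symm) _ _
  exact congrArg SSet.stdSimplex.objEquiv.symm (Category.id_comp α)

lemma base_vtx {n : ℕ} (s : (underlying.obj X) _⦋n⦌) {m : ℕ}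
    (y : (Δ[n] : SSet.{u}) _⦋m⦌) (i : Fin (m + 1)) :
    Hom.base (toHom s) (vtx i y) = vertexBase (vtx (y i) s) := by
  rw [base_vertexBase]
  rfl

/-- The value is natural. -/
lemma map_simpValue {m n : ℕ} (f : IntervalMap m n) {a b : X.base}
    (s : Simp (underlying.obj X) vertexBase n a b) :
    X.map f a b (simpValue s) = simpValue (s.map f) := by
  have h0 : Hom.base (toHom s.val) (stdVertex 0) = a := s.first
  have h1 : Hom.base (toHom s.val) (stdVertex (Fin.last n)) = b := s.last
  refine Eq.trans ?_ (simpValue_map f.toHom s.val (s.map f).first (s.map f).last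
    ((stdSimp (𝟙 ⦋n⦌)).map f) ?_ h0 h1).symm
  · unfold simpValue
    refine (X.map_tr _ _ _ _).trans (congrArg (X.tr h0 h1) ?_)
    refine ((toHom s.val).naturality _ _ _ _).symm.trans ?_
    exact congrArg (Hom.app (toHom s.val) _ _ _) (map_freeGen _ _)
  · rfl

/-- The value of `s` is the image of the top generator of `F̃(Δ[m + n])`, whose comultiplication is
the tensor of its front and back faces. `simpValue_map` identifies the images of these with the
values of the faces of `s`. -/
lemma comul_simpValue {m n : ℕ} {a b : X.base}
    (s : Simp (underlying.obj X) vertexBase (m + n) a b) :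
    X.comul m n a b (simpValue s) =
      X.incl m n a b s.mid (simpValue (s.front m n rfl) ⊗ₜ simpValue (s.back m n rfl)) := by
  have h0 : Hom.base (toHom s.val) (stdVertex 0) = a := s.first
  have h1 : Hom.base (toHom s.val) (stdVertex (Fin.last (m + n))) = b := s.last
  have h2 : Hom.base (toHom s.val) (stdSimp (𝟙 ⦋m + n⦌)).mid = s.mid := base_vtx s.val _ _
  have e1 := simpValue_map (frontHom m n) s.val (s.front m n rfl).first (s.front m n rfl).last
    ((stdSimp (𝟙 ⦋m + n⦌)).front m n rfl) rfl h0 h2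
  have e2 := simpValue_map (backHom m n) s.val (s.back m n rfl).first (s.back m n rfl).last
    ((stdSimp (𝟙 ⦋m + n⦌)).back m n rfl) rfl h2 h1
  refine (comul_tr_of_incl h0 h1 h2 (comul_app_freeGen (toHom s.val) _ rfl)).trans ?_
  exact congrArg _ (congrArg₂ _ e1.symm e2.symm)

lemma comul_simpValue' {m n : ℕ} {a b c : X.base}
    (s : Simp (underlying.obj X) vertexBase (m + n) a b) (h : s.mid = c) :
    X.comul m n a b (simpValue s) =
      X.incl m n a b c (simpValue (s.front m n h) ⊗ₜ simpValue (s.back m n h)) := by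
  subst h
  exact comul_simpValue s

lemma counit_simpValue {a : X.base} (s : Simp (underlying.obj X) vertexBase 0 a a) :
    simpValue s = X.unit a := by
  obtain ⟨s, rfl, h⟩ := s
  unfold simpValue
  apply X.eq_unit
  exact (Hom.counit_app (toHom s) _ _).trans (counit_freeGen _)

lemma tr_simpValue {n : ℕ} {a b a' b' : X.base} (s : Simp (underlying.obj X) vertexBase n a b)
    (t : Simp (underlying.obj X) vertexBase n a' b') (h : s.val = t.val) (ha : a = a')
    (hb : b = b') : X.tr ha hb (simpValue s) = simpValue t := by
  subst ha hb
  obtain rfl : s = t := Simp.ext h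
  rfl

/-- Two simplices of `Ũ(X)` agree when they have the same vertices and all their faces have the
same values. -/
lemma underlying_ext {n : ℕ} {s t : (underlying.obj X) _⦋n⦌}
    (hb : ∀ i, vertexBase (vtx i s) = vertexBase (vtx i t))
    (h : ∀ (m : ℕ) (α : ⦋m⦌ ⟶ ⦋n⦌) (a b : X.base) (h1 h2 h1' h2'),
      simpValue (⟨(underlying.obj X).map α.op s, h1, h2⟩ :
        Simp (underlying.obj X) vertexBase m a b) =
      simpValue (⟨(underlying.obj X).map α.op t, h1', h2'⟩ :
        Simp (underlying.obj X) vertexBase m a b)) : s = t := by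
  have hb' : ∀ v, Hom.base (toHom s) v = Hom.base (toHom t) v := fun v =>
    (base_vertexBase s v).trans ((hb _).trans (base_vertexBase t v).symm)
  refine freeHom_ext (φ := toHom s) (ψ := toHom t) hb' fun m a b y => ?_
  -- A generator of `F̃(Δ[n])` is an operator `α` into `[n]`, and its image under `s` is the value
  -- of the face of `s` along `α`.
  obtain ⟨α, hα⟩ := SSet.stdSimplex.objEquiv.symm.surjective y.val
  have h1 : ∀ (s : (underlying.obj X) _⦋n⦌) (i : Fin (m + 1)),
      vertexBase (vtx i ((underlying.obj X).map α.op s)) =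
        Hom.base (toHom s) (vtx i y.val) := fun s i => by
    rw [vtx_map, base_vtx, ← hα]
    rfl
  have h2 : ∀ s : (underlying.obj X) _⦋n⦌, vertexBase (vtx 0 ((underlying.obj X).map α.op s)) =
      Hom.base (toHom s) a := fun s => (h1 s 0).trans (congrArg (Hom.base (toHom s)) y.first)
  have h3 : ∀ s : (underlying.obj X) _⦋n⦌,
      vertexBase (vtx (Fin.last m) ((underlying.obj X).map α.op s)) =
      Hom.base (toHom s) b := fun s => (h1 s _).trans (congrArg (Hom.base (toHom s)) y.last)
  have e1 := simpValue_map α s ((h2 s).trans (hb' a)) ((h3 s).trans (hb' b)) y hα.symm (hb' a)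
    (hb' b)
  have e2 := simpValue_map α t (h2 t) (h3 t) y hα.symm (rfl : Hom.base (toHom t) a = _)
    (rfl : Hom.base (toHom t) b = _)
  have e3 := h m α _ _ ((h2 s).trans (hb' a)) ((h3 s).trans (hb' b)) (h2 t) (h3 t)
  refine e1.symm.trans (e3.trans ?_)
  exact e2

lemma simpValue_push (φ : X ⟶ X') {n : ℕ} {a b : X.base}
    (s : Simp (underlying.obj X) vertexBase n a b) :
    simpValue (s.push (vert' := vertexBase) (underlying.map φ) (Hom.base φ) (fun _ => rfl)) =
      Hom.app φ n a b (simpValue s) := by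
  obtain ⟨s, rfl, rfl⟩ := s
  rfl

end Underlying

end Templicial

namespace Templicial

open TemplicialModule

/-! ### The adjunction between `F̃` and `Ũ` -/

section Adjunction

variable {k : Type u} [CommRing k] {X X' : TemplicialModule.{u} k} {Y Y' : SSet.{u}}

lemma app_vtx (φ : Y ⟶ Y') {n : ℕ} (i : Fin (n + 1)) (y : Y _⦋n⦌) :
    vtx i (φ.app _ y) = φ.app _ (vtx i y) :=
  (NatTrans.naturality_apply φ _ _).symm

lemma Simp.mid_push {S S' : Type u} {vert : Y _⦋0⦌ → S} {vert' : Y' _⦋0⦌ → S'}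
    (φ : Y ⟶ Y') (base : S → S') (h : ∀ y, vert' (φ.app _ y) = base (vert y)) {m n : ℕ} {a b : S}
    (y : Simp Y vert (m + n) a b) : (y.push φ base h).mid = base y.mid := by
  unfold Simp.mid Simp.push
  dsimp only
  rw [← h]
  unfold vtx
  rw [NatTrans.naturality_apply]

/-- The morphism `F̃(Y) ⟶ X` adjoint to `Y ⟶ Ũ(X)`, as data. -/
noncomputable def freeHomDataOf (ψ : Y ⟶ underlying.obj X) : FreeHomData Y X where
  base v := vertexBase (ψ.app _ v)
  val y := simpValue (y.push ψ (vert' := vertexBase) (fun v => vertexBase (ψ.app _ v))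
    (fun _ => rfl))
  map_val f a b y := (map_simpValue f _).trans
    (congrArg simpValue (Simp.ext (NatTrans.naturality_apply ψ _ _).symm))
  comul_val {m n a b} y := by
    refine (comul_simpValue' _ (Simp.mid_push (vert' := vertexBase) ψ
      (fun v => vertexBase (ψ.app _ v)) (fun _ => rfl) y)).trans ?_
    refine congrArg _ (congrArg₂ _ (congrArg simpValue (Simp.ext ?_))
      (congrArg simpValue (Simp.ext ?_)))
    · exact (NatTrans.naturality_apply ψ _ _).symm
    · exact (NatTrans.naturality_apply ψ _ _).symm
  counit_val y := (congrArg _ (counit_simpValue _)).trans (counit_unit _ _)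

/-- The morphism `Y ⟶ Ũ(X)` adjoint to `F̃(Y) ⟶ X`. -/
noncomputable def toUnderlying (φ : (freeTemplicial k).obj Y ⟶ X) : Y ⟶ underlying.obj X where
  app U := ↾fun y => (freeTemplicial k).map (SSet.yonedaEquiv.symm y) ≫ φ
  naturality U V f := by
    ext y
    have h : SSet.yonedaEquiv.symm (Y.map f y) =
        SSet.stdSimplex.map f.unop ≫ SSet.yonedaEquiv.symm y :=
      (SSet.yonedaEquiv_symm_naturality_left f.unop y).symm
    change (freeTemplicial k).map (SSet.yonedaEquiv.symm (Y.map f y)) ≫ φ =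
      (freeTemplicial k).map (SSet.stdSimplex.map f.unop) ≫
        (freeTemplicial k).map (SSet.yonedaEquiv.symm y) ≫ φ
    rw [h, Functor.map_comp, Category.assoc]

lemma map_yonedaEquiv_symm_freeGen {n m : ℕ} (y : Y _⦋n⦌) {a b : (Δ[n] : SSet.{u}) _⦋0⦌}
    (z : Simp (Δ[n] : SSet.{u}) (fun y => y) m a b) :
    Hom.app ((freeTemplicial k).map (SSet.yonedaEquiv.symm y)) m a b (freeGen k z) =
      freeGen k (z.push (vert' := fun y => y) (SSet.yonedaEquiv.symm y)
        (fun v => (SSet.yonedaEquiv.symm y).app _ v) (fun _ => rfl)) :=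
  freeTemplicial_map_freeGen _ _

/-- The value of `φ` on a simplex is the value of the adjoint morphism. -/
lemma simpValue_toUnderlying (φ : (freeTemplicial k).obj Y ⟶ X) {n : ℕ} {a b : Y _⦋0⦌}
    (y : Simp Y (fun y => y) n a b) {a' b' : X.base} (h1 h2) (ha : Hom.base φ a = a')
    (hb : Hom.base φ b = b') :
    simpValue (⟨(toUnderlying φ).app _ y.val, h1, h2⟩ :
      Simp (underlying.obj X) vertexBase n a' b') =
      X.tr ha hb (Hom.app φ n a b (freeGen k y)) := by
  subst ha hb
  unfold simpValue
  refine (congrArg (X.tr _ _) (congrArg (Hom.app φ n _ _)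
    (map_yonedaEquiv_symm_freeGen y.val (stdSimp (𝟙 ⦋n⦌))))).trans ?_
  refine (app_freeGen_congr φ _ y ?_ _ _)
  change Y.map (𝟙 ⦋n⦌ : ⦋n⦌ ⟶ ⦋n⦌).op y.val = y.val
  simp

lemma vertexBase_toUnderlying (φ : (freeTemplicial k).obj Y ⟶ X) (v : Y _⦋0⦌) :
    vertexBase ((toUnderlying φ).app _ v) = Hom.base φ v := by
  refine congrArg (Hom.base φ) ?_
  change Y.map (𝟙 ⦋0⦌ : ⦋0⦌ ⟶ ⦋0⦌).op v = v
  simp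

lemma first_toUnderlying (φ : (freeTemplicial k).obj Y ⟶ X) {n : ℕ} {a b : Y _⦋0⦌}
    (y : Simp Y (fun y => y) n a b) :
    vertexBase (vtx 0 ((toUnderlying φ).app _ y.val)) = Hom.base φ a :=
  (y.push (toUnderlying φ) (vert' := vertexBase) (fun a => Hom.base φ a)
    (vertexBase_toUnderlying φ)).first

lemma last_toUnderlying (φ : (freeTemplicial k).obj Y ⟶ X) {n : ℕ} {a b : Y _⦋0⦌}
    (y : Simp Y (fun y => y) n a b) :
    vertexBase (vtx (Fin.last n) ((toUnderlying φ).app _ y.val)) = Hom.base φ b :=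
  (y.push (toUnderlying φ) (vert' := vertexBase) (fun a => Hom.base φ a)
    (vertexBase_toUnderlying φ)).last

/-- The values of the simplices in the image of the transpose recover the values of `φ` on
generators. -/
lemma toUnderlying_injective :
    Function.Injective (toUnderlying : ((freeTemplicial k).obj Y ⟶ X) → _) := by
  intro φ ψ h
  have hb : ∀ v : Y _⦋0⦌, Hom.base φ v = Hom.base ψ v := fun v =>
    (vertexBase_toUnderlying φ v).symm.trans ((congrArg (fun χ : Y ⟶ underlying.obj X =>
      vertexBase (χ.app _ v)) h).trans (vertexBase_toUnderlying ψ v))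
  refine freeHom_ext hb fun n a b y => ?_
  refine (simpValue_toUnderlying φ y ((first_toUnderlying φ y).trans (hb a))
    ((last_toUnderlying φ y).trans (hb b)) (hb a) (hb b)).symm.trans
    (Eq.trans ?_ (simpValue_toUnderlying ψ y (first_toUnderlying ψ y) (last_toUnderlying ψ y)
      rfl rfl))
  exact congrArg simpValue (Simp.ext (congrArg (fun χ : Y ⟶ underlying.obj X => χ.app _ y.val) h))

/-- Simplices of `Ũ(X)` are detected by the values of all their faces (`underlying_ext`). For both
sides these are the values of `ψ` on the faces of `y`. -/
lemma toUnderlying_freeHomDataOf_app (ψ : Y ⟶ underlying.obj X) {n : ℕ} (y : Y _⦋n⦌) :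
    (toUnderlying (freeHomDataOf ψ).toHom).app _ y = ψ.app _ y := by
  have hb : ∀ v, vertexBase ((toUnderlying (freeHomDataOf ψ).toHom).app _ v) =
    vertexBase (ψ.app _ v) := vertexBase_toUnderlying _
  refine underlying_ext (fun i => ?_) fun m α a b h1 h2 h1' h2' => ?_
  · rw [app_vtx, app_vtx]
    exact hb _
  · let z : Simp Y (fun y => y) m _ _ := ⟨Y.map α.op y, rfl, rfl⟩
    have e : ∀ χ : Y ⟶ underlying.obj X, (underlying.obj X).map α.op (χ.app _ y) =
      χ.app _ z.val := fun χ => (NatTrans.naturality_apply χ _ _).symm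
    have hv : ∀ i, vertexBase (ψ.app _ (vtx i z.val)) =
        vertexBase (vtx i ((underlying.obj X).map α.op (ψ.app _ y))) := fun i =>
      (congrArg vertexBase (app_vtx ψ i z.val)).symm.trans
        (congrArg (fun t => vertexBase (vtx i t)) (e ψ).symm)
    have h3 := simpValue_toUnderlying (freeHomDataOf ψ).toHom z
      ((congrArg (fun t => vertexBase (vtx 0 t)) (e _)).symm.trans h1)
      ((congrArg (fun t => vertexBase (vtx (Fin.last m) t)) (e _)).symm.trans h2)
      ((hv 0).trans h1') ((hv _).trans h2')
    refine Eq.trans (congrArg simpValue (Simp.ext (e _))) (h3.trans ?_)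
    refine (congrArg (X.tr _ _) ((freeHomDataOf ψ).toHom_app _ _ _ z)).trans ?_
    exact tr_simpValue _ _ (e ψ).symm _ _

lemma toUnderlying_surjective :
    Function.Surjective (toUnderlying : ((freeTemplicial k).obj Y ⟶ X) → _) := by
  intro ψ
  refine ⟨(freeHomDataOf ψ).toHom, ?_⟩
  ext U y
  exact toUnderlying_freeHomDataOf_app ψ y

/-- `F̃` is left adjoint to `Ũ`. -/
noncomputable def freeAdjunction : freeTemplicial k ⊣ underlying (k := k) :=
  Adjunction.mkOfHomEquiv
    { homEquiv := fun Y X => Equiv.ofBijective toUnderlying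
        ⟨toUnderlying_injective, toUnderlying_surjective⟩
      homEquiv_naturality_left_symm := fun {Y' Y X} f g => by
        apply toUnderlying_injective
        refine (Equiv.ofBijective_apply_symm_apply toUnderlying _ _).trans ?_
        obtain ⟨φ, rfl⟩ := toUnderlying_surjective g
        have : (Equiv.ofBijective toUnderlying
            ⟨toUnderlying_injective, toUnderlying_surjective⟩).symm (toUnderlying φ) = φ :=
          Equiv.ofBijective_symm_apply_apply toUnderlying _ φ
        rw [this]
        ext U y
        change (freeTemplicial k).map (SSet.yonedaEquiv.symm (f.app _ y)) ≫ φ =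
          (freeTemplicial k).map (SSet.yonedaEquiv.symm y) ≫ (freeTemplicial k).map f ≫ φ
        rw [← Category.assoc, ← Functor.map_comp, SSet.yonedaEquiv_symm_comp]
      homEquiv_naturality_right := fun f g => by
        ext U y
        exact (Category.assoc _ _ _).symm }

/-- A horn in `Ũ(X)` transposes to a morphism from the free templicial module on the horn. An
extension of that morphism to `F̃(Δ[n])` transposes back to a filler. -/
lemma underlyingPreserves (k : Type u) [CommRing k] : UnderlyingPreserves.{u} k := by
  intro X hX
  refine ⟨fun n i σ h0 hn => ?_⟩
  obtain ⟨φ, rfl⟩ := toUnderlying_surjective σ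
  obtain ⟨g, rfl⟩ := hX h0 hn φ
  refine ⟨toUnderlying g, ?_⟩
  ext U y
  change (freeTemplicial k).map (SSet.yonedaEquiv.symm y) ≫ (freeTemplicial k).map Λ[n + 2, i].ι ≫
    g = (freeTemplicial k).map (SSet.yonedaEquiv.symm (Λ[n + 2, i].ι.app _ y)) ≫ g
  rw [← Category.assoc, ← Functor.map_comp]
  rfl

end Adjunction

end Templicial

namespace Templicial

open TemplicialModule

/-! ### Constructing simplices of `Ũ(X)` -/

section Extend

variable {k : Type u} [CommRing k] {X : TemplicialModule.{u} k}

/-- The nondegenerate `n`-simplex of `Δ[n]`. -/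
def stdTop (n : ℕ) : Simp (Δ[n] : SSet.{u}) (fun y => y) n (stdVertex 0) (stdVertex (Fin.last n)) :=
  stdSimp (𝟙 ⦋n⦌)

lemma stdVertex_injective {n : ℕ} : Function.Injective (stdVertex.{u} (n := n)) := by
  intro i j h
  exact congrArg (fun v : (Δ[n] : SSet.{u}) _⦋0⦌ => v 0) h

/-- A simplex of `Δ[n]` with end points `0` and `n`, as an interval map. -/
def Simp.toInterval {m n : ℕ}
    (y : Simp (Δ[n] : SSet.{u}) (fun y => y) m (stdVertex 0) (stdVertex (Fin.last n))) :
    IntervalMap m n where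
  toOrderHom := (SSet.stdSimplex.objEquiv y.val).toOrderHom
  map_zero := congrArg (fun v : (Δ[n] : SSet.{u}) _⦋0⦌ => v 0) y.first
  map_last := congrArg (fun v : (Δ[n] : SSet.{u}) _⦋0⦌ => v 0) y.last

lemma stdTop_map_toInterval {m n : ℕ}
    (y : Simp (Δ[n] : SSet.{u}) (fun y => y) m (stdVertex 0) (stdVertex (Fin.last n))) :
    (stdTop n).map y.toInterval = y := by
  ext
  rfl

lemma toInterval_stdTop_map {m n : ℕ} (f : IntervalMap m n) :
    ((stdTop.{u} n).map f).toInterval = f := rfl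

/-- A simplex with end points which lies in a subcomplex. -/
def Simp.restrict {Y : SSet.{u}} {A : Y.Subcomplex} {m : ℕ} {a b : Y _⦋0⦌}
    (y : Simp Y (fun y => y) m a b) (hy : y.val ∈ A.obj _) (ha : a ∈ A.obj _)
    (hb : b ∈ A.obj _) : Simp (A : SSet.{u}) (fun y => y) m ⟨a, ha⟩ ⟨b, hb⟩ where
  val := ⟨y.val, hy⟩
  first := Subtype.ext y.first
  last := Subtype.ext y.last

variable {n : ℕ} {A : (Δ[n] : SSet.{u}).Subcomplex}

/-- The data needed to extend a morphism `F̃(A) ⟶ X` to `F̃(Δ[n])`, where `A` is a subcomplex of `Δ[n]` which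
contains all simplices whose end points are not `0` and `n`: the value of the top simplex. -/
structure ExtensionData (D : FreeHomData (A : SSet.{u}) X) where
  pos : 0 < n
  mem {m : ℕ} {a b : (Δ[n] : SSet.{u}) _⦋0⦌} (y : Simp (Δ[n] : SSet.{u}) (fun y => y) m a b) :
    ¬ (a = stdVertex 0 ∧ b = stdVertex (Fin.last n)) → y.val ∈ A.obj _
  mem_vertex (v : (Δ[n] : SSet.{u}) _⦋0⦌) : v ∈ A.obj _
  top : X.obj n (D.base ⟨stdVertex 0, mem_vertex _⟩)
    (D.base ⟨stdVertex (Fin.last n), mem_vertex _⟩)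
  comul_top (i j : ℕ) (h : i + j = n) (hi : 0 < i) (hj : 0 < j) (c : (Δ[n] : SSet.{u}) _⦋0⦌)
    (hc : ((stdTop n).map (IntervalMap.cast h)).mid = c)
    (h1 : (((stdTop n).map (IntervalMap.cast h)).front i j hc).val ∈ A.obj _)
    (h2 : (((stdTop n).map (IntervalMap.cast h)).back i j hc).val ∈ A.obj _) :
    X.comul i j _ _ (X.map (IntervalMap.cast h) _ _ top) =
      X.incl i j _ _ (D.base ⟨c, mem_vertex _⟩)
        (D.val ((((stdTop n).map (IntervalMap.cast h)).front i j hc).restrict h1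
            (mem_vertex _) (mem_vertex _)) ⊗ₜ
          D.val ((((stdTop n).map (IntervalMap.cast h)).back i j hc).restrict h2
            (mem_vertex _) (mem_vertex _)))
  map_top {m : ℕ} (f : IntervalMap m n) (hf : ((stdTop n).map f).val ∈ A.obj _) :
    X.map f _ _ top = D.val (((stdTop n).map f).restrict hf
      (mem_vertex _) (mem_vertex _))

namespace ExtensionData

variable {D : FreeHomData (A : SSet.{u}) X} (d : ExtensionData D)

/-- The image of a vertex. -/
abbrev base (v : (Δ[n] : SSet.{u}) _⦋0⦌) : X.base := D.base ⟨v, d.mem_vertex v⟩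

open Classical in
/-- The value of the extension on a simplex. -/
noncomputable def val {m : ℕ} {a b : (Δ[n] : SSet.{u}) _⦋0⦌}
    (y : Simp (Δ[n] : SSet.{u}) (fun y => y) m a b) : X.obj m (d.base a) (d.base b) :=
  if h : a = stdVertex 0 ∧ b = stdVertex (Fin.last n) then
    X.tr (congrArg d.base h.1.symm) (congrArg d.base h.2.symm)
      (X.map (Simp.toInterval (by obtain ⟨rfl, rfl⟩ := h; exact y)) _ _ d.top)
  else D.val (y.restrict (d.mem y h) (d.mem_vertex _) (d.mem_vertex _))

lemma val_interval {m : ℕ}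
    (y : Simp (Δ[n] : SSet.{u}) (fun y => y) m (stdVertex 0) (stdVertex (Fin.last n))) :
    d.val y = X.map y.toInterval _ _ d.top := (dif_pos (⟨rfl, rfl⟩ : stdVertex 0 = stdVertex 0 ∧ _)).trans rfl

/-- Consistency of the two cases in the definition of `val`: a simplex from `0` to `n` may also lie
in `A`, and then `map_top` says that both prescriptions agree. -/
lemma val_of_mem {m : ℕ} {a b : (Δ[n] : SSet.{u}) _⦋0⦌}
    (y : Simp (Δ[n] : SSet.{u}) (fun y => y) m a b) (hy : y.val ∈ A.obj _) :
    d.val y = D.val (y.restrict hy (d.mem_vertex _) (d.mem_vertex _)) := by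
  by_cases h : a = stdVertex 0 ∧ b = stdVertex (Fin.last n)
  · obtain ⟨rfl, rfl⟩ := h
    obtain ⟨f, rfl⟩ : ∃ f, (stdTop n).map f = y := ⟨_, stdTop_map_toInterval y⟩
    rw [val_interval]
    exact d.map_top f hy
  · exact dif_neg h

lemma map_val {l m : ℕ} (f : IntervalMap l m) {a b : (Δ[n] : SSet.{u}) _⦋0⦌}
    (y : Simp (Δ[n] : SSet.{u}) (fun y => y) m a b) :
    X.map f _ _ (d.val y) = d.val (y.map f) := by
  by_cases h : a = stdVertex 0 ∧ b = stdVertex (Fin.last n)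
  · obtain ⟨rfl, rfl⟩ := h
    rw [val_interval, val_interval]
    exact X.map_comp_apply _ _ _
  · rw [val_of_mem d y (d.mem y h), val_of_mem d _ (d.mem _ h)]
    exact D.map_val f _

/-- By monotonicity a simplex of `Δ[n]` with equal end points is constant, hence degenerate on a
vertex. -/
lemma val_of_eq {m : ℕ} {v : (Δ[n] : SSet.{u}) _⦋0⦌}
    (y : Simp (Δ[n] : SSet.{u}) (fun y => y) m v v) : d.val y = X.deg m (d.base v) := by
  let p : Simp (Δ[n] : SSet.{u}) (fun y => y) 0 v v := default
  have hp : d.val p = X.unit (d.base v) := by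
    rw [val_of_mem d p (d.mem p _)]
    · exact X.eq_unit (D.counit_val _)
    -- The condition `0 < n` enters here: no vertex is both the first and the last.
    · rintro ⟨h1, h2⟩
      have := stdVertex_injective (h1.symm.trans h2)
      exact d.pos.ne (congrArg Fin.val this)
  have hy : y = p.map (IntervalMap.toZero m) := by
    refine Simp.ext (SSet.stdSimplex.ext _ _ fun i => ?_)
    have h1 : (y.val) 0 = v 0 := congrArg (fun v : (Δ[n] : SSet.{u}) _⦋0⦌ => v 0) y.first
    have h2 : (y.val) (Fin.last m) = v 0 :=
      congrArg (fun v : (Δ[n] : SSet.{u}) _⦋0⦌ => v 0) y.last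
    have h3 := SSet.stdSimplex.monotone_apply y.val (Fin.zero_le i)
    have h4 := SSet.stdSimplex.monotone_apply y.val (Fin.le_last i)
    exact le_antisymm (h4.trans h2.le) (h1.ge.trans h3)
  rw [hy, ← map_val, hp]
  rfl

lemma comul_val_of_mem {p q : ℕ} {a b c : (Δ[n] : SSet.{u}) _⦋0⦌}
    (y : Simp (Δ[n] : SSet.{u}) (fun y => y) (p + q) a b) (hc : y.mid = c)
    (h : ¬ (a = stdVertex 0 ∧ b = stdVertex (Fin.last n))) :
    X.comul p q _ _ (d.val y) =
      X.incl p q _ _ (d.base c) (d.val (y.front p q hc) ⊗ₜ d.val (y.back p q hc)) := by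
  subst hc
  have hy := d.mem y h
  have h1 : (y.front p q rfl).val ∈ A.obj _ := A.map (frontHom p q).op hy
  have h2 : (y.back p q rfl).val ∈ A.obj _ := A.map (backHom p q).op hy
  rw [val_of_mem d y hy, val_of_mem d _ h1, val_of_mem d _ h2]
  exact D.comul_val _

/-- The simplex is an interval map, which splits as `f₁ + f₂` with `f₁ : [p] ⟶ [i]` and `f₂ : [q] ⟶
[j]`, where `i + j = n`. By naturality the claim reduces to the comultiplication `μ_{i,j}` of the
top value. This is prescribed when `i` and `j` are positive, and otherwise it is given by a counit
axiom. -/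
lemma comul_val_interval {p q : ℕ} {c : (Δ[n] : SSet.{u}) _⦋0⦌}
    (y : Simp (Δ[n] : SSet.{u}) (fun y => y) (p + q) (stdVertex 0) (stdVertex (Fin.last n)))
    (hc : y.mid = c) :
    X.comul p q _ _ (d.val y) =
      X.incl p q _ _ (d.base c) (d.val (y.front p q hc) ⊗ₜ d.val (y.back p q hc)) := by
  obtain ⟨f, rfl⟩ : ∃ f, (stdTop n).map f = y := ⟨_, stdTop_map_toInterval y⟩
  obtain ⟨i, j, h, f₁, f₂, hf, hi⟩ := f.exists_split
  have hci : c = stdVertex (f.toOrderHom ⟨p, by omega⟩) := by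
    subst hc
    apply SSet.stdSimplex.objEquiv.injective
    ext; rfl
  rw [val_interval, toInterval_stdTop_map]
  nth_rewrite 1 [hf]
  rw [← X.map_comp_apply]
  -- If `i = 0`, the first part collapses to the vertex `0`, so the front face is degenerate and the
  -- back face carries the top value. The case `j = 0` is symmetric.
  rcases Nat.eq_zero_or_pos i with h0 | hi'
  · subst h0
    obtain rfl : j = n := by omega
    obtain rfl : f₁ = IntervalMap.toZero p := Subsingleton.elim _ _
    obtain rfl : c = stdVertex 0 := by
      rw [hci]; congr 1; exact Fin.ext hi.symm
    rw [X.comul_map_of_incl _ _ (X.comul_left_zero d.top), TensorProduct.map_tmul, val_of_eq]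
    rw [val_interval]
    have : f₂ = (Simp.back p q ((stdTop j).map f) hc).toInterval := by
      refine IntervalMap.ext_val fun r => ?_
      change _ = (f.toOrderHom ⟨p + r.1, by omega⟩).1
      rw [hf, IntervalMap.comp_val, IntervalMap.cast_val, IntervalMap.add_val_of_ge _ _ (by simp)]
      simp
    rw [← this]
    rfl
  rcases Nat.eq_zero_or_pos j with h0 | hj'
  · subst h0
    obtain rfl : i = n := by omega
    obtain rfl : f₂ = IntervalMap.toZero q := Subsingleton.elim _ _
    obtain rfl : c = stdVertex (Fin.last i) := by
      rw [hci]; congr 1; exact Fin.ext hi.symm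
    rw [X.map_cast_rfl, X.comul_map_of_incl _ _ (X.comul_right_zero d.top),
      TensorProduct.map_tmul, val_of_eq, val_interval]
    have : f₁ = (Simp.front p q ((stdTop i).map f) hc).toInterval := by
      refine IntervalMap.ext_val fun r => ?_
      change _ = (f.toOrderHom ⟨r.1, by omega⟩).1
      rw [hf, IntervalMap.comp_val, IntervalMap.cast_val,
        IntervalMap.add_val_of_le _ _ (by simp; omega)]
    rw [← this]
    rfl
  -- Here the cut is at a vertex `c` different from `0` and `n`. Neither part runs from `0` to `n`,
  -- so both lie in `A` and `comul_top` applies.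
  · have hc' : ((stdTop n).map (IntervalMap.cast h)).mid = c := by
      rw [hci]
      apply SSet.stdSimplex.objEquiv.injective
      ext; exact hi
    have hc0 : c ≠ stdVertex 0 := by
      rw [hci]; intro e
      have := congrArg Fin.val (stdVertex_injective e)
      simp only [Fin.val_zero] at this
      omega
    have hcn : c ≠ stdVertex (Fin.last n) := by
      rw [hci]; intro e
      have := congrArg Fin.val (stdVertex_injective e)
      simp only [Fin.val_last] at this
      omega
    refine (X.comul_map_of_incl f₁ f₂ (d.comul_top i j h hi' hj' c hc' (d.mem _ fun e => hcn e.2)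
      (d.mem _ fun e => hc0 e.1))).trans (congrArg _ ((TensorProduct.map_tmul _ _ _ _).trans
        (congrArg₂ (· ⊗ₜ[k] ·)
        ((D.map_val f₁ _).trans (Eq.trans (congrArg D.val ?_)
          (d.val_of_mem _ (d.mem _ fun e => hcn e.2)).symm))
        ((D.map_val f₂ _).trans (Eq.trans (congrArg D.val ?_)
          (d.val_of_mem _ (d.mem _ fun e => hc0 e.1)).symm)))))
    · refine Simp.ext (Subtype.ext (SSet.stdSimplex.ext _ _ fun r => Fin.ext ?_))
      change _ = (f.toOrderHom ⟨r.1, by omega⟩).1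
      rw [hf, IntervalMap.comp_val, IntervalMap.cast_val,
        IntervalMap.add_val_of_le _ _ (by simp; omega)]
      rfl
    · refine Simp.ext (Subtype.ext (SSet.stdSimplex.ext _ _ fun r => Fin.ext ?_))
      change _ = (f.toOrderHom ⟨p + r.1, by omega⟩).1
      rw [hf, IntervalMap.comp_val, IntervalMap.cast_val, IntervalMap.add_val_of_ge _ _ (by simp)]
      simp
      rfl

/-- The extension, as data. -/
noncomputable def freeHomData : FreeHomData (Δ[n] : SSet.{u}) X where
  base := d.base
  val := d.val
  map_val f _ _ y := d.map_val f y
  comul_val {m l a b} y := by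
    by_cases h : a = stdVertex 0 ∧ b = stdVertex (Fin.last n)
    · obtain ⟨rfl, rfl⟩ := h
      exact d.comul_val_interval y rfl
    · exact d.comul_val_of_mem y rfl h
  counit_val y := by
    rw [val_of_eq, deg_zero, counit_unit]

/-- The extension, as a simplex. -/
noncomputable def simplex : (underlying.obj X) _⦋n⦌ := d.freeHomData.toHom

lemma vertexBase_vtx (i : Fin (n + 1)) :
    vertexBase (vtx i d.simplex) = d.base (stdVertex i) := rfl

lemma simpValue_simplex (h1 h2) :
    simpValue (⟨d.simplex, h1, h2⟩ : Simp (underlying.obj X) vertexBase n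
      (d.base (stdVertex 0)) (d.base (stdVertex (Fin.last n)))) = d.top := by
  refine (d.freeHomData.toHom_app n _ _ (stdTop n)).trans ?_
  refine (d.val_interval (stdTop n)).trans ?_
  exact X.map_id_apply _

lemma map_ι_toHom : (freeTemplicial k).map A.ι ≫ d.freeHomData.toHom = D.toHom := by
  refine freeHom_ext (fun _ => rfl) fun m a b y => ?_
  refine (congrArg (Hom.app d.freeHomData.toHom m _ _) (freeTemplicial_map_freeGen A.ι y)).trans ?_
  refine (d.freeHomData.toHom_app _ _ _ _).trans ((d.val_of_mem _ y.val.2).trans ?_)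
  exact (D.toHom_app _ _ _ _).symm

end ExtensionData

lemma ExtensionData.map_simplex {ψ : (A : SSet.{u}) ⟶ underlying.obj X}
    (d : ExtensionData (freeHomDataOf ψ)) {m : ℕ} (y : (A : SSet.{u}) _⦋m⦌) :
    (underlying.obj X).map (SSet.stdSimplex.objEquiv y.1).op d.simplex = ψ.app _ y := by
  refine Eq.trans ?_ (toUnderlying_freeHomDataOf_app ψ y)
  rw [← d.map_ι_toHom]
  change (freeTemplicial k).map _ ≫ d.freeHomData.toHom = (freeTemplicial k).map _ ≫
    (freeTemplicial k).map A.ι ≫ d.freeHomData.toHom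
  rw [← Category.assoc, ← Functor.map_comp]
  congr 2

end Extend

end Templicial

namespace Templicial

open TemplicialModule

/-! ### Vertices, edges and triangles of `Ũ(X)` -/

section LowDim

variable {k : Type u} [CommRing k] {X X' : TemplicialModule.{u} k}

lemma vtx_zero_eq_δ {Y : SSet.{u}} (s : Y _⦋1⦌) : vtx 0 s = Y.δ 1 s := by
  refine congrArg (fun f : ⦋0⦌ ⟶ ⦋1⦌ => Y.map f.op s) ?_
  ext i
  obtain rfl : i = 0 := Subsingleton.elim (α := Fin 1) _ _
  rfl

lemma vtx_last_eq_δ {Y : SSet.{u}} (s : Y _⦋1⦌) : vtx (Fin.last 1) s = Y.δ 0 s := by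
  refine congrArg (fun f : ⦋0⦌ ⟶ ⦋1⦌ => Y.map f.op s) ?_
  ext i
  obtain rfl : i = 0 := Subsingleton.elim (α := Fin 1) _ _
  rfl

/-- The vertex of `Ũ(X)` given by an element of the base, as data. -/
noncomputable def vertexData (a : X.base) : FreeHomData (Δ[0] : SSet.{u}) X where
  base _ := a
  val {n _ _} _ := X.deg n a
  map_val f _ _ _ := X.map_deg f a
  comul_val {m n _ _} _ := X.comul_deg m n a
  counit_val _ := by rw [deg_zero, counit_unit]

/-- The vertex of `Ũ(X)` given by an element of the base. -/
noncomputable def vertexOf (a : X.base) : (underlying.obj X) _⦋0⦌ := (vertexData a).toHom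

@[simp]
lemma vertexBase_vertexOf (a : X.base) : vertexBase (vertexOf a) = a := rfl

/-- A simplex pulled back from a vertex is totally degenerate, and in degree zero the only possible
value is the unit. The transport appears because the two end points are only propositionally equal.
-/
lemma simpValue_toZero {m : ℕ} {a b : X.base} (s : Simp (underlying.obj X) vertexBase m a b)
    (v : (underlying.obj X) _⦋0⦌) (α : ⦋m⦌ ⟶ ⦋0⦌) (h : s.val = (underlying.obj X).map α.op v)
    (hb : a = b) : simpValue s = X.tr rfl hb (X.deg m a) := by
  subst hb
  have hv : vertexBase v = a := by
    have := s.first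
    rw [h, vtx_map, vtx_zero_self] at this
    exact this
  let t : Simp (underlying.obj X) vertexBase 0 a a :=
    ⟨v, by rw [vtx_zero_self]; exact hv, by rw [vtx_zero_self]; exact hv⟩
  have e : s = t.map (IntervalMap.toZero m) := by
    refine Simp.ext (h.trans (congrArg (fun f : ⦋m⦌ ⟶ ⦋0⦌ => (underlying.obj X).map f.op v) ?_))
    ext i
    exact congrArg Fin.val (Subsingleton.elim (α := Fin 1) _ _)
  rw [e, ← map_simpValue, counit_simpValue]
  rfl

/-- All faces of a `0`-simplex are degenerate, so their values depend only on the base element. -/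
lemma vertexBase_injective : Function.Injective (vertexBase (X := X)) := by
  intro x y h
  have hb : ∀ i : Fin (0 + 1), vertexBase (vtx i x) = vertexBase (vtx i y) := fun i => by
    rw [vtx_zero_self, vtx_zero_self, h]
  refine underlying_ext hb fun m α a b h1 h2 h1' h2' => ?_
  have hab : a = b := by
    rw [← h1, ← h2, vtx_map, vtx_map, vtx_zero_self, vtx_zero_self]
  rw [simpValue_toZero _ x α rfl hab, simpValue_toZero _ y α rfl hab]

lemma vertexOf_vertexBase (x : (underlying.obj X) _⦋0⦌) : vertexOf (vertexBase x) = x :=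
  vertexBase_injective (vertexBase_vertexOf _)

/-- A `1`-simplex of `Ũ(X)` is determined by its value. -/
lemma simpValue_one_injective {a b : X.base} :
    Function.Injective (simpValue : Simp (underlying.obj X) vertexBase 1 a b → X.obj 1 a b) := by
  intro s t h
  have hv : ∀ i : Fin (1 + 1), vertexBase (vtx i s.val) = vertexBase (vtx i t.val) := fun i => by
    obtain rfl | rfl := Fin.exists_fin_two.1 ⟨i, rfl⟩
    · exact s.first.trans t.first.symm
    · exact s.last.trans t.last.symm
  refine Simp.ext (underlying_ext hv fun m α a' b' h1 h2 h1' h2' => ?_)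
  -- An operator into `[1]` is either constant, with a degenerate face, or it preserves both end
  -- points. In the second case the value of the face is an operator of `X` applied to the value of
  -- the edge.
  by_cases hα : α.toOrderHom 0 = α.toOrderHom (Fin.last m)
  · have hc : α = (IntervalMap.toZero m).toHom ≫ SimplexCategory.const ⦋0⦌ ⦋1⦌ (α.toOrderHom 0) := by
      ext i
      exact congrArg Fin.val (le_antisymm ((α.toOrderHom.monotone (Fin.le_last i)).trans hα.ge)
        (α.toOrderHom.monotone (Fin.zero_le i)))
    have e : ∀ s : (underlying.obj X) _⦋1⦌, (underlying.obj X).map α.op s =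
        (underlying.obj X).map (IntervalMap.toZero m).toHom.op (vtx (α.toOrderHom 0) s) :=
      fun s => by
        rw [vtx, map_map, ← hc]
    have hab : a' = b' := by
      rw [← h1, ← h2, vtx_map, vtx_map, hα]
    rw [simpValue_toZero _ _ _ (e _) hab, simpValue_toZero _ _ _ (e _) hab]
  · have h0 : α.toOrderHom 0 = 0 := by
      have := α.toOrderHom.monotone (Fin.zero_le (Fin.last m))
      have h3 := (α.toOrderHom (Fin.last m)).2
      have h4 : (α.toOrderHom 0).1 < (α.toOrderHom (Fin.last m)).1 := lt_of_le_of_ne this fun e => hα (Fin.ext e)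
      refine Fin.ext ?_
      simp only [SimplexCategory.len_mk] at h3
      change _ = 0
      omega
    have hl : α.toOrderHom (Fin.last m) = Fin.last 1 := by
      have := α.toOrderHom.monotone (Fin.zero_le (Fin.last m))
      have h3 := (α.toOrderHom (Fin.last m)).2
      have h4 : (α.toOrderHom 0).1 < (α.toOrderHom (Fin.last m)).1 := lt_of_le_of_ne this fun e => hα (Fin.ext e)
      refine Fin.ext ?_
      simp only [SimplexCategory.len_mk] at h3
      change _ = 1
      omega
    let f : IntervalMap m 1 := ⟨α.toOrderHom, h0, hl⟩
    have ha : a = a' := by rw [← h1, vtx_map, h0]; exact s.first.symm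
    have hb : b = b' := by rw [← h2, vtx_map, hl]; exact s.last.symm
    subst ha hb
    refine (map_simpValue f s).symm.trans (Eq.trans ?_ (map_simpValue f t))
    rw [h]

/-- A simplex of the boundary of `Δ[1]` misses one of the two vertices, so it is constant at the
other. -/
lemma boundary_first_eq_last {n : ℕ} {v w : (∂Δ[1] : SSet.{u}) _⦋0⦌}
    (y : Simp (∂Δ[1] : SSet.{u}) (fun y => y) n v w) : v.1 0 = w.1 0 := by
  obtain ⟨j, hj⟩ := (SSet.mem_boundary_iff_notMem_range y.val.1).1 y.val.2
  have h1 : v.1 0 = y.val.1 0 := congrArg (fun v : (∂Δ[1] : SSet.{u}) _⦋0⦌ => v.1 0) y.first.symm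
  have h2 : w.1 0 = y.val.1 (Fin.last n) :=
    congrArg (fun v : (∂Δ[1] : SSet.{u}) _⦋0⦌ => v.1 0) y.last.symm
  rw [h1, h2]
  have h3 : y.val.1 0 ≠ j := fun e => hj ⟨_, e⟩
  have h4 : y.val.1 (Fin.last n) ≠ j := fun e => hj ⟨_, e⟩
  omega

lemma tr_deg_eq {m : ℕ} {a b c : X.base} (h : a = b) (h' : a = c) (h'' : b = c) :
    X.tr h h' (X.deg m a) = X.tr rfl h'' (X.deg m b) := by
  subst h h'; rfl

/-- A morphism from the free templicial module on the boundary of `Δ[1]`, as data. -/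
noncomputable def boundaryData (a b : X.base) : FreeHomData (∂Δ[1] : SSet.{u}) X where
  base v := ![a, b] (v.1 0)
  val {n v w} y := X.tr rfl (congrArg ![a, b] (boundary_first_eq_last y))
    (X.deg n (![a, b] (v.1 0)))
  map_val f _ _ _ := by rw [map_tr, map_deg]
  comul_val {m n v w} y :=
    (comul_tr_of_incl rfl _ (congrArg ![a, b] (boundary_first_eq_last (y.front m n rfl)))
      (X.comul_deg m n (![a, b] (v.1 0)))).trans
      (congrArg _ (congrArg₂ _ rfl (tr_deg_eq _ _ _)))
  counit_val y := by rw [tr_deg, deg_zero, counit_unit]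

lemma stdVertex_apply_zero {n : ℕ} (v : (Δ[n] : SSet.{u}) _⦋0⦌) : stdVertex (v 0) = v := by
  refine SSet.stdSimplex.ext _ _ fun i => ?_
  obtain rfl : i = 0 := Subsingleton.elim (α := Fin 1) _ _
  rfl

lemma boundaryData_base (a b : X.base) (i : Fin 2) (h) :
    (boundaryData a b).base ⟨stdVertex i, h⟩ = ![a, b] i := rfl

/-- An edge with given value, as data. -/
noncomputable def edgeData {a b : X.base} (x : X.obj 1 a b) :
    ExtensionData (boundaryData a b) where
  pos := one_pos
  mem {m v w} y h := by
    refine (SSet.mem_boundary_iff_notMem_range _).2 ?_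
    have h1 : v 0 = y.val 0 := congrArg (fun v : (Δ[1] : SSet.{u}) _⦋0⦌ => v 0) y.first.symm
    have h2 : w 0 = y.val (Fin.last m) :=
      congrArg (fun v : (Δ[1] : SSet.{u}) _⦋0⦌ => v 0) y.last.symm
    by_cases h3 : y.val 0 = 0
    · refine ⟨1, ?_⟩
      rintro ⟨r, hr⟩
      refine h ⟨?_, ?_⟩
      · rw [← stdVertex_apply_zero v, h1, h3]
      · rw [← stdVertex_apply_zero w, h2]
        congr 1
        exact le_antisymm (Fin.le_last _)
          (hr.ge.trans (SSet.stdSimplex.monotone_apply y.val (Fin.le_last r)))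
    · refine ⟨0, ?_⟩
      rintro ⟨r, hr⟩
      exact h3 (le_antisymm ((SSet.stdSimplex.monotone_apply y.val (Fin.zero_le r)).trans hr.le)
        (Fin.zero_le _))
  mem_vertex v := by
    rw [SSet.boundary_obj_eq_univ 0 1]
    trivial
  top := X.tr (boundaryData_base a b 0 _).symm (boundaryData_base a b 1 _).symm x
  -- There is no way to write `1` as a sum of two positive numbers, so the value on an edge is
  -- subject to no condition.
  comul_top i j h hi hj := by omega
  -- An interval map hits both vertices of `Δ[1]`, so its simplex never lies in the boundary.
  map_top {m} f hf := by
    exfalso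
    obtain ⟨j, hj⟩ := (SSet.mem_boundary_iff_notMem_range _).1 hf
    obtain rfl | rfl := Fin.exists_fin_two.1 ⟨j, rfl⟩
    · exact hj ⟨0, f.map_zero⟩
    · exact hj ⟨Fin.last m, f.map_last⟩

lemma exists_simpValue_one {a b : X.base} (x : X.obj 1 a b) :
    ∃ s : Simp (underlying.obj X) vertexBase 1 a b, simpValue s = x :=
  ⟨⟨(edgeData x).simplex, (edgeData x).vertexBase_vtx 0, (edgeData x).vertexBase_vtx (Fin.last 1)⟩,
    (edgeData x).simpValue_simplex _ _⟩

variable {x y z : (underlying.obj X) _⦋0⦌}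

/-- An edge of `Ũ(X)` as a `1`-simplex with given end points. -/
noncomputable def edgeSimp (e : SSet.Edge x y) :
    Simp (underlying.obj X) vertexBase 1 (vertexBase x) (vertexBase y) where
  val := e.edge
  first := congrArg vertexBase ((vtx_zero_eq_δ e.edge).trans e.src_eq)
  last := congrArg vertexBase ((vtx_last_eq_δ e.edge).trans e.tgt_eq)

lemma cast_eq_tr {n : ℕ} {a b a' b' : X.base} (ha : a = a') (hb : b = b') (m : X.obj n a b) :
    cast (congrArg₂ (fun a b => (X.obj n a b : Type u)) ha hb) m = X.tr ha hb m := by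
  subst ha hb; rfl

lemma edgeValue_eq (e : SSet.Edge x y) : edgeValue e = simpValue (edgeSimp e) :=
  cast_eq_tr _ _ _

lemma edgeValue_injective :
    Function.Injective (edgeValue : SSet.Edge x y → X.obj 1 (vertexBase x) (vertexBase y)) := by
  intro e e' h
  rw [edgeValue_eq, edgeValue_eq] at h
  exact SSet.Edge.ext (congrArg Simp.val (simpValue_one_injective h))

lemma edgeValue_surjective :
    Function.Surjective (edgeValue : SSet.Edge x y → X.obj 1 (vertexBase x) (vertexBase y)) := by
  intro m
  obtain ⟨s, rfl⟩ := exists_simpValue_one m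
  refine ⟨SSet.Edge.mk s.val ?_ ?_, edgeValue_eq _⟩
  · rw [← vtx_zero_eq_δ]
    exact vertexBase_injective s.first
  · rw [← vtx_last_eq_δ]
    exact vertexBase_injective s.last

lemma edgeValue_id (x : (underlying.obj X) _⦋0⦌) :
    edgeValue (SSet.Edge.id x) = X.deg 1 (vertexBase x) := by
  rw [edgeValue_eq, simpValue_toZero (edgeSimp (SSet.Edge.id x)) x (SimplexCategory.σ 0) rfl rfl]
  rfl

lemma edgeValue_map (φ : X ⟶ X') (e : SSet.Edge x y) :
    edgeValue (e.map (underlying.map φ)) = Hom.app φ 1 _ _ (edgeValue e) := by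
  rw [edgeValue_eq, edgeValue_eq, ← simpValue_push]
  rfl

end LowDim

end Templicial

namespace Templicial

open TemplicialModule

/-! ### Triangles of `Ũ(X)`. -/

section Horn

variable {k : Type u} [CommRing k] {X X' : TemplicialModule.{u} k}

/-- By monotonicity, such a simplex avoids the vertex `0` or the vertex `n`. It then lies in the
opposite face, and both of these faces belong to every inner horn. -/
lemma mem_horn_of_endpoints {n : ℕ} {i : Fin (n + 1)} (h0 : 0 < i) (hn : i < Fin.last n) {m : ℕ}
    {a b : (Δ[n] : SSet.{u}) _⦋0⦌} (y : Simp (Δ[n] : SSet.{u}) (fun y => y) m a b)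
    (h : ¬ (a = stdVertex 0 ∧ b = stdVertex (Fin.last n))) : y.val ∈ Λ[n, i].obj _ := by
  refine (SSet.mem_horn_iff_notMem_range _ _).2 ?_
  have h1 : a 0 = y.val 0 := congrArg (fun v : (Δ[n] : SSet.{u}) _⦋0⦌ => v 0) y.first.symm
  have h2 : b 0 = y.val (Fin.last m) :=
    congrArg (fun v : (Δ[n] : SSet.{u}) _⦋0⦌ => v 0) y.last.symm
  by_cases h3 : y.val 0 = 0
  · refine ⟨Fin.last n, hn.ne', ?_⟩
    rintro ⟨r, hr⟩
    refine h ⟨?_, ?_⟩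
    · rw [← stdVertex_apply_zero a, h1, h3]
    · rw [← stdVertex_apply_zero b, h2]
      congr 1
      exact le_antisymm (Fin.le_last _)
        (hr.ge.trans (SSet.stdSimplex.monotone_apply y.val (Fin.le_last r)))
  · refine ⟨0, h0.ne, ?_⟩
    rintro ⟨r, hr⟩
    exact h3 (le_antisymm ((SSet.stdSimplex.monotone_apply y.val (Fin.zero_le r)).trans hr.le)
      (Fin.zero_le _))

lemma vertex_mem_horn {n : ℕ} {i : Fin (n + 1)} (h0 : 0 < i) (hn : i < Fin.last n)
    (v : (Δ[n] : SSet.{u}) _⦋0⦌) : v ∈ Λ[n, i].obj _ :=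
  mem_horn_of_endpoints h0 hn (default : Simp (Δ[n] : SSet.{u}) (fun y => y) 0 v v) fun h =>
    (h0.trans hn).ne (stdVertex_injective (h.1.symm.trans h.2))

variable {x y z : (underlying.obj X) _⦋0⦌}

/-- The only compatibility required of the two faces of `Λ[2, 1]` is that they share the vertex `y`.
-/
lemma exists_horn_two (e : SSet.Edge x y) (e' : SSet.Edge y z) :
    ∃ ψ : (Λ[2, 1] : SSet.{u}) ⟶ underlying.obj X,
      ψ.app _ (SSet.horn.face 1 0 (by decide)) = e'.edge ∧
      ψ.app _ (SSet.horn.face 1 2 (by decide)) = e.edge := by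
  have hc : SSet.horn.IsCompatible (i := (1 : Fin 3))
      (fun j _ => SSet.yonedaEquiv.symm ((![e'.edge, e.edge, e.edge] : Fin 3 → _) j)) := by
    rw [SSet.horn.isCompatible_iff]
    intro j k hj hk hjk
    rw [δ_comp_symm, δ_comp_symm]
    congr 1
    fin_cases j <;> fin_cases k <;> first | (exfalso; revert hj hk hjk; decide) | skip
    exact e'.src_eq.trans e.tgt_eq.symm
  obtain ⟨ψ, hψ⟩ := hc.exists_desc
  refine ⟨ψ, ?_, ?_⟩
  · have := congrArg SSet.yonedaEquiv (hψ 0 (by decide))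
    rw [Equiv.apply_symm_apply, SSet.yonedaEquiv_comp, SSet.horn.yonedaEquiv_ι] at this
    exact this
  · have := congrArg SSet.yonedaEquiv (hψ 2 (by decide))
    rw [Equiv.apply_symm_apply, SSet.yonedaEquiv_comp, SSet.horn.yonedaEquiv_ι] at this
    exact this

/-- A triangle of `Ũ(X)` with given value, as data. -/
noncomputable def triangleData {e : SSet.Edge x y} {e' : SSet.Edge y z}
    {ψ : (Λ[2, 1] : SSet.{u}) ⟶ underlying.obj X}
    (h₀ : ψ.app _ (SSet.horn.face 1 0 (by decide)) = e'.edge)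
    (h₂ : ψ.app _ (SSet.horn.face 1 2 (by decide)) = e.edge)
    (hx : ∀ h, ψ.app _ ⟨stdVertex 0, h⟩ = x) (hy : ∀ h, ψ.app _ ⟨stdVertex 1, h⟩ = y)
    (hz : ∀ h, ψ.app _ ⟨stdVertex (Fin.last 2), h⟩ = z)
    (w : X.obj 2 (vertexBase x) (vertexBase z))
    (hw : X.comul 1 1 _ _ w = X.incl 1 1 _ _ (vertexBase y) (edgeValue e ⊗ₜ edgeValue e')) :
    ExtensionData (freeHomDataOf ψ) where
  pos := two_pos
  mem y h := mem_horn_of_endpoints (by decide) (by decide) y h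
  mem_vertex v := vertex_mem_horn (by decide) (by decide) v
  top := X.tr (congrArg vertexBase (hx _)).symm (congrArg vertexBase (hz _)).symm w
  comul_top i j h hi hj c hc h1 h2 := by
    -- The only decomposition of `2` into positive parts is `1 + 1`, so `hw` is the one condition on
    -- the comultiplications.
    obtain rfl : i = 1 := by omega
    obtain rfl : j = 1 := by omega
    obtain rfl : c = stdVertex 1 := hc.symm.trans (by
      apply SSet.stdSimplex.objEquiv.injective
      ext; rfl)
    refine (congrArg _ (X.map_cast_rfl _ _)).trans ?_
    refine (comul_tr_of_incl _ _ (congrArg vertexBase (hy (vertex_mem_horn (by decide) (by decide) _))).symm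
      hw).trans ?_
    refine congrArg _ (congrArg₂ _ ?_ ?_)
    · refine (congrArg _ (edgeValue_eq e)).trans (tr_simpValue _ _ (Eq.trans h₂.symm ?_) _ _)
      refine congrArg (ψ.app _) (Subtype.ext ?_)
      apply SSet.stdSimplex.objEquiv.injective
      ext i
      fin_cases i <;> rfl
    · refine (congrArg _ (edgeValue_eq e')).trans (tr_simpValue _ _ (Eq.trans h₀.symm ?_) _ _)
      refine congrArg (ψ.app _) (Subtype.ext ?_)
      apply SSet.stdSimplex.objEquiv.injective
      ext i
      fin_cases i <;> rfl
  -- A simplex of `Λ[2, 1]` misses the vertex `0` or the vertex `2`, whereas an interval map hits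
  -- both.
  map_top {m} f hf := by
    exfalso
    obtain ⟨j, hj, hj'⟩ := (SSet.mem_horn_iff_notMem_range _ _).1 hf
    fin_cases j
    · exact hj' ⟨0, f.map_zero⟩
    · exact hj rfl
    · exact hj' ⟨Fin.last m, f.map_last⟩

lemma exists_simplex_two (e : SSet.Edge x y) (e' : SSet.Edge y z)
    (w : X.obj 2 (vertexBase x) (vertexBase z))
    (hw : X.comul 1 1 _ _ w = X.incl 1 1 _ _ (vertexBase y) (edgeValue e ⊗ₜ edgeValue e')) :
    ∃ s : Simp (underlying.obj X) vertexBase 2 (vertexBase x) (vertexBase z),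
      simpValue s = w ∧ (underlying.obj X).δ 0 s.val = e'.edge ∧
        (underlying.obj X).δ 2 s.val = e.edge := by
  obtain ⟨ψ, h₀, h₂⟩ := exists_horn_two e e'
  have hx : ∀ h, ψ.app _ ⟨stdVertex 0, h⟩ = x := fun h => by
    rw [← e.src_eq, ← vtx_zero_eq_δ, ← h₂, app_vtx]
    refine congrArg (ψ.app _) (Subtype.ext (SSet.stdSimplex.ext _ _ fun i => ?_))
    obtain rfl : i = 0 := Subsingleton.elim (α := Fin 1) _ _
    rfl
  have hy : ∀ h, ψ.app _ ⟨stdVertex 1, h⟩ = y := fun h => by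
    rw [← e.tgt_eq, ← vtx_last_eq_δ, ← h₂, app_vtx]
    refine congrArg (ψ.app _) (Subtype.ext (SSet.stdSimplex.ext _ _ fun i => ?_))
    obtain rfl : i = 0 := Subsingleton.elim (α := Fin 1) _ _
    rfl
  have hz : ∀ h, ψ.app _ ⟨stdVertex (Fin.last 2), h⟩ = z := fun h => by
    rw [← e'.tgt_eq, ← vtx_last_eq_δ, ← h₀, app_vtx]
    refine congrArg (ψ.app _) (Subtype.ext (SSet.stdSimplex.ext _ _ fun i => ?_))
    obtain rfl : i = 0 := Subsingleton.elim (α := Fin 1) _ _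
    rfl
  let d := triangleData h₀ h₂ hx hy hz w hw
  have h0 := vertex_mem_horn (i := (1 : Fin 3)) (by decide) (by decide) (stdVertex.{u} 0)
  have hl := vertex_mem_horn (i := (1 : Fin 3)) (by decide) (by decide) (stdVertex.{u} (Fin.last 2))
  let s : Simp (underlying.obj X) vertexBase 2 _ _ :=
    ⟨d.simplex, d.vertexBase_vtx 0, d.vertexBase_vtx (Fin.last 2)⟩
  let t : Simp (underlying.obj X) vertexBase 2 (vertexBase x) (vertexBase z) :=
    ⟨d.simplex, (d.vertexBase_vtx 0).trans (congrArg vertexBase (hx h0)),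
      (d.vertexBase_vtx (Fin.last 2)).trans (congrArg vertexBase (hz hl))⟩
  refine ⟨t, ?_, ?_, ?_⟩
  · refine (tr_simpValue s t rfl (congrArg vertexBase (hx h0)) (congrArg vertexBase (hz hl))).symm.trans ?_
    refine (congrArg _ (d.simpValue_simplex _ _)).trans ?_
    exact (X.tr_tr _ _ _ _ _).trans (X.tr_rfl _ _ _)
  · exact (d.map_simplex (SSet.horn.face 1 0 (by decide))).trans h₀
  · exact (d.map_simplex (SSet.horn.face 1 2 (by decide))).trans h₂

/-- The value of a triangle has the pure tensor of its outer edges as comultiplication, and its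
inner face is the third edge. Conversely `triangleData` realises every such element. This turns
composition in the homotopy category into linear algebra in `X_1` and `X_2`. -/
lemma nonempty_compStruct_iff (e : SSet.Edge x y) (e' : SSet.Edge y z) (e'' : SSet.Edge x z) :
    Nonempty (SSet.Edge.CompStruct e e' e'') ↔ ∃ w : X.obj 2 (vertexBase x) (vertexBase z),
      X.comul 1 1 _ _ w = X.incl 1 1 _ _ (vertexBase y) (edgeValue e ⊗ₜ edgeValue e') ∧
        X.map (IntervalMap.ofOne 2) _ _ w = edgeValue e'' := by
  have hf : (IntervalMap.ofOne 2).toHom = SimplexCategory.δ 1 := by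
    ext i; fin_cases i <;> rfl
  have hfr : frontHom 1 1 = SimplexCategory.δ 2 := by
    ext i; fin_cases i <;> rfl
  have hba : backHom 1 1 = SimplexCategory.δ 0 := by
    ext i; fin_cases i <;> rfl
  constructor
  · rintro ⟨s⟩
    have h01 : (underlying.obj X).map (frontHom 1 1).op s.simplex = e.edge :=
      (congrArg (fun f : ⦋1⦌ ⟶ ⦋2⦌ => (underlying.obj X).map f.op s.simplex) hfr).trans s.d₂
    have h12 : (underlying.obj X).map (backHom 1 1).op s.simplex = e'.edge :=
      (congrArg (fun f : ⦋1⦌ ⟶ ⦋2⦌ => (underlying.obj X).map f.op s.simplex) hba).trans s.d₀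
    have h02 : (underlying.obj X).map (IntervalMap.ofOne 2).toHom.op s.simplex = e''.edge :=
      (congrArg (fun f : ⦋1⦌ ⟶ ⦋2⦌ => (underlying.obj X).map f.op s.simplex) hf).trans s.d₁
    have hv0 : vtx 0 s.simplex = vtx 0 e''.edge := by
      rw [← h02, vtx_map]
      exact congrArg (vtx · s.simplex) (IntervalMap.ofOne 2).map_zero.symm
    have hv2 : vtx (Fin.last 2) s.simplex = vtx (Fin.last 1) e''.edge := by
      rw [← h02, vtx_map]
      exact congrArg (vtx · s.simplex) (IntervalMap.ofOne 2).map_last.symm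
    let t : Simp (underlying.obj X) vertexBase 2 (vertexBase x) (vertexBase z) :=
      ⟨s.simplex, (congrArg vertexBase hv0).trans (edgeSimp e'').first,
        (congrArg vertexBase hv2).trans (edgeSimp e'').last⟩
    have hm : Simp.mid 1 1 t = vertexBase y := by
      refine Eq.trans ?_ (edgeSimp e).last
      change _ = vertexBase (vtx (Fin.last 1) e.edge)
      rw [← h01, vtx_map]
      rfl
    refine ⟨simpValue t, ?_, ?_⟩
    · refine (comul_simpValue' (m := 1) (n := 1) t hm).trans (congrArg _ (congrArg₂ _ ?_ ?_))
      · exact (congrArg simpValue (Simp.ext h01)).trans (edgeValue_eq e).symm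
      · exact (congrArg simpValue (Simp.ext h12)).trans (edgeValue_eq e').symm
    · rw [map_simpValue, edgeValue_eq]
      exact congrArg simpValue (Simp.ext h02)
  · rintro ⟨w, hw, hw'⟩
    obtain ⟨s, rfl, h0, h2⟩ := exists_simplex_two e e' w hw
    refine ⟨SSet.Edge.CompStruct.mk s.val h2 h0 ?_⟩
    rw [map_simpValue, edgeValue_eq] at hw'
    refine Eq.trans ?_ (congrArg Simp.val (simpValue_one_injective hw'))
    exact congrArg (fun f : ⦋1⦌ ⟶ ⦋2⦌ => (underlying.obj X).map f.op s.val) hf.symm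

end Horn

end Templicial

namespace Templicial

open TemplicialModule

/-! ### The linear structure on the homotopy category of `Ũ(X)` -/

section HoLinear

variable {k : Type u} [CommRing k] {X X' : TemplicialModule.{u} k}

namespace TemplicialModule

/-- The degeneracy `[2] ⟶ [1]` which collapses the last two elements. -/
def lastDegeneracy : IntervalMap 2 1 := (IntervalMap.id 1).add (IntervalMap.toZero 1)

/-- This is the counit axiom in degree `1 + 0`, pulled back along the identity plus a collapse. -/
lemma comul_lastDegeneracy {a b : X.base} (m : X.obj 1 a b) :
    X.comul 1 1 a b (X.map lastDegeneracy a b m) = X.incl 1 1 a b b (m ⊗ₜ X.deg 1 b) := by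
  refine (X.comul_map_of_incl (IntervalMap.id 1) (IntervalMap.toZero 1)
    (X.comul_right_zero m)).trans (congrArg _ ?_)
  rw [TensorProduct.map_tmul, map_id_apply]
  rfl

lemma map_ofOne_lastDegeneracy {a b : X.base} (m : X.obj 1 a b) :
    X.map (IntervalMap.ofOne 2) a b (X.map lastDegeneracy a b m) = m := by
  rw [map_comp_apply, Subsingleton.elim ((IntervalMap.ofOne 2).comp lastDegeneracy)
    (IntervalMap.id 1), map_id_apply]

variable (X)

/-- The elements of `X_1(a, b)` which are homotopic to zero. -/
noncomputable def nullHomotopic (a b : X.base) : Submodule k (X.obj 1 a b) :=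
  (LinearMap.ker (X.comul 1 1 a b)).map (X.map (IntervalMap.ofOne 2) a b)

variable {X}

end TemplicialModule

open TemplicialModule

variable {x y z : (underlying.obj X) _⦋0⦌} [SSet.Quasicategory (underlying.obj X)]

lemma edgeClass_surjective :
    Function.Surjective (edgeClass : SSet.Edge x y → ((⟨x⟩ : HoCat (underlying.obj X)) ⟶ ⟨y⟩)) :=
  SSet.Truncated.HomotopyCategory₂.homMk_surjective

lemma edgeClass_comp_eq_iff (e : SSet.Edge x y) (e' : SSet.Edge y z) (e'' : SSet.Edge x z) :
    edgeClass e ≫ edgeClass e' = edgeClass e'' ↔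
      ∃ w : X.obj 2 (vertexBase x) (vertexBase z),
        X.comul 1 1 _ _ w = X.incl 1 1 _ _ (vertexBase y) (edgeValue e ⊗ₜ edgeValue e') ∧
          X.map (IntervalMap.ofOne 2) _ _ w = edgeValue e'' :=
  SSet.Truncated.Edge.CompStruct.nonempty_iff.symm.trans (nonempty_compStruct_iff e e' e'')

lemma edgeClass_id (x : (underlying.obj X) _⦋0⦌) :
    edgeClass (SSet.Edge.id x) = 𝟙 (⟨x⟩ : HoCat (underlying.obj X)) := rfl

/-- The edges are homotopic when the composite of `e` with an identity is `e'`, that is, when some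
`w` has comultiplication `e ⊗ deg` and inner face `e'`. The degeneracy of `e` has the same
comultiplication and inner face `e`. Subtracting from it exchanges such elements `w` with elements
of the kernel of `μ_{1,1}` whose inner face is the difference of the values. -/
lemma edgeClass_eq_iff (e e' : SSet.Edge x y) :
    edgeClass e = edgeClass e' ↔
      edgeValue e - edgeValue e' ∈ X.nullHomotopic (vertexBase x) (vertexBase y) := by
  have h1 := edgeClass_comp_eq_iff e (SSet.Edge.id y) e'
  rw [edgeClass_id, Category.comp_id, edgeValue_id] at h1
  rw [h1]
  constructor
  · rintro ⟨w, hw, hw'⟩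
    refine ⟨X.map lastDegeneracy _ _ (edgeValue e) - w, ?_, ?_⟩
    · refine (map_sub _ _ _).trans ?_
      rw [comul_lastDegeneracy, hw, sub_self]
    · rw [map_sub, map_ofOne_lastDegeneracy, hw']
  · rintro ⟨w, hw, hw'⟩
    refine ⟨X.map lastDegeneracy _ _ (edgeValue e) - w, ?_, ?_⟩
    · refine (map_sub _ _ _).trans ?_
      rw [comul_lastDegeneracy, show X.comul 1 1 _ _ w = 0 from hw, sub_zero]
    · rw [map_sub, map_ofOne_lastDegeneracy, hw', sub_sub_cancel]

/-- The morphisms of the homotopy category as a quotient of `X_1`. -/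
noncomputable def classValue (f : (⟨x⟩ : HoCat (underlying.obj X)) ⟶ ⟨y⟩) :
    X.obj 1 (vertexBase x) (vertexBase y) ⧸ X.nullHomotopic (vertexBase x) (vertexBase y) :=
  Submodule.Quotient.mk (edgeValue (edgeClass_surjective f).choose)

lemma classValue_edgeClass (e : SSet.Edge x y) :
    classValue (edgeClass e) = Submodule.Quotient.mk (edgeValue e) :=
  (Submodule.Quotient.eq _).2
    ((edgeClass_eq_iff _ _).1 (edgeClass_surjective (edgeClass e)).choose_spec)

lemma classValue_bijective : Function.Bijective (classValue (X := X) (x := x) (y := y)) := by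
  constructor
  · intro f g h
    obtain ⟨e, rfl⟩ := edgeClass_surjective f
    obtain ⟨e', rfl⟩ := edgeClass_surjective g
    rw [classValue_edgeClass, classValue_edgeClass] at h
    exact (edgeClass_eq_iff _ _).2 ((Submodule.Quotient.eq _).1 h)
  · intro m
    obtain ⟨m, rfl⟩ := Submodule.Quotient.mk_surjective _ m
    obtain ⟨e, rfl⟩ := edgeValue_surjective m
    exact ⟨_, classValue_edgeClass e⟩

variable (x y) in
/-- The morphisms of the homotopy category as a quotient of `X_1`. -/
noncomputable def classEquiv : ((⟨x⟩ : HoCat (underlying.obj X)) ⟶ ⟨y⟩) ≃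
    X.obj 1 (vertexBase x) (vertexBase y) ⧸ X.nullHomotopic (vertexBase x) (vertexBase y) :=
  Equiv.ofBijective classValue classValue_bijective

/-- The additive structure on morphisms of the homotopy category. -/
noncomputable instance homAddCommGroup (x y : HoCat (underlying.obj X)) : AddCommGroup (x ⟶ y) :=
  (classEquiv x.pt y.pt).addCommGroup

/-- The linear structure on morphisms of the homotopy category. -/
noncomputable instance homModule (x y : HoCat (underlying.obj X)) : Module k (x ⟶ y) :=
  (classEquiv x.pt y.pt).module k

lemma edgeClass_add {e e₁ e₂ : SSet.Edge x y} (h : edgeValue e = edgeValue e₁ + edgeValue e₂) :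
    edgeClass e = edgeClass e₁ + edgeClass e₂ := by
  apply (classEquiv x y).injective
  refine Eq.trans ?_ ((classEquiv x y).apply_symm_apply _).symm
  change classValue _ = classValue _ + classValue _
  rw [classValue_edgeClass, classValue_edgeClass, classValue_edgeClass, h]
  rfl

lemma edgeClass_smul {r : k} {e e₁ : SSet.Edge x y} (h : edgeValue e = r • edgeValue e₁) :
    edgeClass e = r • edgeClass e₁ := by
  apply (classEquiv x y).injective
  refine Eq.trans ?_ ((classEquiv x y).apply_symm_apply _).symm
  change classValue _ = r • classValue _
  rw [classValue_edgeClass, classValue_edgeClass, h]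
  rfl

lemma exists_edgeClass_comp (e : SSet.Edge x y) (e' : SSet.Edge y z) :
    ∃ (w : X.obj 2 (vertexBase x) (vertexBase z)) (e'' : SSet.Edge x z),
      X.comul 1 1 _ _ w = X.incl 1 1 _ _ (vertexBase y) (edgeValue e ⊗ₜ edgeValue e') ∧
      X.map (IntervalMap.ofOne 2) _ _ w = edgeValue e'' ∧
        edgeClass e ≫ edgeClass e' = edgeClass e'' := by
  obtain ⟨e'', he⟩ := edgeClass_surjective (edgeClass e ≫ edgeClass e')
  obtain ⟨w, h1, h2⟩ := (edgeClass_comp_eq_iff e e' e'').1 he.symm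
  exact ⟨w, e'', h1, h2, he.symm⟩

/-- The homotopy category of `Ũ(X)` is preadditive. -/
noncomputable instance hoPreadditive : Preadditive (HoCat (underlying.obj X)) where
  homGroup := homAddCommGroup
  add_comp := by
    rintro ⟨x⟩ ⟨y⟩ ⟨z⟩ f f' g
    obtain ⟨e, rfl⟩ := edgeClass_surjective f
    obtain ⟨e', rfl⟩ := edgeClass_surjective f'
    obtain ⟨c, rfl⟩ := edgeClass_surjective g
    obtain ⟨s, hs⟩ := edgeValue_surjective (edgeValue e + edgeValue e')
    obtain ⟨w, d, h1, h2, h3⟩ := exists_edgeClass_comp e c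
    obtain ⟨w', d', h1', h2', h3'⟩ := exists_edgeClass_comp e' c
    obtain ⟨t, ht⟩ := edgeValue_surjective (edgeValue d + edgeValue d')
    rw [h3, h3', ← edgeClass_add hs, ← edgeClass_add ht]
    -- The sum of the two witnesses is a witness for the sum, because the comultiplication is
    -- additive and the tensor is additive in its first factor.
    refine (edgeClass_comp_eq_iff _ _ _).2 ⟨w + w', ?_, ?_⟩
    · refine (map_add _ _ _).trans ?_
      rw [h1, h1', hs, TensorProduct.add_tmul, map_add]
    · rw [map_add, h2, h2', ht]
  comp_add := by
    rintro ⟨x⟩ ⟨y⟩ ⟨z⟩ c f f'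
    obtain ⟨e, rfl⟩ := edgeClass_surjective f
    obtain ⟨e', rfl⟩ := edgeClass_surjective f'
    obtain ⟨c, rfl⟩ := edgeClass_surjective c
    obtain ⟨s, hs⟩ := edgeValue_surjective (edgeValue e + edgeValue e')
    obtain ⟨w, d, h1, h2, h3⟩ := exists_edgeClass_comp c e
    obtain ⟨w', d', h1', h2', h3'⟩ := exists_edgeClass_comp c e'
    obtain ⟨t, ht⟩ := edgeValue_surjective (edgeValue d + edgeValue d')
    rw [h3, h3', ← edgeClass_add hs, ← edgeClass_add ht]
    refine (edgeClass_comp_eq_iff _ _ _).2 ⟨w + w', ?_, ?_⟩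
    · refine (map_add _ _ _).trans ?_
      rw [h1, h1', hs, TensorProduct.tmul_add, map_add]
    · rw [map_add, h2, h2', ht]

/-- The homotopy category of `Ũ(X)` is linear. -/
noncomputable instance hoLinear : Linear k (HoCat (underlying.obj X)) where
  homModule := homModule
  smul_comp := by
    rintro ⟨x⟩ ⟨y⟩ ⟨z⟩ r f g
    obtain ⟨e, rfl⟩ := edgeClass_surjective f
    obtain ⟨c, rfl⟩ := edgeClass_surjective g
    obtain ⟨s, hs⟩ := edgeValue_surjective (r • edgeValue e)
    obtain ⟨w, d, h1, h2, h3⟩ := exists_edgeClass_comp e c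
    obtain ⟨t, ht⟩ := edgeValue_surjective (r • edgeValue d)
    rw [h3, ← edgeClass_smul hs, ← edgeClass_smul ht]
    -- A multiple of a witness is a witness for the multiple.
    refine (edgeClass_comp_eq_iff _ _ _).2 ⟨r • w, ?_, ?_⟩
    · refine (map_smul _ _ _).trans ?_
      rw [h1, hs, ← TensorProduct.smul_tmul', map_smul]
    · rw [map_smul, h2, ht]
  comp_smul := by
    rintro ⟨x⟩ ⟨y⟩ ⟨z⟩ f r g
    obtain ⟨e, rfl⟩ := edgeClass_surjective g
    obtain ⟨c, rfl⟩ := edgeClass_surjective f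
    obtain ⟨s, hs⟩ := edgeValue_surjective (r • edgeValue e)
    obtain ⟨w, d, h1, h2, h3⟩ := exists_edgeClass_comp c e
    obtain ⟨t, ht⟩ := edgeValue_surjective (r • edgeValue d)
    rw [h3, ← edgeClass_smul hs, ← edgeClass_smul ht]
    refine (edgeClass_comp_eq_iff _ _ _).2 ⟨r • w, ?_, ?_⟩
    · refine (map_smul _ _ _).trans ?_
      rw [h1, hs, TensorProduct.tmul_smul, map_smul]
    · rw [map_smul, h2, ht]

variable [SSet.Quasicategory (underlying.obj X')]

lemma hoMap_additive (φ : X ⟶ X') : (hoMap (underlying.map φ)).Additive where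
  map_add := by
    rintro ⟨x⟩ ⟨y⟩ f f'
    obtain ⟨e, rfl⟩ := edgeClass_surjective f
    obtain ⟨e', rfl⟩ := edgeClass_surjective f'
    obtain ⟨s, hs⟩ := edgeValue_surjective (edgeValue e + edgeValue e')
    rw [← edgeClass_add hs]
    refine edgeClass_add (e := s.map (underlying.map φ)) (e₁ := e.map (underlying.map φ))
      (e₂ := e'.map (underlying.map φ)) ?_
    exact (edgeValue_map φ s).trans ((congrArg _ hs).trans ((map_add _ _ _).trans
      (congrArg₂ _ (edgeValue_map φ e).symm (edgeValue_map φ e').symm)))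

lemma hoMap_linear (φ : X ⟶ X') : (hoMap (underlying.map φ)).Linear k where
  map_smul := by
    rintro ⟨x⟩ ⟨y⟩ f r
    obtain ⟨e, rfl⟩ := edgeClass_surjective f
    obtain ⟨s, hs⟩ := edgeValue_surjective (r • edgeValue e)
    rw [← edgeClass_smul hs]
    refine edgeClass_smul (e := s.map (underlying.map φ)) (e₁ := e.map (underlying.map φ)) ?_
    exact (edgeValue_map φ s).trans ((congrArg _ hs).trans ((map_smul _ _ _).trans
      (congrArg _ (edgeValue_map φ e).symm)))

/-- The linear structure on the homotopy categories of linear quasi-categories. -/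
noncomputable def linearHomotopyStructure (hU : UnderlyingPreserves.{u} k) :
    LinearHomotopyStructure hU where
  preadditive X :=
    haveI := hU X.obj X.property
    hoPreadditive (X := X.obj)
  linear X :=
    haveI := hU X.obj X.property
    hoLinear (X := X.obj)
  class_add X _ _ _ _ _ h :=
    haveI := hU X.obj X.property
    edgeClass_add (X := X.obj) h
  class_smul X _ _ _ _ _ h :=
    haveI := hU X.obj X.property
    edgeClass_smul (X := X.obj) h
  map_additive {X Y} φ :=
    haveI := hU X.obj X.property
    haveI := hU Y.obj Y.property
    hoMap_additive (X := X.obj) (X' := Y.obj) φ.hom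
  map_linear {X Y} φ :=
    haveI := hU X.obj X.property
    haveI := hU Y.obj Y.property
    hoMap_linear (X := X.obj) (X' := Y.obj) φ.hom

end HoLinear

end Templicial

namespace Templicial

/-! ### Inner faces and degeneracies of intervals. -/

namespace IntervalMap

/-- The inner face which omits `r`. -/
def face (N r : ℕ) (h0 : 0 < r) (h : r ≤ N) : IntervalMap N (N + 1) where
  toOrderHom := ⟨fun i => ⟨if i.1 < r then i.1 else i.1 + 1, by split_ifs <;> omega⟩,
    fun i j hij => by
      have hij' : i.1 ≤ j.1 := hij
      simp only [Fin.le_def]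
      split_ifs <;> omega⟩
  map_zero := Fin.ext (if_pos h0)
  map_last := Fin.ext (if_neg (Nat.not_lt_of_le h))

lemma face_val {N r : ℕ} (h0 : 0 < r) (h : r ≤ N) (i : Fin (N + 1)) :
    ((face N r h0 h).toOrderHom i).1 = if i.1 < r then i.1 else i.1 + 1 := rfl

/-- The degeneracy which identifies `t` and `t + 1`. -/
def degen (N t : ℕ) (h : t ≤ N) : IntervalMap (N + 1) N where
  toOrderHom := ⟨fun i => ⟨if i.1 ≤ t then i.1 else i.1 - 1, by split_ifs <;> omega⟩,
    fun i j hij => by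
      have hij' : i.1 ≤ j.1 := hij
      simp only [Fin.le_def]
      split_ifs <;> omega⟩
  map_zero := Fin.ext (if_pos (e := 0 - 1) (Nat.zero_le t))
  map_last := Fin.ext (if_neg (Nat.not_le_of_lt (Nat.lt_succ_of_le h)))

lemma degen_val {N t : ℕ} (h : t ≤ N) (i : Fin (N + 1 + 1)) :
    ((degen N t h).toOrderHom i).1 = if i.1 ≤ t then i.1 else i.1 - 1 := rfl

/-- A map which misses `r` factors through the face omitting `r`. The degeneracy identifying `r` and
`r + 1` loses nothing on its image, and so provides the factorization. -/
lemma comp_degen_comp_face {m N r : ℕ} (h0 : 0 < r) (h : r ≤ N) (f : IntervalMap m (N + 1))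
    (hf : ∀ i, (f.toOrderHom i).1 ≠ r) : (f.comp (degen N r h)).comp (face N r h0 h) = f := by
  refine ext_val fun i => ?_
  have := hf i
  rw [comp_val, face_val, comp_val, degen_val]
  split_ifs <;> omega

lemma face_comp_degen {N r t : ℕ} (h0 : 0 < r) (h : r ≤ N) (ht : t ≤ N) (hrt : t = r ∨ t + 1 = r) :
    (face N r h0 h).comp (degen N t ht) = id N := by
  refine ext_val fun i => ?_
  rw [comp_val, degen_val, face_val]
  change _ = i.1
  split_ifs <;> omega

end IntervalMap

namespace TemplicialModule

/-! ### Correcting faces without changing comultiplications. -/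

section Moore

variable {k : Type u} [CommRing k] (X : TemplicialModule.{u} k)

open Classical in
/-- The comultiplication on `X_n`, for `p + q = n`. -/
noncomputable def cut {n : ℕ} (p q : ℕ) (h : p + q = n) (a b : X.base) :
    X.obj n a b →ₗ[k] ⨁ c : X.base, (X.obj p a c ⊗[k] X.obj q c b) :=
  X.comul p q a b ∘ₗ X.map (IntervalMap.cast h) a b

lemma cut_apply {n : ℕ} {p q : ℕ} (h : p + q = n) {a b : X.base} (x : X.obj n a b) :
    X.cut p q h a b x = X.comul p q a b (X.map (IntervalMap.cast h) a b x) := rfl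

lemma cut_rfl {p q : ℕ} {a b : X.base} (x : X.obj (p + q) a b) :
    X.cut p q rfl a b x = X.comul p q a b x := congrArg _ (X.map_cast_rfl _ _)

lemma cut_coassoc {l m q r s n : ℕ} (h₁ : l + m = s) (h₂ : s + q = n) (h₃ : m + q = r)
    (h₄ : l + r = n) {a b : X.base} (x : X.obj n a b) (c d : X.base) :
    TensorProduct.assoc k _ _ _
      (LinearMap.rTensor (X.obj q d b) (DirectSum.component k X.base _ c ∘ₗ X.cut l m h₁ a d)
        (X.cut s q h₂ a b x d)) =
    LinearMap.lTensor (X.obj l a c) (DirectSum.component k X.base _ d ∘ₗ X.cut m q h₃ c b)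
      (X.cut l r h₄ a b x c) := by
  subst h₁ h₃ h₄
  have h1 : X.cut l m rfl a d = X.comul l m a d := LinearMap.ext fun x => X.cut_rfl x
  have h2 : X.cut m q rfl c b = X.comul m q c b := LinearMap.ext fun x => X.cut_rfl x
  rw [h1, h2, cut_rfl]
  exact X.coassoc l m q a b c d x

/-- Cutting the image of `x` under `f` at `p` amounts to cutting `x` at the image of `p`, by
`IntervalMap.exists_split` and naturality. -/
lemma exists_cut_map {m n : ℕ} (f : IntervalMap m n) {p q : ℕ} (h : p + q = m) {a b : X.base}
    (x : X.obj n a b) : ∃ (i j : ℕ) (h' : i + j = n) (f₁ : IntervalMap p i) (f₂ : IntervalMap q j),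
      i = (f.toOrderHom ⟨p, by omega⟩).1 ∧ ∀ c, X.cut p q h a b (X.map f a b x) c =
        TensorProduct.map (X.map f₁ a c) (X.map f₂ c b) (X.cut i j h' a b x c) := by
  subst h
  obtain ⟨i, j, h, f₁, f₂, hf, hi⟩ := f.exists_split
  refine ⟨i, j, h, f₁, f₂, hi, fun c => ?_⟩
  rw [cut_rfl, cut_apply, ← X.comul_natural, map_comp_apply, ← hf]

/-- The elements whose comultiplications all vanish. -/
noncomputable def comulKer (n : ℕ) (a b : X.base) : Submodule k (X.obj n a b) :=
  ⨅ (p : ℕ) (q : ℕ) (h : p + q = n) (_ : 0 < p) (_ : 0 < q), LinearMap.ker (X.cut p q h a b)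

lemma mem_comulKer {n : ℕ} {a b : X.base} {x : X.obj n a b} :
    x ∈ X.comulKer n a b ↔ ∀ p q (h : p + q = n), 0 < p → 0 < q → X.cut p q h a b x = 0 := by
  simp only [comulKer, Submodule.mem_iInf, LinearMap.mem_ker]

/-- When `f` sends interior points to interior points, every proper cut of the image of `x` comes
from a proper cut of `x`. -/
lemma map_mem_comulKer {m n : ℕ} (f : IntervalMap m n)
    (hf : ∀ i, 0 < i.1 → i.1 < m → 0 < (f.toOrderHom i).1 ∧ (f.toOrderHom i).1 < n) {a b : X.base}
    {x : X.obj n a b} (hx : x ∈ X.comulKer n a b) : X.map f a b x ∈ X.comulKer m a b := by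
  rw [mem_comulKer] at hx ⊢
  intro p q h hp hq
  obtain ⟨i, j, h', f₁, f₂, hi, hc⟩ := X.exists_cut_map f h x
  have := hf ⟨p, by omega⟩ hp (by simp only; omega)
  refine DFinsupp.ext fun c => ?_
  rw [hc, hx i j h' (by omega) (by omega)]
  exact map_zero _

lemma map_face_mem_comulKer {N r : ℕ} (h0 : 0 < r) (h : r ≤ N) {a b : X.base}
    {x : X.obj (N + 1) a b} (hx : x ∈ X.comulKer (N + 1) a b) :
    X.map (IntervalMap.face N r h0 h) a b x ∈ X.comulKer N a b :=
  X.map_mem_comulKer _ (fun i _ _ => by rw [IntervalMap.face_val]; split_ifs <;> omega) hx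

/-- The degeneracies at `0` and at `N` have to be excluded, since they send an interior point to an
end point. -/
lemma map_degen_mem_comulKer {N t : ℕ} (h0 : 0 < t) (h : t < N) {a b : X.base}
    {x : X.obj N a b} (hx : x ∈ X.comulKer N a b) :
    X.map (IntervalMap.degen N t h.le) a b x ∈ X.comulKer (N + 1) a b :=
  X.map_mem_comulKer _ (fun i _ _ => by rw [IntervalMap.degen_val]; split_ifs <;> omega) hx

/-- Writing `d` for the face `r`, the corrected quantity is `y - d w = (y - d w₀) - d (w - w₀)`. It
has vanishing proper comultiplications, and so does its interior degeneracy. The correction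
therefore keeps the comultiplications of `w₀`. -/
lemma update_mem_comulKer {N r t : ℕ} {a b : X.base} (hr : 0 < r) (hr' : r ≤ N) (ht : 0 < t)
    (ht' : t < N) {w w₀ : X.obj (N + 1) a b} {y : X.obj N a b}
    (hw : w - w₀ ∈ X.comulKer (N + 1) a b)
    (hw₀ : y - X.map (IntervalMap.face N r hr hr') a b w₀ ∈ X.comulKer N a b) :
    w + X.map (IntervalMap.degen N t ht'.le) a b
      (y - X.map (IntervalMap.face N r hr hr') a b w) - w₀ ∈ X.comulKer (N + 1) a b := by
  have h1 := X.map_face_mem_comulKer hr hr' hw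
  have h2 := X.map_degen_mem_comulKer ht ht' (Submodule.sub_mem _ hw₀ h1)
  rw [map_sub (X.map (IntervalMap.face N r hr hr') a b), sub_sub_sub_cancel_right] at h2
  have h3 := Submodule.add_mem _ hw h2
  rwa [sub_add_eq_add_sub] at h3

variable {X}

/-- Elements which agree where they would have to if they were the inner faces, except for the
face `j`, of an element of `X_{N + 1}`. -/
def FaceCompatible {N j : ℕ} {a b : X.base} (y : ∀ r, 0 < r → r ≤ N → r ≠ j → X.obj N a b) :
    Prop :=
  ∀ (m : ℕ) (f g : IntervalMap m N) (r s : ℕ) (hr : 0 < r) (hr' : r ≤ N) (hrj : r ≠ j)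
    (hs : 0 < s) (hs' : s ≤ N) (hsj : s ≠ j),
    f.comp (IntervalMap.face N r hr hr') = g.comp (IntervalMap.face N s hs hs') →
      X.map f a b (y r hr hr' hrj) = X.map g a b (y s hs hs' hsj)

section

variable {N j : ℕ} {a b : X.base} {y : ∀ r, 0 < r → r ≤ N → r ≠ j → X.obj N a b}

/-- Correcting the face `r`, without changing the faces which already agree. -/
lemma map_face_update (hy : FaceCompatible y) {r t s : ℕ} (hr : 0 < r) (hr' : r ≤ N) (hrj : r ≠ j) (ht : t ≤ N)
    (hs : 0 < s) (hs' : s ≤ N) (hsj : s ≠ j) (h : (t = r ∧ s ≠ r + 1) ∨ (t + 1 = r ∧ s ≠ t))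
    {w : X.obj (N + 1) a b}
    (hw : s = r ∨ X.map (IntervalMap.face N s hs hs') a b w = y s hs hs' hsj) :
    X.map (IntervalMap.face N s hs hs') a b (w + X.map (IntervalMap.degen N t ht) a b
      (y r hr hr' hrj - X.map (IntervalMap.face N r hr hr') a b w)) = y s hs hs' hsj := by
  rw [map_add, map_comp_apply]
  by_cases hsr : s = r
  · subst hsr
    rw [IntervalMap.face_comp_degen _ _ _ (by omega), map_id_apply]
    abel
  · replace hw := hw.resolve_left hsr
    -- The face `s` of the correction involves the operator face `s`, degeneracy `t`, face `r`,
    -- which still omits `s` and hence factors through the face `s`. As `w` already has the right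
    -- face `s`, compatibility of `y` makes this part of the correction vanish.
    have key := IntervalMap.comp_degen_comp_face hs hs' (((IntervalMap.face N s hs hs').comp
      (IntervalMap.degen N t ht)).comp (IntervalMap.face N r hr hr')) (fun i => by
        rw [IntervalMap.comp_val, IntervalMap.face_val, IntervalMap.comp_val,
          IntervalMap.degen_val, IntervalMap.face_val]
        split_ifs <;> omega)
    rw [map_sub, hy _ _ _ r s hr hr' hrj hs hs' hsj key.symm, ← hw, map_comp_apply, map_comp_apply,
      key, sub_self, add_zero]

/-- A simplex with the right comultiplications can be corrected to have the right faces. -/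
lemma exists_faces (hy : FaceCompatible y) (hj : 0 < j) (hjN : j ≤ N) (w₀ : X.obj (N + 1) a b)
    (hw₀ : ∀ r hr hr' hrj, y r hr hr' hrj - X.map (IntervalMap.face N r hr hr') a b w₀ ∈
      X.comulKer N a b) :
    ∃ w, w - w₀ ∈ X.comulKer (N + 1) a b ∧
      ∀ r hr hr' hrj, X.map (IntervalMap.face N r hr hr') a b w = y r hr hr' hrj := by
  -- The faces below `j` are corrected in increasing order, the face `r` with the degeneracy `t =
  -- r`.
  have h1 : ∀ R, R ≤ j → ∃ w, w - w₀ ∈ X.comulKer (N + 1) a b ∧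
      ∀ r hr hr' hrj, r < R → X.map (IntervalMap.face N r hr hr') a b w = y r hr hr' hrj := by
    intro R
    induction R with
    | zero => exact fun _ => ⟨w₀, by simp, fun r _ _ _ h => absurd h (Nat.not_lt_zero r)⟩
    | succ R ih =>
      intro hR
      obtain ⟨w, hw, hw'⟩ := ih (by omega)
      by_cases hR0 : R = 0
      · exact ⟨w, hw, fun r hr _ _ h => by omega⟩
      refine ⟨_, update_mem_comulKer X (r := R) (t := R) (by omega) (by omega)
        (by omega) (by omega) hw (hw₀ _ _ _ (by omega)), fun r hr hr' hrj hlt => ?_⟩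
      refine map_face_update hy _ _ _ _ hr hr' hrj (by omega) ?_
      rcases Nat.lt_succ_iff_lt_or_eq.1 hlt with h | h
      · exact Or.inr (hw' r hr hr' hrj h)
      · exact Or.inl h
  -- The faces above `j` are corrected in decreasing order, the face `r` with the degeneracy `t = r
  -- - 1`. As `t ≥ j`, it differs from every face already corrected on either side.
  have h2 : ∀ R, R + j ≤ N → ∃ w, w - w₀ ∈ X.comulKer (N + 1) a b ∧
      ∀ r hr hr' hrj, (r < j ∨ N < r + R) →
        X.map (IntervalMap.face N r hr hr') a b w = y r hr hr' hrj := by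
    intro R
    induction R with
    | zero =>
      intro _
      obtain ⟨w, hw, hw'⟩ := h1 j le_rfl
      exact ⟨w, hw, fun r hr hr' hrj h => hw' r hr hr' hrj (by omega)⟩
    | succ R ih =>
      intro hR
      obtain ⟨w, hw, hw'⟩ := ih (by omega)
      refine ⟨_, update_mem_comulKer X (r := N - R) (t := N - R - 1) (by omega)
        (by omega) (by omega) (by omega) hw (hw₀ _ _ _ (by omega)), fun r hr hr' hrj hlt => ?_⟩
      refine map_face_update hy _ _ _ _ hr hr' hrj (by omega) ?_
      by_cases h : r = N - R
      · exact Or.inl h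
      · exact Or.inr (hw' r hr hr' hrj (by omega))
  obtain ⟨w, hw, hw'⟩ := h2 (N - j) (by omega)
  exact ⟨w, hw, fun r hr hr' hrj => hw' r hr hr' hrj (by omega)⟩

end

end Moore

end TemplicialModule

end Templicial

namespace Templicial

open TemplicialModule

namespace TemplicialModule

/-! ### Elements with prescribed comultiplications. -/

section Wedge

variable {k : Type u} [CommRing k] (X : TemplicialModule.{u} k)

open Classical in
/-- The comultiplications have sections which preserve the vanishing of the comultiplications
which cut further to the left. -/
def HasSections : Prop :=
  ∀ (p q : ℕ) (a b : X.base), 0 < p → 0 < q →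
    ∃ G : (⨁ c : X.base, (X.obj p a c ⊗[k] X.obj q c b)) → X.obj (p + q) a b,
      (∀ t, X.comul p q a b (G t) = t) ∧
      ∀ (l m r : ℕ) (h : l + m = p) (h' : l + r = p + q) (t : _), 0 < l → 0 < m →
        (∀ c d, LinearMap.rTensor (X.obj q d b) (DirectSum.component k X.base _ c ∘ₗ
          X.cut l m h a d) (t d) = 0) → X.cut l r h' a b (G t) = 0

variable {X}

/-- Filling wedges. -/
lemma HasSections.exists_wedge (hX : X.HasSections) {n : ℕ} {a b : X.base}
    (c : Fin (n + 1) → X.base)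
    (F : ∀ p (h : p < n), X.obj p a (c ⟨p, by omega⟩))
    (B : ∀ p q (h : p + q = n), 0 < p → X.obj q (c ⟨p, by omega⟩) b)
    (M : ∀ l m s (_ : l + m = s) (_ : s < n), 0 < l → X.obj m (c ⟨l, by omega⟩) (c ⟨s, by omega⟩))
    (hF : ∀ l m s (h : l + m = s) (h' : s < n) (hl : 0 < l), 0 < m → X.cut l m h _ _ (F s h') =
      X.incl l m _ _ _ (F l (by omega) ⊗ₜ M l m s h h' hl))
    (hB : ∀ l m q r s (h : m + q = r) (h' : l + r = n) (h'' : l + m = s) (hl : 0 < l), 0 < m →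
      ∀ (_ : 0 < q), X.cut m q h _ _ (B l r h' hl) = X.incl m q _ _ _
        (M l m s h'' (by omega) hl ⊗ₜ B s q (by omega) (by omega))) :
    ∃ w : X.obj n a b, ∀ p q (h : p + q = n) (hp : 0 < p) (_ : 0 < q),
      X.cut p q h a b w = X.incl p q _ _ _ (F p (by omega) ⊗ₜ B p q h hp) := by
  -- The cuts are made right from left to right; at stage `K` all cuts at `p ≤ K` are correct.
  have key : ∀ K, ∃ w : X.obj n a b, ∀ p q (h : p + q = n) (hp : 0 < p) (_ : 0 < q), p ≤ K →
      X.cut p q h a b w = X.incl p q _ _ _ (F p (by omega) ⊗ₜ B p q h hp) := by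
    intro K
    induction K with
    | zero => exact ⟨0, fun p q h hp _ hpK => by omega⟩
    | succ K ih =>
      obtain ⟨w, hw⟩ := ih
      by_cases hK : K + 1 < n
      · obtain ⟨q, rfl⟩ : ∃ q, n = K + 1 + q := ⟨n - (K + 1), by omega⟩
        obtain ⟨G, hG, hG'⟩ := hX (K + 1) q a b (by omega) (by omega)
        -- The error at the cut `K + 1`. Its first factor has vanishing cuts at every `p ≤ K`, so by
        -- the second property of the section `G` adding `G t` leaves those cuts unchanged.
        set t := X.incl (K + 1) q a b _ (F (K + 1) hK ⊗ₜ B (K + 1) q rfl (by omega)) -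
          X.comul (K + 1) q a b w with ht
        refine ⟨w + G t, fun p r h hp hr hpK => ?_⟩
        rw [map_add]
        rcases Nat.le_succ_iff_eq_or_le.1 hpK with e | hpK
        · subst e
          obtain rfl : r = q := by omega
          rw [cut_rfl, cut_rfl, hG, ht]
          abel
        · obtain ⟨m, hm⟩ : ∃ m, K + 1 = p + m := ⟨K + 1 - p, by omega⟩
          have hF' := hF p m (K + 1) hm.symm hK hp (by omega)
          have hB' := hB p m q r (K + 1) (by omega) h hm.symm hp (by omega) (by omega)
          rw [hw p r h hp hr hpK, hG' p m r hm.symm h t hp (by omega), add_zero]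
          intro c' d
          -- Coassociativity replaces cutting `w` at `K + 1` and then at `p` by cutting it at `p`,
          -- where it is already correct, and then cutting the second part. `hB'` evaluates the
          -- latter and `hF'` the cut of the prescribed tensor.
          have h2 := X.cut_coassoc hm.symm rfl (show m + q = r by omega) h w c' d
          rw [hw p r h hp hr hpK] at h2
          apply (TensorProduct.assoc k _ _ _).injective
          rw [ht, map_zero, DFinsupp.sub_apply, map_sub, map_sub, ← cut_rfl, h2]
          by_cases hd : c ⟨K + 1, by omega⟩ = d
          · subst hd
            rw [incl_same, LinearMap.rTensor_tmul, LinearMap.comp_apply, hF',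
              ← DirectSum.apply_eq_component]
            by_cases hc : c ⟨p, by omega⟩ = c'
            · subst hc
              rw [incl_same, incl_same, LinearMap.lTensor_tmul, LinearMap.comp_apply, hB',
                ← DirectSum.apply_eq_component, incl_same, TensorProduct.assoc_tmul, sub_self]
            · rw [incl_ne _ _ hc, incl_ne _ _ hc, TensorProduct.zero_tmul, map_zero, map_zero,
                sub_self]
          · rw [incl_ne _ _ hd, map_zero, map_zero, zero_sub, neg_eq_zero]
            by_cases hc : c ⟨p, by omega⟩ = c'
            · subst hc
              rw [incl_same, LinearMap.lTensor_tmul, LinearMap.comp_apply, hB',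
                ← DirectSum.apply_eq_component, incl_ne _ _ hd, TensorProduct.tmul_zero]
            · rw [incl_ne _ _ hc, map_zero]
      · exact ⟨w, fun p q h hp hq _ => hw p q h hp hq (by omega)⟩
  obtain ⟨w, hw⟩ := key n
  exact ⟨w, fun p q h hp hq => hw p q h hp hq (by omega)⟩

end Wedge

end TemplicialModule

/-! ### Filling inner horns in modules with sections. -/

section Criterion

variable {k : Type u} [CommRing k] {X : TemplicialModule.{u} k} {Y : SSet.{u}}

/-- The data of a given morphism `F̃(Y) ⟶ X`. -/
noncomputable def freeHomDataOfHom (φ : (freeTemplicial k).obj Y ⟶ X) : FreeHomData Y X where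
  base v := Hom.base φ v
  val y := Hom.app φ _ _ _ (freeGen k y)
  map_val f _ _ y := (Hom.naturality φ f _ _ _).symm.trans
    (congrArg (Hom.app φ _ _ _) (map_freeGen f y))
  comul_val y := comul_app_freeGen φ y rfl
  counit_val y := (Hom.counit_app φ _ _).trans (counit_freeGen y)

lemma freeHomDataOfHom_toHom (φ : (freeTemplicial k).obj Y ⟶ X) :
    (freeHomDataOfHom φ).toHom = φ :=
  freeHom_ext (fun _ => rfl) fun _ _ _ y => (freeHomDataOfHom φ).toHom_app _ _ _ y

lemma FreeHomData.cut_val (D : FreeHomData Y X) {n p q : ℕ} (h : p + q = n) {a b c : Y _⦋0⦌}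
    (y : Simp Y (fun y => y) n a b) (y₁ : Simp Y (fun y => y) p a c)
    (y₂ : Simp Y (fun y => y) q c b)
    (h₁ : Y.map (frontHom p q).op (Y.map (IntervalMap.cast h).toHom.op y.val) = y₁.val)
    (h₂ : Y.map (backHom p q).op (Y.map (IntervalMap.cast h).toHom.op y.val) = y₂.val) :
    X.cut p q h _ _ (D.val y) = X.incl p q _ _ (D.base c) (D.val y₁ ⊗ₜ D.val y₂) := by
  have hm : (y.map (IntervalMap.cast h)).mid = c := by
    refine Eq.trans ?_ y₁.last
    rw [← h₁, vtx_map]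
    rfl
  subst hm
  rw [cut_apply, D.map_val]
  refine (D.comul_val _).trans (congrArg _ (congrArg₂ _ (congrArg D.val (Simp.ext h₁))
    (congrArg D.val (Simp.ext h₂))))

/-- The simplex of `Δ[n]` with vertices `i, …, j`. -/
def segment {n : ℕ} (i m j : ℕ) (h : i + m = j) (hj : j < n + 1) :
    Simp (Δ[n] : SSet.{u}) (fun y => y) m (stdVertex ⟨i, by omega⟩) (stdVertex ⟨j, hj⟩) where
  val := SSet.stdSimplex.objEquiv.symm (SimplexCategory.Hom.mk
    ⟨fun r : Fin (m + 1) => (⟨i + r.1, by omega⟩ : Fin (n + 1)), fun r s hrs => by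
      have hrs' : r.1 ≤ s.1 := hrs
      simp only [Fin.mk_le_mk]; omega⟩)
  first := by
    refine SSet.stdSimplex.ext _ _ fun r => ?_
    rfl
  last := by
    subst h
    refine SSet.stdSimplex.ext _ _ fun r => ?_
    rfl

/-- The simplex of `Λ[n, j]` with vertices `r, …, s`. -/
def hornSegment {n : ℕ} {j : Fin (n + 1)} (h0 : 0 < j) (hn : j < Fin.last n) (r m s : ℕ)
    (h : r + m = s) (hs : s < n + 1) (hrs : ¬ (r = 0 ∧ s = n)) :
    Simp (Λ[n, j] : SSet.{u}) (fun y => y) m ⟨stdVertex ⟨r, by omega⟩, vertex_mem_horn h0 hn _⟩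
      ⟨stdVertex ⟨s, hs⟩, vertex_mem_horn h0 hn _⟩ :=
  (segment r m s h hs).restrict (mem_horn_of_endpoints h0 hn _ fun e => hrs
    ⟨congrArg Fin.val (stdVertex_injective e.1), congrArg Fin.val (stdVertex_injective e.2)⟩) _ _

lemma cut_hornSegment {n : ℕ} {j : Fin (n + 1)} (h0 : 0 < j) (hn : j < Fin.last n)
    (D : FreeHomData (Λ[n, j] : SSet.{u}) X) {r s t m p q : ℕ} (h : r + m = t) (ht : t < n + 1)
    (hrt : ¬ (r = 0 ∧ t = n)) (h' : p + q = m) (hs : r + p = s) (hrs hst) :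
    X.cut p q h' _ _ (D.val (hornSegment h0 hn r m t h ht hrt)) = X.incl p q _ _ _
      (D.val (hornSegment h0 hn r p s hs (by omega) hrs) ⊗ₜ
        D.val (hornSegment h0 hn s q t (by omega) ht hst)) := by
  refine D.cut_val h' _ _ _ (Subtype.ext (SSet.stdSimplex.ext _ _ fun i => Fin.ext ?_))
    (Subtype.ext (SSet.stdSimplex.ext _ _ fun i => Fin.ext ?_))
  · rfl
  · change r + (p + i.1) = s + i.1
    omega

/-- The face of `Δ[N + 1]` opposite to `r`, as a simplex of `Λ[N + 1, j]`. -/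
def hornFace {N : ℕ} {j : Fin (N + 2)} (h0 : 0 < j) (hn : j < Fin.last (N + 1)) (r : ℕ)
    (hr : 0 < r) (hr' : r ≤ N) (hrj : r ≠ j.1) :
    Simp (Λ[N + 1, j] : SSet.{u}) (fun y => y) N ⟨stdVertex 0, vertex_mem_horn h0 hn _⟩
      ⟨stdVertex (Fin.last _), vertex_mem_horn h0 hn _⟩ :=
  ((stdTop (N + 1)).map (IntervalMap.face N r hr hr')).restrict (by
    refine (SSet.mem_horn_iff_notMem_range _ _).2 ⟨⟨r, by omega⟩, fun e => hrj
      (congrArg Fin.val e), ?_⟩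
    rintro ⟨i, hi⟩
    have hi' : ((IntervalMap.face N r hr hr').toOrderHom i).1 = r := congrArg Fin.val hi
    rw [IntervalMap.face_val] at hi'
    split_ifs at hi' <;> omega) _ _

variable {N : ℕ} {j : Fin (N + 2)}

/-- Both sides are the value of `D` on one and the same simplex of the horn. -/
lemma faceCompatible_hornFace (h0 : 0 < j) (hn : j < Fin.last (N + 1))
    (D : FreeHomData (Λ[N + 1, j] : SSet.{u}) X) :
    FaceCompatible (j := j.1) fun r hr hr' hrj => D.val (hornFace h0 hn r hr hr' hrj) := by
  intro m f g r s hr hr' hrj hs hs' hsj h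
  refine (D.map_val f _).trans (Eq.trans (congrArg D.val (Simp.ext (Subtype.ext ?_)))
    (D.map_val g _).symm)
  exact congrArg (fun f => ((stdTop (N + 1)).map f).val) h

lemma TemplicialModule.cut_map_of_incl (X : TemplicialModule.{u} k) {m n p q i i' : ℕ} (h : p + q = m)
    (hi : i + i' = n) {f : IntervalMap m n} {f₁ : IntervalMap p i} {f₂ : IntervalMap q i'}
    (hf : (IntervalMap.cast h).comp f = (f₁.add f₂).comp (IntervalMap.cast hi))
    {a b c : X.base} {x : X.obj n a b} {t} (hx : X.cut i i' hi a b x = X.incl i i' a b c t) :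
    X.cut p q h a b (X.map f a b x) =
      X.incl p q a b c (TensorProduct.map (X.map f₁ a c) (X.map f₂ c b) t) := by
  rw [cut_apply X h (X.map _ _ _ x), map_comp_apply, hf, ← map_comp_apply]
  exact X.comul_map_of_incl f₁ f₂ hx

/-- The segments of the horn prescribe the comultiplications, and `exists_wedge` realises them by
some `w₀` with uncontrolled faces. `exists_faces` then adjusts the inner faces other than `j` by an
element with vanishing comultiplications. -/
lemma exists_top (hX : X.HasSections) (h0 : 0 < j) (hn : j < Fin.last (N + 1))
    (D : FreeHomData (Λ[N + 1, j] : SSet.{u}) X) :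
    ∃ w : X.obj (N + 1) (D.base ⟨stdVertex 0, vertex_mem_horn h0 hn _⟩)
        (D.base ⟨stdVertex (Fin.last _), vertex_mem_horn h0 hn _⟩),
      (∀ p q (h : p + q = N + 1) (_ : 0 < p) (_ : 0 < q), X.cut p q h _ _ w = X.incl p q _ _ _
        (D.val (hornSegment h0 hn 0 p p (by omega) (by omega) (by omega)) ⊗ₜ
          D.val (hornSegment h0 hn p q (N + 1) h (by omega) (by omega)))) ∧
      ∀ r hr hr' hrj, X.map (IntervalMap.face N r hr hr') _ _ w =
        D.val (hornFace h0 hn r hr hr' hrj) := by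
  obtain ⟨w₀, hw₀⟩ : ∃ w : X.obj (N + 1) (D.base ⟨stdVertex 0, vertex_mem_horn h0 hn _⟩)
        (D.base ⟨stdVertex (Fin.last _), vertex_mem_horn h0 hn _⟩),
      ∀ p q (h : p + q = N + 1) (_ : 0 < p) (_ : 0 < q), X.cut p q h _ _ w = X.incl p q _ _ _
        (D.val (hornSegment h0 hn 0 p p (by omega) (by omega) (by omega)) ⊗ₜ
          D.val (hornSegment h0 hn p q (N + 1) h (by omega) (by omega))) :=
    hX.exists_wedge (n := N + 1)
    (a := D.base ⟨stdVertex ⟨0, by omega⟩, vertex_mem_horn h0 hn _⟩)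
    (b := D.base ⟨stdVertex ⟨N + 1, by omega⟩, vertex_mem_horn h0 hn _⟩)
    (fun i => D.base ⟨stdVertex i, vertex_mem_horn h0 hn _⟩)
    (fun p h => D.val (hornSegment h0 hn 0 p p (by omega) (by omega) (by omega)))
    (fun p q h hp => D.val (hornSegment h0 hn p q (N + 1) h (by omega) (by omega)))
    (fun l m s h hs hl => D.val (hornSegment h0 hn l m s h (by omega) (by omega)))
    (fun l m s h h' hl hm => cut_hornSegment h0 hn D _ _ _ _ _ _ _)
    (fun l m q r s h h' h'' hl hm hq => cut_hornSegment h0 hn D _ _ _ _ _ _ _)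
  obtain ⟨w, hw, hw'⟩ := exists_faces (faceCompatible_hornFace h0 hn D) h0
    (Nat.lt_succ_iff.1 hn) w₀ (fun r hr hr' hrj => by
      rw [mem_comulKer]
      intro p q h hp hq
      refine (map_sub _ _ _).trans (sub_eq_zero.2 ?_)
      -- The face `r` of `w₀` has the comultiplications of the prescribed face: cutting it at `p` is
      -- cutting `w₀` at the image `i` of `p`, and that cut is known.
      obtain ⟨i, i', hi, f₁, f₂, hf, hfi⟩ :=
        ((IntervalMap.cast h).comp (IntervalMap.face N r hr hr')).exists_split
      have hfi' : i = if p < r then p else p + 1 := hfi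
      have hi0 : 0 < i := by split_ifs at hfi' <;> omega
      have hi0' : 0 < i' := by split_ifs at hfi' <;> omega
      refine Eq.trans ?_ (X.cut_map_of_incl h hi hf (hw₀ i i' hi hi0 hi0')).symm
      refine Eq.trans ?_ (congrArg _ ((TensorProduct.map_tmul _ _ _ _).trans
        (congrArg₂ _ (D.map_val _ _) (D.map_val _ _)))).symm
      have hv : ∀ x : Fin (p + q + 1), (if x.1 < r then x.1 else x.1 + 1) =
          ((f₁.add f₂).toOrderHom x).1 := fun x =>
        congrArg (fun f : IntervalMap (p + q) (N + 1) => (f.toOrderHom x).1) hf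
      refine D.cut_val h _ _ _ (Subtype.ext (SSet.stdSimplex.ext _ _ fun x => Fin.ext ?_))
        (Subtype.ext (SSet.stdSimplex.ext _ _ fun x => Fin.ext ?_))
      · refine (hv ⟨x.1, by omega⟩).trans ((IntervalMap.add_val_of_le f₁ f₂ (by
          simp only; omega)).trans ?_)
        exact (Nat.zero_add _).symm
      · refine (hv ⟨p + x.1, by omega⟩).trans ((IntervalMap.add_val_of_ge f₁ f₂ (by
          simp only; omega)).trans ?_)
        refine congrArg (fun z : Fin (q + 1) => i + (f₂.toOrderHom z).1) (Fin.ext ?_)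
        simp)
  refine ⟨w, fun p q h hp hq => ?_, hw'⟩
  have h1 := (X.mem_comulKer.1 hw) p q h hp hq
  exact (sub_eq_zero.1 ((map_sub _ _ _).symm.trans h1)).trans (hw₀ p q h hp hq)

/-- A templicial module whose comultiplications have suitable sections is a linear
quasi-category. -/
theorem isLinearQuasicategory_of_hasSections (hX : X.HasSections) : IsLinearQuasicategory k X := by
  intro n j h0 hn φ
  obtain ⟨N, rfl⟩ : ∃ N, n = N + 1 := ⟨n - 1, by have := Fin.lt_def.1 (h0.trans hn); simp at this; omega⟩
  obtain ⟨w, hw, hw'⟩ := exists_top hX h0 hn (freeHomDataOfHom φ)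
  let d : ExtensionData (A := Λ[N + 1, j]) (freeHomDataOfHom φ) :=
    { pos := Nat.succ_pos N
      mem := fun y h => mem_horn_of_endpoints h0 hn y h
      mem_vertex := vertex_mem_horn h0 hn
      top := w
      comul_top := fun p q h hp hq c hc h1 h2 => by
        obtain rfl : c = stdVertex ⟨p, by omega⟩ := hc.symm.trans
          (SSet.stdSimplex.ext _ _ fun i => rfl)
        refine (hw p q h hp hq).trans (congrArg _ (congrArg₂ _
          (congrArg (freeHomDataOfHom φ).val (Simp.ext (Subtype.ext (SSet.stdSimplex.ext _ _
            fun x => Fin.ext ?_))))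
          (congrArg (freeHomDataOfHom φ).val (Simp.ext (Subtype.ext (SSet.stdSimplex.ext _ _
            fun x => Fin.ext ?_))))))
        · exact Nat.zero_add _
        · rfl
      map_top := fun f hf => by
        -- A simplex of the horn misses some `r ≠ j`. An interval map hits both ends, so `r` is
        -- interior and `f` factors through the inner face `r`, where the value of `w` is
        -- prescribed.
        obtain ⟨⟨r, hr⟩, hrj, hr'⟩ := (SSet.mem_horn_iff_notMem_range _ _).1 hf
        have hr0 : 0 < r := by
          by_contra h
          obtain rfl : r = 0 := by omega
          exact hr' ⟨0, f.map_zero⟩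
        have hrN : r ≤ N := by
          by_contra h
          obtain rfl : r = N + 1 := by omega
          exact hr' ⟨Fin.last _, f.map_last⟩
        have key := IntervalMap.comp_degen_comp_face hr0 hrN f
          (fun i hi => hr' ⟨i, Fin.ext hi⟩)
        refine (congrArg (fun f => X.map f _ _ w) key).symm.trans ?_
        refine (X.map_comp_apply _ _ _).symm.trans ?_
        refine (congrArg _ (hw' r hr0 hrN fun e => hrj (Fin.ext e))).trans ?_
        refine ((freeHomDataOfHom φ).map_val _ _).trans (congrArg (freeHomDataOfHom φ).val
          (Simp.ext (Subtype.ext ?_)))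
        exact congrArg (fun f => ((stdTop (N + 1)).map f).val) key }
  exact ⟨d.freeHomData.toHom, d.map_ι_toHom.trans (freeHomDataOfHom_toHom φ)⟩

end Criterion

end Templicial

namespace Templicial

/-! ### Gluing simplices of a quasi-category -/

section Gluing

/-- The inclusion `[m] ⟶ [n]` onto the interval `{i, …, i + m}`. -/
def segHom (i m n : ℕ) (h : i + m ≤ n) : ⦋m⦌ ⟶ ⦋n⦌ :=
  SimplexCategory.Hom.mk ⟨fun x : Fin (m + 1) => (⟨i + x.1, by omega⟩ : Fin (n + 1)),
    fun x y hxy => by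
      have hxy' : x.1 ≤ y.1 := hxy
      simp only [Fin.mk_le_mk]; omega⟩

/-- The face map which omits `r`. -/
def omitHom (r n : ℕ) : ⦋n⦌ ⟶ ⦋n + 1⦌ :=
  SimplexCategory.Hom.mk ⟨fun x : Fin (n + 1) =>
      (⟨if x.1 < r then x.1 else x.1 + 1, by split_ifs <;> omega⟩ : Fin (n + 1 + 1)),
    fun x y hxy => by
      have hxy' : x.1 ≤ y.1 := hxy
      simp only [Fin.mk_le_mk]; split_ifs <;> omega⟩

variable {Y : SSet.{u}}

/-- The face on the vertices `i, …, i + m`. -/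
def seg (i m : ℕ) {n : ℕ} (h : i + m ≤ n) (y : Y _⦋n⦌) : Y _⦋m⦌ := Y.map (segHom i m n h).op y

/-- The face opposite to the vertex `r`. -/
def omitFace (r : ℕ) {n : ℕ} (y : Y _⦋n + 1⦌) : Y _⦋n⦌ := Y.map (omitHom r n).op y

lemma map_congr {m n : ℕ} (f g : ⦋m⦌ ⟶ ⦋n⦌) (h : ∀ x, (f.toOrderHom x).1 = (g.toOrderHom x).1)
    (y : Y _⦋n⦌) : Y.map f.op y = Y.map g.op y := by
  have : f = g := by ext x; exact h x
  rw [this]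

lemma seg_seg {i m j l n r : ℕ} (h : i + m ≤ n) (h' : j + l ≤ m) (e : i + j = r) (y : Y _⦋n⦌) :
    seg j l h' (seg i m h y) = seg r l (by omega) y := by
  subst e
  exact (map_map _ _ y).trans (map_congr (segHom j l m h' ≫ segHom i m n h)
    (segHom (i + j) l n (by omega)) (fun x => (Nat.add_assoc i j x.1).symm) y)

lemma seg_self {n : ℕ} (h : 0 + n ≤ n) (y : Y _⦋n⦌) : seg 0 n h y = y := by
  refine (map_congr (segHom 0 n n h) (𝟙 ⦋n⦌) (fun x => Nat.zero_add x.1) y).trans ?_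
  simp

lemma omit_zero {n : ℕ} (y : Y _⦋n + 1⦌) : omitFace 0 y = seg 1 n (by omega) y :=
  map_congr (omitHom 0 n) (segHom 1 n (n + 1) (by omega)) (fun x => Nat.add_comm x.1 1) y

lemma omit_last {n : ℕ} (y : Y _⦋n + 1⦌) : omitFace (n + 1) y = seg 0 n (by omega) y :=
  map_congr (omitHom (n + 1) n) (segHom 0 n (n + 1) (by omega)) (fun x => (if_pos x.2).trans (Nat.zero_add x.1).symm) y

lemma omit_omit {n r s : ℕ} (h : r ≤ s) (y : Y _⦋n + 2⦌) :
    omitFace r (omitFace (s + 1) y) = omitFace s (omitFace r y) :=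
  map_map_eq Y (by
    ext x
    change (if (if x.1 < r then x.1 else x.1 + 1) < s + 1 then (if x.1 < r then x.1 else x.1 + 1)
      else (if x.1 < r then x.1 else x.1 + 1) + 1) = (if (if x.1 < s then x.1 else x.1 + 1) < r then
      (if x.1 < s then x.1 else x.1 + 1) else (if x.1 < s then x.1 else x.1 + 1) + 1)
    split_ifs <;> omega) y

lemma δ_eq_omit {n : ℕ} (j : Fin (n + 2)) (y : Y _⦋n + 1⦌) : Y.δ j y = omitFace j.1 y := by
  refine map_congr (SimplexCategory.δ j) (omitHom j.1 n) (fun x => ?_) y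
  change (Fin.succAbove j x).1 = if x.1 < j.1 then x.1 else x.1 + 1
  unfold Fin.succAbove
  simp only [Fin.lt_def, Fin.val_castSucc]
  split_ifs <;> rfl

variable [SSet.Quasicategory Y]

/-- Filling partial horns with the faces `0`, `n + 2` and `2, …, i - 1`. -/
lemma exists_simplex_of_partial (n : ℕ) : ∀ (d i : ℕ) (_ : i + d = n + 2) (_ : 2 ≤ i)
    (s : ℕ → Y _⦋n + 1⦌), (∀ j l, j ≠ 1 → l ≠ 1 → j < l → (j < i) → (l < i ∨ l = n + 2) →
      omitFace (l - 1) (s j) = omitFace j (s l)) →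
    ∃ T : Y _⦋n + 2⦌, ∀ j, j ≠ 1 → (j < i ∨ j = n + 2) → omitFace j T = s j := by
  induction n with
  | zero =>
    intro d i hd hi s hs
    obtain ⟨T, hT⟩ := exists_simplex Y (n := 0) (i := 1) (by decide) (by decide) (fun j => s j.1)
      (by
        intro j l hj hl hjl
        rw [δ_eq_omit, δ_eq_omit]
        have hj' : j.1 ≠ 1 := fun e => hj (Fin.ext e)
        have hl' : l.1 ≠ 1 := fun e => hl (Fin.ext e)
        have hjl' : j.1 < l.1 := hjl
        exact hs j.1 l.1 hj' hl' hjl' (by omega) (by omega))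
    refine ⟨T, fun j hj hj' => ?_⟩
    have := hT ⟨j, by omega⟩ (fun e => hj (congrArg Fin.val e))
    rwa [δ_eq_omit] at this
  | succ n ih =>
    intro d
    induction d with
    -- With `d = 0` every face except the one opposite to `1` is given, which is an inner horn.
    | zero =>
      intro i hd hi s hs
      obtain ⟨T, hT⟩ := exists_simplex Y (i := 1) (by simp)
        (by simp [Fin.lt_def]) (fun j => s j.1)
        (by
          intro j l hj hl hjl
          rw [δ_eq_omit, δ_eq_omit]
          have hj' : j.1 ≠ 1 := fun e => hj (Fin.ext e)
          have hl' : l.1 ≠ 1 := fun e => hl (Fin.ext e)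
          have hjl' : j.1 < l.1 := hjl
          exact hs j.1 l.1 hj' hl' hjl' (by omega) (by omega))
      refine ⟨T, fun j hj hj' => ?_⟩
      have := hT ⟨j, by omega⟩ (fun e => hj (congrArg Fin.val e))
      rwa [δ_eq_omit] at this
    | succ d ihd =>
      intro i hd hi s hs
      -- The face `i` is not given and is constructed first. Its own faces opposite to `j < i`, `j ≠
      -- 1`, and its last face are forced by the simplicial identities, and they form a partial horn
      -- one dimension lower.
      obtain ⟨x, hx⟩ := ih d i (by omega) hi
        (fun j => if j < i then omitFace (i - 1) (s j) else omitFace i (s (j + 1))) (by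
          obtain ⟨i, rfl⟩ : ∃ i', i = i' + 2 := ⟨i - 2, by omega⟩
          intro j l hj hl hjl hji hli
          obtain ⟨l, rfl⟩ : ∃ l', l = l' + 1 := ⟨l - 1, by omega⟩
          simp only [if_pos hji]
          rcases hli with hli | hli
          · rw [if_pos hli]
            refine (omit_omit (r := l) (s := i) (by omega) (s j)).trans ?_
            refine (congrArg (omitFace i) (hs j (l + 1) hj hl hjl hji (Or.inl hli))).trans ?_
            exact (omit_omit (r := j) (s := i) (by omega) _).symm
          · rw [if_neg (by omega)]
            refine (omit_omit (r := i + 1) (s := l) (by omega) (s j)).symm.trans ?_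
            refine (congrArg (omitFace (i + 1)) (hs j (l + 2) hj (by omega) (by omega) hji
              (Or.inr (by omega)))).trans ?_
            exact (omit_omit (r := j) (s := i + 1) (by omega) _).symm)
      -- With the face `i` added, the partial horn has one more face and the inner induction
      -- applies.
      obtain ⟨T, hT⟩ := ihd (i + 1) (by omega) (by omega) (Function.update s i x) (by
        intro j l hj hl hjl hji hli
        by_cases hjl' : l = i
        · subst hjl'
          rw [Function.update_self, Function.update_of_ne (by omega), hx j hj (Or.inl hjl),
            if_pos hjl]
        · by_cases hj' : j = i
          · subst hj'
            rw [Function.update_self, Function.update_of_ne (by omega),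
              hx (l - 1) (by omega) (Or.inr (by omega)), if_neg (by omega),
              Nat.sub_add_cancel (by omega)]
          · rw [Function.update_of_ne hj', Function.update_of_ne hjl']
            exact hs j l hj hl hjl (by omega) (by omega))
      refine ⟨T, fun j hj hj' => ?_⟩
      have := hT j hj (by omega)
      rwa [Function.update_of_ne (by omega)] at this

/-- Two simplices whose faces fit are the outer faces of a simplex. -/
lemma exists_outer {n : ℕ} (A B : Y _⦋n + 1⦌) (h : seg 1 n (by omega) A = seg 0 n (by omega) B) :
    ∃ T : Y _⦋n + 2⦌, seg 0 (n + 1) (by omega) T = A ∧ seg 1 (n + 1) (by omega) T = B := by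
  -- For `i = 2` only the two outer faces `0` and `n + 2` are prescribed.
  obtain ⟨T, hT⟩ := exists_simplex_of_partial n n 2 (by omega) le_rfl
    (fun j => if j = 0 then B else A) (by
      intro j l hj hl hjl hj' hl'
      obtain rfl : j = 0 := by omega
      obtain rfl : l = n + 2 := by omega
      rw [if_pos rfl, if_neg (by omega)]
      exact (omit_last B).trans (h.symm.trans (omit_zero A).symm))
  refine ⟨T, (omit_last T).symm.trans (hT _ (by omega) (Or.inr rfl)), (omit_zero T).symm.trans
    (hT 0 (by omega) (Or.inl (by omega)))⟩

/-- Here `s` and `v` overlap in all vertices of `s` but the first. Induction on the number `q` of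
further vertices of `v`: the simplex built for `v` without its last vertex and `v` itself are the
two outer faces of a larger simplex (`exists_outer`). -/
lemma exists_front_back {P : ℕ} (s : Y _⦋P + 1⦌) : ∀ (q m n : ℕ) (hm : P + q = m)
    (hn : m + 1 = n) (v : Y _⦋m⦌), seg 1 P (by omega) s = seg 0 P (by omega) v →
    ∃ T : Y _⦋n⦌, seg 0 (P + 1) (by omega) T = s ∧ seg 1 m (by omega) T = v := by
  intro q
  induction q with
  | zero =>
    rintro m n rfl rfl v h
    exact ⟨s, seg_self _ s, h.trans (seg_self _ v)⟩
  | succ q ih =>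
    rintro m n rfl rfl v h
    obtain ⟨A, h1, h2⟩ := ih (P + q) (P + q + 1) rfl rfl (seg 0 (P + q) (by omega) v)
      (by rw [seg_seg (r := 0) _ _ rfl]; exact h)
    obtain ⟨T, h3, h4⟩ := exists_outer A v h2
    refine ⟨T, ?_, h4⟩
    rw [← h1, ← h3]
    exact (seg_seg (r := 0) _ _ rfl T).symm

open Classical in
/-- A choice of simplices with given front and back faces. -/
noncomputable def glue {q : ℕ} (u : Y _⦋q⦌) : ∀ (P : ℕ) (_ : Y _⦋P + 1⦌), Y _⦋P + 1 + q⦌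
  | 0, s => if h : ∃ T : Y _⦋0 + 1 + q⦌, seg 0 (0 + 1) (by omega) T = s ∧ seg 1 q (by omega) T = u
      -- A default value, not used when the last vertex of `s` is the first vertex of `u`.
      then h.choose else Y.map (SimplexCategory.const _ _ 0).op s
  -- The face opposite to the first vertex is required to be the gluing already chosen for the
  -- corresponding face of `s`, which makes the choices compatible with dropping initial vertices.
  | P + 1, s => if h : ∃ T : Y _⦋P + 1 + 1 + q⦌, seg 0 (P + 1 + 1) (by omega) T = s ∧
        seg 1 (P + 1 + q) (by omega) T = glue u P (seg 1 (P + 1) (by omega) s)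
      then h.choose else Y.map (SimplexCategory.const _ _ 0).op s

/-- In the recursive step the previously chosen simplex begins with the face of `s` opposite to its
first vertex, so `exists_front_back` supplies a simplex and the default value is never taken. -/
lemma glue_spec {q : ℕ} (u : Y _⦋q⦌) (P : ℕ) (s : Y _⦋P + 1⦌)
    (h : seg (P + 1) 0 (by omega) s = seg 0 0 (by omega) u) :
    seg 0 (P + 1) (by omega) (glue u P s) = s ∧ seg (P + 1) q (by omega) (glue u P s) = u := by
  induction P with
  | zero =>
    have h' := exists_front_back s q q (0 + 1 + q) (by omega) (by omega) u h
    have e : glue u 0 s = h'.choose := dif_pos h'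
    rw [e]
    exact h'.choose_spec
  | succ P ih =>
    obtain ⟨h1, h2⟩ := ih (seg 1 (P + 1) (by omega) s) ((seg_seg (r := P + 1 + 1) _ _ (by omega) s).trans h)
    have h' := exists_front_back s q (P + 1 + q) (P + 1 + 1 + q) (by omega) (by omega)
      (glue u P (seg 1 (P + 1) (by omega) s)) h1.symm
    have e : glue u (P + 1) s = h'.choose := dif_pos h'
    refine ⟨(congrArg _ e).trans h'.choose_spec.1, ?_⟩
    refine Eq.trans ?_ h2
    rw [← h'.choose_spec.2, seg_seg (r := P + 1 + 1) _ _ (by omega), e]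

/-- By the recursion, dropping the first vertex of a glued simplex gives the gluing of `s` without
its first vertex; this is iterated `l` times. It is the property that makes gluing respect cuts
further left. -/
lemma seg_glue {q : ℕ} (u : Y _⦋q⦌) (P l m : ℕ) (hlm : l + m = P) (s : Y _⦋P + 1⦌)
    (h : seg (P + 1) 0 (by omega) s = seg 0 0 (by omega) u) :
    seg l (m + 1 + q) (by omega) (glue u P s) = glue u m (seg l (m + 1) (by omega) s) := by
  induction l generalizing P with
  | zero =>
    obtain rfl : m = P := by omega
    rw [seg_self, seg_self]
  | succ l ih =>
    obtain ⟨P, rfl⟩ : ∃ P', P = P' + 1 := ⟨P - 1, by omega⟩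
    have hs := (seg_seg (i := 1) (m := P + 1) (j := P + 1) (l := 0) (r := P + 1 + 1) (by omega) (by omega)
      (by omega) s).trans h
    obtain ⟨h1, -⟩ := glue_spec u P (seg 1 (P + 1) (by omega) s) hs
    have h' := exists_front_back s q (P + 1 + q) (P + 1 + 1 + q) (by omega) (by omega)
      (glue u P (seg 1 (P + 1) (by omega) s)) h1.symm
    have e : glue u (P + 1) s = h'.choose := dif_pos h'
    have := ih P (by omega) (seg 1 (P + 1) (by omega) s) hs
    rw [seg_seg (r := l + 1) _ _ (Nat.add_comm 1 l), ← h'.choose_spec.2, ← e,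
      seg_seg (r := l + 1) _ _ (Nat.add_comm 1 l)] at this
    exact this

end Gluing

end Templicial

namespace Templicial

open TemplicialModule

/-! ### Free templicial modules on quasi-categories -/

section FreeSections

variable {k : Type u} [CommRing k]

lemma toModule_eq_zero {ι : Type*} [DecidableEq ι] {M : ι → Type*} [∀ i, AddCommMonoid (M i)]
    [∀ i, Module k (M i)] {N : Type*} [AddCommMonoid N] [Module k N] (φ : ∀ i, M i →ₗ[k] N)
    (t : ⨁ i, M i) (h : ∀ i, φ i (t i) = 0) : DirectSum.toModule k ι N φ t = 0 := by
  classical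
  refine (DFinsupp.sumAddHom_apply (fun i => (φ i).toAddMonoidHom) t).trans ?_
  exact Finset.sum_eq_zero fun i _ => h i

variable {Y : SSet.{u}}

lemma cut_freeGen {n p q : ℕ} (h : p + q = n) {a b c : Y _⦋0⦌}
    (y : Simp Y (fun y => y) n a b) (y₁ : Simp Y (fun y => y) p a c)
    (y₂ : Simp Y (fun y => y) q c b) (h₁ : seg 0 p (by omega) y.val = y₁.val)
    (h₂ : seg p q (by omega) y.val = y₂.val) :
    ((freeTemplicial k).obj Y).cut p q h a b (freeGen k y) =
      ((freeTemplicial k).obj Y).incl p q a b c (freeGen k y₁ ⊗ₜ freeGen k y₂) := by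
  subst h
  have hm : y.mid = c := by
    refine Eq.trans ?_ y₁.last
    rw [← h₁, seg, vtx_map]
    refine congrArg (fun i => vtx i y.val) (Fin.ext ?_)
    exact (Nat.zero_add p).symm
  subst hm
  refine (cut_rfl _ _).trans ((comul_freeGen y).trans (congrArg _ (congrArg₂ _ (congrArg _
    (Simp.ext (Eq.trans ?_ h₁))) (congrArg _ (Simp.ext h₂)))))
  exact map_congr (frontHom p q) (segHom 0 p (p + q) (by omega)) (fun x => (Nat.zero_add x.1).symm)
    y.val

/-- A choice of bilinear extensions of a map on pairs of generators. -/
noncomputable def freeBilift {p q n : ℕ} {a b c : Y _⦋0⦌}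
    (g : Simp Y (fun y => y) p a c → Simp Y (fun y => y) q c b → Simp Y (fun y => y) n a b) :
    ((freeTemplicial k).obj Y).obj p a c ⊗[k] ((freeTemplicial k).obj Y).obj q c b →ₗ[k]
      ((freeTemplicial k).obj Y).obj n a b :=
  TensorProduct.lift (Finsupp.lift _ k _ fun s => Finsupp.lift _ k _ fun t => freeGen k (g s t))

lemma freeBilift_tmul {p q n : ℕ} {a b c : Y _⦋0⦌}
    (g : Simp Y (fun y => y) p a c → Simp Y (fun y => y) q c b → Simp Y (fun y => y) n a b)
    (s : Simp Y (fun y => y) p a c) (t : Simp Y (fun y => y) q c b) :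
    freeBilift g (freeGen k s ⊗ₜ freeGen k t) = freeGen k (g s t) := by
  refine (TensorProduct.lift.tmul _ _).trans ?_
  have h1 : ∀ {p : ℕ} {a c : Y _⦋0⦌} {M : Type _} [AddCommGroup M] [Module k M]
      (f : Simp Y (fun y => y) p a c → M) (s : Simp Y (fun y => y) p a c),
      Finsupp.lift M k _ f (Finsupp.single s 1) = f s := by
    intro p a c M _ _ f s
    simp
  exact (LinearMap.congr_fun (h1 _ s) _).trans (h1 _ t)

lemma free_tensor_ext {p q : ℕ} {a b : Y _⦋0⦌} {M : Type*} [AddCommGroup M] [Module k M]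
    {f g : (⨁ c, (((freeTemplicial k).obj Y).obj p a c ⊗[k] ((freeTemplicial k).obj Y).obj q c b))
      →ₗ[k] M}
    (h : ∀ c (s : Simp Y (fun y => y) p a c) (t : Simp Y (fun y => y) q c b),
      f (((freeTemplicial k).obj Y).incl p q a b c (freeGen k s ⊗ₜ freeGen k t)) =
      g (((freeTemplicial k).obj Y).incl p q a b c (freeGen k s ⊗ₜ freeGen k t))) : f = g := by
  classical
  refine DirectSum.linearMap_ext k fun c => TensorProduct.ext ?_
  refine (freeData k Y).hom_ext fun s => (freeData k Y).hom_ext fun t => ?_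
  exact h c s t

lemma seg_point {n : ℕ} (i : Fin (n + 1)) (y : Y _⦋n⦌) : seg i.1 0 (by omega) y = vtx i y :=
  map_congr (segHom i.1 0 n (by omega)) (SimplexCategory.const ⦋0⦌ ⦋n⦌ i) (fun x => by
    obtain rfl : x = 0 := Subsingleton.elim (α := Fin 1) _ _
    rfl) y

lemma seg_last_eq {p q : ℕ} {a b c : Y _⦋0⦌} (s : Simp Y (fun y => y) p a c)
    (t : Simp Y (fun y => y) q c b) :
    seg p 0 (by omega) s.val = seg 0 0 (by omega) t.val :=
  (seg_point (Fin.last p) s.val).trans (s.last.trans (t.first.symm.trans (seg_point 0 t.val).symm))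

variable [SSet.Quasicategory Y]

/-- The chosen simplex with given front and back. -/
noncomputable def glueSimp {P q : ℕ} {a b c : Y _⦋0⦌} (s : Simp Y (fun y => y) (P + 1) a c)
    (t : Simp Y (fun y => y) q c b) : Simp Y (fun y => y) (P + 1 + q) a b where
  val := glue t.val P s.val
  first := by
    refine Eq.trans ?_ s.first
    refine ((seg_point 0 _).symm.trans ?_).trans (seg_point 0 s.val)
    conv_rhs => rw [← (glue_spec t.val P s.val (seg_last_eq s t)).1]
    exact (seg_seg (r := 0) _ _ rfl _).symm
  last := by
    refine Eq.trans ?_ t.last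
    refine ((seg_point (Fin.last _) _).symm.trans ?_).trans (seg_point (Fin.last _) t.val)
    conv_rhs => rw [← (glue_spec t.val P s.val (seg_last_eq s t)).2]
    exact (seg_seg (r := P + 1 + q) _ _ rfl _).symm

open Classical in
/-- The linear extension of `glueSimp`. -/
noncomputable def freeGlue (k : Type u) [CommRing k] (Y : SSet.{u}) [SSet.Quasicategory Y]
    (P q : ℕ) (a b : Y _⦋0⦌) :
    (⨁ c, (((freeTemplicial k).obj Y).obj (P + 1) a c ⊗[k] ((freeTemplicial k).obj Y).obj q c b))
      →ₗ[k] ((freeTemplicial k).obj Y).obj (P + 1 + q) a b :=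
  DirectSum.toModule k ((freeTemplicial k).obj Y).base _ fun _ => freeBilift glueSimp

open Classical in
lemma freeGlue_incl {P q : ℕ} {a b c : Y _⦋0⦌} (s : Simp Y (fun y => y) (P + 1) a c)
    (t : Simp Y (fun y => y) q c b) :
    freeGlue k Y P q a b (((freeTemplicial k).obj Y).incl (P + 1) q a b c
      (freeGen k s ⊗ₜ freeGen k t)) = freeGen k (glueSimp s t) :=
  (DirectSum.toModule_lof k _ _).trans (freeBilift_tmul _ s t)

open Classical in
-- Evaluates the right side of `cut_freeGlue` on a pure tensor: cut the first factor, reassociate,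
-- and glue its second part to the second factor.
lemma lTensor_component_cut {X : TemplicialModule.{u} k} {l m n q r : ℕ} {h : l + m = n}
    {a b d e : X.base} {s : X.obj n a d} {t : X.obj q d b} {x₁ : X.obj l a e} {x₂ : X.obj m e d}
    (hs : X.cut l m h a d s = X.incl l m a d e (x₁ ⊗ₜ x₂))
    (G : ∀ c, (⨁ d, (X.obj m c d ⊗[k] X.obj q d b)) →ₗ[k] X.obj r c b) {z : X.obj r e b}
    (hz : G e (X.incl m q e b d (x₂ ⊗ₜ t)) = z) (c : X.base) :
    (LinearMap.lTensor _ (G c ∘ₗ X.incl m q c b d) ∘ₗ (TensorProduct.assoc k _ _ _).toLinearMap ∘ₗ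
      LinearMap.rTensor _ (DirectSum.component k X.base _ c ∘ₗ X.cut l m h a d)) (s ⊗ₜ t) =
    DirectSum.component k X.base _ c (X.incl l r a b e (x₁ ⊗ₜ z)) := by
  rw [LinearMap.comp_apply, LinearMap.comp_apply, LinearMap.rTensor_tmul, LinearMap.comp_apply, hs]
  by_cases hc : e = c
  · subst hc
    have e1 : DirectSum.component k X.base _ e (X.incl l m a d e (x₁ ⊗ₜ x₂)) = x₁ ⊗ₜ x₂ :=
      incl_same _ _
    have e2 : DirectSum.component k X.base _ e (X.incl l r a b e (x₁ ⊗ₜ z)) = x₁ ⊗ₜ z :=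
      incl_same _ _
    rw [e1, e2, LinearEquiv.coe_coe, TensorProduct.assoc_tmul, LinearMap.lTensor_tmul,
      LinearMap.comp_apply, hz]
  · have e1 : DirectSum.component k X.base _ c (X.incl l m a d e (x₁ ⊗ₜ x₂)) = 0 :=
      incl_ne _ _ hc
    have e2 : DirectSum.component k X.base _ c (X.incl l r a b e (x₁ ⊗ₜ z)) = 0 := incl_ne _ _ hc
    rw [e1, e2, TensorProduct.zero_tmul, map_zero, map_zero]

open Classical in
-- Cutting a glued simplex inside its first part is cutting that part and gluing the remainder
-- (`seg_glue`). Hence the cut of the section depends on `t` only through the cut of its first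
-- factor, and vanishes with it.
lemma cut_freeGlue {l M P q : ℕ} (h : l + (M + 1) = P + 1) (hr : l + (M + 1 + q) = P + 1 + q)
    (a b c : Y _⦋0⦌) :
    (DirectSum.component k ((freeTemplicial k).obj Y).base _ c ∘ₗ ((freeTemplicial k).obj Y).cut l (M + 1 + q) hr a b) ∘ₗ
      freeGlue k Y P q a b =
    DirectSum.toModule k ((freeTemplicial k).obj Y).base _ fun d =>
      LinearMap.lTensor _ (freeGlue k Y M q c b ∘ₗ ((freeTemplicial k).obj Y).incl (M + 1) q c b d) ∘ₗ
        (TensorProduct.assoc k _ _ _).toLinearMap ∘ₗ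
          LinearMap.rTensor _ (DirectSum.component k ((freeTemplicial k).obj Y).base _ c ∘ₗ
            ((freeTemplicial k).obj Y).cut l (M + 1) h a d) := by
  refine free_tensor_ext fun d s t => ?_
  obtain ⟨e, he⟩ : ∃ e, e = vtx (⟨l, by omega⟩ : Fin (P + 1 + 1)) s.val := ⟨_, rfl⟩
  have hs := seg_last_eq s t
  have hg := glue_spec t.val P s.val hs
  let s₁ : Simp Y (fun y => y) l a e :=
    { val := seg 0 l (by omega) s.val
      first := (vtx_map _ _ _).trans s.first
      last := (vtx_map _ _ _).trans ((congrArg (fun i => vtx i s.val)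
        (Fin.ext (Nat.zero_add l))).trans he.symm) }
  let s₂ : Simp Y (fun y => y) (M + 1) e d :=
    { val := seg l (M + 1) (by omega) s.val
      first := (vtx_map _ _ _).trans he.symm
      last := (vtx_map _ _ _).trans ((congrArg (fun i => vtx i s.val)
        (Fin.ext h)).trans s.last) }
  have h1 : ((freeTemplicial k).obj Y).cut l (M + 1) h a d (freeGen k s) =
      ((freeTemplicial k).obj Y).incl l (M + 1) a d e (freeGen k s₁ ⊗ₜ freeGen k s₂) :=
    cut_freeGen h s s₁ s₂ rfl rfl
  have h2 : ((freeTemplicial k).obj Y).cut l (M + 1 + q) hr a b (freeGen k (glueSimp s t)) =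
      ((freeTemplicial k).obj Y).incl l (M + 1 + q) a b e
        (freeGen k s₁ ⊗ₜ freeGen k (glueSimp s₂ t)) := by
    refine cut_freeGen hr _ s₁ (glueSimp s₂ t) ?_ (seg_glue t.val P l M (by omega) s.val hs)
    refine Eq.trans ?_ (congrArg (seg 0 l (by omega)) hg.1)
    exact (seg_seg (r := 0) _ _ rfl _).symm
  refine (congrArg (DirectSum.component k ((freeTemplicial k).obj Y).base _ c)
    ((congrArg (((freeTemplicial k).obj Y).cut l (M + 1 + q) hr a b)
      (freeGlue_incl s t)).trans h2)).trans ?_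
  refine Eq.trans ?_ (DirectSum.toModule_lof k d _).symm
  exact (lTensor_component_cut h1 (fun c => freeGlue k Y M q c b) (freeGlue_incl s₂ t) c).symm

open Classical in
lemma hasSections_free (k : Type u) [CommRing k] (Y : SSet.{u}) [SSet.Quasicategory Y] :
    ((freeTemplicial k).obj Y).HasSections := by
  intro p q a b hp hq
  obtain ⟨P, rfl⟩ : ∃ P, p = P + 1 := ⟨p - 1, by omega⟩
  refine ⟨freeGlue k Y P q a b, fun t => ?_, ?_⟩
  · have : ((freeTemplicial k).obj Y).comul (P + 1) q a b ∘ₗ freeGlue k Y P q a b =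
        LinearMap.id := free_tensor_ext fun c s t => by
      have hg := glue_spec t.val P s.val (seg_last_eq s t)
      refine (congrArg _ (freeGlue_incl s t)).trans ((cut_rfl _ _).symm.trans ?_)
      exact cut_freeGen rfl _ s t hg.1 hg.2
    exact LinearMap.congr_fun this t
  · intro l m r h h' t hl hm ht
    obtain ⟨M, rfl⟩ : ∃ M, m = M + 1 := ⟨m - 1, by omega⟩
    obtain rfl : r = M + 1 + q := by omega
    refine DFinsupp.ext fun c => ?_
    refine (LinearMap.congr_fun (cut_freeGlue h h' a b c) t).trans ?_
    refine toModule_eq_zero _ _ fun d => ?_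
    rw [LinearMap.comp_apply, LinearMap.comp_apply, ht c d, map_zero, map_zero]

theorem freePreserves (k : Type u) [CommRing k] : FreePreserves.{u} k :=
  fun Y _ => isLinearQuasicategory_of_hasSections (hasSections_free k Y)

end FreeSections

end Templicial

namespace Templicial

open TemplicialModule

/-! ### The Segal condition -/

section Segal

variable {k : Type u} [CommRing k]

/-- The comultiplications are bijective. -/
def TemplicialModule.IsSegal (X : TemplicialModule.{u} k) : Prop :=
  ∀ p q a b, Function.Bijective (X.comul p q a b)

/-- The tensor product commutes with direct sums, so an element is detected by its components. -/
lemma eq_zero_of_lTensor_component {ι : Type*} {M : Type*} [AddCommGroup M] [Module k M]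
    {N : ι → Type*} [∀ i, AddCommGroup (N i)] [∀ i, Module k (N i)] (z : M ⊗[k] (⨁ i, N i))
    (h : ∀ i, LinearMap.lTensor M (DirectSum.component k ι N i) z = 0) : z = 0 := by
  classical
  apply (TensorProduct.directSumRight k k M N).injective
  rw [map_zero]
  refine DFinsupp.ext fun i => ?_
  have : DirectSum.component k ι (fun i => M ⊗[k] N i) i ∘ₗ
      (TensorProduct.directSumRight k k M N).toLinearMap =
      LinearMap.lTensor M (DirectSum.component k ι N i) :=
    TensorProduct.ext' fun m n => TensorProduct.directSumRight_tmul k k m n i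
  exact (LinearMap.congr_fun this z).trans (h i)

lemma map_cast_bijective (X : TemplicialModule.{u} k) {m n : ℕ} (h : m = n) (a b : X.base) :
    Function.Bijective (X.map (IntervalMap.cast h) a b) := by
  subst h
  have : X.map (IntervalMap.cast (rfl : m = m)) a b = LinearMap.id :=
    LinearMap.ext (X.map_cast_rfl rfl)
  rw [this]
  exact Function.bijective_id

lemma TemplicialModule.IsSegal.cut_bijective {X : TemplicialModule.{u} k} (hX : X.IsSegal)
    {n p q : ℕ} (h : p + q = n) (a b : X.base) : Function.Bijective (X.cut p q h a b) :=
  (hX p q a b).comp (map_cast_bijective X h a b)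

/-- The section is the inverse of the comultiplication. By coassociativity the cut of `G t` at `l`,
cut again in its second factor, is the given vanishing cut of `t`. The second cut is an isomorphism
and stays so after tensoring, so it can be cancelled. -/
lemma TemplicialModule.IsSegal.hasSections {X : TemplicialModule.{u} k} (hX : X.IsSegal) :
    X.HasSections := by
  intro p q a b hp hq
  choose G hG using (hX p q a b).2
  refine ⟨G, hG, ?_⟩
  intro l m r h h' t hl hm ht
  refine DFinsupp.ext fun c => ?_
  have hr : m + q = r := by omega
  let e := LinearEquiv.ofBijective _ (hX.cut_bijective hr c b)
  apply (LinearEquiv.lTensor (X.obj l a c) e).injective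
  refine Eq.trans ?_ (map_zero _).symm
  refine eq_zero_of_lTensor_component _ fun d => ?_
  have h1 := X.cut_coassoc h rfl hr h' (G t) c d
  rw [cut_rfl, hG, ht, map_zero, LinearMap.lTensor_comp] at h1
  exact h1.symm

/-- A tensor product of direct sums is a direct sum over pairs of indices, so `F` consists of the
bijections `φ p` placed along a bijection of index sets. Injectivity is read off from the components
through `key`, and surjectivity is checked on pure tensors of homogeneous elements. -/
lemma directSum_tensor_bijective {C P : Type*} {I J : C → Type*} {M : P → Type*}
    [DecidableEq C] [DecidableEq P] [∀ c, DecidableEq (I c)] [∀ c, DecidableEq (J c)]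
    {A : ∀ c, I c → Type*} {B : ∀ c, J c → Type*} [∀ p, AddCommMonoid (M p)] [∀ p, Module k (M p)]
    [∀ c i, AddCommMonoid (A c i)] [∀ c i, Module k (A c i)] [∀ c i, AddCommMonoid (B c i)]
    [∀ c i, Module k (B c i)] {mid : P → C} {f : ∀ p, I (mid p)} {g : ∀ p, J (mid p)}
    (φ : ∀ p, M p →ₗ[k] A (mid p) (f p) ⊗[k] B (mid p) (g p))
    (hφ : ∀ p, Function.Bijective (φ p))
    (F : (⨁ p, M p) →ₗ[k] ⨁ c, ((⨁ i, A c i) ⊗[k] (⨁ j, B c j)))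
    (hlof : ∀ p t, F (DirectSum.lof k P M p t) =
      DirectSum.lof k C (fun c => (⨁ i, A c i) ⊗[k] (⨁ j, B c j)) (mid p)
        (TensorProduct.map (DirectSum.lof k _ (A (mid p)) (f p))
          (DirectSum.lof k _ (B (mid p)) (g p)) (φ p t)))
    (h : Function.Bijective fun p => (⟨mid p, f p, g p⟩ : (c : C) × (I c × J c))) :
    Function.Bijective F := by
  have hA : ∀ c i, DirectSum.component k _ (A c) i ∘ₗ DirectSum.lof k _ (A c) i = LinearMap.id :=
    fun c i => LinearMap.ext fun t => DirectSum.component.lof_self k _ t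
  have hB : ∀ c i, DirectSum.component k _ (B c) i ∘ₗ DirectSum.lof k _ (B c) i = LinearMap.id :=
    fun c i => LinearMap.ext fun t => DirectSum.component.lof_self k _ t
  have hA' : ∀ c i i', i ≠ i' → DirectSum.component k _ (A c) i ∘ₗ
      DirectSum.lof k _ (A c) i' = 0 := fun c i i' h => LinearMap.ext fun t =>
    DirectSum.of_eq_of_ne _ _ _ h
  have hB' : ∀ c i i', i ≠ i' → DirectSum.component k _ (B c) i ∘ₗ
      DirectSum.lof k _ (B c) i' = 0 := fun c i i' h => LinearMap.ext fun t =>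
    DirectSum.of_eq_of_ne _ _ _ h
  have key : ∀ p x, TensorProduct.map (DirectSum.component k _ (A (mid p)) (f p))
      (DirectSum.component k _ (B (mid p)) (g p)) (F x (mid p)) = φ p (x p) := by
    intro p x
    induction x using DirectSum.induction_on with
    | zero => rw [map_zero, DirectSum.zero_apply, map_zero, DirectSum.zero_apply, map_zero]
    | add x y hx hy =>
      rw [map_add, DirectSum.add_apply, map_add, hx, hy, DirectSum.add_apply, map_add]
    | of p' t =>
      change TensorProduct.map _ _ (F (DirectSum.lof k P M p' t) _) = _
      rw [hlof]
      by_cases hp : p' = p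
      · subst hp
        rw [DirectSum.lof_apply, ← LinearMap.comp_apply (TensorProduct.map _ _),
          ← TensorProduct.map_comp, hA, hB, TensorProduct.map_id, DirectSum.of_eq_same]
        rfl
      · rw [DirectSum.of_eq_of_ne _ _ _ (Ne.symm hp), map_zero]
        have hne : (⟨mid p, f p, g p⟩ : (c : C) × (I c × J c)) ≠ ⟨mid p', f p', g p'⟩ :=
          fun e => hp (h.1 e).symm
        -- The indices become variables so that the equality of the middle indices can be
        -- substituted.
        generalize f p = i at *
        generalize g p = j at *
        generalize mid p = c at *
        by_cases hc : mid p' = c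
        · subst hc
          rw [DirectSum.lof_apply, ← LinearMap.comp_apply (TensorProduct.map _ _),
            ← TensorProduct.map_comp]
          by_cases hf : i = f p'
          · have hg : j ≠ g p' := fun hg => hne (by rw [hf, hg])
            rw [hB' _ _ _ hg, TensorProduct.map_zero_right]
            rfl
          · rw [hA' _ _ _ hf, TensorProduct.map_zero_left]
            rfl
        · have h1 : ∀ z, DirectSum.lof k C (fun c => (⨁ i, A c i) ⊗[k] (⨁ j, B c j))
            (mid p') z c = 0 := fun z => DirectSum.of_eq_of_ne _ _ _ (Ne.symm hc)
          rw [h1, map_zero]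
  constructor
  · intro x y hxy
    refine DFinsupp.ext fun p => (hφ p).1 ?_
    exact (key p x).symm.trans ((congrArg _ (congrArg (fun z => z (mid p)) hxy)).trans (key p y))
  · rw [← LinearMap.range_eq_top, eq_top_iff]
    rintro x -
    induction x using DirectSum.induction_on with
    | zero => exact zero_mem _
    | add x y hx hy => exact add_mem hx hy
    | of c t =>
      induction t using TensorProduct.induction_on with
      | zero => rw [map_zero]; exact zero_mem _
      | add x y hx hy => rw [map_add]; exact add_mem hx hy
      | tmul x y =>
        induction x using DirectSum.induction_on with
        | zero => rw [TensorProduct.zero_tmul, map_zero]; exact zero_mem _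
        | add x y hx hy => rw [TensorProduct.add_tmul, map_add]; exact add_mem hx hy
        | of p s =>
          induction y using DirectSum.induction_on with
          | zero => rw [TensorProduct.tmul_zero, map_zero]; exact zero_mem _
          | add x y hx hy => rw [TensorProduct.tmul_add, map_add]; exact add_mem hx hy
          | of q t =>
            obtain ⟨r, hr⟩ := h.2 ⟨c, p, q⟩
            cases hr
            obtain ⟨z, hz⟩ := (hφ r).2 (s ⊗ₜ t)
            refine ⟨DirectSum.lof k P M r z, (hlof r z).trans ?_⟩
            rw [hz]
            rfl

end Segal

/-! ### Splitting sequences of objects. -/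

section PathParts

variable {C : Type u} {m n : ℕ} {a b : C}

/-- The two parts of a path. -/
def Path.parts (p : Path C (m + n) a b) : (c : C) × (Path C m a c × Path C n c b) :=
  ⟨_, Path.front p, Path.back p⟩

lemma Path.parts_bijective : Function.Bijective (Path.parts (C := C) (m := m) (n := n) (a := a) (b := b)) := by
  constructor
  · intro p p' h
    have h1 : ∀ i (hi : i < m + 1), p.1 ⟨i, by omega⟩ = p'.1 ⟨i, by omega⟩ := fun i hi =>
      congrArg (fun x : (c : C) × (Path C m a c × Path C n c b) => x.2.1.1 ⟨i, hi⟩) h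
    have h2 : ∀ i (hi : i < n + 1), p.1 ⟨m + i, by omega⟩ = p'.1 ⟨m + i, by omega⟩ := fun i hi =>
      congrArg (fun x : (c : C) × (Path C m a c × Path C n c b) => x.2.2.1 ⟨i, hi⟩) h
    refine Subtype.ext (funext fun i => ?_)
    by_cases hi : i.1 < m + 1
    · exact h1 i.1 hi
    · have := h2 (i.1 - m) (by omega)
      have e : (⟨m + (i.1 - m), by omega⟩ : Fin (m + n + 1)) = i := Fin.ext (by simp only; omega)
      rwa [e] at this
  · rintro ⟨c, p, q⟩
    have hq : ∀ i (hi : i < n + 1), (if h : m + i < m + 1 then p.1 ⟨m + i, h⟩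
        else q.1 ⟨m + i - m, by omega⟩) = q.1 ⟨i, hi⟩ := by
      intro i hi
      split_ifs with h
      -- The two parts overlap only in the middle object, where both take the value `c`.
      · obtain rfl : i = 0 := by omega
        exact p.2.2.trans q.2.1.symm
      · exact congrArg q.1 (Fin.ext (Nat.add_sub_cancel_left m i))
    let r : Path C (m + n) a b := ⟨fun i => if h : i.1 < m + 1 then p.1 ⟨i.1, h⟩
        else q.1 ⟨i.1 - m, by omega⟩, (dif_pos (Nat.succ_pos m)).trans p.2.1,
        (hq n (by omega)).trans q.2.2⟩
    have hc : Path.mid m n r = c := (hq 0 (by omega)).trans q.2.1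
    refine ⟨r, ?_⟩
    obtain ⟨p, hp⟩ := p
    obtain ⟨q, hq'⟩ := q
    have h1 : (Path.front r).1 = p := funext fun i => dif_pos i.2
    have h2 : (Path.back r).1 = q := funext fun i => hq i.1 i.2
    refine Sigma.ext hc ?_
    clear_value r
    subst hc
    exact heq_of_eq (Prod.ext (Subtype.ext h1) (Subtype.ext h2))

end PathParts

/-! ### The Segal condition for the linear nerve. -/

section NerveSegal

variable (k : Type u) [CommRing k] {C : Type u} [Category.{u} C] [Preadditive C] [Linear k C]

/-- The map is a reindexing along `Fin (m + n) ≃ Fin m ⊕ Fin n` followed by the isomorphism that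
splits a tensor product over a disjoint union. -/
lemma split_bijective {m n : ℕ} (p : Fin (m + n + 1) → C) :
    Function.Bijective (PiTensorProduct.lift (splitMultilinear k p)) := by
  let s : Fin (m + n) → Type u := fun i => p i.castSucc ⟶ p i.succ
  let e := (PiTensorProduct.reindex k s finSumFinEquiv.symm) ≪≫ₗ
    (PiTensorProduct.tmulEquivDep k (fun i => s (finSumFinEquiv i))).symm
  have : PiTensorProduct.lift (splitMultilinear k p) = e.toLinearMap := by
    refine PiTensorProduct.ext (MultilinearMap.ext fun c => ?_)
    refine (PiTensorProduct.lift.tprod c).trans ?_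
    refine Eq.trans ?_ (congrArg
      (PiTensorProduct.tmulEquivDep k (fun i => s (finSumFinEquiv i))).symm
      (PiTensorProduct.reindex_tprod (R := k) (s := s) finSumFinEquiv.symm c)).symm
    exact (PiTensorProduct.tmulEquivDep_symm_apply k (fun i => s (finSumFinEquiv i))
      (fun i => c (finSumFinEquiv i))).symm
  rw [this]
  exact e.bijective

variable {m n : ℕ} {a b : C}

/-- Splitting a string of morphisms. -/
noncomputable def splitMap (p : Path C (m + n) a b) :
    (⨂[k] i : Fin (m + n), (p.1 i.castSucc ⟶ p.1 i.succ)) →ₗ[k]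
      (⨂[k] i : Fin m, ((Path.front p).1 i.castSucc ⟶ (Path.front p).1 i.succ)) ⊗[k]
        (⨂[k] i : Fin n, ((Path.back p).1 i.castSucc ⟶ (Path.back p).1 i.succ)) :=
  PiTensorProduct.lift (splitMultilinear k p.1)

lemma splitMap_tprod (p : Path C (m + n) a b) (c : ∀ i : Fin (m + n), p.1 i.castSucc ⟶ p.1 i.succ) :
    splitMap k p (PiTensorProduct.tprod k c) = PiTensorProduct.tprod k (frontString p.1 c) ⊗ₜ
      PiTensorProduct.tprod k (backString p.1 c) :=
  PiTensorProduct.lift.tprod c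

open Classical in
lemma nerveComul_nerveIncl (p : Path C (m + n) a b) (t) :
    nerveComul k C m n a b (nerveIncl k C p t) =
      DirectSum.lof k C (fun c => NerveObj k C m a c ⊗[k] NerveObj k C n c b) (Path.mid m n p)
        (TensorProduct.map (nerveIncl k C (Path.front p)) (nerveIncl k C (Path.back p))
          (splitMap k p t)) := by
  have : nerveComul k C m n a b ∘ₗ nerveIncl k C p =
      (DirectSum.lof k C (fun c => NerveObj k C m a c ⊗[k] NerveObj k C n c b) (Path.mid m n p) ∘ₗ
        TensorProduct.map (nerveIncl k C (Path.front p)) (nerveIncl k C (Path.back p))) ∘ₗ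
          splitMap k p := by
    refine PiTensorProduct.ext (MultilinearMap.ext fun c => ?_)
    refine (nerveComul_tprod k m n a b p c).trans ?_
    exact congrArg (DirectSum.lof k C (fun c => NerveObj k C m a c ⊗[k] NerveObj k C n c b)
      (Path.mid m n p) ∘ₗ
        TensorProduct.map (nerveIncl k C (Path.front p)) (nerveIncl k C (Path.back p)))
      (splitMap_tprod k p c).symm
  exact LinearMap.congr_fun this t

open Classical in
lemma nerveComul_bijective (m n : ℕ) (a b : C) : Function.Bijective (nerveComul k C m n a b) :=
  directSum_tensor_bijective (k := k) (C := C) (P := Path C (m + n) a b)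
    (I := fun c => Path C m a c) (J := fun c => Path C n c b)
    (M := fun p => ⨂[k] i : Fin (m + n), (p.1 i.castSucc ⟶ p.1 i.succ))
    (A := fun _ p => ⨂[k] i : Fin m, (p.1 i.castSucc ⟶ p.1 i.succ))
    (B := fun _ p => ⨂[k] i : Fin n, (p.1 i.castSucc ⟶ p.1 i.succ))
    (mid := Path.mid m n) (f := Path.front) (g := Path.back)
    (splitMap k) (fun p => split_bijective k p.1) (nerveComul k C m n a b)
    (nerveComul_nerveIncl k) Path.parts_bijective

lemma isSegal_linearNerve (C : LinCat.{u} k) : ((linearNerve k).obj C).IsSegal :=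
  fun p q a b => nerveComul_bijective (C := C.carrier) k p q a b

theorem nervePreserves : NervePreserves.{u} k :=
  fun C => isLinearQuasicategory_of_hasSections (isSegal_linearNerve k C).hasSections

end NerveSegal

end Templicial

namespace Templicial

/-! ### Morphisms to templicial modules which satisfy the Segal condition -/

namespace TemplicialModule

section SegalHom

variable {k : Type u} [CommRing k] {X Z : TemplicialModule.{u} k}

open Classical in
-- Injectivity of `β` ensures that only the summand at `c` contributes to the component at `β c`.
lemma toModule_lof_apply {β : X.base → Z.base} (hβ : Function.Injective β) {m n : ℕ}
    {a b : X.base} (f : ∀ c, X.obj m a c →ₗ[k] Z.obj m (β a) (β c))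
    (g : ∀ c, X.obj n c b →ₗ[k] Z.obj n (β c) (β b)) (c : X.base)
    (t : ⨁ c : X.base, (X.obj m a c ⊗[k] X.obj n c b)) :
    (DirectSum.toModule k X.base (⨁ d : Z.base, (Z.obj m (β a) d ⊗[k] Z.obj n d (β b)))
      (fun c => Z.incl m n (β a) (β b) (β c) ∘ₗ TensorProduct.map (f c) (g c)) t) (β c) =
    TensorProduct.map (f c) (g c) (t c) := by
  induction t using DirectSum.induction_on with
  | zero => simp
  | add s t hs ht => rw [map_add, DirectSum.add_apply, hs, ht, DirectSum.add_apply, map_add]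
  | of d t =>
    have h1 : (DirectSum.toModule k X.base (⨁ d : Z.base, (Z.obj m (β a) d ⊗[k] Z.obj n d (β b)))
      (fun c => Z.incl m n (β a) (β b) (β c) ∘ₗ TensorProduct.map (f c) (g c)))
      (DirectSum.lof k X.base (fun c => X.obj m a c ⊗[k] X.obj n c b) d t) =
      Z.incl m n (β a) (β b) (β d) (TensorProduct.map (f d) (g d) t) := DirectSum.toModule_lof k _ _
    refine (congrArg (fun s => s (β c)) h1).trans ?_
    by_cases h : d = c
    · subst h
      rw [Z.incl_same, DirectSum.of_eq_same]
    · rw [Z.incl_ne _ (fun e => h (hβ e)), DirectSum.of_eq_of_ne _ _ _ (Ne.symm h), map_zero]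

/-- A morphism to a module which satisfies the Segal condition is determined by its values on
`X_1`. -/
lemma IsSegal.hom_ext (hZ : Z.IsSegal) {φ ψ : X ⟶ Z} (hb : ∀ a, Hom.base φ a = Hom.base ψ a)
    (h : ∀ a b (x : X.obj 1 a b), Z.tr (hb a) (hb b) (Hom.app φ 1 a b x) = Hom.app ψ 1 a b x) :
    φ = ψ := by
  refine Hom.ext_tr hb ?_
  obtain ⟨base, app, h1, h2, h3⟩ := φ
  obtain ⟨base', app', h1', h2', h3'⟩ := ψ
  obtain rfl : base = base' := funext hb
  simp only [tr_rfl] at h ⊢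
  intro n
  induction n with
  | zero =>
    intro a b x
    by_cases hab : a = b
    · subst hab
      exact (Z.counit_bijective _).1 ((h3 a x).trans (h3' a x).symm)
    · have := X.obj_zero_subsingleton a b hab
      rw [Subsingleton.elim x 0, map_zero, map_zero]
  | succ n ih =>
    intro a b x
    -- An element of `Z_{n+1}` is determined by its image under `μ_{n,1}`, which involves only the
    -- degrees `n` and `1`.
    apply (hZ n 1 _ _).1
    have e0 : app n = app' n := by funext a b; exact LinearMap.ext (ih a b)
    have e1 : app 1 = app' 1 := by funext a b; exact LinearMap.ext (h a b)
    rw [h2, h2', e0, e1]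

variable {β : X.base → Z.base} (θ : ∀ a b, X.obj 1 a b →ₗ[k] Z.obj 1 (β a) (β b))

open Classical in
/-- The degree zero part of a morphism. -/
noncomputable def zeroMap (β : X.base → Z.base) (a b : X.base) :
    X.obj 0 a b →ₗ[k] Z.obj 0 (β a) (β b) :=
  if h : a = b then Z.tr rfl (congrArg β h) ∘ₗ
    (LinearMap.toSpanSingleton k _ (Z.unit (β a))) ∘ₗ X.counit a ∘ₗ X.tr rfl h.symm else 0

lemma counit_zeroMap (a : X.base) (x : X.obj 0 a a) :
    Z.counit (β a) (zeroMap β a a x) = X.counit a x := by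
  unfold zeroMap
  rw [dif_pos rfl]
  change Z.counit (β a) (X.counit a x • Z.unit (β a)) = _
  rw [map_smul, counit_unit, smul_eq_mul, mul_one]

lemma zeroMap_unit (a : X.base) : zeroMap β a a (X.unit a) = Z.unit (β a) :=
  Z.eq_unit ((counit_zeroMap a _).trans (X.counit_unit a))

lemma map_incl_apply (hβ : Function.Injective β) {m n : ℕ}
    {a b : X.base} (f : ∀ c, X.obj m a c →ₗ[k] Z.obj m (β a) (β c))
    (g : ∀ c, X.obj n c b →ₗ[k] Z.obj n (β c) (β b)) (c d : X.base) (t) :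
    TensorProduct.map (f d) (g d) (X.incl m n a b c t d) =
      Z.incl m n (β a) (β b) (β c) (TensorProduct.map (f c) (g c) t) (β d) := by
  by_cases h : c = d
  · subst h
    rw [X.incl_same, Z.incl_same]
  · rw [X.incl_ne _ h, Z.incl_ne _ (fun e => h (hβ e)), map_zero]

open Classical in
/-- The components of the morphism with given values on `X_1`. -/
noncomputable def segalApp (hZ : Z.IsSegal) (θ : ∀ a b, X.obj 1 a b →ₗ[k] Z.obj 1 (β a) (β b))
    (n : ℕ) : ∀ (a b : X.base), X.obj n a b →ₗ[k] Z.obj n (β a) (β b) :=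
  match n with
  | 0 => zeroMap β
  | n + 1 => fun a b => (LinearEquiv.ofBijective _ (hZ n 1 (β a) (β b))).symm.toLinearMap ∘ₗ
      DirectSum.toModule k X.base (⨁ d : Z.base, (Z.obj n (β a) d ⊗[k] Z.obj 1 d (β b)))
        (fun c => Z.incl n 1 (β a) (β b) (β c) ∘ₗ
          TensorProduct.map (segalApp hZ θ n a c) (θ c b)) ∘ₗ X.comul n 1 a b

lemma comul_segalApp_succ (hβ : Function.Bijective β) (hZ : Z.IsSegal) (n : ℕ) (a b c : X.base) (x : X.obj (n + 1) a b) :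
    Z.comul n 1 _ _ (segalApp hZ θ (n + 1) a b x) (β c) =
      TensorProduct.map (segalApp hZ θ n a c) (θ c b) (X.comul n 1 a b x c) := by
  refine Eq.trans (congrArg (fun s : ⨁ d : Z.base, (Z.obj n (β a) d ⊗[k] Z.obj 1 d (β b)) => s (β c)) ?_)
    (toModule_lof_apply hβ.1 (segalApp hZ θ n a) (fun c => θ c b) c (X.comul n 1 a b x))
  exact (LinearEquiv.ofBijective _ (hZ n 1 (β a) (β b))).apply_symm_apply _

lemma IsSegal.comul_ext (hZ : Z.IsSegal) (hβ : Function.Bijective β) {m n : ℕ} {a b : X.base} {x y : Z.obj (m + n) (β a) (β b)}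
    (h : ∀ c, Z.comul m n _ _ x (β c) = Z.comul m n _ _ y (β c)) : x = y := by
  apply (hZ m n _ _).1
  refine DFinsupp.ext fun d => ?_
  obtain ⟨c, rfl⟩ := hβ.2 d
  exact h c

lemma comul_zero_one (X : TemplicialModule.{u} k) {a b : X.base} (x : X.obj 1 a b) :
    X.comul 0 1 a b x = X.incl 0 1 a b a (X.unit a ⊗ₜ x) :=
  (congrArg (X.comul 0 1 a b) (X.map_cast_rfl rfl x).symm).trans (X.comul_left_zero x)

lemma segalApp_zero_unit (hZ : Z.IsSegal) (a : X.base) :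
    segalApp hZ θ 0 a a (X.unit a) = Z.unit (β a) := zeroMap_unit a

lemma counit_segalApp (hZ : Z.IsSegal) (a : X.base) (x : X.obj 0 a a) :
    Z.counit (β a) (segalApp hZ θ 0 a a x) = X.counit a x := counit_zeroMap a x

attribute [irreducible] segalApp

/-- The recursion reaches degree one through `μ_{0,1}`, which merely adds a unit on the left. -/
lemma segalApp_one (hβ : Function.Bijective β) (hZ : Z.IsSegal) (a b : X.base) :
    segalApp hZ θ 1 a b = θ a b := by
  refine LinearMap.ext fun x => ?_
  have h := fun c => comul_segalApp_succ θ hβ hZ 0 a b c x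
  refine hZ.comul_ext hβ (m := 0) (n := 1) fun c => (h c).trans ?_
  rw [comul_zero_one, comul_zero_one,
    map_incl_apply hβ.1 (segalApp hZ θ 0 a) (fun c => θ c b) a c, TensorProduct.map_tmul,
    segalApp_zero_unit]

lemma coassoc_one (X : TemplicialModule.{u} k) (m n : ℕ) {a b : X.base} (c d : X.base)
    (x : X.obj (m + n + 1) a b) :
    TensorProduct.assoc k _ _ _ (LinearMap.rTensor (X.obj 1 d b)
      (DirectSum.component k X.base _ c ∘ₗ X.comul m n a d) (X.comul (m + n) 1 a b x d)) =
    LinearMap.lTensor (X.obj m a c) (DirectSum.component k X.base _ d ∘ₗ X.comul n 1 c b)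
      (X.comul m (n + 1) a b x c) :=
  (congrArg (fun y => TensorProduct.assoc k _ _ _ (LinearMap.rTensor (X.obj 1 d b)
      (DirectSum.component k X.base _ c ∘ₗ X.comul m n a d) (X.comul (m + n) 1 a b y d)))
    (X.map_cast_rfl rfl x).symm).trans (X.coassoc m n 1 a b c d x)

/-- The diagram chase behind `comul_segalApp`. There `h` and `h'` are coassociativity in the source
and in the target, while `hG` and `hH` are the compatibilities already known on the two factors. -/
lemma lTensor_eq_of_assoc {A A' B B' D D' U U' V V' : Type*} [AddCommGroup A] [AddCommGroup A']
    [AddCommGroup B] [AddCommGroup B'] [AddCommGroup D] [AddCommGroup D'] [AddCommGroup U]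
    [AddCommGroup U'] [AddCommGroup V] [AddCommGroup V'] [Module k A] [Module k A'] [Module k B]
    [Module k B'] [Module k D] [Module k D'] [Module k U] [Module k U'] [Module k V] [Module k V']
    {α : A →ₗ[k] A'} {β : B →ₗ[k] B'} {δ : D →ₗ[k] D'} {F : U →ₗ[k] U'} {K : V →ₗ[k] V'}
    {G : U →ₗ[k] A ⊗[k] B} {G' : U' →ₗ[k] A' ⊗[k] B'} {H : V →ₗ[k] B ⊗[k] D}
    {H' : V' →ₗ[k] B' ⊗[k] D'} (hG : G' ∘ₗ F = TensorProduct.map α β ∘ₗ G)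
    (hH : H' ∘ₗ K = TensorProduct.map β δ ∘ₗ H) {u : U ⊗[k] D} {v : A ⊗[k] V} {v' : A' ⊗[k] V'}
    (h : TensorProduct.assoc k _ _ _ (LinearMap.rTensor D G u) = LinearMap.lTensor A H v)
    (h' : TensorProduct.assoc k _ _ _ (LinearMap.rTensor D' G' (TensorProduct.map F δ u)) =
      LinearMap.lTensor A' H' v') :
    LinearMap.lTensor A' H' v' = LinearMap.lTensor A' H' (TensorProduct.map α K v) := by
  have e1 : LinearMap.rTensor D' G' ∘ₗ TensorProduct.map F δ =
      TensorProduct.map (TensorProduct.map α β) δ ∘ₗ LinearMap.rTensor D G := by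
    rw [LinearMap.rTensor_comp_map, hG, LinearMap.map_comp_rTensor]
  have e2 : (TensorProduct.assoc k _ _ _).toLinearMap ∘ₗ
      TensorProduct.map (TensorProduct.map α β) δ =
      TensorProduct.map α (TensorProduct.map β δ) ∘ₗ (TensorProduct.assoc k A B D).toLinearMap :=
    TensorProduct.ext_threefold fun _ _ _ => rfl
  have e3 : LinearMap.lTensor A' H' ∘ₗ TensorProduct.map α K =
      TensorProduct.map α (TensorProduct.map β δ) ∘ₗ LinearMap.lTensor A H := by
    rw [LinearMap.lTensor_comp_map, hH, LinearMap.map_comp_lTensor]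
  rw [← h', ← LinearMap.comp_apply (LinearMap.lTensor A' H'), e3, LinearMap.comp_apply, ← h,
    ← LinearMap.comp_apply (LinearMap.rTensor D' G'), e1, LinearMap.comp_apply]
  exact LinearMap.congr_fun e2 _

/-- The construction respects `μ_{n,1}` by definition. For general `μ_{m,n+1}`, by induction, the
second factor is cut further by `μ_{n,1}`. Coassociativity reduces this to the known cases, and the
bijectivity of `μ_{n,1}` in `Z` cancels the extra cut. -/
lemma comul_segalApp (hβ : Function.Bijective β) (hZ : Z.IsSegal) (m n : ℕ) (a b c : X.base)
    (x : X.obj (m + n) a b) :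
    Z.comul m n _ _ (segalApp hZ θ (m + n) a b x) (β c) =
      TensorProduct.map (segalApp hZ θ m a c) (segalApp hZ θ n c b) (X.comul m n a b x c) := by
  induction n generalizing a b c with
  | zero =>
    refine (congrArg (fun s => s (β c)) (Z.comul_right_zero (segalApp hZ θ m a b x))).trans ?_
    rw [X.comul_right_zero]
    refine Eq.trans ?_ (map_incl_apply hβ.1 (segalApp hZ θ m a)
      (fun c => segalApp hZ θ 0 c b) b c _).symm
    rw [TensorProduct.map_tmul]
    exact congrArg (fun z => Z.incl m 0 (β a) (β b) (β b) (segalApp hZ θ m a b x ⊗ₜ z) (β c))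
      (segalApp_zero_unit θ hZ b).symm
  | succ n ih =>
    let e := LinearEquiv.ofBijective _ (hZ n 1 (β c) (β b))
    apply (LinearEquiv.lTensor (Z.obj m (β a) (β c)) e).injective
    rw [← sub_eq_zero, ← map_sub]
    refine eq_zero_of_lTensor_component _ fun d => ?_
    obtain ⟨d, rfl⟩ := hβ.2 d
    rw [map_sub, map_sub, sub_eq_zero]
    have h1 := Z.coassoc_one m n (β c) (β d) (segalApp hZ θ (m + n + 1) a b x)
    rw [comul_segalApp_succ θ hβ] at h1
    have key := lTensor_eq_of_assoc (F := segalApp hZ θ (m + n) a d) (K := segalApp hZ θ (n + 1) c b)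
      (LinearMap.ext fun y => ih a d c y)
      (LinearMap.ext fun y => comul_segalApp_succ θ hβ hZ n c b d y) (X.coassoc_one m n c d x) h1
    rw [LinearMap.lTensor_comp] at key
    exact key

/-- The condition under which a map `X_1 ⟶ Z_1` extends. -/
structure IsSegalData (β : X.base → Z.base) (θ : ∀ a b, X.obj 1 a b →ₗ[k] Z.obj 1 (β a) (β b)) :
    Prop where
  deg (a : X.base) : θ a a (X.deg 1 a) = Z.deg 1 (β a)
  comp (a b : X.base) (x : X.obj 2 a b) (z : Z.obj 2 (β a) (β b))
    (h : ∀ c, Z.comul 1 1 _ _ z (β c) =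
      TensorProduct.map (θ a c) (θ c b) (X.comul 1 1 a b x c)) :
    θ a b (X.map (IntervalMap.ofOne 2) a b x) = Z.map (IntervalMap.ofOne 2) _ _ z

/-! ### Compatibility of the extension with interval maps. -/

section Naturality

/-- Compatibility with an operator. -/
def SegalNatural (hZ : Z.IsSegal) (θ : ∀ a b, X.obj 1 a b →ₗ[k] Z.obj 1 (β a) (β b)) {m n : ℕ}
    (f : IntervalMap m n) : Prop :=
  ∀ a b x, segalApp hZ θ m a b (X.map f a b x) = Z.map f _ _ (segalApp hZ θ n a b x)

variable {θ}

lemma SegalNatural.comp {hZ : Z.IsSegal} {l m n : ℕ} {f : IntervalMap l m} {g : IntervalMap m n}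
    (hf : SegalNatural hZ θ f) (hg : SegalNatural hZ θ g) : SegalNatural hZ θ (f.comp g) := by
  intro a b x
  rw [X.map_comp, Z.map_comp, LinearMap.comp_apply, LinearMap.comp_apply, hf, hg]

lemma SegalNatural.cast (hZ : Z.IsSegal) {m n : ℕ} (h : m = n) :
    SegalNatural hZ θ (IntervalMap.cast h) := by
  subst h
  intro a b x
  rw [map_cast_rfl, map_cast_rfl]

/-- Elements of `Z_{p+q}` are determined by `μ_{p,q}`, and after applying it the claim becomes
naturality along `f` and along `g`. -/
lemma SegalNatural.add (hβ : Function.Bijective β) {hZ : Z.IsSegal} {p q i j : ℕ}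
    {f : IntervalMap p i} {g : IntervalMap q j} (hf : SegalNatural hZ θ f)
    (hg : SegalNatural hZ θ g) : SegalNatural hZ θ (f.add g) := by
  intro a b x
  refine hZ.comul_ext hβ fun c => ?_
  rw [comul_segalApp θ hβ, X.comul_natural, Z.comul_natural, comul_segalApp θ hβ,
    ← LinearMap.comp_apply, ← LinearMap.comp_apply, ← TensorProduct.map_comp,
    ← TensorProduct.map_comp]
  congr 2
  · exact LinearMap.ext fun y => hf a c y
  · exact LinearMap.ext fun y => hg c b y

variable (hβ : Function.Bijective β) (hZ : Z.IsSegal) (hθ : IsSegalData β θ)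

/-- For `n = 2` and `n = 0` these are the two conditions in `IsSegalData`. In general `[1] ⟶ [n +
1]` is `[1] ⟶ [2]` followed by the sum of `[1] ⟶ [n]` and an identity. -/
lemma segalNatural_ofOne (hβ : Function.Bijective β) (hZ : Z.IsSegal) (hθ : IsSegalData β θ)
    (n : ℕ) : SegalNatural hZ θ (IntervalMap.ofOne n) := by
  have h2 : SegalNatural hZ θ (IntervalMap.ofOne 2) := by
    intro a b x
    refine (LinearMap.congr_fun (segalApp_one θ hβ hZ a b) _).trans (hθ.comp a b x _ fun c => ?_)
    refine (comul_segalApp θ hβ hZ 1 1 a b c x).trans ?_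
    rw [segalApp_one θ hβ, segalApp_one θ hβ]
  induction n with
  | zero =>
    intro a b x
    by_cases hab : a = b
    · subst hab
      rw [X.eq_smul_unit x, map_smul, map_smul, map_smul, map_smul]
      congr 1
      refine (LinearMap.congr_fun (segalApp_one θ hβ hZ a a) _).trans ?_
      refine Eq.trans ?_ (congrArg _ (segalApp_zero_unit θ hZ a).symm)
      refine Eq.trans ?_ ((hθ.deg a).trans ?_)
      · exact congrArg (fun f => θ a a (X.map f a a (X.unit a))) (Subsingleton.elim _ _)
      · exact congrArg (fun f => Z.map f _ _ (Z.unit (β a))) (Subsingleton.elim _ _)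
    · have := X.obj_zero_subsingleton a b hab
      rw [Subsingleton.elim x 0, map_zero, map_zero, map_zero, map_zero]
  | succ n ih =>
    have e : IntervalMap.ofOne (n + 1) = (IntervalMap.ofOne 2).comp
        ((IntervalMap.ofOne n).add (IntervalMap.id 1)) := Subsingleton.elim _ _
    rw [e]
    exact h2.comp (ih.add hβ (SegalNatural.cast hZ rfl))

/-- Splitting off the last unit of the source writes every interval map as a sum of maps out of
`[1]`, up to a cast. -/
lemma segalNatural (hβ : Function.Bijective β) (hZ : Z.IsSegal) (hθ : IsSegalData β θ)
    {m n : ℕ} (f : IntervalMap m n) : SegalNatural hZ θ f := by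
  induction m generalizing n with
  | zero =>
    obtain rfl := f.eq_zero_of_zero
    obtain rfl : f = IntervalMap.cast rfl := Subsingleton.elim _ _
    exact SegalNatural.cast hZ rfl
  | succ m ih =>
    obtain ⟨i, j, h, f₁, f₂, hf, -⟩ := f.exists_split
    obtain rfl : f₂ = IntervalMap.ofOne j := Subsingleton.elim _ _
    have : f = (f₁.add (IntervalMap.ofOne j)).comp (IntervalMap.cast h) := hf
    rw [this]
    exact ((ih f₁).add hβ (segalNatural_ofOne hβ hZ hθ j)).comp (SegalNatural.cast hZ h)

end Naturality

/-- The morphism with given values on `X_1`. -/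
noncomputable def segalHom (hβ : Function.Bijective β) (hZ : Z.IsSegal) (hθ : IsSegalData β θ) :
    X ⟶ Z where
  base := β
  app := segalApp hZ θ
  naturality f a b x := segalNatural hβ hZ hθ f a b x
  comul_app m n a b x := by
    refine DFinsupp.ext fun d => ?_
    obtain ⟨c, rfl⟩ := hβ.2 d
    exact (comul_segalApp θ hβ hZ m n a b c x).trans (toModule_lof_apply hβ.1 (segalApp hZ θ m a)
      (fun c => segalApp hZ θ n c b) c _).symm
  counit_app a x := counit_segalApp θ hZ a x

lemma segalHom_app_one (hβ : Function.Bijective β) (hZ : Z.IsSegal) (hθ : IsSegalData β θ)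
    (a b : X.base) : Hom.app (segalHom θ hβ hZ hθ) 1 a b = θ a b :=
  segalApp_one θ hβ hZ a b

end SegalHom

end TemplicialModule

end Templicial

namespace Templicial

open TemplicialModule

namespace TemplicialModule

/-! ### Testing the extension condition on pure tensors. -/

section SegalData

variable {k : Type u} [CommRing k] {X Z : TemplicialModule.{u} k} {β : X.base → Z.base}
  {θ : ∀ a b, X.obj 1 a b →ₗ[k] Z.obj 1 (β a) (β b)}

/-- A sufficient condition for a map `X_1 ⟶ Z_1` to extend, in terms of pure tensors. -/
lemma isSegalData_of_pure (hZ : Z.IsSegal) (hβ : Function.Bijective β)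
    (hdeg : ∀ a, θ a a (X.deg 1 a) = Z.deg 1 (β a))
    (hnull : ∀ a b w, X.comul 1 1 a b w = 0 → θ a b (X.map (IntervalMap.ofOne 2) a b w) = 0)
    (hpure : ∀ a b c (x : X.obj 1 a c) (y : X.obj 1 c b), ∃ w z,
      X.comul 1 1 a b w = X.incl 1 1 a b c (x ⊗ₜ y) ∧
      Z.comul 1 1 _ _ z = Z.incl 1 1 _ _ (β c) (θ a c x ⊗ₜ θ c b y) ∧
      θ a b (X.map (IntervalMap.ofOne 2) a b w) = Z.map (IntervalMap.ofOne 2) _ _ z) :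
    IsSegalData β θ := by
  classical
  refine ⟨hdeg, fun a b x z h => ?_⟩
  let T := DirectSum.toModule k X.base (⨁ d : Z.base, (Z.obj 1 (β a) d ⊗[k] Z.obj 1 d (β b)))
    (fun c => Z.incl 1 1 (β a) (β b) (β c) ∘ₗ TensorProduct.map (θ a c) (θ c b))
  -- Every `t` lifts to some `w` in `X_2`, and its image lifts to `Z_2`, with matching inner faces.
  -- The property is additive in `t`, so pure tensors suffice.
  have key : ∀ t, ∃ w z, X.comul 1 1 a b w = t ∧ Z.comul 1 1 _ _ z = T t ∧
      θ a b (X.map (IntervalMap.ofOne 2) a b w) = Z.map (IntervalMap.ofOne 2) _ _ z := by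
    have hadd : ∀ s t, (∃ w z, X.comul 1 1 a b w = s ∧ Z.comul 1 1 _ _ z = T s ∧
      θ a b (X.map (IntervalMap.ofOne 2) a b w) = Z.map (IntervalMap.ofOne 2) _ _ z) →
      (∃ w z, X.comul 1 1 a b w = t ∧ Z.comul 1 1 _ _ z = T t ∧
      θ a b (X.map (IntervalMap.ofOne 2) a b w) = Z.map (IntervalMap.ofOne 2) _ _ z) →
      (∃ w z, X.comul 1 1 a b w = s + t ∧ Z.comul 1 1 _ _ z = T (s + t) ∧
      θ a b (X.map (IntervalMap.ofOne 2) a b w) = Z.map (IntervalMap.ofOne 2) _ _ z) := by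
      rintro s t ⟨w, z, h1, h2, h3⟩ ⟨w', z', h1', h2', h3'⟩
      exact ⟨w + w', z + z', by rw [map_add, h1, h1'], by rw [map_add, h2, h2', map_add],
        by rw [map_add, map_add, map_add, h3, h3']⟩
    intro t
    induction t using DirectSum.induction_on with
    | zero => exact ⟨0, 0, by simp, by simp, by simp⟩
    | add s t hs ht => exact hadd s t hs ht
    | of c t =>
      change ∃ w z, X.comul 1 1 a b w = X.incl 1 1 a b c t ∧
        Z.comul 1 1 _ _ z = T (X.incl 1 1 a b c t) ∧ _
      have hT : ∀ t, T (X.incl 1 1 a b c t) = Z.incl 1 1 (β a) (β b) (β c)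
        (TensorProduct.map (θ a c) (θ c b) t) := fun t => DirectSum.toModule_lof k _ _
      induction t using TensorProduct.induction_on with
      | zero => exact ⟨0, 0, by simp, by simp, by simp⟩
      | add s t hs ht => rw [map_add]; exact hadd _ _ hs ht
      | tmul x y =>
        obtain ⟨w, z, h1, h2, h3⟩ := hpure a b c x y
        exact ⟨w, z, h1, by rw [hT, TensorProduct.map_tmul]; exact h2, h3⟩
  obtain ⟨w, z', h1, h2, h3⟩ := key (X.comul 1 1 a b x)
  obtain rfl : z' = z := hZ.comul_ext hβ (m := 1) (n := 1) fun c => by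
    refine Eq.trans ?_ (h c).symm
    rw [h2]
    exact toModule_lof_apply hβ.1 (θ a) (fun c => θ c b) c _
  -- The element `x` and the lift `w` have the same comultiplication, and `θ` vanishes on the inner
  -- face of their difference by `hnull`.
  rw [← h3, ← sub_eq_zero, ← map_sub, ← map_sub]
  exact hnull a b _ (by rw [map_sub, h1, sub_self])

end SegalData

end TemplicialModule

/-! ### Morphisms to linear nerves -/

section NerveArrow

variable {C : Type u} [Category.{u} C]

/-- The vertices of the nerve of a category are its objects. -/
abbrev nerveVert (F : ComposableArrows C 0) : C := F.obj 0

/-- A morphism, as a simplex of the nerve. -/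
def arrowSimp {a b : C} (f : a ⟶ b) : Simp (nerve C) nerveVert 1 a b :=
  ⟨ComposableArrows.mk₁ f, rfl, rfl⟩

/-- A composable pair, as a simplex of the nerve. -/
def arrowsSimp {a b c : C} (f : a ⟶ c) (g : c ⟶ b) : Simp (nerve C) nerveVert 2 a b :=
  ⟨ComposableArrows.mk₂ f g, rfl, rfl⟩

lemma exists_arrowSimp {a b : C} (y : Simp (nerve C) nerveVert 1 a b) : ∃ f, y = arrowSimp f := by
  obtain ⟨F, rfl, rfl⟩ := y
  exact ⟨(show ComposableArrows C 1 from F).map' 0 1, Simp.ext (ComposableArrows.ext₁ rfl rfl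
    (((Category.id_comp _).trans (Category.comp_id _)).symm))⟩

/-- A simplex whose edge is `f`. -/
lemma eq_arrowSimp {a b : C} (f : a ⟶ b) (F : ComposableArrows C 1) (h₀ : F.obj 0 = a)
    (h₁ : F.obj 1 = b) (h : F.map (homOfLE (Fin.zero_le 1)) = eqToHom h₀ ≫ f ≫ eqToHom h₁.symm) :
    F = ComposableArrows.mk₁ f := ComposableArrows.ext₁ h₀ h₁ h

lemma arrowsSimp_front {a b c : C} (f : a ⟶ c) (g : c ⟶ b) :
    Simp.front 1 1 (arrowsSimp f g) rfl = arrowSimp f :=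
  Simp.ext (eq_arrowSimp f _ rfl rfl (((Category.id_comp _).trans (Category.comp_id _)).symm))

lemma arrowsSimp_back {a b c : C} (f : a ⟶ c) (g : c ⟶ b) :
    Simp.back 1 1 (arrowsSimp f g) rfl = arrowSimp g :=
  Simp.ext (eq_arrowSimp g _ rfl rfl (((Category.id_comp _).trans (Category.comp_id _)).symm))

lemma arrowsSimp_map {a b c : C} (f : a ⟶ c) (g : c ⟶ b) :
    Simp.map (IntervalMap.ofOne 2) (arrowsSimp f g) = arrowSimp (f ≫ g) :=
  Simp.ext (eq_arrowSimp (f ≫ g) _ rfl rfl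
    (((Category.id_comp _).trans (Category.comp_id _)).symm))

lemma arrowSimp_id (a : C) (y : Simp (nerve C) nerveVert 0 a a) :
    Simp.map (IntervalMap.toZero 1) y = arrowSimp (𝟙 a) := by
  obtain ⟨F, h, h'⟩ := y
  subst h
  exact Simp.ext (eq_arrowSimp (𝟙 _) _ rfl rfl
    (Eq.trans ((show ComposableArrows C 0 from F).map_id _)
      ((Category.id_comp _).trans (Category.comp_id _)).symm))

end NerveArrow

section NerveHom

variable {k : Type u} [CommRing k] (C : LinCat.{u} k) {a b c : C.carrier}

/-- The path of length one. -/
def onePath {D : Type u} (a b : D) : Path D 1 a b := ⟨ComposableArrows.Mk₁.obj a b, rfl, rfl⟩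

lemma eq_onePath {D : Type u} {a b : D} (p : Path D 1 a b) : p = onePath a b := by
  refine Subtype.ext (funext fun i => ?_)
  match i with
  | 0 => exact p.2.1
  | 1 => exact p.2.2

lemma lof_bijective_of_unique {ι : Type*} [DecidableEq ι] (M : ι → Type*)
    [∀ i, AddCommMonoid (M i)] [∀ i, Module k (M i)] (i : ι) (h : ∀ j, j = i) :
    Function.Bijective (DirectSum.lof k ι M i) := by
  refine ⟨DirectSum.of_injective i, fun x => ?_⟩
  induction x using DirectSum.induction_on with
  | zero => exact ⟨0, map_zero _⟩
  | add x y hx hy =>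
    obtain ⟨s, rfl⟩ := hx
    obtain ⟨t, rfl⟩ := hy
    exact ⟨s + t, map_add _ _ _⟩
  | of j t =>
    obtain rfl := h j
    exact ⟨t, rfl⟩

open Classical in
/-- The morphisms of `C` as elements of the first module of the nerve. -/
noncomputable def arrowEquiv (a b : C.carrier) :
    (a ⟶ b) ≃ₗ[k] ((linearNerve k).obj C).obj 1 a b :=
  (PiTensorProduct.subsingletonEquiv (R := k) (s := fun i : Fin 1 =>
      ((onePath a b).1 i.castSucc ⟶ (onePath a b).1 i.succ)) (0 : Fin 1)).symm.trans
    (LinearEquiv.ofBijective (nerveIncl k C.carrier (onePath a b))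
      (lof_bijective_of_unique _ _ eq_onePath))

lemma arrowEquiv_apply (f : a ⟶ b) : arrowEquiv C a b f = nerveGen k (arrowSimp f) := by
  refine congrArg (nerveIncl k C.carrier (onePath a b))
    (Eq.trans (PiTensorProduct.subsingletonEquiv_symm_apply _ _) ?_)
  refine congrArg (PiTensorProduct.tprod k) (funext fun i => ?_)
  obtain rfl : i = 0 := Subsingleton.elim _ _
  rfl

lemma exists_comul_arrow (f : a ⟶ c) (g : c ⟶ b) :
    ∃ z, ((linearNerve k).obj C).comul 1 1 a b z = ((linearNerve k).obj C).incl 1 1 a b c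
      (arrowEquiv C a c f ⊗ₜ arrowEquiv C c b g) ∧
      ((linearNerve k).obj C).map (IntervalMap.ofOne 2) a b z = arrowEquiv C a b (f ≫ g) := by
  refine ⟨nerveGen k (arrowsSimp f g), (nerveComul_gen k 1 1 a b _).trans ?_,
    (nerveOp_gen k _ a b _).trans ?_⟩
  · rw [arrowEquiv_apply, arrowEquiv_apply]
    exact congrArg _ (congrArg₂ _ (congrArg _ (arrowsSimp_front f g))
      (congrArg _ (arrowsSimp_back f g)))
  · rw [arrowEquiv_apply]
    exact congrArg _ (arrowsSimp_map f g)

lemma arrowEquiv_id (a : C.carrier) :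
    arrowEquiv C a a (𝟙 a) = ((linearNerve k).obj C).deg 1 a := by
  let y : Simp (nerve C.carrier) nerveVert 0 a a := ⟨ComposableArrows.mk₀ a, rfl, rfl⟩
  have h : nerveGen k y = ((linearNerve k).obj C).unit a :=
    ((linearNerve k).obj C).eq_unit (nerveCounit_gen k a y)
  rw [arrowEquiv_apply]
  refine Eq.trans ?_ (congrArg (((linearNerve k).obj C).map (IntervalMap.toZero 1) a a) h)
  exact ((nerveOp_gen k _ a a y).trans (congrArg _ (arrowSimp_id a y))).symm

lemma linearNerve_map_arrowEquiv {C D : LinCat.{u} k} (H : C ⟶ D) {a b : C.carrier} (f : a ⟶ b) :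
    Hom.app ((linearNerve k).map H) 1 a b (arrowEquiv C a b f) =
      arrowEquiv D (H.functor.obj a) (H.functor.obj b) (H.functor.map f) := by
  rw [arrowEquiv_apply, arrowEquiv_apply]
  refine (nerveApp_gen H 1 a b (arrowSimp f)).trans (congrArg _ ?_)
  exact Simp.ext (eq_arrowSimp (H.functor.map f) _ rfl rfl
    (((Category.id_comp _).trans (Category.comp_id _)).symm))

variable {X : TemplicialModule.{u} k} {C}

/-- Linear maps `X_1(a, b) ⟶ C(β a, β b)` compatible with degenerate edges and with the
compositions given by elements of `X_2`. -/
structure IsNerveData (β : X.base → C.carrier) (θ : ∀ a b, X.obj 1 a b →ₗ[k] (β a ⟶ β b)) :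
    Prop where
  deg (a : X.base) : θ a a (X.deg 1 a) = 𝟙 (β a)
  comp (a b c : X.base) (x : X.obj 1 a c) (y : X.obj 1 c b) (w : X.obj 2 a b)
    (h : X.comul 1 1 a b w = X.incl 1 1 a b c (x ⊗ₜ y)) :
    θ a b (X.map (IntervalMap.ofOne 2) a b w) = θ a c x ≫ θ c b y

/-- Any two composable elements of `X_1` have a composite. -/
def TemplicialModule.HasComposites (X : TemplicialModule.{u} k) : Prop :=
  ∀ (a b c : X.base) (x : X.obj 1 a c) (y : X.obj 1 c b),
    ∃ w, X.comul 1 1 a b w = X.incl 1 1 a b c (x ⊗ₜ y)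

/-- The full subcategory spanned by a family of objects. -/
def LinCat.induced {S : Type u} (C : LinCat.{u} k) (β : S → C.carrier) : LinCat.{u} k where
  carrier := InducedCategory C.carrier β

/-- The inclusion of a full subcategory. -/
def LinCat.inducedHom {S : Type u} (C : LinCat.{u} k) (β : S → C.carrier) : C.induced β ⟶ C :=
  ⟨inducedFunctor β, inferInstanceAs (inducedFunctor (D := C.carrier) β).Additive,
    inferInstanceAs ((inducedFunctor (D := C.carrier) β).Linear k)⟩

/-- The morphisms of a full subcategory. -/
def inducedHomEquiv {S : Type u} (C : LinCat.{u} k) (β : S → C.carrier)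
    (a b : (C.induced β).carrier) :
    ((C.inducedHom β).functor.obj a ⟶ (C.inducedHom β).functor.obj b) ≃ₗ[k] (a ⟶ b) where
  toFun f := InducedCategory.homMk (F := β) f
  invFun f := InducedCategory.Hom.hom (F := β) f
  map_add' _ _ := rfl
  map_smul' _ _ := rfl

/-- The morphisms of a full subcategory, as elements of its nerve. -/
noncomputable def inducedEquiv {S : Type u} (C : LinCat.{u} k) (β : S → C.carrier)
    (a b : (C.induced β).carrier) :
    ((C.inducedHom β).functor.obj a ⟶ (C.inducedHom β).functor.obj b) ≃ₗ[k]
      ((linearNerve k).obj (C.induced β)).obj 1 a b :=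
  (inducedHomEquiv C β a b).trans (arrowEquiv (C.induced β) a b)

variable {β : X.base → C.carrier} {θ : ∀ a b, X.obj 1 a b →ₗ[k] (β a ⟶ β b)}

/-- The map `X_1 ⟶ N_k(C)_1` in the full subcategory spanned by `β`. -/
noncomputable def inducedTheta (θ : ∀ a b, X.obj 1 a b →ₗ[k] (β a ⟶ β b)) (a b : X.base) :
    X.obj 1 a b →ₗ[k] ((linearNerve k).obj (C.induced β)).obj 1 a b :=
  (inducedEquiv C β a b).toLinearMap ∘ₗ θ a b

/-- The passage to the full subcategory on the family `β` makes the base map the identity, hence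
bijective as `segalHom` requires, even when `β` is not. -/
lemma IsNerveData.isSegalData (hX : X.HasComposites) (h : IsNerveData β θ) :
    IsSegalData (X := X) (Z := (linearNerve k).obj (C.induced β)) (fun a => a)
      (inducedTheta θ) := by
  refine isSegalData_of_pure (X := X) (isSegal_linearNerve k _) Function.bijective_id
    (fun a => ?_) (fun a b w hw => ?_) (fun a b c x y => ?_)
  · refine Eq.trans ?_ (arrowEquiv_id (C.induced β) a)
    exact congrArg (arrowEquiv (C.induced β) a a) (InducedCategory.hom_ext (h.deg a))
  -- An element with zero comultiplication witnesses the composite of two zero morphisms.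
  · exact (congrArg (inducedEquiv C β a b) ((h.comp a b a 0 0 w (hw.trans (by simp))).trans
      (show θ a a 0 ≫ θ a b 0 = 0 by rw [map_zero, Limits.zero_comp]))).trans
      (map_zero _)
  · obtain ⟨w, h1⟩ := hX a b c x y
    obtain ⟨z, h3, h4⟩ := exists_comul_arrow (C.induced β) (a := a) (b := b) (c := c)
      (InducedCategory.homMk (θ a c x)) (InducedCategory.homMk (θ c b y))
    refine ⟨w, z, h1, h3, Eq.trans ?_ h4.symm⟩
    exact congrArg (inducedEquiv C β a b) (h.comp a b c x y w h1)

/-- The morphism to the linear nerve with given values on `X_1`. -/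
noncomputable def nerveHom (hX : X.HasComposites) (h : IsNerveData β θ) : X ⟶ (linearNerve k).obj C :=
  segalHom (inducedTheta θ) Function.bijective_id (isSegal_linearNerve k (C.induced β))
    (h.isSegalData hX) ≫ (linearNerve k).map (C.inducedHom β)

lemma nerveHom_app_one (hX : X.HasComposites) (h : IsNerveData β θ) {a b : X.base} (x : X.obj 1 a b) :
    Hom.app (nerveHom hX h) 1 a b x = arrowEquiv C (β a) (β b) (θ a b x) := by
  refine Eq.trans (congrArg (Hom.app ((linearNerve k).map (C.inducedHom β)) 1 a b)
    (LinearMap.congr_fun (segalHom_app_one (inducedTheta θ) Function.bijective_id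
      (isSegal_linearNerve k (C.induced β)) (h.isSegalData hX) a b) x)) ?_
  exact linearNerve_map_arrowEquiv (C.inducedHom β) (a := a) (b := b) _

/-- The objects given by a morphism to the linear nerve. -/
noncomputable def nerveObj (φ : X ⟶ (linearNerve k).obj C) (a : X.base) : C.carrier := Hom.base φ a

/-- The morphisms given by a morphism to the linear nerve. -/
noncomputable def nerveVal (φ : X ⟶ (linearNerve k).obj C) (a b : X.base) :
    X.obj 1 a b →ₗ[k] (nerveObj φ a ⟶ nerveObj φ b) :=
  (arrowEquiv C (nerveObj φ a) (nerveObj φ b)).symm.toLinearMap ∘ₗ Hom.app φ 1 a b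

lemma arrowEquiv_nerveVal (φ : X ⟶ (linearNerve k).obj C) {a b : X.base} (x : X.obj 1 a b) :
    arrowEquiv C (nerveObj φ a) (nerveObj φ b) (nerveVal φ a b x) = Hom.app φ 1 a b x :=
  (arrowEquiv C (nerveObj φ a) (nerveObj φ b)).apply_symm_apply _

lemma nerveVal_eq {φ : X ⟶ (linearNerve k).obj C} {a b : X.base} {x : X.obj 1 a b}
    {f : nerveObj φ a ⟶ nerveObj φ b}
    (h : Hom.app φ 1 a b x = arrowEquiv C (nerveObj φ a) (nerveObj φ b) f) :
    nerveVal φ a b x = f :=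
  (arrowEquiv C (nerveObj φ a) (nerveObj φ b)).symm_apply_eq.2 h

/-- By the Segal condition `z` is the element given by the composable pair, whose inner face is the
composite. -/
lemma map_of_comul_arrow (f : a ⟶ c) (g : c ⟶ b) {z : ((linearNerve k).obj C).obj 2 a b}
    (h : ((linearNerve k).obj C).comul 1 1 a b z = ((linearNerve k).obj C).incl 1 1 a b c
      (arrowEquiv C a c f ⊗ₜ arrowEquiv C c b g)) :
    ((linearNerve k).obj C).map (IntervalMap.ofOne 2) a b z = arrowEquiv C a b (f ≫ g) := by
  obtain ⟨z', h1, h2⟩ := exists_comul_arrow C f g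
  rw [← h2, (isSegal_linearNerve k C 1 1 a b).1 (h.trans h1.symm)]

lemma isNerveData_nerveVal (φ : X ⟶ (linearNerve k).obj C) :
    IsNerveData (nerveObj φ) (nerveVal φ) where
  deg a := nerveVal_eq ((Hom.app_deg φ 1 a).trans (arrowEquiv_id C (nerveObj φ a)).symm)
  comp a b c x y w h := by
    refine nerveVal_eq ((Hom.naturality φ _ _ _ w).trans (map_of_comul_arrow _ _ ?_))
    refine (Hom.comul_app_of_incl φ h).trans (congrArg _ ?_)
    refine (TensorProduct.map_tmul _ _ _ _).trans ?_
    exact congrArg₂ _ (arrowEquiv_nerveVal φ x).symm (arrowEquiv_nerveVal φ y).symm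

lemma nerveVal_nerveHom (hX : X.HasComposites) (h : IsNerveData β θ) {a b : X.base}
    (x : X.obj 1 a b) : nerveVal (nerveHom hX h) a b x = θ a b x :=
  nerveVal_eq (nerveHom_app_one hX h x)

lemma nerveVal_comp {D : LinCat.{u} k} (φ : X ⟶ (linearNerve k).obj C) (G : C ⟶ D) {a b : X.base}
    (x : X.obj 1 a b) :
    nerveVal (φ ≫ (linearNerve k).map G) a b x = G.functor.map (nerveVal φ a b x) :=
  nerveVal_eq ((congrArg (Hom.app ((linearNerve k).map G) 1 (nerveObj φ a) (nerveObj φ b))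
    (arrowEquiv_nerveVal φ x).symm).trans (linearNerve_map_arrowEquiv G _))

lemma nerveVal_precomp {X' : TemplicialModule.{u} k} (f : X' ⟶ X) (φ : X ⟶ (linearNerve k).obj C)
    {a b : X'.base} (x : X'.obj 1 a b) :
    nerveVal (f ≫ φ) a b x = nerveVal φ (Hom.base f a) (Hom.base f b) (Hom.app f 1 a b x) := rfl

lemma arrowEquiv_eqToHom {a a' b b' : C.carrier} (ha : a' = a) (hb : b = b') (f : a ⟶ b) :
    arrowEquiv C a' b' (eqToHom ha ≫ f ≫ eqToHom hb) =
      ((linearNerve k).obj C).tr ha.symm hb (arrowEquiv C a b f) := by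
  subst ha hb
  refine congrArg (arrowEquiv C a' b) ?_
  simp

/-- A morphism to a linear nerve is determined by the objects and morphisms which it gives. -/
lemma nerveHom_ext {φ ψ : X ⟶ (linearNerve k).obj C} (hb : ∀ a, nerveObj φ a = nerveObj ψ a)
    (h : ∀ a b (x : X.obj 1 a b),
      nerveVal ψ a b x = eqToHom (hb a).symm ≫ nerveVal φ a b x ≫ eqToHom (hb b)) : φ = ψ := by
  refine (isSegal_linearNerve k C).hom_ext hb fun a b x => ?_
  refine (congrArg (((linearNerve k).obj C).tr (hb a) (hb b)) (arrowEquiv_nerveVal φ x)).symm.trans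
    (Eq.trans ?_ (arrowEquiv_nerveVal ψ x))
  rw [h]
  exact (arrowEquiv_eqToHom (hb a).symm (hb b) _).symm

end NerveHom

end Templicial

namespace Templicial

open TemplicialModule

/-! ### The linear homotopy category is left adjoint to the linear nerve -/

section LinearHomotopyAdjunction

variable {k : Type u} [CommRing k] {X X' : TemplicialModule.{u} k} {C D : LinCat.{u} k}

/-- The edge with a given value. -/
noncomputable def edgeOf {a b : X.base} (v : X.obj 1 a b) :
    SSet.Edge (vertexOf a : (underlying.obj X) _⦋0⦌) (vertexOf b) :=
  (edgeValue_surjective (x := vertexOf a) (y := vertexOf b) v).choose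

lemma edgeValue_edgeOf {a b : X.base} (v : X.obj 1 a b) : edgeValue (edgeOf v) = v :=
  (edgeValue_surjective (x := vertexOf a) (y := vertexOf b) v).choose_spec

variable {x y z : (underlying.obj X) _⦋0⦌} [SSet.Quasicategory (underlying.obj X)]

/-- Composable edges of `Ũ(X)` have a composite in the homotopy category, and the triangle
exhibiting it has the required value. -/
lemma hasComposites_of_quasicategory : X.HasComposites := by
  intro a b c v w
  obtain ⟨t, e, h, -, -⟩ := exists_edgeClass_comp (edgeOf v) (edgeOf w)
  rw [edgeValue_edgeOf, edgeValue_edgeOf] at h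
  exact ⟨t, h⟩

section NerveData

variable {β : X.base → C.carrier} {θ : ∀ a b, X.obj 1 a b →ₗ[k] (β a ⟶ β b)}

/-- Homotopic edges differ by the inner face of an element with zero comultiplication, and `θ` sends
such a face to a composite of zeros. -/
lemma IsNerveData.congr (h : IsNerveData β θ) {e e' : SSet.Edge x y}
    (he : edgeClass e = edgeClass e') : θ _ _ (edgeValue e) = θ _ _ (edgeValue e') := by
  obtain ⟨w, hw, hw'⟩ := (edgeClass_eq_iff e e').1 he
  rw [← sub_eq_zero, ← map_sub, ← hw', h.comp _ _ (vertexBase x) 0 0 w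
    ((show X.comul 1 1 _ _ w = 0 from hw).trans (by simp)), map_zero, Limits.zero_comp]

/-- The morphism of `C` given by a homotopy class of edges. -/
noncomputable def classArrow (θ : ∀ a b, X.obj 1 a b →ₗ[k] (β a ⟶ β b))
    (f : (⟨x⟩ : HoCat (underlying.obj X)) ⟶ ⟨y⟩) : β (vertexBase x) ⟶ β (vertexBase y) :=
  θ _ _ (edgeValue (edgeClass_surjective f).choose)

lemma classArrow_edgeClass (h : IsNerveData β θ) (e : SSet.Edge x y) :
    classArrow θ (edgeClass e) = θ _ _ (edgeValue e) :=
  h.congr (edgeClass_surjective (edgeClass e)).choose_spec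

lemma classArrow_id (h : IsNerveData β θ) (x : (underlying.obj X) _⦋0⦌) :
    classArrow θ (𝟙 (⟨x⟩ : HoCat (underlying.obj X))) = 𝟙 (β (vertexBase x)) := by
  refine (classArrow_edgeClass h (SSet.Edge.id x)).trans ?_
  rw [edgeValue_id, h.deg]

lemma classArrow_comp (h : IsNerveData β θ) (f : (⟨x⟩ : HoCat (underlying.obj X)) ⟶ ⟨y⟩)
    (g : (⟨y⟩ : HoCat (underlying.obj X)) ⟶ ⟨z⟩) :
    classArrow θ (f ≫ g) = classArrow θ f ≫ classArrow θ g := by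
  obtain ⟨e, rfl⟩ := edgeClass_surjective f
  obtain ⟨e', rfl⟩ := edgeClass_surjective g
  obtain ⟨w, e'', h1, h2, h3⟩ := exists_edgeClass_comp e e'
  rw [h3, classArrow_edgeClass h, classArrow_edgeClass h, classArrow_edgeClass h, ← h2,
    h.comp _ _ _ _ _ w h1]

lemma classArrow_add (h : IsNerveData β θ) (f g : (⟨x⟩ : HoCat (underlying.obj X)) ⟶ ⟨y⟩) :
    classArrow θ (f + g) = classArrow θ f + classArrow θ g := by
  obtain ⟨e, rfl⟩ := edgeClass_surjective f
  obtain ⟨e', rfl⟩ := edgeClass_surjective g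
  obtain ⟨s, hs⟩ := edgeValue_surjective (edgeValue e + edgeValue e')
  rw [← edgeClass_add hs, classArrow_edgeClass h, classArrow_edgeClass h, classArrow_edgeClass h,
    hs, map_add]

lemma classArrow_smul (h : IsNerveData β θ) (r : k)
    (f : (⟨x⟩ : HoCat (underlying.obj X)) ⟶ ⟨y⟩) :
    classArrow θ (r • f) = r • classArrow θ f := by
  obtain ⟨e, rfl⟩ := edgeClass_surjective f
  obtain ⟨s, hs⟩ := edgeValue_surjective (r • edgeValue e)
  rw [← edgeClass_smul hs, classArrow_edgeClass h, classArrow_edgeClass h, hs, map_smul]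

end NerveData

variable (X) in
/-- The homotopy category of `Ũ(X)`, as a linear category. -/
noncomputable abbrev hoLin : LinCat.{u} k := { carrier := HoCat (underlying.obj X) }

/-- The linear functor adjoint to a morphism to the linear nerve. -/
noncomputable def nerveAdj (φ : X ⟶ (linearNerve k).obj C) : hoLin X ⟶ C where
  functor :=
    { obj x := nerveObj φ (vertexBase x.pt)
      map {x y} f := classArrow (x := x.pt) (y := y.pt) (nerveVal φ) f
      map_id x := classArrow_id (isNerveData_nerveVal φ) x.pt
      map_comp f g := classArrow_comp (isNerveData_nerveVal φ) f g }
  additive := { map_add := classArrow_add (isNerveData_nerveVal φ) _ _ }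
  linear := { map_smul f r := classArrow_smul (isNerveData_nerveVal φ) r f }

lemma nerveAdj_map (φ : X ⟶ (linearNerve k).obj C) (e : SSet.Edge x y) :
    (nerveAdj φ).functor.map (edgeClass e : (⟨x⟩ : HoCat (underlying.obj X)) ⟶ ⟨y⟩) =
      nerveVal φ (vertexBase x) (vertexBase y) (edgeValue e) :=
  classArrow_edgeClass (isNerveData_nerveVal φ) e

lemma hoLin_hom_ext {F G : hoLin X ⟶ C} (h : ∀ a, F.functor.obj a = G.functor.obj a)
    (h' : ∀ (x y : (underlying.obj X) _⦋0⦌) (e : SSet.Edge x y),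
      HEq (F.functor.map (edgeClass e : (⟨x⟩ : HoCat (underlying.obj X)) ⟶ ⟨y⟩))
        (G.functor.map (edgeClass e : (⟨x⟩ : HoCat (underlying.obj X)) ⟶ ⟨y⟩))) : F = G := by
  refine LinCat.Hom.ext (CategoryTheory.Functor.hext h ?_)
  rintro ⟨x⟩ ⟨y⟩ f
  obtain ⟨e, rfl⟩ := edgeClass_surjective (X := X) f
  exact h' x y e

lemma nerveAdj_comp (φ : X ⟶ (linearNerve k).obj C) (G : C ⟶ D) :
    nerveAdj (φ ≫ (linearNerve k).map G) = nerveAdj φ ≫ G := by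
  refine hoLin_hom_ext (fun _ => rfl) fun x y e => heq_of_eq ?_
  exact (nerveAdj_map _ e).trans ((nerveVal_comp φ G _).trans
    (congrArg G.functor.map (nerveAdj_map φ e)).symm)

lemma nerveAdj_precomp [SSet.Quasicategory (underlying.obj X')] (f : X' ⟶ X)
    (φ : X ⟶ (linearNerve k).obj C) :
    nerveAdj (f ≫ φ) = (⟨hoMap (underlying.map f), hoMap_additive f, hoMap_linear f⟩ :
      hoLin X' ⟶ hoLin X) ≫ nerveAdj φ := by
  refine hoLin_hom_ext (fun _ => rfl) fun x y e => heq_of_eq ?_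
  refine (nerveAdj_map _ e).trans (Eq.trans ?_ (nerveAdj_map φ (e.map (underlying.map f))).symm)
  exact congrArg (nerveVal φ _ _) (edgeValue_map f e).symm

/-- Every element of `X_1` is the value of an edge, so the functor remembers all the morphisms that
determine `φ` (`nerveHom_ext`). -/
lemma nerveAdj_injective :
    Function.Injective (nerveAdj : (X ⟶ (linearNerve k).obj C) → (hoLin X ⟶ C)) := by
  intro φ ψ h
  have key : ∀ (χ : X ⟶ (linearNerve k).obj C) {a b : X.base} (v : X.obj 1 a b),
      (nerveAdj χ).functor.map (edgeClass (edgeOf v) :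
        (⟨vertexOf a⟩ : HoCat (underlying.obj X)) ⟶ ⟨vertexOf b⟩) = nerveVal χ a b v :=
    fun χ a b v => (nerveAdj_map χ (edgeOf v)).trans
      (congrArg (nerveVal χ a b) (edgeValue_edgeOf v))
  refine nerveHom_ext (fun a => congrArg (fun F : hoLin X ⟶ C => F.functor.obj ⟨vertexOf a⟩) h)
    fun a b v => ?_
  refine (key ψ v).symm.trans (Eq.trans ?_ (congrArg (fun f => _ ≫ f ≫ _) (key φ v)))
  exact CategoryTheory.Functor.congr_hom (congrArg LinCat.Hom.functor h.symm) _

/-- The linear map `X_1 ⟶ C` given by a functor on the homotopy category. -/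
noncomputable def hoTheta (F : hoLin X ⟶ C) (a b : X.base) :
    X.obj 1 a b →ₗ[k] (F.functor.obj ⟨vertexOf a⟩ ⟶ F.functor.obj ⟨vertexOf b⟩) where
  toFun v := F.functor.map (edgeClass (edgeOf v))
  map_add' v w := by
    have := F.additive
    refine Eq.trans (congrArg F.functor.map (edgeClass_add ?_)) F.functor.map_add
    rw [edgeValue_edgeOf, edgeValue_edgeOf, edgeValue_edgeOf]
    rfl
  map_smul' r v := by
    have := F.linear
    refine Eq.trans (congrArg F.functor.map (edgeClass_smul ?_)) (F.functor.map_smul r _)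
    rw [edgeValue_edgeOf, edgeValue_edgeOf]
    rfl

lemma isNerveData_hoTheta (F : hoLin X ⟶ C) : IsNerveData _ (hoTheta F) where
  deg a := by
    refine Eq.trans (congrArg F.functor.map ?_) (F.functor.map_id _)
    refine Eq.trans (congrArg edgeClass (edgeValue_injective ?_)) (edgeClass_id (vertexOf a))
    exact (edgeValue_edgeOf _).trans (edgeValue_id (vertexOf a)).symm
  comp a b c v w t h := by
    refine Eq.trans (congrArg F.functor.map ?_) (F.functor.map_comp _ _)
    refine ((edgeClass_comp_eq_iff (edgeOf v) (edgeOf w) _).2 ⟨t, ?_, ?_⟩).symm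
    · rw [edgeValue_edgeOf, edgeValue_edgeOf]
      exact h
    · rw [edgeValue_edgeOf]
      rfl

lemma nerveAdj_surjective :
    Function.Surjective (nerveAdj : (X ⟶ (linearNerve k).obj C) → (hoLin X ⟶ C)) := by
  intro F
  refine ⟨nerveHom hasComposites_of_quasicategory (isNerveData_hoTheta F),
    hoLin_hom_ext ?_ fun x y e => ?_⟩
  · rintro ⟨x⟩
    exact congrArg (fun x => F.functor.obj ⟨x⟩) (vertexOf_vertexBase x)
  -- Writing the vertices as `vertexOf` makes the two sides have the same type, so that an honest
  -- equality can be proved.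
  · obtain ⟨a, rfl⟩ : ∃ a, vertexOf a = x := ⟨_, vertexOf_vertexBase x⟩
    obtain ⟨b, rfl⟩ : ∃ b, vertexOf b = y := ⟨_, vertexOf_vertexBase y⟩
    refine heq_of_eq ((nerveAdj_map _ e).trans ?_)
    refine (nerveVal_nerveHom hasComposites_of_quasicategory (isNerveData_hoTheta F) _).trans ?_
    exact congrArg F.functor.map (congrArg edgeClass
      (edgeValue_injective (edgeValue_edgeOf _)))

end LinearHomotopyAdjunction

/-- The bijection on morphisms of the adjunction between `h_k` and `N_k`. -/
noncomputable def nerveAdjEquiv {k : Type u} [CommRing k] (hU : UnderlyingPreserves.{u} k)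
    (hN : NervePreserves.{u} k) (X : LinQCat.{u} k) (C : LinCat.{u} k) :
    (X ⟶ (linearNerveQCat hN).obj C) ≃ ((linearHomotopyStructure hU).functor.obj X ⟶ C) :=
  haveI : SSet.Quasicategory (underlying.obj X.obj) := hU X.obj X.property
  { toFun φ := nerveAdj (X := X.obj) (C := C) φ.hom
    invFun F := ObjectProperty.homMk
      ((Equiv.ofBijective _ ⟨nerveAdj_injective, nerveAdj_surjective⟩).symm F)
    left_inv _ := InducedCategory.hom_ext (Equiv.ofBijective_symm_apply_apply _ _ _)
    right_inv _ := Equiv.ofBijective_apply_symm_apply _ _ _ }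

/-- The linear homotopy functor is left adjoint to the linear nerve. -/
noncomputable def linearHomotopyAdjunction {k : Type u} [CommRing k]
    (hU : UnderlyingPreserves.{u} k) (hN : NervePreserves.{u} k) :
    (linearHomotopyStructure hU).functor ⊣ linearNerveQCat hN :=
  haveI (X : LinQCat.{u} k) : SSet.Quasicategory (underlying.obj X.obj) := hU X.obj X.property
  Adjunction.mkOfHomEquiv
    { homEquiv X C := (nerveAdjEquiv hU hN X C).symm
      homEquiv_naturality_left_symm f g := nerveAdj_precomp f.hom g.hom
      homEquiv_naturality_right {X C D} f g := by
        obtain ⟨f, rfl⟩ := (nerveAdjEquiv hU hN X C).surjective f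
        rw [Equiv.symm_apply_eq, Equiv.symm_apply_apply]
        exact (nerveAdj_comp f.hom g).symm }

end Templicial

namespace Templicial

/-! ### The remaining adjunctions -/

section

variable (k : Type u) [CommRing k]

/-! ### The adjunction between free linear categories and the forgetful functor. -/

section FreeForget

variable (C : Type u) [Category.{u} C] {C' : Type u} [Category.{u} C'] (D : LinCat.{u} k)

/-- Linear functors on a free linear category. -/
noncomputable def LinCat.freeEquiv :
    (({ carrier := CategoryTheory.Free k C } : LinCat.{u} k) ⟶ D) ≃ (C ⥤ D.carrier) where
  toFun F := (Free.embedding k C).comp (show CategoryTheory.Free k C ⥤ D.carrier from F.functor)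
  invFun F :=
    ⟨Free.lift (C := C) (D := D.carrier) k F, Free.lift_additive k _, Free.lift_linear k _⟩
  left_inv F := by
    have := F.additive
    have := F.linear
    exact LinCat.Hom.ext (LinCat.free_functor_ext (C := C) (D := D.carrier) _ F.functor
      (LinCat.embedding_comp_lift _))
  right_inv F := LinCat.embedding_comp_lift F

end FreeForget

/-- The free linear category functor is left adjoint to the forgetful functor. -/
noncomputable def LinCat.freeForgetAdjunction : LinCat.free k ⊣ LinCat.forget k :=
  Adjunction.mkOfHomEquiv
    { homEquiv C D := (LinCat.freeEquiv k C D).trans (Cat.Hom.equivFunctor C (Cat.of D.carrier)).symm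
      homEquiv_naturality_left_symm {C C' D} f g := by
        refine (LinCat.freeEquiv k C D).injective ?_
        refine ((LinCat.freeEquiv k C D).apply_symm_apply _).trans ?_
        symm
        change (Functor.comp (D := CategoryTheory.Free k C) (Free.embedding k C)
          (Free.lift k (f.toFunctor ⋙ Free.embedding k C'))) ⋙
          Free.lift (D := D.carrier) k g.toFunctor = _
        rw [LinCat.embedding_comp_lift]
        exact congrArg (f.toFunctor ⋙ ·)
          (LinCat.embedding_comp_lift (C := C') (show C' ⥤ D.carrier from g.toFunctor))
      homEquiv_naturality_right {C D D'} f g := rfl }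

variable {k}

/-- The adjunction between `F̃` and `Ũ` on quasi-categories. -/
noncomputable def freeQCatAdjunction (hF : FreePreserves.{u} k) (hU : UnderlyingPreserves.{u} k) :
    freeQCat hF ⊣ underlyingQCat hU :=
  freeAdjunction.restrictFullyFaithful (ObjectProperty.fullyFaithfulι _)
    (ObjectProperty.fullyFaithfulι _) (Iso.refl _) (Iso.refl _)

end

/-! ### Two models of the homotopy category of a quasi-category. -/

section HoCat

variable (X : SSet.{u}) [SSet.Quasicategory X]

/-- The comparison from the homotopy category as a quotient of a free category. -/
noncomputable def ofHoFunctor :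
    ((SSet.truncation 2).obj X).HomotopyCategory ⥤ HoCat X :=
  SSet.Truncated.HomotopyCategory.lift (fun x => ⟨x⟩)
    (fun e => SSet.Truncated.HomotopyCategory₂.homMk e) (fun _ => rfl)
    (fun h => h.homotopyCategory₂_fac)

lemma ofHoFunctor_map {x y : ((SSet.truncation 2).obj X).obj _} (e : SSet.Truncated.Edge x y) :
    (ofHoFunctor X).map (SSet.Truncated.HomotopyCategory.homMk e) =
      SSet.Truncated.HomotopyCategory₂.homMk e :=
  SSet.Truncated.HomotopyCategory.lift_map_homMk _ _ _ (fun h => h.homotopyCategory₂_fac) e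

/-- The comparison to the homotopy category as a quotient of a free category. -/
noncomputable def toHoFunctor :
    HoCat X ⥤ ((SSet.truncation 2).obj X).HomotopyCategory where
  obj x := SSet.Truncated.HomotopyCategory.mk x.pt
  map {x y} := Quotient.lift (fun e => SSet.Truncated.HomotopyCategory.homMk e) (by
    rintro e e' ⟨s⟩
    -- A homotopy is a triangle with an identity as second edge, so it yields the relation `e ≫ 𝟙 =
    -- e'`.
    refine Eq.trans ?_ (SSet.Truncated.HomotopyCategory.homMk_comp_homMk s)
    rw [SSet.Truncated.HomotopyCategory.homMk_id, Category.comp_id])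
  map_id x := SSet.Truncated.HomotopyCategory.homMk_id x.pt
  map_comp {x y z} f g := by
    obtain ⟨e, rfl⟩ := SSet.Truncated.HomotopyCategory₂.homMk_surjective f
    obtain ⟨e', rfl⟩ := SSet.Truncated.HomotopyCategory₂.homMk_surjective g
    exact (SSet.Truncated.HomotopyCategory.homMk_comp_homMk
      (SSet.Truncated.Edge.compStruct e e')).symm

lemma toHoFunctor_comp_ofHoFunctor : toHoFunctor X ⋙ ofHoFunctor X = 𝟭 _ := by
  refine CategoryTheory.Functor.hext (fun _ => rfl) ?_
  rintro x y ⟨e⟩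
  exact heq_of_eq (ofHoFunctor_map X e)

lemma ofHoFunctor_comp_toHoFunctor : ofHoFunctor X ⋙ toHoFunctor X = 𝟭 _ := by
  refine SSet.Truncated.HomotopyCategory.functor_ext (fun _ => rfl) fun x y e => ?_
  refine Eq.trans ?_ ((Category.id_comp _).trans (Category.comp_id _)).symm
  exact congrArg (toHoFunctor X).map (ofHoFunctor_map X e)

/-- The two constructions of the homotopy category of a quasi-category agree. -/
noncomputable def hoFunctorIso : SSet.hoFunctor.obj X ≅ Cat.of (HoCat X) where
  hom := (ofHoFunctor X).toCatHom
  inv := (toHoFunctor X).toCatHom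
  hom_inv_id := congrArg Functor.toCatHom (ofHoFunctor_comp_toHoFunctor X)
  inv_hom_id := congrArg Functor.toCatHom (toHoFunctor_comp_ofHoFunctor X)

end HoCat

/-- The homotopy category functor agrees with Mathlib's `SSet.hoFunctor`. -/
noncomputable def homotopyCategoryIso :
    ObjectProperty.ι _ ⋙ SSet.hoFunctor ≅ homotopyCategory.{u} :=
  NatIso.ofComponents (fun X => hoFunctorIso X.obj) fun {X Y} φ => congrArg Functor.toCatHom (by
    refine SSet.Truncated.HomotopyCategory.functor_ext (fun _ => rfl) fun x y e => ?_
    refine Eq.trans ?_ ((Category.id_comp _).trans (Category.comp_id _)).symm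
    refine (ofHoFunctor_map Y.obj _).trans ?_
    exact (congrArg (hoMap φ.hom).map (ofHoFunctor_map X.obj e)).symm)

/-- The homotopy category functor is left adjoint to the nerve. -/
noncomputable def homotopyCategoryAdjunction : homotopyCategory.{u} ⊣ nerveQCat.{u} :=
  nerveAdjunction.restrictFullyFaithful (ObjectProperty.fullyFaithfulι _)
    (Functor.FullyFaithful.id _) (homotopyCategoryIso.{u} ≪≫ (Functor.rightUnitor _).symm)
    (Iso.refl _)

end Templicial

namespace Templicial

open TemplicialModule

/-! ### The nerve and the linear nerve -/

section Comparison

variable {k : Type u} [CommRing k] {Y : SSet.{u}} {C D : LinCat.{u} k}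

lemma freeGen_deg {a : Y _⦋0⦌} (y : Simp Y (fun y => y) 0 a a) (m : ℕ) :
    ((freeTemplicial k).obj Y).deg m a = freeGen k (y.map (IntervalMap.toZero m)) :=
  (congrArg (((freeTemplicial k).obj Y).map (IntervalMap.toZero m) a a)
    (((freeTemplicial k).obj Y).eq_unit (counit_freeGen y)).symm).trans (map_freeGen _ y)

/-- A morphism from a free templicial module to a linear nerve is determined by its values on
`1`-simplices. -/
lemma free_nerveHom_ext {φ ψ : (freeTemplicial k).obj Y ⟶ (linearNerve k).obj C}
    (hb : ∀ a, nerveObj φ a = nerveObj ψ a)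
    (h : ∀ a b (y : Simp Y (fun y => y) 1 a b),
      nerveVal ψ a b (freeGen k y) =
        eqToHom (hb a).symm ≫ nerveVal φ a b (freeGen k y) ≫ eqToHom (hb b)) : φ = ψ := by
  refine nerveHom_ext hb fun a b x => ?_
  let L : (nerveObj φ a ⟶ nerveObj φ b) →ₗ[k] (nerveObj ψ a ⟶ nerveObj ψ b) :=
    Linear.leftComp k _ (eqToHom (hb a).symm) ∘ₗ Linear.rightComp k _ (eqToHom (hb b))
  have : nerveVal ψ a b = L ∘ₗ nerveVal φ a b := (freeData k Y).hom_ext fun y => h a b y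
  exact LinearMap.congr_fun this x

/-- The name of a simplex of the nerve by the objects at its ends. -/
def namedSimp {C : Type u} [Category.{u} C] {n : ℕ} {a b : (nerve C) _⦋0⦌}
    (y : Simp (nerve C) (fun y => y) n a b) : Simp (nerve C) nerveVert n (nerveVert a) (nerveVert b) :=
  ⟨y.val, congrArg nerveVert y.first, congrArg nerveVert y.last⟩

variable (C) in
/-- The comparison from the free templicial module on the nerve to the linear nerve, as data. -/
noncomputable def comparisonData : FreeHomData (nerve C.carrier) ((linearNerve k).obj C) where
  base a := (show C.carrier from nerveVert (C := C.carrier) a)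
  val y := nerveGen k (namedSimp y)
  map_val f _ _ y := nerveOp_gen k f _ _ (namedSimp y)
  comul_val y := nerveComul_gen k _ _ _ _ (namedSimp y)
  counit_val y := nerveCounit_gen k _ (namedSimp y)

variable (C) in
/-- The comparison from the free templicial module on the nerve to the linear nerve. -/
noncomputable def comparison : (freeTemplicial k).obj (nerve C.carrier) ⟶ (linearNerve k).obj C :=
  (comparisonData C).toHom

lemma nerveVal_comparison (F : ComposableArrows C.carrier 1) :
    nerveVal (comparison C) _ _
      (freeGen k (⟨F, rfl, rfl⟩ : Simp (nerve C.carrier) (fun y => y) 1 _ _)) = F.map' 0 1 := by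
  refine nerveVal_eq (((comparisonData C).toHom_app _ _ _ _).trans
    (Eq.trans ?_ (arrowEquiv_apply C (a := F.obj 0) (b := F.obj 1) _).symm))
  exact congrArg (nerveGen k) (Simp.ext (eq_arrowSimp (F.map' 0 1) F rfl rfl
    (((Category.id_comp _).trans (Category.comp_id _)).symm)))

lemma nerveVal_comparison_of {a b : (nerve C.carrier) _⦋0⦌}
    (y : Simp (nerve C.carrier) (fun y => y) 1 a b) {A B : C.carrier} (hA : nerveVert a = A)
    (hB : nerveVert b = B) (g : A ⟶ B)
    (hg : namedSimp y = arrowSimp (eqToHom hA ≫ g ≫ eqToHom hB.symm)) :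
    nerveVal (comparison C) a b (freeGen k y) = eqToHom hA ≫ g ≫ eqToHom hB.symm :=
  nerveVal_eq (((comparisonData C).toHom_app _ _ _ _).trans ((congrArg (nerveGen k) hg).trans
    (arrowEquiv_apply C (a := nerveVert a) (b := nerveVert b) _).symm))

lemma comparison_naturality (G : C ⟶ D) :
    comparison C ≫ (linearNerve k).map G =
      (freeTemplicial k).map (nerveMap G.functor) ≫ comparison D := by
  refine free_nerveHom_ext (fun _ => rfl) fun a b y => ?_
  refine Eq.trans ?_ (((Category.id_comp _).trans (Category.comp_id _)).symm)
  obtain ⟨F, rfl, rfl⟩ := y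
  refine Eq.trans ?_ ((nerveVal_comp (comparison C) G _).trans
    (congrArg G.functor.map (nerveVal_comparison F))).symm
  refine (nerveVal_precomp ((freeTemplicial k).map (nerveMap G.functor)) (comparison D) _).trans ?_
  refine (congrArg (nerveVal (comparison D) _ _)
    (freeTemplicial_map_freeGen (nerveMap G.functor) _)).trans ?_
  exact nerveVal_comparison (F ⋙ G.functor)

variable (C) in
/-- The comparison from the nerve to the simplicial set underlying the linear nerve. -/
noncomputable def nerveComparison : nerve C.carrier ⟶ underlying.obj ((linearNerve k).obj C) :=
  toUnderlying (comparison C)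

lemma nerveComparison_naturality (G : C ⟶ D) :
    nerveComparison C ≫ underlying.map ((linearNerve k).map G) =
      nerveMap G.functor ≫ nerveComparison D := by
  have h1 : nerveComparison C ≫ underlying.map ((linearNerve k).map G) =
      toUnderlying (comparison C ≫ (linearNerve k).map G) := by
    ext U y
    exact Category.assoc _ _ _
  have h2 : nerveMap G.functor ≫ nerveComparison D =
      toUnderlying ((freeTemplicial k).map (nerveMap G.functor) ≫ comparison D) := by
    ext U y
    change (freeTemplicial k).map (SSet.yonedaEquiv.symm ((nerveMap G.functor).app _ y)) ≫ _ =
      (freeTemplicial k).map (SSet.yonedaEquiv.symm y) ≫ (freeTemplicial k).map _ ≫ _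
    rw [← Category.assoc, ← Functor.map_comp, SSet.yonedaEquiv_symm_comp]
  rw [h1, h2, comparison_naturality]

/-! ### Simplices of `Ũ(N_k(C))` as strings of morphisms. -/

section Simplices

variable {n : ℕ}

/-- The edge of `Δ[n]` with given end points. -/
def stdEdge {i j : Fin (n + 1)} (h : i ≤ j) :
    Simp (Δ[n] : SSet.{u}) (fun y => y) 1 (stdVertex i) (stdVertex j) :=
  stdSimp (SimplexCategory.mkOfLe i j h)

lemma eq_stdEdge {i j : Fin (n + 1)}
    (y : Simp (Δ[n] : SSet.{u}) (fun y => y) 1 (stdVertex i) (stdVertex j)) :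
    ∃ h : i ≤ j, y = stdEdge h := by
  have h0 : y.val 0 = i := congrArg (fun v : (Δ[n] : SSet.{u}) _⦋0⦌ => v 0) y.first
  have h1 : y.val 1 = j := congrArg (fun v : (Δ[n] : SSet.{u}) _⦋0⦌ => v 0) y.last
  refine ⟨h0.symm.le.trans ((SSet.stdSimplex.monotone_apply y.val (Fin.zero_le 1)).trans h1.le),
    Simp.ext (SSet.stdSimplex.ext _ _ fun r => ?_)⟩
  obtain rfl | rfl := Fin.exists_fin_two.1 ⟨r, rfl⟩
  · exact h0
  · exact h1

/-- The triangle of `Δ[n]` with given end points. -/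
def stdTriangle {i j l : Fin (n + 1)} (h : i ≤ j) (h' : j ≤ l) :
    Simp (Δ[n] : SSet.{u}) (fun y => y) 2 (stdVertex i) (stdVertex l) :=
  stdSimp (SimplexCategory.mkOfLeComp i j l h h')

/-- The simplex of the nerve given by a morphism to the linear nerve. -/
noncomputable def arrowsOf (ψ : (freeTemplicial k).obj (Δ[n] : SSet.{u}) ⟶ (linearNerve k).obj C) :
    ComposableArrows C.carrier n where
  obj i := nerveObj ψ (stdVertex i)
  map {i j} f := nerveVal ψ (stdVertex i) (stdVertex j) (freeGen k (stdEdge (leOfHom f)))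
  map_id i := by
    refine Eq.trans (congrArg _ ?_) ((isNerveData_nerveVal ψ).deg (stdVertex i))
    refine Eq.trans (congrArg (freeGen k) ?_) (freeGen_deg (k := k) (stdSimp (SimplexCategory.const ⦋0⦌ ⦋n⦌ i)) 1).symm
    exact Simp.ext (SSet.stdSimplex.ext _ _ fun r => by
      obtain rfl | rfl := Fin.exists_fin_two.1 ⟨r, rfl⟩ <;> rfl)
  map_comp {i j l} f g := by
    -- The value of `ψ` on the triangle `i ≤ j ≤ l` of `Δ[n]` exhibits the morphism of the long edge
    -- as a composite.
    let t : Simp (Δ[n] : SSet.{u}) (fun y => y) (1 + 1) (stdVertex i) (stdVertex l) :=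
      stdTriangle (leOfHom f) (leOfHom g)
    have hm : t.mid = stdVertex j := SSet.stdSimplex.ext _ _ fun r => by
      obtain rfl : r = 0 := Subsingleton.elim (α := Fin 1) _ _
      rfl
    have h1 : t.front 1 1 hm = stdEdge (leOfHom f) := (eq_stdEdge _).choose_spec
    have h2 : t.back 1 1 hm = stdEdge (leOfHom g) := (eq_stdEdge _).choose_spec
    have h3 : t.map (IntervalMap.ofOne 2) = stdEdge (leOfHom (f ≫ g)) := (eq_stdEdge _).choose_spec
    have h4 := ((freeData k (Δ[n] : SSet.{u})).comul_gen' t hm).trans (congrArg _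
      (congrArg₂ (fun x y => freeGen k x ⊗ₜ[k] freeGen k y) h1 h2))
    refine Eq.trans (congrArg _ ?_) ((isNerveData_nerveVal ψ).comp _ _ _ _ _ (freeGen k t) h4)
    exact (congrArg (freeGen k) h3.symm).trans (map_freeGen (k := k) _ t).symm

lemma nerveVert_simplex (F : ComposableArrows C.carrier n) (i : Fin (n + 1)) :
    nerveVert (C := C.carrier)
      ((SSet.yonedaEquiv.symm (show (nerve C.carrier) _⦋n⦌ from F)).app _ (stdVertex i)) =
      F.obj i := rfl

lemma namedSimp_simplex (F : ComposableArrows C.carrier n) {i j : Fin (n + 1)} (h : i ≤ j) :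
    namedSimp ((stdEdge h).push (vert' := fun y => y)
      (SSet.yonedaEquiv.symm (show (nerve C.carrier) _⦋n⦌ from F))
      (fun y => (SSet.yonedaEquiv.symm (show (nerve C.carrier) _⦋n⦌ from F)).app _ y) fun _ => rfl) =
      arrowSimp (eqToHom (nerveVert_simplex F i) ≫ F.map (homOfLE h) ≫
        eqToHom (nerveVert_simplex F j).symm) := by
  refine Simp.ext ?_
  refine eq_arrowSimp _ (((SSet.yonedaEquiv.symm (show (nerve C.carrier) _⦋n⦌ from F)).app _ (stdEdge h).val)) rfl rfl ?_
  exact ((((Category.id_comp _).trans (Category.comp_id _)).trans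
    ((Category.id_comp _).trans (Category.comp_id _)))).symm

lemma nerveVal_toUnderlying (φ : (freeTemplicial k).obj Y ⟶ (linearNerve k).obj C)
    (y : Y _⦋n⦌) {i j : Fin (n + 1)} (h : i ≤ j) :
    nerveVal (X := (freeTemplicial k).obj (Δ[n] : SSet.{u})) ((toUnderlying φ).app (op ⦋n⦌) y)
      (stdVertex i) (stdVertex j) (freeGen k (stdEdge h)) =
    nerveVal φ ((SSet.yonedaEquiv.symm y).app _ (stdVertex i))
      ((SSet.yonedaEquiv.symm y).app _ (stdVertex j))
      (freeGen k ((stdEdge h).push (vert' := fun y => y) (SSet.yonedaEquiv.symm y)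
        (fun v => (SSet.yonedaEquiv.symm y).app _ v) fun _ => rfl)) :=
  (nerveVal_precomp ((freeTemplicial k).map (SSet.yonedaEquiv.symm y)) φ _).trans
    (congrArg (nerveVal φ _ _) (freeTemplicial_map_freeGen _ _))

lemma nerveObj_nerveComparison (F : ComposableArrows C.carrier n) (i : Fin (n + 1)) :
    nerveObj (X := (freeTemplicial k).obj (Δ[n] : SSet.{u})) ((nerveComparison C).app (op ⦋n⦌) F)
      (stdVertex i) = F.obj i := rfl

lemma nerveVal_nerveComparison (F : ComposableArrows C.carrier n) {i j : Fin (n + 1)} (h : i ≤ j) :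
    nerveVal (X := (freeTemplicial k).obj (Δ[n] : SSet.{u})) ((nerveComparison C).app (op ⦋n⦌) F)
      (stdVertex i) (stdVertex j) (freeGen k (stdEdge h)) =
      eqToHom (nerveObj_nerveComparison F i) ≫ F.map (homOfLE h) ≫
        eqToHom (nerveObj_nerveComparison F j).symm :=
  (nerveVal_toUnderlying (comparison C) (show (nerve C.carrier) _⦋n⦌ from F) h).trans
    (nerveVal_comparison_of _ (nerveVert_simplex F i) (nerveVert_simplex F j) _
      (namedSimp_simplex F h))

lemma nerveVal_heq {X : TemplicialModule.{u} k} {φ ψ : X ⟶ (linearNerve k).obj C} (h : φ = ψ)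
    {a b : X.base} (x : X.obj 1 a b) : HEq (nerveVal φ a b x) (nerveVal ψ a b x) := by
  subst h; rfl

/-- A morphism `F̃(Δ[n]) ⟶ N_k(C)` is determined by its values on edges of `Δ[n]`, and by `arrowsOf`
these form a functor from `[n]` to `C`. -/
lemma nerveComparison_bijective : Function.Bijective ((nerveComparison C).app (op ⦋n⦌)) := by
  constructor
  · intro F G h
    refine CategoryTheory.Functor.hext (fun i => ?_) fun i j f => ?_
    · exact (nerveObj_nerveComparison F i).symm.trans ((congrArg (fun χ => nerveObj
        (X := (freeTemplicial k).obj (Δ[n] : SSet.{u})) χ (stdVertex i)) h).trans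
        (nerveObj_nerveComparison G i))
    · have key (F : ComposableArrows C.carrier n) := (heq_of_eq (nerveVal_nerveComparison F
        (leOfHom f))).trans ((conj_eqToHom_iff_heq _ _ (nerveObj_nerveComparison F i)
        (nerveObj_nerveComparison F j)).1 rfl)
      exact (key F).symm.trans ((nerveVal_heq
        (X := (freeTemplicial k).obj (Δ[n] : SSet.{u})) h _).trans (key G))
  · intro ψ
    refine ⟨arrowsOf ψ, ?_⟩
    refine Eq.symm (free_nerveHom_ext (fun (v : (Δ[n] : SSet.{u}) _⦋0⦌) => ((congrArg (nerveObj (X :=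
      (freeTemplicial k).obj (Δ[n] : SSet.{u})) ψ) (stdVertex_apply_zero v)).symm.trans
        (nerveObj_nerveComparison (arrowsOf ψ) (v 0)).symm).trans
        (congrArg (nerveObj (X := (freeTemplicial k).obj (Δ[n] : SSet.{u}))
          ((nerveComparison C).app (op ⦋n⦌) (arrowsOf ψ))) (stdVertex_apply_zero v))) fun v w y => ?_)
    obtain ⟨i, rfl⟩ : ∃ i, stdVertex i = v := ⟨_, stdVertex_apply_zero v⟩
    obtain ⟨j, rfl⟩ : ∃ j, stdVertex j = w := ⟨_, stdVertex_apply_zero w⟩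
    obtain ⟨h, rfl⟩ := eq_stdEdge y
    exact nerveVal_nerveComparison (arrowsOf ψ) h

end Simplices

variable (C) in
/-- The nerve is the simplicial set underlying the linear nerve. -/
noncomputable def nerveComparisonIso :
    nerve C.carrier ≅ underlying.obj ((linearNerve k).obj C) :=
  have : IsIso (nerveComparison C) := (NatTrans.isIso_iff_isIso_app _).2 fun U =>
    (isIso_iff_bijective _).2 (nerveComparison_bijective (n := U.unop.len))
  asIso (nerveComparison C)

/-- The linear nerve has the nerve as its underlying simplicial set. -/
noncomputable def underlyingNerveIso (hU : UnderlyingPreserves.{u} k) (hN : NervePreserves.{u} k) :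
    linearNerveQCat hN ⋙ underlyingQCat hU ≅ LinCat.forget k ⋙ nerveQCat :=
  Iso.symm (NatIso.ofComponents (fun C => ObjectProperty.isoMk _ (nerveComparisonIso C))
    fun G => ObjectProperty.hom_ext _ (nerveComparison_naturality G).symm)

end Comparison

end Templicial

namespace Templicial

open TemplicialModule

/-! ### Free templicial modules on strictly Segal simplicial sets -/

section FreeSegal

variable {k : Type u} [CommRing k] {Y : SSet.{u}}

/-- A tensor product of free modules is free on pairs of generators, so `f` carries a basis
bijectively to a basis. -/
lemma finsupp_tensor_bijective {ι C : Type*} [DecidableEq C] {S T : C → Type*}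
    {parts : ι → (c : C) × (S c × T c)} (hp : Function.Bijective parts)
    (f : (ι →₀ k) →ₗ[k] ⨁ c, (S c →₀ k) ⊗[k] (T c →₀ k))
    (hf : ∀ i, f (Finsupp.single i 1) =
      DirectSum.lof k C (fun c => (S c →₀ k) ⊗[k] (T c →₀ k)) (parts i).1
        (Finsupp.single (parts i).2.1 1 ⊗ₜ Finsupp.single (parts i).2.2 1)) :
    Function.Bijective f := by
  classical
  let e₁ : ((c : C) × (S c × T c) →₀ k) ≃ₗ[k] Π₀ c, (S c × T c →₀ k) :=
    sigmaFinsuppLequivDFinsupp k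
  let e : (ι →₀ k) ≃ₗ[k] ⨁ c, (S c →₀ k) ⊗[k] (T c →₀ k) :=
    (Finsupp.domLCongr (R := k) (M := k) (Equiv.ofBijective parts hp)) ≪≫ₗ e₁ ≪≫ₗ
      DFinsupp.mapRange.linearEquiv (fun c => (finsuppTensorFinsupp' k (S c) (T c)).symm)
  have : f = e.toLinearMap := by
    refine Finsupp.lhom_ext' fun i => LinearMap.ext_ring ?_
    refine (hf i).trans ?_
    have h1 : e₁ (Finsupp.domLCongr (R := k) (M := k) (Equiv.ofBijective parts hp) (Finsupp.single i (1 : k))) =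
        DFinsupp.single (parts i).1 (Finsupp.single (parts i).2 1) := by
      rw [Finsupp.domLCongr_single]
      exact sigmaFinsuppEquivDFinsupp_single _ _
    refine Eq.trans ?_ (congrArg (DFinsupp.mapRange.linearEquiv
      (fun c => (finsuppTensorFinsupp' k (S c) (T c)).symm)) h1).symm
    refine Eq.trans ?_ (DFinsupp.mapRange_single (hf := fun c => map_zero _)).symm
    exact congrArg (DirectSum.lof k C (fun c => (S c →₀ k) ⊗[k] (T c →₀ k)) _)
      (finsuppTensorFinsupp'_symm_single_eq_single_one_tmul k _ _ _ _).symm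
  rw [this]
  exact e.bijective

lemma mkOfSucc_frontHom {m n i : ℕ} (hi : i < m) :
    SimplexCategory.mkOfSucc (⟨i, hi⟩ : Fin m) ≫ frontHom m n =
      SimplexCategory.mkOfSucc (⟨i, by omega⟩ : Fin (m + n)) := by
  ext r
  obtain rfl | rfl := Fin.exists_fin_two.1 ⟨r, rfl⟩ <;> rfl

lemma mkOfSucc_backHom {m n i : ℕ} (hi : i < n) :
    SimplexCategory.mkOfSucc (⟨i, hi⟩ : Fin n) ≫ backHom m n =
      SimplexCategory.mkOfSucc (⟨m + i, by omega⟩ : Fin (m + n)) := by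
  ext r
  obtain rfl | rfl := Fin.exists_fin_two.1 ⟨r, rfl⟩ <;> rfl

/-- The edge of a simplex from a vertex to the next one. -/
def edge {n : ℕ} (i : Fin n) (y : Y _⦋n⦌) : Y _⦋1⦌ := Y.map (SimplexCategory.mkOfSucc i).op y

lemma edge_src {n : ℕ} (i : Fin n) (y : Y _⦋n⦌) :
    Y.map (SimplexCategory.δ 1).op (edge i y) = vtx i.castSucc y := by
  refine (map_map _ _ y).trans (congrArg (fun f => Y.map (Quiver.Hom.op f) y) ?_)
  ext r; obtain rfl : r = 0 := Subsingleton.elim (α := Fin 1) _ _; rfl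

lemma edge_tgt {n : ℕ} (i : Fin n) (y : Y _⦋n⦌) :
    Y.map (SimplexCategory.δ 0).op (edge i y) = vtx i.succ y := by
  refine (map_map _ _ y).trans (congrArg (fun f => Y.map (Quiver.Hom.op f) y) ?_)
  ext r; obtain rfl : r = 0 := Subsingleton.elim (α := Fin 1) _ _; rfl

lemma eq_of_edges (hY : Y.StrictSegal) {n : ℕ} {y z : Y _⦋n⦌} (h : ∀ i, vtx i y = vtx i z)
    (h' : ∀ i, edge i y = edge i z) : y = z :=
  hY.spineInjective (SSet.Path.ext (funext h) (funext h'))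

namespace Simp

variable {m n : ℕ} {a b : Y _⦋0⦌}

/-- The two faces of a simplex at its `m`-th vertex. -/
def parts (y : Simp Y (fun y => y) (m + n) a b) :
    (c : Y _⦋0⦌) × (Simp Y (fun y => y) m a c × Simp Y (fun y => y) n c b) :=
  ⟨y.mid, y.front m n rfl, y.back m n rfl⟩

lemma parts_eq (y : Simp Y (fun y => y) (m + n) a b) {c : Y _⦋0⦌} (h : y.mid = c) :
    y.parts = ⟨c, y.front m n h, y.back m n h⟩ := by
  subst h; rfl

lemma vtx_front (y : Simp Y (fun y => y) (m + n) a b) {c : Y _⦋0⦌} (h : y.mid = c) {i : ℕ}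
    (hi : i < m + 1) :
    vtx (⟨i, by omega⟩ : Fin (m + n + 1)) y.val = vtx (⟨i, hi⟩ : Fin (m + 1)) (y.front m n h).val :=
  (vtx_map (frontHom m n) ⟨i, hi⟩ y.val).symm

lemma vtx_back (y : Simp Y (fun y => y) (m + n) a b) {c : Y _⦋0⦌} (h : y.mid = c) {i : ℕ}
    (hi : i < n + 1) :
    vtx (⟨m + i, by omega⟩ : Fin (m + n + 1)) y.val =
      vtx (⟨i, hi⟩ : Fin (n + 1)) (y.back m n h).val :=
  (vtx_map (backHom m n) ⟨i, hi⟩ y.val).symm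

lemma edge_front (y : Simp Y (fun y => y) (m + n) a b) {c : Y _⦋0⦌} (h : y.mid = c) {i : ℕ}
    (hi : i < m) :
    edge (⟨i, by omega⟩ : Fin (m + n)) y.val = edge (⟨i, hi⟩ : Fin m) (y.front m n h).val :=
  ((map_map _ _ y.val).trans
    (congrArg (fun f => Y.map (Quiver.Hom.op f) y.val) (mkOfSucc_frontHom hi))).symm

lemma edge_back (y : Simp Y (fun y => y) (m + n) a b) {c : Y _⦋0⦌} (h : y.mid = c) {i : ℕ}
    (hi : i < n) :
    edge (⟨m + i, by omega⟩ : Fin (m + n)) y.val = edge (⟨i, hi⟩ : Fin n) (y.back m n h).val :=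
  ((map_map _ _ y.val).trans
    (congrArg (fun f => Y.map (Quiver.Hom.op f) y.val) (mkOfSucc_backHom hi))).symm

/-- The spine of a simplex is made of the spines of its front and back faces, and it determines the
simplex. -/
lemma parts_injective (hY : Y.StrictSegal) :
    Function.Injective (parts (Y := Y) (m := m) (n := n) (a := a) (b := b)) := by
  intro y z h
  have key {α : Type u} (F : (c : Y _⦋0⦌) × (Simp Y (fun y => y) m a c ×
      Simp Y (fun y => y) n c b) → α) : F y.parts = F z.parts := congrArg F h
  refine Simp.ext (eq_of_edges hY (fun ⟨i, hi⟩ => ?_) (fun ⟨i, hi⟩ => ?_))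
  · by_cases h : i < m + 1
    · rw [vtx_front y rfl h, vtx_front z rfl h]
      exact key fun p => vtx (⟨i, h⟩ : Fin (m + 1)) p.2.1.val
    · obtain ⟨i, rfl⟩ := Nat.exists_eq_add_of_le (show m ≤ i by omega)
      have h' : i < n + 1 := by omega
      rw [vtx_back y rfl h', vtx_back z rfl h']
      exact key fun p => vtx (⟨i, h'⟩ : Fin (n + 1)) p.2.2.val
  · by_cases h : i < m
    · rw [edge_front y rfl h, edge_front z rfl h]
      exact key fun p => edge (⟨i, h⟩ : Fin m) p.2.1.val
    · obtain ⟨i, rfl⟩ := Nat.exists_eq_add_of_le (show m ≤ i by omega)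
      have h' : i < n := by omega
      rw [edge_back y rfl h', edge_back z rfl h']
      exact key fun p => edge (⟨i, h'⟩ : Fin n) p.2.2.val

/-! ### Concatenation of spines. -/

section Concat

variable {c : Y _⦋0⦌} (s : Simp Y (fun y => y) m a c) (t : Simp Y (fun y => y) n c b)

/-- The vertices of a concatenation. -/
def concatVertex (i : ℕ) (hi : i < m + n + 1) : Y _⦋0⦌ :=
  if h : i < m + 1 then vtx (⟨i, h⟩ : Fin (m + 1)) s.val else
    vtx (⟨i - m, by omega⟩ : Fin (n + 1)) t.val

lemma concatVertex_left (i : ℕ) (hi : i < m + 1) :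
    concatVertex s t i (by omega) = vtx (⟨i, hi⟩ : Fin (m + 1)) s.val := dif_pos hi

lemma concatVertex_right (i : ℕ) (hi : i < n + 1) :
    concatVertex s t (m + i) (by omega) = vtx (⟨i, hi⟩ : Fin (n + 1)) t.val := by
  unfold concatVertex
  split_ifs with h
  · obtain rfl : i = 0 := by omega
    exact s.last.trans t.first.symm
  · congr 2
    omega

/-- The edges of a concatenation. -/
def concatEdge (i : ℕ) (hi : i < m + n) : Y _⦋1⦌ :=
  if h : i < m then edge (⟨i, h⟩ : Fin m) s.val else edge (⟨i - m, by omega⟩ : Fin n) t.val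

lemma concatEdge_left (i : ℕ) (hi : i < m) :
    concatEdge s t i (by omega) = edge (⟨i, hi⟩ : Fin m) s.val := dif_pos hi

lemma concatEdge_right (i : ℕ) (hi : i < n) :
    concatEdge s t (m + i) (by omega) = edge (⟨i, hi⟩ : Fin n) t.val := by
  refine (dif_neg (by omega)).trans ?_
  congr 2
  omega

/-- The concatenation of two simplices, as a path. -/
def concat : Y.Path (m + n) where
  vertex i := concatVertex s t i.1 i.2
  arrow i := concatEdge s t i.1 i.2
  arrow_src := fun ⟨i, hi⟩ => by
    by_cases h : i < m
    · exact (congrArg (Y.map (SimplexCategory.δ 1).op) (concatEdge_left s t i h)).trans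
        ((edge_src _ _).trans (concatVertex_left s t i (by omega)).symm)
    · obtain ⟨i, rfl⟩ := Nat.exists_eq_add_of_le (show m ≤ i by omega)
      exact (congrArg (Y.map (SimplexCategory.δ 1).op) (concatEdge_right s t i (by omega))).trans
        ((edge_src _ _).trans (concatVertex_right s t i (by omega)).symm)
  arrow_tgt := fun ⟨i, hi⟩ => by
    by_cases h : i < m
    · exact (congrArg (Y.map (SimplexCategory.δ 0).op) (concatEdge_left s t i h)).trans
        ((edge_tgt _ _).trans (concatVertex_left s t (i + 1) (by omega)).symm)
    · obtain ⟨i, rfl⟩ := Nat.exists_eq_add_of_le (show m ≤ i by omega)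
      exact (congrArg (Y.map (SimplexCategory.δ 0).op) (concatEdge_right s t i (by omega))).trans
        ((edge_tgt _ _).trans (concatVertex_right s t (i + 1) (by omega)).symm)

/-- The concatenation of the two spines is the spine of a unique simplex. Its front and back faces
are recognised by their spines. -/
lemma parts_bijective (hY : Y.StrictSegal) :
    Function.Bijective (parts (Y := Y) (m := m) (n := n) (a := a) (b := b)) := by
  refine ⟨parts_injective hY, ?_⟩
  rintro ⟨c, s, t⟩
  have hv (i : ℕ) (hi : i < m + n + 1) :
      vtx (⟨i, hi⟩ : Fin (m + n + 1)) (hY.spineToSimplex (concat s t)) = concatVertex s t i hi :=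
    hY.spineToSimplex_vertex _ _
  have he (i : ℕ) (hi : i < m + n) :
      edge (⟨i, hi⟩ : Fin (m + n)) (hY.spineToSimplex (concat s t)) =
        concatEdge s t i hi :=
    hY.spineToSimplex_arrow _ _
  let y : Simp Y (fun y => y) (m + n) a b := ⟨hY.spineToSimplex (concat s t),
    ((hv 0 _).trans (concatVertex_left s t 0 (by omega))).trans s.first,
    ((hv (m + n) _).trans (concatVertex_right s t n (by omega))).trans t.last⟩
  have hy : y.mid = c := ((hv m _).trans (concatVertex_left s t m (by omega))).trans s.last
  have h1 : y.front m n hy = s := Simp.ext (eq_of_edges hY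
    (fun ⟨i, hi⟩ => ((vtx_front y hy hi).symm.trans (hv _ _)).trans (concatVertex_left s t i hi))
    (fun ⟨i, hi⟩ => ((edge_front y hy hi).symm.trans (he _ _)).trans (concatEdge_left s t i hi)))
  have h2 : y.back m n hy = t := Simp.ext (eq_of_edges hY
    (fun ⟨i, hi⟩ => ((vtx_back y hy hi).symm.trans (hv _ _)).trans (concatVertex_right s t i hi))
    (fun ⟨i, hi⟩ => ((edge_back y hy hi).symm.trans (he _ _)).trans (concatEdge_right s t i hi)))
  exact ⟨y, by rw [parts_eq y hy, h1, h2]⟩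

end Concat

end Simp

/-- The comultiplication sends generators to pure tensors of generators along the bijection
`Simp.parts`. -/
theorem isSegal_freeTemplicial (hY : Y.StrictSegal) : ((freeTemplicial k).obj Y).IsSegal := by
  classical
  intro p q a b
  exact finsupp_tensor_bijective (k := k) (Simp.parts_bijective (m := p) (n := q) (a := a) (b := b) hY)
    ((freeData k Y).comul p q a b) fun y => comul_freeGen y

end FreeSegal

end Templicial

namespace Templicial

open TemplicialModule

/-! ### The linear nerve of a free linear category -/

section FreeNerve

variable {k : Type u} [CommRing k]

/-- Serves to invert a morphism knowing only its inverse `θ` in degree one. Since `X` satisfies the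
Segal condition, an `x` matching the comultiplication of `z` has to be `A z`, and the naturality of
`A` then gives the condition on compositions. -/
lemma isSegalData_of_inverse {X Z : TemplicialModule.{u} k} (hX : X.IsSegal)
    {β : X.base → Z.base} {θ : ∀ a b, X.obj 1 a b →ₗ[k] Z.obj 1 (β a) (β b)}
    (A : ∀ n a b, Z.obj n (β a) (β b) →ₗ[k] X.obj n a b)
    (hmap : ∀ {m n : ℕ} (f : IntervalMap m n) (a b : X.base) (z : Z.obj n (β a) (β b)),
      A m a b (Z.map f _ _ z) = X.map f a b (A n a b z))
    (hcomul : ∀ (a b c : X.base) (z : Z.obj (1 + 1) (β a) (β b)),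
      X.comul 1 1 a b (A (1 + 1) a b z) c =
        TensorProduct.map (A 1 a c) (A 1 c b) (Z.comul 1 1 _ _ z (β c)))
    (hdeg : ∀ a, A 1 a a (Z.deg 1 (β a)) = X.deg 1 a)
    (hA : ∀ a b x, A 1 a b (θ a b x) = x) (hθ : ∀ a b z, θ a b (A 1 a b z) = z) :
    IsSegalData β θ where
  deg a := (congrArg (θ a a) (hdeg a)).symm.trans (hθ a a _)
  comp a b x z h := by
    have hA' (a b) : A 1 a b ∘ₗ θ a b = LinearMap.id := LinearMap.ext (hA a b)
    have hz : A (1 + 1) a b z = x := by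
      refine (hX 1 1 a b).1 (DFinsupp.ext fun c => ?_)
      rw [hcomul, h, ← LinearMap.comp_apply, ← TensorProduct.map_comp, hA', hA',
        TensorProduct.map_id]
      rfl
    rw [← hz]
    exact (congrArg (θ a b) (hmap (IntervalMap.ofOne 2) a b z)).symm.trans (hθ a b _)

variable (k) (C : Type u) [Category.{u} C]

/-- The free linear category. -/
noncomputable abbrev FreeLin : LinCat.{u} k := { carrier := CategoryTheory.Free k C }

/-- The comparison from the free templicial module on the nerve of a category to the linear nerve
of its free linear category. -/
noncomputable def freeComparison :
    (freeTemplicial k).obj (nerve C) ⟶ (linearNerve k).obj (FreeLin k C) :=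
  (freeTemplicial k).map (nerveMap (Free.embedding k C)) ≫ comparison (FreeLin k C)

variable {C}

/-- The edge of the nerve given by a morphism. -/
def freeArrow {a b : C} (f : a ⟶ b) :
    Simp (nerve C) (fun y => y) 1 (ComposableArrows.mk₀ a) (ComposableArrows.mk₀ b) :=
  ⟨ComposableArrows.mk₁ f, ComposableArrows.ext₀ rfl, ComposableArrows.ext₀ rfl⟩

lemma exists_freeArrow {a b : C}
    (y : Simp (nerve C) (fun y => y) 1 (ComposableArrows.mk₀ a) (ComposableArrows.mk₀ b)) :
    ∃ f : a ⟶ b, y = freeArrow f := by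
  obtain ⟨f, hf⟩ := exists_arrowSimp (C := C) (a := a) (b := b) (namedSimp y)
  exact ⟨f, Simp.ext (congrArg (fun z : Simp (nerve C) nerveVert 1 a b => z.val) hf)⟩

variable (a b : C) in
/-- The morphisms of a free linear category, as elements of its linear nerve. -/
noncomputable def freeArrowEquiv :
    ((a ⟶ b) →₀ k) ≃ₗ[k] ((linearNerve k).obj (FreeLin k C)).obj 1 a b :=
  arrowEquiv (FreeLin k C) (show (FreeLin k C).carrier from a) (show (FreeLin k C).carrier from b)

lemma freeComparison_arrow {a b : C} (f : a ⟶ b) :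
    Hom.app (freeComparison k C) 1 (ComposableArrows.mk₀ a) (ComposableArrows.mk₀ b)
      (freeGen k (freeArrow f)) = freeArrowEquiv k a b (Finsupp.single f 1) := by
  refine Eq.trans ?_ (arrowEquiv_apply (FreeLin k C) (a := show (FreeLin k C).carrier from a)
    (b := show (FreeLin k C).carrier from b) _).symm
  refine (congrArg (Hom.app (comparison (FreeLin k C)) 1 _ _)
    (freeTemplicial_map_freeGen (nerveMap (Free.embedding k C)) (freeArrow f))).trans ?_
  refine ((comparisonData (FreeLin k C)).toHom_app _ _ _ _).trans ?_
  exact congrArg (nerveGen k) (Simp.ext (eq_arrowSimp ((Free.embedding k C).map f) _ rfl rfl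
    (((Category.id_comp _).trans (Category.comp_id _)).symm)))

/-- The comparison in each degree. -/
noncomputable def freeComparisonApp (n : ℕ) (a b : C) :
    ((freeTemplicial k).obj (nerve C)).obj n (ComposableArrows.mk₀ a) (ComposableArrows.mk₀ b)
      →ₗ[k] ((linearNerve k).obj (FreeLin k C)).obj n a b :=
  Hom.app (freeComparison k C) n (ComposableArrows.mk₀ a) (ComposableArrows.mk₀ b)

/-- The inverse of the comparison in degree `1`. -/
noncomputable def freeComparisonInv (a b : C) :
    ((linearNerve k).obj (FreeLin k C)).obj 1 a b →ₗ[k]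
      ((freeTemplicial k).obj (nerve C)).obj 1 (ComposableArrows.mk₀ a) (ComposableArrows.mk₀ b) :=
  (show ((a ⟶ b) →₀ k) →ₗ[k] (Simp (nerve C) (fun y => y) 1 (ComposableArrows.mk₀ a)
      (ComposableArrows.mk₀ b) →₀ k) from Finsupp.lmapDomain k k freeArrow) ∘ₗ
    (freeArrowEquiv k a b).symm.toLinearMap

lemma freeComparisonInv_apply {a b : C} (f : a ⟶ b) :
    freeComparisonInv k a b (freeArrowEquiv k a b (Finsupp.single f 1)) =
      freeGen k (freeArrow f) :=
  (congrArg (Finsupp.mapDomain freeArrow)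
    ((freeArrowEquiv k a b).symm_apply_apply _)).trans Finsupp.mapDomain_single

lemma freeComparisonInv_app {a b : C} (z : ((freeTemplicial k).obj (nerve C)).obj 1
    (ComposableArrows.mk₀ a) (ComposableArrows.mk₀ b)) :
    freeComparisonInv k a b (freeComparisonApp k 1 a b z) = z := by
  have : freeComparisonInv k a b ∘ₗ freeComparisonApp k 1 a b = LinearMap.id :=
    (freeData k (nerve C)).hom_ext fun y => by
      obtain ⟨f, rfl⟩ := exists_freeArrow y
      exact (congrArg (freeComparisonInv k a b) (freeComparison_arrow k f)).trans
        (freeComparisonInv_apply k f)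
  exact LinearMap.congr_fun this z

lemma freeComparison_inv {a b : C} (x : ((linearNerve k).obj (FreeLin k C)).obj 1 a b) :
    freeComparisonApp k 1 a b (freeComparisonInv k a b x) = x := by
  obtain ⟨g, rfl⟩ := (freeArrowEquiv k a b).surjective x
  have : (freeComparisonApp k 1 a b ∘ₗ freeComparisonInv k a b) ∘ₗ
      (freeArrowEquiv k a b).toLinearMap = (freeArrowEquiv k a b).toLinearMap :=
    Finsupp.lhom_ext' fun f => LinearMap.ext_ring
      ((congrArg (freeComparisonApp k (C := C) 1 a b) (freeComparisonInv_apply k f)).trans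
        (freeComparison_arrow k f))
  exact LinearMap.congr_fun this g

variable (C) in
/-- The objects as vertices of the nerve. -/
def vertexMk (a : ((linearNerve k).obj (FreeLin k C)).base) :
    ((freeTemplicial k).obj (nerve C)).base :=
  ComposableArrows.mk₀ (show C from a)

lemma vertexMk_bijective : Function.Bijective (vertexMk k C) :=
  ⟨fun _ _ h => congrArg (nerveVert (C := C)) h, fun F =>
    ⟨nerveVert (C := C) F, ComposableArrows.ext₀ (C := C) rfl⟩⟩

/-- A `0`-simplex of the nerve is determined by its object, so the base map of the comparison is
injective and the component at `c` can be isolated. -/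
lemma comul_freeComparisonApp (a b c : C) (z : ((freeTemplicial k).obj (nerve C)).obj (1 + 1)
    (ComposableArrows.mk₀ a) (ComposableArrows.mk₀ b)) :
    ((linearNerve k).obj (FreeLin k C)).comul 1 1 a b (freeComparisonApp k (1 + 1) a b z) c =
      TensorProduct.map (freeComparisonApp k 1 a c) (freeComparisonApp k 1 c b)
        (((freeTemplicial k).obj (nerve C)).comul 1 1 _ _ z (ComposableArrows.mk₀ c)) := by
  classical
  exact (DFunLike.congr_fun (Hom.comul_app (freeComparison k C) 1 1 _ _ z)
    (Hom.base (freeComparison k C) (ComposableArrows.mk₀ c))).trans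
      (toModule_lof_apply (β := Hom.base (freeComparison k C))
        (fun (F G : ComposableArrows C 0) h => ComposableArrows.ext₀ (C := C) h)
        (fun c => Hom.app (freeComparison k C) 1 (ComposableArrows.mk₀ a) c)
        (fun c => Hom.app (freeComparison k C) 1 c (ComposableArrows.mk₀ b))
        (ComposableArrows.mk₀ c) _)

lemma freeComparison_isSegalData :
    IsSegalData (X := (linearNerve k).obj (FreeLin k C)) (Z := (freeTemplicial k).obj (nerve C))
      (β := vertexMk k C) (freeComparisonInv k (C := C)) :=
  isSegalData_of_inverse (isSegal_linearNerve k _) (β := vertexMk k C)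
    (freeComparisonApp k (C := C))
    (fun f _ _ z => Hom.naturality (freeComparison k C) f _ _ z)
    (comul_freeComparisonApp k (C := C))
    (fun _ => Hom.app_deg (freeComparison k C) 1 _)
    (fun _ _ x => freeComparison_inv k (C := C) x)
    (fun _ _ z => freeComparisonInv_app k (C := C) z)

/-- The inverse of the comparison. -/
noncomputable def freeComparisonInverse :
    (linearNerve k).obj (FreeLin k C) ⟶ (freeTemplicial k).obj (nerve C) :=
  segalHom (freeComparisonInv k (C := C)) (vertexMk_bijective k)
    (isSegal_freeTemplicial (Nerve.strictSegal C)) (freeComparison_isSegalData k)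

lemma freeComparisonInverse_app (a b : C) :
    Hom.app (freeComparisonInverse k (C := C)) 1 a b = freeComparisonInv k a b :=
  segalHom_app_one (X := (linearNerve k).obj (FreeLin k C))
    (Z := (freeTemplicial k).obj (nerve C)) (β := vertexMk k C) (freeComparisonInv k (C := C))
    (vertexMk_bijective k) (isSegal_freeTemplicial (Nerve.strictSegal C))
    (freeComparison_isSegalData k) a b

/-- As the target satisfies the Segal condition, it suffices to compare in degree one, where the two
maps are inverse to each other. -/
lemma freeComparison_comp_inverse :
    freeComparison k C ≫ freeComparisonInverse k = 𝟙 _ := by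
  have hb (F : ComposableArrows C 0) : ComposableArrows.mk₀ (nerveVert F) = F :=
    ComposableArrows.ext₀ rfl
  refine IsSegal.hom_ext (isSegal_freeTemplicial (Nerve.strictSegal C)) hb fun F G x => ?_
  obtain ⟨a, rfl⟩ : ∃ a : C, ComposableArrows.mk₀ a = F := ⟨_, hb F⟩
  obtain ⟨b, rfl⟩ : ∃ b : C, ComposableArrows.mk₀ b = G := ⟨_, hb G⟩
  exact (LinearMap.congr_fun (freeComparisonInverse_app k a b) _).trans
    (freeComparisonInv_app k x)

lemma base_inverse_comp_freeComparison (a : C) :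
    Hom.base (freeComparisonInverse k ≫ freeComparison k C) a = a := rfl

lemma app_inverse_comp_freeComparison {a b : C}
    (x : ((linearNerve k).obj (FreeLin k C)).obj 1 a b) :
    Hom.app (freeComparisonInverse k ≫ freeComparison k C) 1 a b x = x :=
  (congrArg (freeComparisonApp k (C := C) 1 a b)
    (LinearMap.congr_fun (freeComparisonInverse_app k a b) x)).trans
    (freeComparison_inv k (C := C) x)

lemma inverse_comp_freeComparison :
    freeComparisonInverse k ≫ freeComparison k C = 𝟙 _ := by
  refine IsSegal.hom_ext (isSegal_linearNerve k _) (base_inverse_comp_freeComparison k (C := C))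
    fun a b x => ?_
  exact app_inverse_comp_freeComparison k (C := C) x

variable (C) in
/-- The linear nerve of a free linear category is the free templicial module on the nerve. -/
noncomputable def freeComparisonIso :
    (freeTemplicial k).obj (nerve C) ≅ (linearNerve k).obj (FreeLin k C) where
  hom := freeComparison k C
  inv := freeComparisonInverse k
  hom_inv_id := freeComparison_comp_inverse k
  inv_hom_id := inverse_comp_freeComparison k

lemma freeComparison_naturality {C D : Cat.{u, u}} (F : C ⟶ D) :
    freeComparison k C ≫ (linearNerve k).map ((LinCat.free k).map F) =
      (freeTemplicial k).map (nerveMap F.toFunctor) ≫ freeComparison k D := by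
  have h : nerveMap (Free.embedding k C) ≫ nerveMap (C := CategoryTheory.Free k C)
      (D := CategoryTheory.Free k D) ((LinCat.free k).map F).functor =
      nerveMap F.toFunctor ≫ nerveMap (Free.embedding k D) :=
    congrArg (nerveMap (C := C) (D := CategoryTheory.Free k D)) (LinCat.embedding_comp_lift (C := C)
      (D := CategoryTheory.Free k D) (F.toFunctor ⋙ Free.embedding k D))
  refine (Category.assoc _ _ _).trans ((congrArg ((freeTemplicial k).map
    (nerveMap (Free.embedding k C)) ≫ ·) (comparison_naturality ((LinCat.free k).map F))).trans ?_)
  refine (Category.assoc _ _ _).symm.trans ((congrArg (· ≫ comparison (FreeLin k D))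
    ((Functor.map_comp _ _ _).symm.trans ((congrArg (freeTemplicial k).map h).trans
      (Functor.map_comp _ _ _)))).trans (Category.assoc _ _ _))

/-- The linear nerve of the free linear category on a category is the free templicial module on
its nerve. -/
noncomputable def linearNerveFreeIso (hF : FreePreserves.{u} k) (hN : NervePreserves.{u} k) :
    LinCat.free k ⋙ linearNerveQCat hN ≅ nerveQCat ⋙ freeQCat hF :=
  Iso.symm (NatIso.ofComponents (fun C => ObjectProperty.isoMk _ (freeComparisonIso k C))
    fun F => ObjectProperty.hom_ext _ (freeComparison_naturality k F).symm)

/-- The linear homotopy category of a free templicial module is the free linear category on the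
homotopy category. -/
noncomputable def freeHomotopyIso (hF : FreePreserves.{u} k) (hU : UnderlyingPreserves.{u} k)
    (hN : NervePreserves.{u} k) :
    homotopyCategory ⋙ LinCat.free k ≅ freeQCat hF ⋙ (linearHomotopyStructure hU).functor :=
  -- The two composites are left adjoint to the nerve of the underlying category and to the
  -- simplicial set underlying the linear nerve. These right adjoints are isomorphic, hence so are
  -- the left adjoints.
  (conjugateIsoEquiv (homotopyCategoryAdjunction.comp (LinCat.freeForgetAdjunction k))
    ((freeQCatAdjunction hF hU).comp (linearHomotopyAdjunction hU hN))).symm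
    (underlyingNerveIso hU hN).symm |>.symm

end FreeNerve

end Templicial

theorem mainTheorem3 (k : Type u) [CommRing k] :
    ∃ (hF : FreePreserves.{u} k) (hU : UnderlyingPreserves.{u} k) (hN : NervePreserves.{u} k)
      (S : LinearHomotopyStructure hU),
      -- the four adjunctions
      Nonempty (LinCat.free k ⊣ LinCat.forget k) ∧
      Nonempty (homotopyCategory.{u} ⊣ nerveQCat.{u}) ∧
      Nonempty (freeQCat hF ⊣ underlyingQCat hU) ∧
      Nonempty (S.functor ⊣ linearNerveQCat hN) ∧
      -- the four natural isomorphisms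
      Nonempty (LinCat.free k ⋙ linearNerveQCat hN ≅ nerveQCat ⋙ freeQCat hF) ∧
      Nonempty (linearNerveQCat hN ⋙ underlyingQCat hU ≅ LinCat.forget k ⋙ nerveQCat) ∧
      Nonempty (homotopyCategory ⋙ LinCat.free k ≅ freeQCat hF ⋙ S.functor) ∧
      Nonempty (underlyingQCat hU ⋙ homotopyCategory ≅ S.functor ⋙ LinCat.forget k) := by
  -- The last isomorphism is an identity, because `h_k(X)` is the category `h(Ũ(X))` equipped with a
  -- linear structure.
  exact ⟨freePreserves k, underlyingPreserves k, nervePreserves k, linearHomotopyStructure _,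
    ⟨LinCat.freeForgetAdjunction k⟩, ⟨homotopyCategoryAdjunction⟩, ⟨freeQCatAdjunction _ _⟩,
    ⟨linearHomotopyAdjunction _ _⟩, ⟨linearNerveFreeIso k _ _⟩, ⟨underlyingNerveIso _ _⟩,
    ⟨freeHomotopyIso k _ _ (nervePreserves k)⟩, ⟨Iso.refl _⟩⟩
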